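/- For integers $m,n\ge 0$ let $D(m,n)$ be the Cartesian product of $m$ copies of the Shrikhande graph (the Cayley graph of $\mathbb{Z}_4^2$ with connecting set $\{01,10,11,03,30,33\}$) and $n$ copies of the complete graph $K_4$. An MDS code in $D(m,n)$ is an independent set of vertices of maximum cardinality. Then the number of MDS codes in $D(m,n)$ has the form $$2\cdot 3^{m+n}\cdot 2^{2^{2m+n-1}}\,(1+o(1)) \qquad\text{as } m+n\to\infty,$$ that is, for every $\varepsilon>0$ there is an $N$ such that for all $m,n\ge 0$ with $m+n\ge N$ the ratio of this number to $2\cdot 3^{m+n}\cdot 2^{2^{2m+n-1}}$ differs from $1$ by less than $\varepsilon$. -/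

import Mathlib

open Filter Topology

/-- The Shrikhande graph: the Cayley graph of `Z₄²` with connecting set `{01, 10, 11, 03, 30, 33}`. -/
def shrikhandeGraph : SimpleGraph (ZMod 4 × ZMod 4) :=
  SimpleGraph.addCayley {(0, 1), (1, 0), (1, 1), (0, 3), (3, 0), (3, 3)}

/-- The complete graph `K = K₄`, presented as the Cayley graph of `Z₂²` with connecting set
`{01, 10, 11}`. -/
def kleinGraph : SimpleGraph (ZMod 2 × ZMod 2) :=
  SimpleGraph.addCayley {(0, 1), (1, 0), (1, 1)}

/-- The Cartesian product of an `ι`-indexed family of copies of a graph `G`: two tuples are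
adjacent iff they are adjacent in one coordinate and equal in all the others. -/
def cartesianPower {V : Type*} (G : SimpleGraph V) (ι : Type*) : SimpleGraph (ι → V) where
  Adj x y := ∃ i, G.Adj (x i) (y i) ∧ ∀ j, j ≠ i → x j = y j
  symm := ⟨fun _ _ ⟨i, h, e⟩ => ⟨i, h.symm, fun j hj => (e j hj).symm⟩⟩
  loopless := ⟨fun _ ⟨_, h, _⟩ => h.ne rfl⟩

/-- The vertex set of `D(m, n)`. -/
abbrev DoobVertex (m n : ℕ) : Type := (Fin m → ZMod 4 × ZMod 4) × (Fin n → ZMod 2 × ZMod 2)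

/-- The graph `D(m, n)`: the Cartesian product of `m` copies of the Shrikhande graph and `n` copies
of `K₄`. -/
def doobGraph (m n : ℕ) : SimpleGraph (DoobVertex m n) :=
  SimpleGraph.boxProd (cartesianPower shrikhandeGraph (Fin m)) (cartesianPower kleinGraph (Fin n))

/-- A (distance-2) MDS code in `D(m, n)`: an independent set of maximum cardinality. -/
def IsMDSCode {m n : ℕ} (C : Finset (DoobVertex m n)) : Prop :=
  (doobGraph m n).IsMaximumIndepSet C

/-- The number of MDS codes in `D(m, n)`. -/
noncomputable def numMDSCodes (m n : ℕ) : ℕ :=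
  Nat.card {C : Finset (DoobVertex m n) // IsMDSCode C}

/-! Label the vertices of every factor by 0 and 1, each label on half of them: there are three ways
up to complement for `K₄`, and three characters of order two are used for the Shrikhande graph. A
sum of such labels plus a constant is a linear function (`dlin`), and there are `2 * 3 ^ (m + n)` of
them. A code inside the zero set of one of them is called semilinear. The main term counts the
semilinear codes, and the work is to show that the other codes are negligible.

Lower bound. Refine each Shrikhande label to a residue modulo four (`refV`). For each refined vector
of the right parity one further parity bit can be chosen freely, and every choice gives a code
(`famCode`). There are `2 ^ (2 * m + n - 1)` such vectors, and a family shares at most one code with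
the zero set of any other linear function (`famCode_eq_of_subset`). So the overlaps are at most the
square of the number of families (`le_ncard_dCode`).

Upper bound in the Hamming graph (`m = 0`, words over four symbols, `IsCode`). The union of two
disjoint codes is a zero set meeting every line in two points. The directions around a connected
component of such a set fall into blocks, each block splits the function into a sum
(`IsBlk.splitOn`), and a component determines the function (`eq_of_common_component`). Hence a code
in a balanced zero set is determined by two of its layers, which gives `2 ^ 2 ^ (N - 1)` codes at
most (`numSub_le`).

For codes that are not semilinear, call a code stiff if it lies in the zero set of a unique linear
function, satisfies some connectivity conditions (`Rigid`), and extends by one dimension only to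
semilinear or split codes (`Extends`); split means that the layers differ by permutations of one
coordinate. A code with a stiff layer is stiff or split (`Stiff.of_layer`). In dimension three every
code is either linear for two labels or isotopic to addition modulo four, which is stiff. So a code
that is not semilinear has a stiff three-dimensional face. Take a stiff face of maximal dimension:
all parallel faces are then stiff, and adjacent ones differ by a permutation of one coordinate
(`exists_good`). This leaves few choices for a second layer next to a given one: at most `250 ^ 2 ^
(N - 5)`, up to a factor two, and the decisive fact is `250 < 256`. If the union of the remaining
two layers is connected, they are then known up to a swap. If some union of two layers is
disconnected, it has a nontrivial block and the code is assembled from codes of smaller dimension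
(`ncard_le_of_block`). Induction gives `numC_bound` and then `nonsemi_bound`.

Upper bound in general. `phi` trades a Shrikhande factor for two factors `K₄`, injectively on codes
and compatibly with labels. A code that is not semilinear either has a non-semilinear image, or an
image that is linear with different labels on the two new coordinates, and the latter are few
(`ncard_bad_le`). -/

set_option linter.unusedSectionVars false
set_option linter.unusedVariables false

/-! ### Balanced functions on an alphabet of four symbols. -/

/-- Exactly two of the four values of `f` vanish. -/
def Bal (f : Fin 4 → ZMod 2) : Prop := (Finset.univ.filter fun t => f t = 0).card = 2

instance : DecidablePred Bal := fun _ => inferInstanceAs (Decidable (_ = 2))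

/-- The pairs on which `f` and `g` equal `c` meet at `a`, so together they cover at most three of
the four positions. -/
theorem Bal.exists_common {f g : Fin 4 → ZMod 2} (hf : Bal f) (hg : Bal g) {a : Fin 4} {c : ZMod 2}
    (h1 : f a = c) (h2 : g a = c) : ∃ b, f b ≠ c ∧ g b ≠ c := by
  revert f g a c; decide

theorem Bal.exists_ne {f : Fin 4 → ZMod 2} (hf : Bal f) (c : ZMod 2) : ∃ b, f b ≠ c := by
  revert f c; decide

theorem Bal.exists_eq {f : Fin 4 → ZMod 2} (hf : Bal f) (c : ZMod 2) : ∃ b, f b = c := by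
  revert f c; decide

theorem Bal.eq_add_of_disjoint {f g : Fin 4 → ZMod 2} (hf : Bal f) (hg : Bal g) {c : ZMod 2}
    (h : ∀ t, f t = c → g t ≠ c) (t : Fin 4) : g t = f t + 1 := by
  revert f g c t; decide

theorem Bal.eq_of_subset {f g : Fin 4 → ZMod 2} (hf : Bal f) (hg : Bal g) {c : ZMod 2}
    (h : ∀ t, f t = c → g t = c) : f = g := by
  revert f g c; decide

theorem ZMod.two_eq_of_ne {a b c : ZMod 2} (h : a ≠ c) (h' : b ≠ c) : a = b := by
  revert a b c; decide

theorem ZMod.two_eq_add_one {a c : ZMod 2} (h : a ≠ c) : a = c + 1 := by revert a c; decide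

/-! ### Components of level sets and their blocks of directions. -/

section Moves
variable {ι : Type*} [DecidableEq ι]

/-- All lines of `F` are balanced. -/
def BalF (F : (ι → Fin 4) → ZMod 2) : Prop := ∀ x i, Bal fun t => F (Function.update x i t)

/-- One move inside a level set of `F`, changing one coordinate from `D`. -/
def Move (F : (ι → Fin 4) → ZMod 2) (D : Set ι) (x y : ι → Fin 4) : Prop :=
  F x = F y ∧ ∃ i ∈ D, ∃ q, y = Function.update x i q

/-- Connectedness inside a level set of `F` by moves in the directions `D`. -/
def Conn (F : (ι → Fin 4) → ZMod 2) (D : Set ι) : (ι → Fin 4) → (ι → Fin 4) → Prop :=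
  Relation.ReflTransGen (Move F D)

variable {F : (ι → Fin 4) → ZMod 2} {D : Set ι} {x y z : ι → Fin 4}

theorem Move.symm (h : Move F D x y) : Move F D y x := by
  obtain ⟨h, i, hi, q, rfl⟩ := h
  exact ⟨h.symm, i, hi, x i, by simp⟩

theorem Conn.refl (F : (ι → Fin 4) → ZMod 2) (D : Set ι) (x : ι → Fin 4) : Conn F D x x :=
  Relation.ReflTransGen.refl

theorem Conn.trans (h : Conn F D x y) (h' : Conn F D y z) : Conn F D x z :=
  Relation.ReflTransGen.trans h h'

theorem Conn.symm (h : Conn F D x y) : Conn F D y x := by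
  induction h with
  | refl => exact Conn.refl _ _ _
  | tail _ h ih => exact Relation.ReflTransGen.head h.symm ih

theorem Conn.level (h : Conn F D x y) : F x = F y := by
  induction h with
  | refl => rfl
  | tail _ h ih => exact ih.trans h.1

theorem Conn.update {i : ι} (hi : i ∈ D) (h : Conn F D x y) {q : Fin 4}
    (hq : F (Function.update y i q) = F y) : Conn F D x (Function.update y i q) :=
  Relation.ReflTransGen.tail h ⟨hq.symm, i, hi, q, rfl⟩

theorem Conn.mono {E : Set ι} (hDE : D ⊆ E) (h : Conn F D x y) : Conn F E x y := by
  refine Relation.ReflTransGen.mono ?_ _ _ h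
  rintro a b ⟨h, i, hi, q, rfl⟩
  exact ⟨h, i, hDE hi, q, rfl⟩

theorem Conn.eq_off (h : Conn F D x y) {i : ι} (hi : i ∉ D) : y i = x i := by
  induction h with
  | refl => rfl
  | tail _ h ih =>
    obtain ⟨-, j, hj, q, rfl⟩ := h
    rw [Function.update_of_ne (by rintro rfl; exact hi hj), ih]

/-- A set closed under moves in directions from `D` contains with `x` every `y` that differs from
`x` only in `D`. -/
theorem mem_of_closed [Finite ι] {P : (ι → Fin 4) → Prop} {D : Set ι}
    (hP : ∀ x, P x → ∀ i ∈ D, ∀ q, P (Function.update x i q)) {x y : ι → Fin 4} (hx : P x)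
    (hxy : ∀ i ∉ D, y i = x i) : P y := by
  classical
  cases nonempty_fintype ι
  have key : ∀ (S : Finset ι), (∀ i ∈ S, i ∈ D) → ∀ y : ι → Fin 4, (∀ i ∉ S, y i = x i) → P y := by
    intro S
    induction S using Finset.induction_on with
    | empty => intro _ y hy; rwa [show y = x from funext fun i => hy i (by simp)]
    | insert a S ha ih =>
      intro hS y hy
      have h1 := ih (fun i hi => hS i (Finset.mem_insert_of_mem hi)) (Function.update y a (x a))
        (fun i hi => by
          by_cases h : i = a
          · subst h; simp
          · rw [Function.update_of_ne h]; exact hy i (by simp [h, hi]))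
      have h2 := hP _ h1 a (hS a (Finset.mem_insert_self _ _)) (y a)
      simpa using h2
  refine key (Finset.univ.filter fun i => i ∈ D) (by simp) y fun i hi => hxy i (by simpa using hi)

/-- Directions in which the line through `x` meets the component of `a`. -/
def dirs (F : (ι → Fin 4) → ZMod 2) (a x : ι → Fin 4) : Set ι :=
  {i | ∃ q, Conn F Set.univ a (Function.update x i q)}

/-- The common set of directions of the neighbours, in direction `i`, of the component of `a`. -/
def blk (F : (ι → Fin 4) → ZMod 2) (a : ι → Fin 4) (i : ι) : Set ι :=
  {j | ∃ q, F (Function.update a i q) ≠ F a ∧ j ∈ dirs F a (Function.update a i q)}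

/-- Points of the component of `a`, and points off its level whose set of directions is `I`. -/
def Reg (F : (ι → Fin 4) → ZMod 2) (a : ι → Fin 4) (I : Set ι) (z : ι → Fin 4) : Prop :=
  Conn F Set.univ a z ∨ (F z ≠ F a ∧ dirs F a z = I)

variable {a : ι → Fin 4}

theorem Conn.line {i : ι} {q r : Fin 4} (h : Conn F Set.univ a (Function.update x i q))
    (hr : F (Function.update x i r) = F a) : Conn F Set.univ a (Function.update x i r) := by
  have := h.update (Set.mem_univ i) (q := r) (by rw [Function.update_idem, hr, h.level])
  rwa [Function.update_idem] at this

/-- The parallel lines through the two points share the opposite level at the position `x i`, so by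
`Bal.exists_common` both reach the level of `a` at a common position. There a move in direction `j`
carries the component from one line to the other. -/
theorem dirs_subset_of_move (hF : BalF F) {j : ι} {q : Fin 4} (hx : F x ≠ F a)
    (hx' : F (Function.update x j q) ≠ F a) : dirs F a x ⊆ dirs F a (Function.update x j q) := by
  rintro i ⟨r, hr⟩
  by_cases hij : i = j
  · subst hij; exact ⟨r, by rwa [Function.update_idem]⟩
  · have hc : F (Function.update x j q) = F x := ZMod.two_eq_of_ne hx' hx
    obtain ⟨b, hb, hb'⟩ := (hF x i).exists_common (hF (Function.update x j q) i) (a := x i)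
      (c := F x) (by simp) (by
        rw [← hc]; congr 1
        rw [Function.update_comm (Ne.symm hij) , Function.update_eq_self])
    have e : F a = F x + 1 := ZMod.two_eq_add_one (Ne.symm hx)
    have hb1 := (ZMod.two_eq_add_one hb).trans e.symm
    have hb2 := (ZMod.two_eq_add_one hb').trans e.symm
    refine ⟨b, ?_⟩
    have h1 := hr.line hb1
    rw [Function.update_comm (Ne.symm hij)] at hb2 ⊢
    exact h1.update (Set.mem_univ j) (hb2.trans hb1.symm)

theorem dirs_move (hF : BalF F) {j : ι} {q : Fin 4} (hx : F x ≠ F a)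
    (hx' : F (Function.update x j q) ≠ F a) : dirs F a (Function.update x j q) = dirs F a x := by
  refine Set.Subset.antisymm ?_ (dirs_subset_of_move hF hx hx')
  have := dirs_subset_of_move hF (x := Function.update x j q) (j := j) (q := x j) hx' (by simpa)
  simpa using this

theorem dirs_same_line (hF : BalF F) {i : ι} {q r : Fin 4} (hq : F (Function.update x i q) ≠ F a)
    (hr : F (Function.update x i r) ≠ F a) :
    dirs F a (Function.update x i r) = dirs F a (Function.update x i q) := by
  have := dirs_move hF (x := Function.update x i q) (j := i) (q := r) hq (by simpa)
  simpa using this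

/-- Follow a path from `a` to `y`. The lines in direction `i` through consecutive points leave the
level at a common position, and adjacent points off the level see the component in the same
directions. So the set of directions depends only on the component and on `i`. -/
theorem dirs_eq_blk (hF : BalF F) {i : ι} (hy : Conn F Set.univ a y) {q : Fin 4}
    (hq : F (Function.update y i q) ≠ F a) : dirs F a (Function.update y i q) = blk F a i := by
  have key : ∀ q', F (Function.update a i q') ≠ F a →
      dirs F a (Function.update y i q) = dirs F a (Function.update a i q') := by
    induction hy generalizing q with
    | refl => intro q' hq'; exact dirs_same_line hF hq' hq
    | @tail y y1 h1 h ih =>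
      intro q' hq'
      have e := Conn.level h1
      obtain ⟨h, j, -, r, rfl⟩ := h
      by_cases hij : j = i
      · subst hij
        rw [Function.update_idem] at hq ⊢
        exact ih hq q' hq'
      · obtain ⟨b, hb, hb'⟩ := (hF y i).exists_common (hF (Function.update y j r) i) (a := y i)
          (c := F a) (by simp [e]) (by
            rw [Function.update_comm hij, Function.update_eq_self, e, h])
        rw [← ih hb q' hq', dirs_same_line hF hb' hq]
        rw [Function.update_comm hij] at hb' ⊢
        exact dirs_move hF hb hb'
  obtain ⟨q', hq'⟩ := (hF a i).exists_ne (F a)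
  rw [key q' hq']
  ext j
  constructor
  · intro h; exact ⟨q', hq', h⟩
  · rintro ⟨r, hr, h⟩; rwa [dirs_same_line hF hr hq']

theorem self_mem_blk (hF : BalF F) (i : ι) : i ∈ blk F a i := by
  obtain ⟨q, hq⟩ := (hF a i).exists_ne (F a)
  exact ⟨q, hq, a i, by simpa using Conn.refl _ _ _⟩

/-- A neighbour of the component in direction `i` whose line in direction `j` also meets the
component is a neighbour in direction `j` as well. Together with `self_mem_blk`, the blocks of a
component partition the directions. -/
theorem blk_eq_of_mem (hF : BalF F) {i j : ι} (h : j ∈ blk F a i) : blk F a j = blk F a i := by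
  obtain ⟨q, hq, r, hr⟩ := h
  rw [← dirs_eq_blk hF (Conn.refl _ _ _) hq]
  have := dirs_eq_blk hF hr (i := j) (q := Function.update a i q j) (by simpa using hq)
  simpa using this.symm

theorem Conn.reg {I : Set ι} (h : Conn F Set.univ a z) : Reg F a I z := Or.inl h

/-- Consequently a whole coset of the block stays in the region, and the part of the coset on the
level of `a` belongs to one component. -/
theorem Reg.move (hF : BalF F) {I : Set ι} (hI : ∀ i ∈ I, blk F a i = I) (h : Reg F a I z)
    {i : ι} (hi : i ∈ I) (q : Fin 4) : Reg F a I (Function.update z i q) := by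
  by_cases hq : F (Function.update z i q) = F a
  · left
    rcases h with h | ⟨h, h'⟩
    · exact h.update (Set.mem_univ _) (by rw [hq, h.level])
    · rw [← h'] at hi
      obtain ⟨r, hr⟩ := hi
      exact hr.line hq
  · right
    refine ⟨hq, ?_⟩
    rcases h with h | ⟨h, h'⟩
    · rw [dirs_eq_blk hF h hq, hI i hi]
    · rw [dirs_move hF h hq, h']

theorem Reg.coset [Finite ι] (hF : BalF F) {I : Set ι} (hI : ∀ i ∈ I, blk F a i = I)
    (h : Reg F a I x) (hxy : ∀ i ∉ I, y i = x i) : Reg F a I y :=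
  mem_of_closed (fun _ hx _ hi q => hx.move hF hI hi q) h hxy

theorem Reg.conn {I : Set ι} (h : Reg F a I z) (hz : F z = F a) : Conn F Set.univ a z := by
  rcases h with h | ⟨h, -⟩
  · exact h
  · exact absurd hz h

theorem Reg.conn_update (hF : BalF F) {I : Set ι} (hI : ∀ i ∈ I, blk F a i = I)
    (h : Reg F a I z) {i : ι} (hi : i ∈ I) {q : Fin 4} (hq : F (Function.update z i q) = F a) :
    Conn F Set.univ a (Function.update z i q) :=
  (h.move hF hI hi q).conn hq

/-- If the two lines reach the level of `a` at a common position without coinciding, some point of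
the component leaves the level in direction `j` while its neighbour still sees the component in
direction `i`; then `i` and `j` would share a block. If there is no common position, the two pairs
are complementary. -/
theorem Reg.square (hF : BalF F) {I : Set ι} (hI : ∀ i ∈ I, blk F a i = I) (h : Reg F a I z)
    {i j : ι} (hi : i ∈ I) (hj : j ∉ I) (r : Fin 4) :
    (∀ t, F (Function.update (Function.update z i t) j r) = F (Function.update z i t)) ∨
    (∀ t, F (Function.update (Function.update z i t) j r) = F (Function.update z i t) + 1) := by
  have hij : i ≠ j := by rintro rfl; exact hj hi
  have hB := hF (Function.update z j r) i
  simp only [Function.update_comm hij.symm] at hB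
  by_cases hs : ∃ t, F (Function.update z i t) = F a ∧
      F (Function.update (Function.update z i t) j r) = F a
  · left
    obtain ⟨t0, h1, h2⟩ := hs
    have c1 := h.conn_update hF hI hi h1
    have c2 := c1.update (Set.mem_univ j) (q := r) (by rw [h2, h1])
    have := (hF z i).eq_of_subset hB (c := F a) (by
      intro t ht
      by_contra hne
      have c3 := h.conn_update hF hI hi ht
      have e := dirs_eq_blk hF c3 hne
      have : i ∈ blk F a j := by
        rw [← e]
        refine ⟨t0, ?_⟩
        rw [Function.update_comm hij.symm, Function.update_idem]
        exact c2
      have e2 := blk_eq_of_mem hF this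
      rw [hI i hi] at e2
      exact hj (e2 ▸ self_mem_blk hF j))
    intro t; exact (congrFun this t).symm
  · right
    intro t
    exact (hF z i).eq_add_of_disjoint hB (c := F a) (fun t h1 h2 => hs ⟨t, h1, h2⟩) t

/-- A shift off the block `I` changes `F` by a constant on a coset. -/
theorem Reg.shift_const [Finite ι] (hF : BalF F) {I : Set ι} (hI : ∀ i ∈ I, blk F a i = I)
    (h : Reg F a I x) (hxy : ∀ i ∉ I, y i = x i) {j : ι} (hj : j ∉ I) (r : Fin 4) :
    F (Function.update y j r) + F y = F (Function.update x j r) + F x := by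
  have := mem_of_closed (D := I) (P := fun y => Reg F a I y ∧
    F (Function.update y j r) + F y = F (Function.update x j r) + F x) ?_ ⟨h, rfl⟩ hxy
  · exact this.2
  rintro z ⟨hz, e⟩ i hi q
  refine ⟨hz.move hF hI hi q, ?_⟩
  rw [← e]
  have := hz.square hF hI hi hj r
  have aux : ∀ a b c d : ZMod 2, (a = b ∧ c = d) ∨ (a = b + 1 ∧ c = d + 1) → a + b = c + d := by
    decide
  apply aux
  rcases this with h | h
  · left; exact ⟨h q, by simpa using h (z i)⟩
  · right; exact ⟨h q, by simpa using h (z i)⟩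

open Classical in
/-- Inside a coset of a block, the component of `a` is connected by moves in the block. -/
theorem conn_block [Finite ι] (hF : BalF F) {I : Set ι} (hI : ∀ i ∈ I, blk F a i = I)
    (hx : Conn F Set.univ a x) (hy : Conn F Set.univ a y) (hxy : ∀ i ∉ I, y i = x i) :
    Conn F I x y := by
  have hc : Conn F Set.univ x y := hx.symm.trans hy
  -- The path is projected to the coset of `x`: moves inside the block are kept, the others dropped.
  -- Dropping is harmless, because a move off the block that preserves `F` at one point of a coset
  -- preserves it on the whole coset.
  have key : ∀ y, Conn F Set.univ x y → (∀ u : ι → Fin 4, (∀ i ∉ I, u i = y i) →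
      F (fun i => if i ∈ I then u i else x i) = F u) ∧
      Conn F I x (fun i => if i ∈ I then y i else x i) := by
    intro y hc
    induction hc with
    | refl =>
      refine ⟨?_, ?_⟩
      · intro u hu
        congr 1; ext i; split_ifs with h
        · rfl
        · rw [hu i h]
      · simpa using Conn.refl _ _ _
    | @tail y y1 h1 h ih =>
      obtain ⟨ih1, ih2⟩ := ih
      obtain ⟨h, j, -, r, rfl⟩ := h
      by_cases hj : j ∈ I
      · refine ⟨?_, ?_⟩
        · intro u hu
          refine ih1 u fun i hi => ?_
          rw [hu i hi, Function.update_of_ne (by rintro rfl; exact hi hj)]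
        · refine Relation.ReflTransGen.tail ih2 ⟨?_, j, hj, r, ?_⟩
          · rw [ih1 y (fun _ _ => rfl), ih1 (Function.update y j r) (fun i hi =>
              Function.update_of_ne (by rintro rfl; exact hi hj) _ _), h]
          · ext i
            by_cases hij : i = j
            · subst hij; simp [hj]
            · simp [Function.update_of_ne hij]
      · refine ⟨?_, ?_⟩
        · intro u hu
          have e := ih1 (Function.update u j (y j)) (fun i hi => by
            by_cases hij : i = j
            · subst hij; simp
            · rw [Function.update_of_ne hij, hu i hi, Function.update_of_ne hij])
          have e1 : (fun i => if i ∈ I then Function.update u j (y j) i else x i) =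
              fun i => if i ∈ I then u i else x i := by
            ext i; split_ifs with hi
            · rw [Function.update_of_ne (by rintro rfl; exact hj hi)]
            · rfl
          rw [e1] at e
          rw [e]
          have hreg : Reg F a I y := (hx.trans h1).reg
          have e2 := hreg.shift_const hF hI (y := Function.update u j (y j)) (fun i hi => by
            by_cases hij : i = j
            · subst hij; simp
            · rw [Function.update_of_ne hij, hu i hi, Function.update_of_ne hij]) hj r
          rw [Function.update_idem, ← h] at e2
          have hur : Function.update u j r = u := by
            have := hu j hj; simp at this
            rw [← this, Function.update_eq_self]
          rw [hur] at e2
          have aux : ∀ a b c : ZMod 2, a + b = c + c → b = a := by decide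
          exact aux _ _ _ e2
        · have : (fun i => if i ∈ I then Function.update y j r i else x i) =
              fun i => if i ∈ I then y i else x i := by
            ext i; split_ifs with hi
            · rw [Function.update_of_ne (by rintro rfl; exact hj hi)]
            · rfl
          rw [this]; exact ih2
  have := (key y hc).2
  rwa [show (fun i => if i ∈ I then y i else x i) = y from by
    ext i; split_ifs with h
    · rfl
    · rw [hxy i h]] at this

end Moves

/-! ### Blocks split the function, and a component determines it. -/

section Blocks
variable {ι : Type*} [DecidableEq ι] [Finite ι] {F : (ι → Fin 4) → ZMod 2} {a x y z : ι → Fin 4}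

/-- `I` is a block of the component of `a`. -/
def IsBlk (F : (ι → Fin 4) → ZMod 2) (a : ι → Fin 4) (I : Set ι) : Prop := ∀ i ∈ I, blk F a i = I

theorem isBlk_blk (hF : BalF F) (a : ι → Fin 4) (i : ι) : IsBlk F a (blk F a i) :=
  fun _ hj => blk_eq_of_mem hF hj

theorem dirs_congr {b : ι → Fin 4} (h : Conn F Set.univ a b) (x : ι → Fin 4) :
    dirs F a x = dirs F b x := by
  ext i; constructor
  · rintro ⟨q, hq⟩; exact ⟨q, h.symm.trans hq⟩
  · rintro ⟨q, hq⟩; exact ⟨q, h.trans hq⟩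

theorem blk_congr (hF : BalF F) {b : ι → Fin 4} (h : Conn F Set.univ a b) (i : ι) :
    blk F a i = blk F b i := by
  obtain ⟨q, hq⟩ := (hF b i).exists_ne (F b)
  rw [← dirs_eq_blk hF h (by rwa [h.level]), ← dirs_eq_blk hF (Conn.refl _ _ _) hq, dirs_congr h]

/-- Shifting a region off its block onto the level set of `a`, the new component has, in each
direction of `I`, the same block, and it contains `I`. -/
theorem exists_shift_block (hF : BalF F) {I : Set ι} (hI : IsBlk F a I) (hne : I.Nonempty)
    (hz : Reg F a I z) (hza : F z ≠ F a) {j : ι} (hj : j ∉ I) {r : Fin 4}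
    (hr : F (Function.update z j r) = F a) :
    ∃ p : ι → Fin 4, Conn F Set.univ a p ∧ F (Function.update p j r) ≠ F a ∧
      I ⊆ dirs F (Function.update z j r) (Function.update p j r) ∧
      ∀ i ∈ I, blk F (Function.update z j r) i =
        dirs F (Function.update z j r) (Function.update p j r) := by
  set b := Function.update z j r with hb
  have hP : ∀ i ∈ I, ∃ s, Conn F Set.univ a (Function.update z i s) := by
    intro i hi
    rcases hz with h | ⟨h, h'⟩
    · exact absurd h.level.symm hza
    · rw [← h'] at hi; exact hi
  -- The shift changes `F` by a constant on the coset. The constant is one, since it takes `z` from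
  -- the opposite level to the level of `a`.
  have hoff : ∀ p, (∀ i ∉ I, p i = z i) → F p = F a → F (Function.update p j r) ≠ F a := by
    intro p hp hpa
    have := hz.shift_const hF hI hp hj r
    rw [hr, hpa] at this
    revert this hza
    generalize F z = u; generalize F a = v; generalize F (Function.update p j r) = w
    revert u v w; decide
  have hdir : ∀ p p', Conn F Set.univ a p → (∀ i ∉ I, p i = z i) → Conn F Set.univ a p' →
      (∀ i ∉ I, p' i = z i) →
      dirs F b (Function.update p j r) = dirs F b (Function.update p' j r) := by
    intro p p' hp hpz hp' hpz'
    have hc := conn_block hF hI hp hp' (fun i hi => by rw [hpz i hi, hpz' i hi])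
    clear hp' hpz'
    induction hc with
    | refl => rfl
    | @tail y y1 h1 h ih =>
      have hay : Conn F Set.univ a y := hp.trans (Conn.mono (Set.subset_univ _) h1)
      have hyz : ∀ i ∉ I, y i = z i := fun i hi => by rw [Conn.eq_off h1 hi, hpz i hi]
      obtain ⟨h, i, hi, q, rfl⟩ := h
      have hij : i ≠ j := by rintro rfl; exact hj hi
      have e1 := hoff y hyz hay.level.symm
      have e2 := hoff (Function.update y i q) (fun k hk => by
        rw [Function.update_of_ne (by rintro rfl; exact hk hi), hyz k hk]) (by rw [← h, hay.level])
      rw [ih]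
      rw [Function.update_comm hij] at e2 ⊢
      exact (dirs_move hF (hr ▸ e1) (hr ▸ e2)).symm
  have hblk : ∀ i ∈ I, ∀ s, Conn F Set.univ a (Function.update z i s) →
      blk F b i = dirs F b (Function.update (Function.update z i s) j r) := by
    intro i hi s hs
    have hij : i ≠ j := by rintro rfl; exact hj hi
    have e := hoff _ (fun k hk => Function.update_of_ne (by rintro rfl; exact hk hi) _ _)
      hs.level.symm
    rw [Function.update_comm hij] at e ⊢
    exact (dirs_eq_blk hF (Conn.refl F Set.univ b) (by rw [hr]; exact e)).symm
  obtain ⟨i0, hi0⟩ := hne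
  obtain ⟨s0, hs0⟩ := hP i0 hi0
  have hz0 : ∀ k ∉ I, Function.update z i0 s0 k = z k := fun k hk =>
    Function.update_of_ne (by rintro rfl; exact hk hi0) _ _
  have hK : ∀ i ∈ I, blk F b i = dirs F b (Function.update (Function.update z i0 s0) j r) := by
    intro i hi
    obtain ⟨s, hs⟩ := hP i hi
    rw [hblk i hi s hs]
    exact hdir _ _ hs (fun k hk => Function.update_of_ne (by rintro rfl; exact hk hi) _ _) hs0 hz0
  refine ⟨_, hs0, hoff _ hz0 hs0.level.symm, ?_, hK⟩
  intro i hi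
  rw [← hK i hi]
  exact self_mem_blk hF i

/-- The block `K` found around the shifted point contains `I`. If `j` lies in `K`, the two
components coincide. Otherwise the same shift taken backwards, applied to `K`, gives the reverse
inclusion. -/
theorem shift_isBlk (hF : BalF F) {I : Set ι} (hI : IsBlk F a I) (hne : I.Nonempty)
    (hz : Reg F a I z) (hza : F z ≠ F a) {j : ι} (hj : j ∉ I) {r : Fin 4}
    (hr : F (Function.update z j r) = F a) : IsBlk F (Function.update z j r) I := by
  obtain ⟨p, hp, hpr, hIK, hK⟩ := exists_shift_block hF hI hne hz hza hj hr
  set b := Function.update z j r with hb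
  set K := dirs F b (Function.update p j r) with hKdef
  obtain ⟨i0, hi0⟩ := id hne
  suffices h : K = I by intro i hi; rw [hK i hi, h]
  by_cases hjK : j ∈ K
  · obtain ⟨s, hs⟩ := hjK
    rw [Function.update_idem] at hs
    have hpa : F p = F b := by rw [hr, hp.level]
    have := hs.line (r := p j) (by rw [Function.update_eq_self, hpa])
    rw [Function.update_eq_self] at this
    rw [← hK i0 hi0, ← hI i0 hi0]
    exact blk_congr hF (this.trans hp.symm) i0
  · refine Set.Subset.antisymm ?_ hIK
    have hKb : IsBlk F b K := by
      rw [← hK i0 hi0]; exact isBlk_blk hF b i0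
    have hlev : F (Function.update (Function.update p j r) j (p j)) = F b := by
      rw [Function.update_idem, Function.update_eq_self, hr, hp.level]
    obtain ⟨p', -, -, h1, h2⟩ := exists_shift_block hF hKb ⟨i0, hIK hi0⟩
      (z := Function.update p j r) (Or.inr ⟨hr ▸ hpr, rfl⟩) (hr ▸ hpr) hjK hlev
    simp only [Function.update_idem, Function.update_eq_self] at h1 h2
    rw [← h2 i0 (hIK hi0), ← blk_congr hF hp, hI i0 hi0] at h1
    exact h1

/-- Every point lies in a region of some component, on the same level, having `I` as a block. -/
theorem exists_reg (hF : BalF F) {I : Set ι} (hI : IsBlk F a I) (hne : I.Nonempty)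
    (z : ι → Fin 4) : ∃ b, F b = F a ∧ IsBlk F b I ∧ Reg F b I z := by
  refine mem_of_closed (D := Set.univ) (P := fun z => ∃ b, F b = F a ∧ IsBlk F b I ∧ Reg F b I z)
    ?_ (x := a) ⟨a, rfl, hI, (Conn.refl _ _ _).reg⟩ (fun i hi => absurd (Set.mem_univ i) hi)
  rintro z ⟨b, hba, hb, hz⟩ j - r
  by_cases hj : j ∈ I
  · exact ⟨b, hba, hb, hz.move hF hb hj r⟩
  obtain ⟨i, hi⟩ := id hne
  have hij : i ≠ j := by rintro rfl; exact hj hi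
  have hback : Function.update (Function.update z j r) i (z i) = Function.update z j r := by
    rw [Function.update_comm hij.symm, Function.update_eq_self]
  rcases hz.square hF hb hi hj r with h | h
  -- The shift preserves `F` along the line, so it stays inside the component.
  · obtain ⟨t, ht⟩ := (hF z i).exists_eq (F b)
    have c1 := hz.conn_update hF hb hi ht
    have c2 := c1.update (Set.mem_univ j) (q := r) (h t)
    refine ⟨b, hba, hb, ?_⟩
    have := (c2.reg (I := I)).move hF hb hi (z i)
    rwa [Function.update_comm hij, Function.update_idem, Function.update_comm hij.symm,
      Function.update_eq_self] at this
  -- The shift flips `F`, so a point of the line off the level lands on it, in a component that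
  -- again has the block `I` by `shift_isBlk`.
  · obtain ⟨t, ht⟩ := (hF z i).exists_ne (F b)
    have e : F (Function.update (Function.update z i t) j r) = F b := by
      rw [h t, ZMod.two_eq_add_one ht, add_assoc]
      simp [show (1 : ZMod 2) + 1 = 0 from rfl]
    refine ⟨_, e.trans hba, shift_isBlk hF hb hne (hz.move hF hb hi t) ht hj e, ?_⟩
    have := ((Conn.refl F Set.univ (Function.update (Function.update z i t) j r)).reg
      (I := I)).move hF (shift_isBlk hF hb hne (hz.move hF hb hi t) ht hj e) hi (z i)
    rw [Function.update_comm hij, Function.update_idem, hback] at this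
    rwa [Function.update_comm hij]

/-- `F` is a sum of a function of the coordinates in `I` and one of the others. -/
def SplitOn (F : (ι → Fin 4) → ZMod 2) (I : Set ι) : Prop :=
  ∀ x x' y y' : ι → Fin 4, (∀ i ∈ I, x i = y i ∧ x' i = y' i) →
    (∀ i ∉ I, x i = x' i ∧ y i = y' i) → F x + F x' + F y + F y' = 0

/-- By `exists_reg` every point lies in a region with block `I`, and there a move off `I` changes
`F` by the same amount on the whole coset. Hence `F w + F (φ w)` is unchanged while `w` moves off
`I`. -/
theorem IsBlk.splitOn (hF : BalF F) {I : Set ι} (hI : IsBlk F a I) (hne : I.Nonempty) :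
    SplitOn F I := by
  intro x x' y y' h1 h2
  -- move `y` to `x` off `I`
  classical
  let φ : (ι → Fin 4) → (ι → Fin 4) := fun w i => if i ∈ I then x' i else w i
  have key := mem_of_closed (D := Iᶜ) (P := fun w => (∀ i ∈ I, w i = x i) ∧
    F x + F x' + F w + F (φ w) = 0) ?_ (x := x) ?_ (y := y) (fun i hi => ?_)
  · have e : φ y = y' := by
      ext i; by_cases hi : i ∈ I
      · simp [φ, hi, (h1 i hi).2]
      · simp [φ, hi, (h2 i hi).2]
    rw [e] at key; exact key.2
  · rintro w ⟨hw, e⟩ j hj r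
    have hj : j ∉ I := hj
    refine ⟨fun i hi => by rw [Function.update_of_ne (by rintro rfl; exact hj hi), hw i hi], ?_⟩
    obtain ⟨b, -, hb, hz⟩ := exists_reg hF hI hne w
    have e1 := hz.shift_const hF hb (y := φ w) (fun i hi => by simp [φ, hi]) hj r
    have e2 : φ (Function.update w j r) = Function.update (φ w) j r := by
      ext i; by_cases hij : i = j
      · subst hij; simp [φ, hj]
      · simp [φ, Function.update_of_ne hij]
    rw [e2]
    revert e e1
    generalize F x = a1; generalize F x' = a2; generalize F w = a3; generalize F (φ w) = a4
    generalize F (Function.update w j r) = a5; generalize F (Function.update (φ w) j r) = a6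
    revert a1 a2 a3 a4 a5 a6; decide
  · refine ⟨fun _ _ => rfl, ?_⟩
    have e : φ x = x' := by
      ext i; by_cases hi : i ∈ I
      · simp [φ, hi]
      · simp [φ, hi, (h2 i hi).1]
    rw [e]
    generalize F x = a1; generalize F x' = a2
    revert a1 a2; decide
  · have hi : i ∈ I := by simpa using hi
    exact (h1 i hi).1.symm

/-- If one block is everything then the level set is connected. -/
theorem conn_of_blk_univ (hF : BalF F) {i : ι} (h : blk F a i = Set.univ) (hx : F x = F a) :
    Conn F Set.univ a x := by
  have hI : IsBlk F a Set.univ := fun j _ => by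
    rw [blk_eq_of_mem hF (i := i) (h ▸ Set.mem_univ j), h]
  exact (((Conn.refl F Set.univ a).reg (I := Set.univ)).coset hF hI (y := x)
    (fun i hi => absurd (Set.mem_univ i) hi)).conn hx

/-- Level sets inside cosets of a block are connected by moves in the block. -/
theorem IsBlk.conn_coset (hF : BalF F) {I : Set ι} (hI : IsBlk F a I) (hne : I.Nonempty)
    (hxy : ∀ i ∉ I, y i = x i) (h : F x = F y) (hxa : F x = F a) : Conn F I x y := by
  obtain ⟨b, hba, hb, hz⟩ := exists_reg hF hI hne x
  exact conn_block hF hb (hz.conn (hxa.trans hba.symm))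
    ((hz.coset hF hb hxy).conn (h.symm.trans (hxa.trans hba.symm))) hxy

/-- On the level opposite to `a`, a shift in a direction outside `I` flips `F` on the entire coset;
paths are found after the shift and carried back. This is where `I` must be proper. -/
theorem IsBlk.conn_coset' (hF : BalF F) {I : Set ι} (hI : IsBlk F a I) (hne : I.Nonempty)
    (hIu : I ≠ Set.univ) (hxy : ∀ i ∉ I, y i = x i) (h : F x = F y) : Conn F I x y := by
  by_cases hxa : F x = F a
  · exact hI.conn_coset hF hne hxy h hxa
  obtain ⟨j, hj⟩ := (Set.ne_univ_iff_exists_notMem _).1 hIu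
  obtain ⟨r, hr⟩ := (hF x j).exists_eq (F a)
  obtain ⟨b, -, hb, hz⟩ := exists_reg hF hI hne x
  have hs : ∀ w, (∀ i ∉ I, w i = x i) →
      F (Function.update w j r) + F w = F (Function.update x j r) + F x :=
    fun w hw => hz.shift_const hF hb hw hj r
  have hc := hI.conn_coset hF hne (x := Function.update x j r) (y := Function.update y j r)
    (fun i hi => by
      by_cases hij : i = j
      · subst hij; simp
      · simp [Function.update_of_ne hij, hxy i hi])
    (by have := hs y hxy; rw [h] at this; exact (add_right_cancel this).symm) hr
  have key : ∀ w, Conn F I (Function.update x j r) w → Conn F I x (Function.update w j (x j)) := by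
    intro w hw
    induction hw with
    | refl => simpa using Conn.refl _ _ _
    | @tail y y1 h1 h ih =>
      have h2 : Conn F I _ _ := Relation.ReflTransGen.tail h1 h
      have e : ∀ w, Conn F I (Function.update x j r) w → F (Function.update w j (x j)) = F x := by
        intro w hw
        have e1 := hs (Function.update w j (x j)) (fun i hi => by
          by_cases hij : i = j
          · subst hij; simp
          · rw [Function.update_of_ne hij, hw.eq_off hi, Function.update_of_ne hij])
        rw [Function.update_idem] at e1
        have e2 : Function.update w j r = w := by
          have := hw.eq_off hj
          rw [Function.update_self] at this
          rw [← this, Function.update_eq_self]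
        rw [e2, ← hw.level] at e1
        exact add_left_cancel e1
      have e1 := e _ h1
      have e2 := e _ h2
      obtain ⟨h, i, hi, q, rfl⟩ := h
      have hij : i ≠ j := by rintro rfl; exact hj hi
      refine Relation.ReflTransGen.tail ih ⟨by rw [e1, e2], i, hi, q, ?_⟩
      rw [Function.update_comm hij]
  have := key _ hc
  rw [Function.update_idem] at this
  rwa [show Function.update y j (x j) = y by rw [← hxy j hj, Function.update_eq_self]] at this

/-- Two functions whose level sets share a component are equal. -/
theorem eq_of_common_component {F' : (ι → Fin 4) → ZMod 2} (hF : BalF F) (hF' : BalF F')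
    (ha : F a = F' a) (h : ∀ x, Conn F Set.univ a x ↔ Conn F' Set.univ a x) : F = F' := by
  have hd : ∀ x, dirs F a x = dirs F' a x := by
    intro x; ext i; simp [dirs, h]
  have hlev : ∀ y i q, Conn F Set.univ a y → (F (Function.update y i q) = F a ↔
      F' (Function.update y i q) = F' a) := by
    intro y i q hy
    constructor
    · intro e
      exact ((h _).1 (hy.update (Set.mem_univ i) (by rw [e, hy.level]))).level.symm
    · intro e
      exact ((h _).2 (((h _).1 hy).update (Set.mem_univ i)
        (by rw [e, ((h _).1 hy).level]))).level.symm
  have hb : ∀ i, blk F a i = blk F' a i := by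
    intro i
    obtain ⟨q, hq⟩ := (hF a i).exists_ne (F a)
    rw [← dirs_eq_blk hF (Conn.refl _ _ _) hq, ← dirs_eq_blk hF' (Conn.refl _ _ _)
      (fun e => hq ((hlev _ _ _ (Conn.refl _ _ _)).2 e)), hd]
  have hreg : ∀ i z, Reg F a (blk F a i) z → (∀ j ∈ blk F a i, blk F a j = blk F a i) →
      (∀ k ∉ blk F a i, z k = a k) → F z = F' z := by
    intro i z _ hB hz
    have hB' : IsBlk F' a (blk F a i) := by
      intro j hj; rw [← hb, hB j hj]
    have r1 := ((Conn.refl F Set.univ a).reg (I := blk F a i)).coset hF hB hz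
    have r2 := ((Conn.refl F' Set.univ a).reg (I := blk F a i)).coset hF' hB' hz
    have : F z = F a ↔ F' z = F' a :=
      ⟨fun e => ((h _).1 (r1.conn e)).level.symm, fun e => ((h _).2 (r2.conn e)).level.symm⟩
    by_cases e : F z = F a
    · rw [e, this.1 e, ha]
    · rw [ZMod.two_eq_add_one e, ZMod.two_eq_add_one (fun e' => e (this.2 e')), ha]
  classical
  cases nonempty_fintype ι
  -- Induction on the number of coordinates in which `x` differs from `a`. Splitting off the block
  -- of such a coordinate reduces `x` to a point `v` in a coset through `a`, where the component
  -- decides the value, and to a point `u` closer to `a`.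
  have key : ∀ n, ∀ x, (Finset.univ.filter fun i => x i ≠ a i).card = n → F x = F' x := by
    intro n
    induction n using Nat.strong_induction_on with
    | _ n ih =>
      intro x hx
      by_cases hxa : x = a
      · rw [hxa, ha]
      obtain ⟨i, hi⟩ := Function.ne_iff.1 hxa
      let I := blk F a i
      have hI : IsBlk F a I := isBlk_blk hF a i
      have hI' : IsBlk F' a I := by intro j hj; rw [← hb, hI j hj]
      have hiI : i ∈ I := self_mem_blk hF i
      let u : ι → Fin 4 := fun k => if k ∈ I then a k else x k
      let v : ι → Fin 4 := fun k => if k ∈ I then x k else a k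
      have hu : F u = F' u := by
        refine ih _ ?_ u rfl
        rw [← hx]
        refine Finset.card_lt_card (Finset.ssubset_iff_subset_ne.2 ⟨?_, ?_⟩)
        · intro k; by_cases hk : k ∈ I <;> simp [u, hk]
        · intro e
          have : i ∈ Finset.univ.filter fun i => x i ≠ a i := by simp [hi]
          rw [← e] at this
          simp [u, hiI] at this
      have hv : F v = F' v := by
        refine hreg i v ?_ hI (fun k hk => by simp [v, show k ∉ I from hk])
        exact ((Conn.refl F Set.univ a).reg).coset hF hI
          (fun k hk => by simp [v, show k ∉ I from hk])
      have s := hI.splitOn hF ⟨i, hiI⟩ x u v a (fun k hk => by simp [u, v, hk])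
        (fun k hk => by simp [u, v, hk])
      have s' := hI'.splitOn hF' ⟨i, hiI⟩ x u v a (fun k hk => by simp [u, v, hk])
        (fun k hk => by simp [u, v, hk])
      rw [hu, hv, ha] at s
      have := s.trans s'.symm
      exact add_right_cancel (add_right_cancel (add_right_cancel this))
  funext x
  exact key _ x rfl

end Blocks

/-! ### Codes, unions of two codes, and codes inside a level set. -/

section Codes
variable {ι : Type*} [DecidableEq ι]

/-- Every line contains exactly one point of `A`. -/
def IsCode (A : Set (ι → Fin 4)) : Prop := ∀ x i, ∃! q, Function.update x i q ∈ A

open Classical in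
/-- The function vanishing exactly on `A ∪ B`. -/
noncomputable def dbl (A B : Set (ι → Fin 4)) (x : ι → Fin 4) : ZMod 2 :=
  if x ∈ A ∨ x ∈ B then 0 else 1

open Classical in
/-- The position of the point of `A` on the line through `x` in direction `j`. -/
noncomputable def gr (A : Set (ι → Fin 4)) (j : ι) (x : ι → Fin 4) : Fin 4 :=
  Classical.epsilon fun q => Function.update x j q ∈ A

variable {A B X Y : Set (ι → Fin 4)} {F : (ι → Fin 4) → ZMod 2} {x y : ι → Fin 4}

theorem IsCode.gr_mem (hA : IsCode A) (j : ι) (x : ι → Fin 4) :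
    Function.update x j (gr A j x) ∈ A :=
  Classical.epsilon_spec (p := fun q => Function.update x j q ∈ A) (hA x j).exists

theorem IsCode.update_mem_iff (hA : IsCode A) {j : ι} {q : Fin 4} :
    Function.update x j q ∈ A ↔ gr A j x = q :=
  ⟨fun h => (hA x j).unique (hA.gr_mem j x) h, fun h => h ▸ hA.gr_mem j x⟩

theorem IsCode.mem_iff (hA : IsCode A) (j : ι) : x ∈ A ↔ gr A j x = x j := by
  rw [← hA.update_mem_iff, Function.update_eq_self]

@[simp] theorem gr_update (A : Set (ι → Fin 4)) (j : ι) (x : ι → Fin 4) (q : Fin 4) :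
    gr A j (Function.update x j q) = gr A j x := by simp [gr]

theorem IsCode.gr_bijective (hA : IsCode A) {i j : ι} (hij : i ≠ j) (x : ι → Fin 4) :
    Function.Bijective fun t => gr A j (Function.update x i t) := by
  rw [← Finite.injective_iff_bijective]
  intro s t h
  have h1 := hA.gr_mem j (Function.update x i s)
  have h2 := hA.gr_mem j (Function.update x i t)
  simp only at h
  rw [h, Function.update_comm hij] at h1
  rw [Function.update_comm hij] at h2
  exact (hA _ i).unique h1 h2

theorem dbl_eq_zero : dbl A B x = 0 ↔ x ∈ A ∨ x ∈ B := by
  unfold dbl; split_ifs with h <;> simp [h]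

theorem dbl_ne_zero : dbl A B x = 1 ↔ x ∉ A ∧ x ∉ B := by
  unfold dbl; split_ifs with h
  · simp; tauto
  · simpa using h

theorem bal_of_zeros {f : Fin 4 → ZMod 2} {a b : Fin 4} (hab : a ≠ b)
    (h : ∀ t, f t = 0 ↔ t = a ∨ t = b) : Bal f := by
  have e : f = fun t => if t = a ∨ t = b then 0 else 1 := by
    ext t
    by_cases ht : t = a ∨ t = b
    · simp [ht, (h t).2 ht]
    · simp only [ht, if_false]
      exact ZMod.two_eq_add_one (fun h0 => ht ((h t).1 h0))
  subst e
  clear h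
  revert a b; decide

theorem balF_dbl (hA : IsCode A) (hB : IsCode B) (h : ∀ x ∈ A, x ∉ B) : BalF (dbl A B) := by
  intro x i
  refine bal_of_zeros (a := gr A i x) (b := gr B i x) ?_ fun t => ?_
  · intro e
    exact h _ (hA.gr_mem i x) (by rw [e]; exact hB.gr_mem i x)
  · rw [dbl_eq_zero, hA.update_mem_iff, hB.update_mem_iff]
    tauto

theorem BalF.add_const (hF : BalF F) (c : ZMod 2) : BalF fun x => F x + c := by
  intro x i
  have : ∀ f : Fin 4 → ZMod 2, ∀ c, Bal f → Bal fun t => f t + c := by decide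
  exact this _ c (hF x i)

theorem Bal.mem_pair {f : Fin 4 → ZMod 2} (hf : Bal f) {a b : Fin 4} {c : ZMod 2} (hab : a ≠ b)
    (ha : f a = c) (hb : f b = c) {t : Fin 4} (ht : f t = c) : t = a ∨ t = b := by
  have key : ∀ f : Fin 4 → ZMod 2, Bal f → ∀ a b t, a ≠ b → f a = f b → f t = f b →
    t = a ∨ t = b := by decide
  exact key f hf a b t hab (ha.trans hb.symm) (ht.trans hb.symm)

/-- Two points of a line on which `X` is confined to two positions: exactly one is in `X`. -/
theorem IsCode.flip (hX : IsCode X) {i : ι} {q : Fin 4} {f : Fin 4 → ZMod 2} (hf : Bal f)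
    {c : ZMod 2} (h : ∀ t, Function.update x i t ∈ X → f t = c) (hx : f (x i) = c) (hq : f q = c)
    (hne : q ≠ x i) : Function.update x i q ∈ X ↔ x ∉ X := by
  have h1 := hf.mem_pair hne hq hx (h _ (hX.gr_mem i x))
  rw [hX.update_mem_iff, hX.mem_iff i]
  rcases h1 with h1 | h1
  · rw [h1]; simp [hne]
  · rw [h1]; simp [hne.symm]

/-- Two codes inside a level set agree or disagree simultaneously along a component. -/
theorem Conn.agree {D : Set ι} (hF : BalF F) (hX : IsCode X) (hY : IsCode Y)
    (hXF : ∀ x ∈ X, F x = 0) (hYF : ∀ x ∈ Y, F x = 0) (h : Conn F D x y) (hx : F x = 0) :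
    (x ∈ X ↔ x ∈ Y) ↔ (y ∈ X ↔ y ∈ Y) := by
  induction h with
  | refl => rfl
  | @tail y y1 h1 h ih =>
    have e := Conn.level h1
    rw [ih]
    obtain ⟨h, i, hi, q, rfl⟩ := h
    by_cases hq : q = y i
    · rw [hq, Function.update_eq_self]
    · have f1 := hX.flip (hF y i) (fun t ht => hXF _ ht) (by simp [← e, hx])
        (by simp only [← h, ← e, hx]) hq
      have f2 := hY.flip (hF y i) (fun t ht => hYF _ ht) (by simp [← e, hx])
        (by simp only [← h, ← e, hx]) hq
      rw [f1, f2]; tauto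

/-- A code inside a connected level set is determined by one point. -/
theorem IsCode.eq_of_conn (hF : BalF F) (hX : IsCode X) (hY : IsCode Y)
    (hXF : ∀ x ∈ X, F x = 0) (hYF : ∀ x ∈ Y, F x = 0)
    (hc : ∀ x y, F x = 0 → F y = 0 → Conn F Set.univ x y) (hx : F x = 0)
    (h : x ∈ X ↔ x ∈ Y) : X = Y := by
  ext y
  by_cases hy : F y = 0
  · exact ((hc x y hx hy).agree hF hX hY hXF hYF hx).1 h
  · exact ⟨fun h => absurd (hXF y h) hy, fun h => absurd (hYF y h) hy⟩

theorem IsCode.eq_of_subset [Nonempty ι] (hX : IsCode X) (hY : IsCode Y) (h : X ⊆ Y) : X = Y := by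
  refine h.antisymm fun x hx => ?_
  obtain ⟨i⟩ := ‹Nonempty ι›
  rw [hX.mem_iff i]
  rw [hY.mem_iff i] at hx
  rw [← hx]
  exact (hY.update_mem_iff.1 (h (hX.gr_mem i x))).symm

/-- The part of a level set outside a code in it is a code. -/
theorem IsCode.compl (hF : BalF F) (hX : IsCode X) {c : ZMod 2} (hXF : ∀ x ∈ X, F x = c) :
    IsCode {x | F x = c ∧ x ∉ X} := by
  intro x i
  have h1 := hXF _ (hX.gr_mem i x)
  have key : ∀ f : Fin 4 → ZMod 2, Bal f → ∀ a, ∃ q, (f q = f a ∧ a ≠ q) ∧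
    ∀ r, f r = f a ∧ a ≠ r → r = q := by decide
  have := key _ (hF x i) (gr X i x)
  simp only [h1] at this
  simpa only [Set.mem_ofPred_eq, hX.update_mem_iff, ExistsUnique] using this

variable [Finite ι]

/-- If a component of `F` lies in a level set of `G`, then `F` and `G` have the same level sets. -/
theorem eq_of_component_subset {G : (ι → Fin 4) → ZMod 2} (hF : BalF F) (hG : BalF G)
    {a : ι → Fin 4} (h : ∀ y, Conn F Set.univ a y → G y = F a) : F = G := by
  have h0 : G a = F a := h a (Conn.refl _ _ _)
  -- On each line through the component the pair of `F` lies in a pair of `G`, so the two are equal.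
  have hl : ∀ y i, Conn F Set.univ a y → ∀ t, F (Function.update y i t) =
      G (Function.update y i t) := by
    intro y i hy t
    refine congrFun ((hF y i).eq_of_subset (hG y i) (c := F a) fun t ht => ?_) t
    exact h _ (hy.update (Set.mem_univ i) (by rw [ht, hy.level]))
  refine eq_of_common_component hF hG h0.symm (a := a) fun x => ⟨fun hx => ?_, fun hx => ?_⟩
  · induction hx with
    | refl => exact Conn.refl _ _ _
    | @tail y y1 h1 h' ih =>
      obtain ⟨e, i, hi, q, rfl⟩ := h'
      refine Relation.ReflTransGen.tail ih ⟨?_, i, hi, q, rfl⟩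
      rw [← hl y i h1 q, ← e]
      simpa using (hl y i h1 (y i)).symm
  · induction hx with
    | refl => exact Conn.refl _ _ _
    | @tail y y1 h1 h' ih =>
      obtain ⟨e, i, hi, q, rfl⟩ := h'
      refine Relation.ReflTransGen.tail ih ⟨?_, i, hi, q, rfl⟩
      rw [hl y i ih q, ← e]
      simpa using hl y i ih (y i)

/-- The number of codes in the zero set of `F`. -/
noncomputable def numSub (F : (ι → Fin 4) → ZMod 2) : ℕ :=
  Set.ncard {X : Set (ι → Fin 4) | IsCode X ∧ ∀ x ∈ X, F x = 0}

end Codes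

/-! ### Layers of a code along a new coordinate. -/

section Layers
variable {ι : Type*}

/-- Prepend a coordinate. -/
def cons (v : Fin 4) (x : ι → Fin 4) : Option ι → Fin 4 := fun o => o.elim v x

@[simp] theorem cons_none (v : Fin 4) (x : ι → Fin 4) : cons v x none = v := rfl
@[simp] theorem cons_some (v : Fin 4) (x : ι → Fin 4) (i : ι) : cons v x (some i) = x i := rfl

theorem cons_eta (x : Option ι → Fin 4) : cons (x none) (fun i => x (some i)) = x := by
  ext o; cases o <;> rfl

theorem forall_cons {P : (Option ι → Fin 4) → Prop} : (∀ x, P x) ↔ ∀ v x, P (cons v x) :=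
  ⟨fun h v x => h _, fun h x => cons_eta x ▸ h _ _⟩

/-- The layer of `C` with first coordinate `v`. -/
def layer (C : Set (Option ι → Fin 4)) (v : Fin 4) : Set (ι → Fin 4) := {x | cons v x ∈ C}

@[simp] theorem mem_layer {C : Set (Option ι → Fin 4)} {v : Fin 4} {x : ι → Fin 4} :
    x ∈ layer C v ↔ cons v x ∈ C := Iff.rfl

/-- The set with given layers. -/
def glue (P : Fin 4 → Set (ι → Fin 4)) : Set (Option ι → Fin 4) :=
  {x | (fun i => x (some i)) ∈ P (x none)}

theorem glue_layer (C : Set (Option ι → Fin 4)) : glue (layer C) = C := by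
  ext x; simp [glue, cons_eta]

theorem layer_injective {C C' : Set (Option ι → Fin 4)} (h : ∀ v, layer C v = layer C' v) :
    C = C' := by
  rw [← glue_layer C, ← glue_layer C', funext h]

variable [DecidableEq ι]

@[simp] theorem update_cons_none (v q : Fin 4) (x : ι → Fin 4) :
    Function.update (cons v x) none q = cons q x := by
  ext o; cases o <;> simp

@[simp] theorem update_cons_some (v q : Fin 4) (x : ι → Fin 4) (i : ι) :
    Function.update (cons v x) (some i) q = cons v (Function.update x i q) := by
  ext o; cases o with
  | none => simp
  | some k => by_cases h : k = i
              · subst h; simp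
              · simp [h]

variable {C : Set (Option ι → Fin 4)} {F : (Option ι → Fin 4) → ZMod 2}

theorem IsCode.layer (hC : IsCode C) (v : Fin 4) : IsCode (layer C v) := by
  intro x i
  simpa using hC (cons v x) (some i)

theorem IsCode.layer_unique (hC : IsCode C) (x : ι → Fin 4) : ∃! v, x ∈ _root_.layer C v := by
  simpa using hC (cons 0 x) none

theorem IsCode.layer_disjoint (hC : IsCode C) {v w : Fin 4} (h : v ≠ w) {x : ι → Fin 4}
    (hv : x ∈ _root_.layer C v) (hw : x ∈ _root_.layer C w) : False :=
  h ((hC.layer_unique x).unique hv hw)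

theorem isCode_of_layers (h1 : ∀ v, IsCode (layer C v)) (h2 : ∀ x, ∃! v, x ∈ layer C v) :
    IsCode C := by
  rw [IsCode, forall_cons]
  intro v x i
  cases i with
  | none => simpa using h2 x
  | some i => simpa using h1 v x i

theorem BalF.layer (hF : BalF F) (v : Fin 4) : BalF fun x => F (cons v x) := by
  intro x i
  simpa using hF (cons v x) (some i)

theorem Conn.cons {v : Fin 4} {D : Set ι} {x y : ι → Fin 4}
    (h : Conn (fun x => F (cons v x)) D x y) :
    Conn F (some '' D) (_root_.cons v x) (_root_.cons v y) := by
  induction h with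
  | refl => exact Conn.refl _ _ _
  | tail _ h ih =>
    obtain ⟨e, i, hi, q, rfl⟩ := h
    exact Relation.ReflTransGen.tail ih ⟨e, some i, ⟨i, hi, rfl⟩, q, by simp⟩

variable [Finite ι]

/-- Two codes that agree in two layers and differ: some component of the complement of these
layers is covered, in any other layer, by the two codes together. -/
theorem exists_component_of_ne {R R' : Set (Option ι → Fin 4)} (hR : IsCode R) (hR' : IsCode R')
    {a b : Fin 4} (hab : a ≠ b) (ha : layer R a = layer R' a) (hb : layer R b = layer R' b)
    (hne : R ≠ R') : ∃ x, dbl (layer R a) (layer R b) x = 1 ∧ ∀ c, c ≠ a → c ≠ b → ∀ y,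
      Conn (dbl (layer R a) (layer R b)) Set.univ x y → y ∈ layer R c ∨ y ∈ layer R' c := by
  set W := dbl (layer R a) (layer R b) with hW
  have hWB : BalF W := balF_dbl (hR.layer a) (hR.layer b) fun x h h' => hR.layer_disjoint hab h h'
  have hWB' := hWB.add_const 1
  have hfin : ∀ a b : Fin 4, a ≠ b → ∃ c d, c ≠ d ∧ c ≠ a ∧ c ≠ b ∧ d ≠ a ∧ d ≠ b ∧
    ∀ e, e = a ∨ e = b ∨ e = c ∨ e = d := by decide
  obtain ⟨c, d, hcd, hca, hcb, hda, hdb, hall⟩ := hfin a b hab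
  have mem : ∀ S : Set (Option ι → Fin 4), IsCode S → layer R a = layer S a →
      layer R b = layer S b → ∀ y, W y = 1 → (y ∈ layer S d ↔ y ∉ layer S c) := by
    intro S hS h1 h2 y hy
    rw [hW, dbl_ne_zero, h1, h2] at hy
    obtain ⟨v, hv⟩ := (hS.layer_unique y).exists
    constructor
    · intro h h'; exact hS.layer_disjoint hcd h' h
    · intro h
      rcases hall v with rfl | rfl | rfl | rfl
      · exact absurd hv hy.1
      · exact absurd hv hy.2
      · exact absurd hv h
      · exact hv
  have sub : ∀ S : Set (Option ι → Fin 4), IsCode S → layer R a = layer S a →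
      layer R b = layer S b → ∀ y ∈ layer S c, W y + 1 = 0 := by
    intro S hS h1 h2 y hy
    have : W y = 1 := by
      rw [hW, dbl_ne_zero, h1, h2]
      exact ⟨fun h => hS.layer_disjoint hca hy h, fun h => hS.layer_disjoint hcb hy h⟩
    rw [this]; rfl
  have hone : ∀ y, W y + 1 = 0 ↔ W y = 1 := by
    intro y; generalize W y = w; revert w; decide
  have hconv : ∀ x y, Conn W Set.univ x y → Conn (fun x => W x + 1) Set.univ x y := by
    intro x y h
    refine Relation.ReflTransGen.mono ?_ _ _ h
    rintro u v ⟨e, h⟩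
    exact ⟨by simp only [e], h⟩
  by_cases hc : layer R c = layer R' c
  · exfalso
    apply hne
    refine layer_injective fun v => ?_
    rcases hall v with rfl | rfl | rfl | rfl
    · exact ha
    · exact hb
    · exact hc
    · ext y
      by_cases hy : W y = 1
      · rw [mem R hR rfl rfl y hy, mem R' hR' ha hb y hy, hc]
      · have : y ∈ layer R a ∨ y ∈ layer R b := by
          rw [← dbl_eq_zero, ← hW]; by_contra h; exact hy (ZMod.two_eq_add_one h)
        constructor
        · intro h
          rcases this with h' | h'
          · exact absurd (hR.layer_disjoint hda h h') id
          · exact absurd (hR.layer_disjoint hdb h h') id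
        · intro h
          rcases this with h' | h'
          · exact absurd (hR'.layer_disjoint hda h (ha ▸ h')) id
          · exact absurd (hR'.layer_disjoint hdb h (hb ▸ h')) id
  -- Off the layers `a` and `b`, the layers `c` of both codes lie in one level set, so a
  -- disagreement at `x` persists along the component: each of its points is in exactly one of them.
  -- The layers `d` are their complements, so they disagree as well.
  · obtain ⟨x, hx⟩ : ∃ x, ¬ (x ∈ layer R c ↔ x ∈ layer R' c) := by
      by_contra! h; exact hc (Set.ext h)
    have hx1 : W x = 1 := by
      rw [← hone]
      by_cases h : x ∈ layer R c
      · exact sub R hR rfl rfl x h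
      · exact sub R' hR' ha hb x (by tauto)
    refine ⟨x, hx1, fun e hea heb y hy => ?_⟩
    have hag := (hconv x y hy).agree hWB' (hR.layer c) (hR'.layer c) (sub R hR rfl rfl)
      (sub R' hR' ha hb) ((hone x).2 hx1)
    have hy1 : W y = 1 := hy.level ▸ hx1
    rcases hall e with rfl | rfl | rfl | rfl
    · exact absurd rfl hea
    · exact absurd rfl heb
    · tauto
    · rw [mem R hR rfl rfl y hy1, mem R' hR' ha hb y hy1]; tauto

/-- Completing a code from two of its layers, with a disjoint code given. -/
theorem eq_or_compl_of_layers {R R' S : Set (Option ι → Fin 4)} (hR : IsCode R) (hR' : IsCode R')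
    (hS : IsCode S) (h : ∀ x ∈ R, x ∉ S) (h' : ∀ x ∈ R', x ∉ S) {a b : Fin 4} (hab : a ≠ b)
    (ha : layer R a = layer R' a) (hb : layer R b = layer R' b) :
    R = R' ∨ ∀ x, (x ∈ layer R a ∨ x ∈ layer R b) ↔ ¬ (x ∈ layer S a ∨ x ∈ layer S b) := by
  by_cases hne : R = R'
  · exact Or.inl hne
  right
  obtain ⟨x, hx, hc⟩ := exists_component_of_ne hR hR' hab ha hb hne
  have hB1 : BalF (dbl (layer R a) (layer R b)) := balF_dbl (hR.layer a) (hR.layer b)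
    fun x h h' => hR.layer_disjoint hab h h'
  have hB2 : BalF (dbl (layer S a) (layer S b)) := balF_dbl (hS.layer a) (hS.layer b)
    fun x h h' => hS.layer_disjoint hab h h'
  -- The two codes cover the component in every other layer, so `S` can meet it only in the layers
  -- `a` and `b`.
  have e := eq_of_component_subset hB1 (hB2.add_const 1) (a := x) (fun y hy => by
    rw [hx]
    have : y ∈ layer S a ∨ y ∈ layer S b := by
      by_contra hcon
      push Not at hcon
      obtain ⟨v, hv⟩ := (hS.layer_unique y).exists
      rcases hc v (by rintro rfl; exact hcon.1 hv) (by rintro rfl; exact hcon.2 hv) y hy with h1 | h1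
      · exact h _ h1 hv
      · exact h' _ h1 hv
    rw [dbl_eq_zero.2 this]; rfl)
  intro y
  rw [← dbl_eq_zero, ← dbl_eq_zero, congrFun e y]
  generalize dbl (layer S a) (layer S b) y = w
  revert w; decide

end Layers

/-! ### Renaming coordinates. -/

section Reindex
variable {ι κ : Type*} [DecidableEq ι] [DecidableEq κ] (e : ι ≃ κ)

theorem update_comp_equiv (x : κ → Fin 4) (i : ι) (q : Fin 4) :
    Function.update x (e i) q ∘ e = Function.update (x ∘ e) i q := by
  ext j
  by_cases h : j = i
  · subst h; simp
  · simp [h]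

theorem BalF.reindex {F : (ι → Fin 4) → ZMod 2} (hF : BalF F) : BalF fun x : κ → Fin 4 => F (x ∘ e) := by
  intro x k
  obtain ⟨i, rfl⟩ := e.surjective k
  simp only [update_comp_equiv]
  exact hF _ i

theorem IsCode.reindex {A : Set (ι → Fin 4)} (hA : IsCode A) : IsCode {x : κ → Fin 4 | x ∘ e ∈ A} := by
  intro x k
  obtain ⟨i, rfl⟩ := e.surjective k
  simp only [Set.mem_ofPred_eq, update_comp_equiv]
  exact hA _ i

theorem Conn.reindex {F : (ι → Fin 4) → ZMod 2} {D : Set ι} {x y : ι → Fin 4} (h : Conn F D x y) :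
    Conn (fun x : κ → Fin 4 => F (x ∘ e)) (e '' D) (x ∘ e.symm) (y ∘ e.symm) := by
  induction h with
  | refl => exact Conn.refl _ _ _
  | @tail y y1 h1 h ih =>
    obtain ⟨h, i, hi, q, rfl⟩ := h
    refine Relation.ReflTransGen.tail ih ⟨?_, e i, ⟨i, hi, rfl⟩, q, ?_⟩
    · simpa [Function.comp_assoc] using h
    · have := update_comp_equiv e.symm y (e i) q
      rw [e.symm_apply_apply] at this
      exact this

theorem preimage_comp_injective : Function.Injective fun X : Set (ι → Fin 4) =>
    {x : κ → Fin 4 | x ∘ e ∈ X} := by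
  intro X Y h
  ext x
  have := Set.ext_iff.1 h (x ∘ e.symm)
  simpa [Function.comp_assoc] using this

variable [Finite ι] [Finite κ]

theorem numSub_reindex_le (F : (ι → Fin 4) → ZMod 2) :
    numSub F ≤ numSub fun x : κ → Fin 4 => F (x ∘ e) := by
  refine Set.ncard_le_ncard_of_injOn (fun X => {x : κ → Fin 4 | x ∘ e ∈ X}) ?_
    (preimage_comp_injective e).injOn (Set.toFinite _)
  rintro X ⟨h1, h2⟩
  exact ⟨h1.reindex e, fun x hx => h2 _ hx⟩

end Reindex

/-! ### The number of codes inside a level set. -/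

section NumSub
variable {ι : Type*} [DecidableEq ι] [Finite ι]

theorem numSub_le_two {F : (ι → Fin 4) → ZMod 2} (hF : BalF F)
    (hc : ∀ x y, F x = 0 → F y = 0 → Conn F Set.univ x y) : numSub F ≤ 2 := by
  classical
  by_cases hx : ∃ x, F x = 0
  · obtain ⟨x, hx⟩ := hx
    have : (2 : ℕ) = (Set.univ : Set Prop).ncard := by
      rw [Set.ncard_univ, Nat.card_eq_fintype_card]; rfl
    rw [this]
    refine Set.ncard_le_ncard_of_injOn (fun X => x ∈ X) (fun _ _ => Set.mem_univ _) ?_ (Set.toFinite _)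
    rintro X ⟨h1, h2⟩ Y ⟨h3, h4⟩ h
    exact h1.eq_of_conn hF h3 h2 h4 hc hx (Iff.of_eq h)
  · refine (Set.ncard_le_ncard (t := {∅}) ?_ (Set.toFinite _)).trans (by simp)
    rintro X ⟨-, h2⟩
    exact Set.eq_empty_of_forall_notMem fun x h => hx ⟨x, h2 x h⟩

/-- If two codes share the layers `a` and `b` and differ, a component outside these layers lies in
the zero sets of `F` on both other layers; then `F` agrees on those two layers, hence also on `a`
and `b`. A balanced `F` cannot agree on three layers, so the pair `0, 1` or the pair `0, 2`
determines the code. -/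
theorem numSub_option_le {F : (Option ι → Fin 4) → ZMod 2} (hF : BalF F) [Nonempty ι] :
    ∃ a b, numSub F ≤ numSub (fun x => F (cons a x)) * numSub (fun x => F (cons b x)) := by
  have key : ∀ a b, (∀ X Y : Set (Option ι → Fin 4), IsCode X → IsCode Y → (∀ x ∈ X, F x = 0) →
      (∀ x ∈ Y, F x = 0) → layer X a = layer Y a → layer X b = layer Y b → X = Y) →
      numSub F ≤ numSub (fun x => F (cons a x)) * numSub (fun x => F (cons b x)) := by
    intro a b h
    rw [numSub, numSub, numSub, ← Set.ncard_prod]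
    refine Set.ncard_le_ncard_of_injOn (fun X => (layer X a, layer X b)) ?_ ?_ (Set.toFinite _)
    · rintro X ⟨h1, h2⟩
      exact ⟨⟨h1.layer a, fun x hx => h2 _ hx⟩, ⟨h1.layer b, fun x hx => h2 _ hx⟩⟩
    · rintro X ⟨h1, h2⟩ Y ⟨h3, h4⟩ e
      simp only [Prod.mk.injEq] at e
      exact h X Y h1 h3 h2 h4 e.1 e.2
  have hfin : ∀ a b : Fin 4, a ≠ b → ∃ c d, c ≠ d ∧ c ≠ a ∧ c ≠ b ∧ d ≠ a ∧ d ≠ b := by decide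
  have main : ∀ a b, a ≠ b → ∀ X Y : Set (Option ι → Fin 4), IsCode X → IsCode Y →
      (∀ x ∈ X, F x = 0) → (∀ x ∈ Y, F x = 0) → layer X a = layer Y a → layer X b = layer Y b →
      X ≠ Y → ∀ x, F (cons a x) = F (cons b x) := by
    intro a b hab X Y hX hY hXF hYF ha hb hne
    obtain ⟨x, hx, hc⟩ := exists_component_of_ne hX hY hab ha hb hne
    have hB : BalF (dbl (layer X a) (layer X b)) := balF_dbl (hX.layer a) (hX.layer b)
      fun x h h' => hX.layer_disjoint hab h h'
    have e : ∀ c, c ≠ a → c ≠ b → ∀ x, dbl (layer X a) (layer X b) x = F (cons c x) + 1 := by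
      intro c hca hcb
      refine congrFun (eq_of_component_subset hB ((hF.layer c).add_const 1) (a := x) fun y hy => ?_)
      have : F (cons c y) = 0 := by
        rcases hc c hca hcb y hy with h | h
        · exact hXF _ h
        · exact hYF _ h
      rw [this, hx]; rfl
    obtain ⟨c, d, hcd, hca, hcb, hda, hdb⟩ := hfin a b hab
    intro y
    have hcd' : F (cons c y) = F (cons d y) := by
      have := (e c hca hcb y).symm.trans (e d hda hdb y)
      exact add_right_cancel this
    have hb := hF (cons a y) none
    simp only [update_cons_none] at hb
    have fin : ∀ f : Fin 4 → ZMod 2, Bal f → ∀ a b c d : Fin 4, (a ≠ b ∧ c ≠ d ∧ c ≠ a ∧ c ≠ b ∧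
      d ≠ a ∧ d ≠ b ∧ f c = f d) → f a = f b := by decide
    exact fin (fun t => F (cons t y)) hb a b c d ⟨hab, hcd, hca, hcb, hda, hdb, hcd'⟩
  by_cases h01 : ∀ x, F (cons 0 x) = F (cons 1 x)
  · refine ⟨0, 2, key 0 2 fun X Y hX hY hXF hYF ha hb => ?_⟩
    by_contra hne
    obtain ⟨x⟩ : Nonempty (ι → Fin 4) := inferInstance
    have h02 := main 0 2 (by decide) X Y hX hY hXF hYF ha hb hne x
    have hb := hF (cons 0 x) none
    simp only [update_cons_none] at hb
    have fin : ∀ f : Fin 4 → ZMod 2, Bal f → ¬ (f 0 = f 1 ∧ f 0 = f 2) := by decide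
    exact fin _ hb ⟨h01 x, h02⟩
  · refine ⟨0, 1, key 0 1 fun X Y hX hY hXF hYF ha hb => ?_⟩
    by_contra hne
    exact h01 (main 0 1 (by decide) X Y hX hY hXF hYF ha hb hne)

end NumSub

theorem numSub_le_of_isEmpty {ι : Type*} [DecidableEq ι] [IsEmpty ι] (F : (ι → Fin 4) → ZMod 2) :
    numSub F ≤ 2 := by
  classical
  have : (2 : ℕ) = (Set.univ : Set (Set (ι → Fin 4))).ncard := by
    rw [Set.ncard_univ, Nat.card_eq_fintype_card, Fintype.card_set, Fintype.card_unique]; rfl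
  rw [this]
  exact Set.ncard_le_ncard (Set.subset_univ _) (Set.toFinite _)

/-- The bound is two in dimension one and is squared by each further coordinate. Truncated
subtraction makes it two in dimension zero as well. -/
theorem numSub_le {ι : Type} [Finite ι] [DecidableEq ι] {F : (ι → Fin 4) → ZMod 2} (hF : BalF F) :
    numSub F ≤ 2 ^ 2 ^ (Nat.card ι - 1) := by
  revert F
  suffices h : ∀ (_ : Finite ι) (d : DecidableEq ι) (F : (ι → Fin 4) → ZMod 2), BalF F →
      numSub F ≤ 2 ^ 2 ^ (Nat.card ι - 1) from fun {_} hF => h inferInstance _ _ hF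
  refine Finite.induction_empty_option (P := fun ι => ∀ (_ : Finite ι) (d : DecidableEq ι)
    (F : (ι → Fin 4) → ZMod 2), BalF F → numSub F ≤ 2 ^ 2 ^ (Nat.card ι - 1)) ?_ ?_ ?_ ι
  · intro α β e ih _ d F hF
    classical
    have : Finite α := Finite.of_equiv β e.symm
    rw [← Nat.card_congr e]
    exact (numSub_reindex_le e.symm F).trans (ih inferInstance inferInstance _ (hF.reindex e.symm))
  · intro _ d F hF
    simpa using numSub_le_of_isEmpty F
  · intro α _ ih _
    classical
    let D : DecidableEq (Option α) := inferInstance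
    intro d F hF
    obtain rfl : d = D := Subsingleton.elim _ _
    rw [Nat.card_eq_fintype_card, Fintype.card_option, Nat.add_sub_cancel]
    rcases isEmpty_or_nonempty α with h | h
    · rw [Fintype.card_eq_zero]
      refine numSub_le_two hF fun x y hx hy => ?_
      have : y = Function.update x none (y none) := by
        funext o; cases o with
        | none => simp
        | some i => exact h.elim i
      exact Relation.ReflTransGen.single ⟨hx.trans hy.symm, none, Set.mem_univ _, _, this⟩
    · obtain ⟨a, b, hab⟩ := numSub_option_le (ι := α) (F := F) hF
      have h1 := ih inferInstance inferInstance _ (BalF.layer (F := F) hF a)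
      have h2 := ih inferInstance inferInstance _ (BalF.layer (F := F) hF b)
      have h3 : 2 ^ 2 ^ (Nat.card α - 1) * 2 ^ 2 ^ (Nat.card α - 1) = 2 ^ 2 ^ Fintype.card α := by
        have : Fintype.card α ≠ 0 := Fintype.card_ne_zero
        obtain ⟨k, hk⟩ := Nat.exists_eq_succ_of_ne_zero this
        rw [Nat.card_eq_fintype_card, hk, Nat.succ_sub_one, ← pow_add, ← two_mul, pow_succ, mul_comm]
      rw [← h3]
      exact hab.trans (Nat.mul_le_mul h1 h2)

/-- The bound when the level sets inside all `I`-cosets are connected. -/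
theorem numSub_le_of_block {n : ℕ} {ι : Type} [Finite ι] [DecidableEq ι] {F : (ι → Fin 4) → ZMod 2}
    (hF : BalF F) {I : Set ι} (hn : Iᶜ.ncard = n)
    (hI : ∀ x y, (∀ i ∉ I, y i = x i) → F x = F y → Conn F I x y) : numSub F ≤ 2 ^ 2 ^ n := by
  induction n generalizing ι with
  | zero =>
    rw [Set.ncard_eq_zero, Set.compl_empty_iff] at hn
    subst hn
    exact numSub_le_two hF fun x y hx hy => hI x y (by simp) (hx.trans hy.symm)
  | succ n ih =>
    classical
    have : Iᶜ.Nonempty := Set.nonempty_of_ncard_ne_zero (by omega)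
    obtain ⟨j, hj⟩ := this
    by_cases hI0 : ∃ i, i ∈ I
    · obtain ⟨i0, hi0⟩ := hI0
      let α := {k : ι // k ≠ j}
      let e : ι ≃ Option α := (Equiv.optionSubtypeNe j).symm
      have ej : e j = none := Equiv.optionSubtypeNe_symm_self j
      have ek : ∀ k : α, e k.1 = some k := fun k =>
        Equiv.optionSubtypeNe_symm_of_ne k.2
      refine (numSub_reindex_le e F).trans ?_
      have : Nonempty α := ⟨⟨i0, by rintro rfl; exact hj hi0⟩⟩
      obtain ⟨a, b, hab⟩ := numSub_option_le (hF.reindex e)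
      refine hab.trans ?_
      have hl : ∀ v, numSub (fun x : α → Fin 4 => F (cons v x ∘ e)) ≤ 2 ^ 2 ^ n := by
        intro v
        refine ih ((hF.reindex e).layer v) (I := {k | k.1 ∈ I}) ?_ ?_
        · have : Iᶜ = insert j (Subtype.val '' ({k : α | k.1 ∈ I}ᶜ : Set α)) := by
            ext k
            by_cases hk : k = j
            · subst hk; simpa using hj
            · simp [hk, α]
          rw [this, Set.ncard_insert_of_notMem (by simp [α]) (Set.toFinite _),
            Set.ncard_image_of_injective _ Subtype.val_injective] at hn
          omega
        · intro x y hxy hFxy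
          have hc := hI (cons v x ∘ e) (cons v y ∘ e) (by
            intro i hi
            by_cases hij : i = j
            · subst hij; simp [ej]
            · simpa [ek ⟨i, hij⟩] using hxy ⟨i, hij⟩ hi) hFxy
          have key : ∀ z, Conn F I (cons v x ∘ e) z → Conn (fun x : α → Fin 4 => F (cons v x ∘ e))
              {k | k.1 ∈ I} x (fun k => z k.1) ∧ cons v (fun k => z k.1) ∘ e = z := by
            intro z hz
            induction hz with
            | refl =>
              have : (fun k : α => (cons v x ∘ e) k.1) = x := by ext k; simp [ek k]
              rw [this]; exact ⟨Conn.refl _ _ _, rfl⟩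
            | @tail z z1 h1 h ih =>
              obtain ⟨ih, ih2⟩ := ih
              obtain ⟨h, i, hi, q, rfl⟩ := h
              have hij : i ≠ j := by rintro rfl; exact hj hi
              have e2 : cons v (fun k : α => Function.update z i q k.1) ∘ e =
                  Function.update z i q := by
                ext k
                by_cases hk : k = j
                · subst hk
                  have := congrFun ih2 k
                  rw [Function.update_of_ne hij.symm, ← this]; simp [ej]
                · simp [ek ⟨k, hk⟩]
              refine ⟨Relation.ReflTransGen.tail ih ⟨?_, ⟨i, hij⟩, hi, q, ?_⟩, e2⟩
              · simp only [ih2, e2, h]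
              · ext k
                by_cases hk : k = ⟨i, hij⟩
                · subst hk; simp
                · have : k.1 ≠ i := fun h => hk (Subtype.ext h)
                  simp [hk, this]
          have := (key _ hc).1
          have e3 : (fun k : α => (cons v y ∘ e) k.1) = y := by ext k; simp [ek k]
          rwa [e3] at this
      calc _ ≤ 2 ^ 2 ^ n * 2 ^ 2 ^ n := Nat.mul_le_mul (hl a) (hl b)
        _ = 2 ^ 2 ^ (n + 1) := by rw [← pow_add, ← two_mul, pow_succ, mul_comm]
    -- With no direction in the block connectedness is of no help, but the complement is then
    -- everything and the general bound has the required exponent.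
    · have : I = ∅ := Set.eq_empty_of_forall_notMem fun i hi => hI0 ⟨i, hi⟩
      subst this
      rw [Set.compl_empty, Set.ncard_univ] at hn
      refine (numSub_le hF).trans (Nat.pow_le_pow_right (by norm_num)
        (Nat.pow_le_pow_right (by norm_num) (by omega)))

/-! ### The involution exchanging the points of each pair. -/

/-- The other point at which `f` takes the same value. -/
def pairSwap (f : Fin 4 → ZMod 2) (t : Fin 4) : Fin 4 :=
  ((List.finRange 4).find? fun q => decide (q ≠ t ∧ f q = f t)).getD t

/-- `f` and `g` define the same partition of `Fin 4`. -/
def SameLab (f g : Fin 4 → ZMod 2) : Prop := ∀ s t, f s = f t ↔ g s = g t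

instance (f g : Fin 4 → ZMod 2) : Decidable (SameLab f g) :=
  inferInstanceAs (Decidable (∀ s t, f s = f t ↔ g s = g t))

theorem SameLab.symm {f g : Fin 4 → ZMod 2} (h : SameLab f g) : SameLab g f := fun s t => (h s t).symm

theorem SameLab.trans {f g k : Fin 4 → ZMod 2} (h : SameLab f g) (h' : SameLab g k) : SameLab f k :=
  fun s t => (h s t).trans (h' s t)

section PairSwap
variable {f g : Fin 4 → ZMod 2}

theorem Bal.pairSwap_ne (hf : Bal f) (t : Fin 4) : pairSwap f t ≠ t := by
  revert f t; decide

theorem Bal.apply_pairSwap (hf : Bal f) (t : Fin 4) : f (pairSwap f t) = f t := by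
  revert f t; decide

theorem Bal.pairSwap_pairSwap (hf : Bal f) (t : Fin 4) : pairSwap f (pairSwap f t) = t := by
  revert f t; decide

theorem Bal.pairSwap_injective (hf : Bal f) : Function.Injective (pairSwap f) :=
  fun s t h => by rw [← hf.pairSwap_pairSwap s, h, hf.pairSwap_pairSwap]

theorem Bal.eq_or_eq_pairSwap (hf : Bal f) {s t : Fin 4} (h : f s = f t) :
    s = t ∨ s = pairSwap f t := by
  revert f s t; decide

theorem Bal.eq_pairSwap (hf : Bal f) {s t : Fin 4} (h : f s = f t) (hne : s ≠ t) :
    s = pairSwap f t := (hf.eq_or_eq_pairSwap h).resolve_left hne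

theorem Bal.apply_eq_iff (hf : Bal f) {s t : Fin 4} : f s = f t ↔ s = t ∨ s = pairSwap f t := by
  refine ⟨hf.eq_or_eq_pairSwap, ?_⟩
  rintro (rfl | rfl)
  · rfl
  · exact hf.apply_pairSwap t

/-- Two different partitions of four points into pairs are transversal. -/
theorem apply_pairSwap_ne (hf : Bal f) (hg : Bal g) (h : ¬ SameLab f g) (t : Fin 4) :
    g (pairSwap f t) ≠ g t := by
  have key : ∀ f : Fin 4 → ZMod 2, Bal f → ∀ g : Fin 4 → ZMod 2, Bal g → ¬ SameLab f g →
    ∀ t, g (pairSwap f t) ≠ g t := by decide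
  exact key f hf g hg h t

theorem exists_pairSwap_conj (hf : Bal f) {α : Fin 4 → Fin 4} (hα : Function.Injective α) (t : Fin 4) :
    α (pairSwap (fun s => f (α s)) t) = pairSwap f (α t) := by
  have hb : Bal fun s => f (α s) := by
    have hc : Function.Bijective α := Finite.injective_iff_bijective.1 hα
    have : (Finset.univ.filter fun s => f (α s) = 0).card = (Finset.univ.filter fun s => f s = 0).card := by
      refine Finset.card_bij (fun s _ => α s) ?_ (fun _ _ _ _ h => hα h) ?_
      · intro s hs; simpa using hs
      · intro b hb
        obtain ⟨a, rfl⟩ := hc.2 b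
        exact ⟨a, by simpa using hb, rfl⟩
    exact this.trans hf
  refine hf.eq_pairSwap (hb.apply_pairSwap t) fun h => hb.pairSwap_ne t (hα h)

theorem Bal.comp (hf : Bal f) {α : Fin 4 → Fin 4} (hα : Function.Bijective α) :
    Bal fun s => f (α s) := by
  have : (Finset.univ.filter fun s => f (α s) = 0).card = (Finset.univ.filter fun s => f s = 0).card := by
    refine Finset.card_bij (fun s _ => α s) ?_ (fun _ _ _ _ h => hα.1 h) ?_
    · intro s hs; simpa using hs
    · intro b hb
      obtain ⟨a, rfl⟩ := hα.2 b
      exact ⟨a, by simpa using hb, rfl⟩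
  exact this.trans hf

theorem Bal.add_const (hf : Bal f) (c : ZMod 2) : Bal fun s => f s + c := by
  revert f c; decide

end PairSwap

/-! ### Linear functions, and permutations of the values of one coordinate. -/

section Linear
variable {ι : Type*} [DecidableEq ι]

/-- `F` is a sum of balanced functions of the single coordinates. -/
def LinF (F : (ι → Fin 4) → ZMod 2) : Prop :=
  BalF F ∧ ∀ x y i q r, F (Function.update x i q) + F (Function.update x i r) =
    F (Function.update y i q) + F (Function.update y i r)

/-- A code in the zero set of a linear function. -/
def Semi (A : Set (ι → Fin 4)) : Prop := ∃ F, LinF F ∧ ∀ x ∈ A, F x = 0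

/-- The function of the coordinate `j` in `F`, up to a constant. -/
def lab (F : (ι → Fin 4) → ZMod 2) (j : ι) (t : Fin 4) : ZMod 2 := F (Function.update (fun _ => 0) j t)

variable {F : (ι → Fin 4) → ZMod 2} {A B X Y : Set (ι → Fin 4)} {j : ι} {x y : ι → Fin 4}

theorem LinF.bal_lab (hF : LinF F) (j : ι) : Bal (lab F j) := hF.1 _ j

theorem two_cancel {a b c d : ZMod 2} (h : a + b = c + d) : a = b + c + d := by
  revert a b c d; decide

theorem LinF.update (hF : LinF F) (x : ι → Fin 4) (j : ι) (q : Fin 4) :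
    F (Function.update x j q) = F x + lab F j q + lab F j (x j) := by
  have := hF.2 x (fun _ => 0) j q (x j)
  rw [Function.update_eq_self] at this
  exact two_cancel this

theorem LinF.update_eq_iff (hF : LinF F) {x : ι → Fin 4} {j : ι} {q : Fin 4} :
    F (Function.update x j q) = F x ↔ lab F j q = lab F j (x j) := by
  rw [hF.update]
  generalize F x = a; generalize lab F j q = b; generalize lab F j (x j) = c
  revert a b c; decide

/-- Moving `x` in direction `j` into `A` brings `F` to zero. -/
theorem LinF.eq_lab (hF : LinF F) (hA : IsCode A) (hAF : ∀ x ∈ A, F x = 0) (j : ι) (x : ι → Fin 4) :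
    F x = lab F j (gr A j x) + lab F j (x j) := by
  have h1 := hAF _ (hA.gr_mem j x)
  rw [hF.update] at h1
  revert h1
  generalize F x = a; generalize lab F j (gr A j x) = b; generalize lab F j (x j) = c
  revert a b c; decide

/-- Points `x` with `gr A j x = α (x j)`. -/
def act (j : ι) (α : Fin 4 → Fin 4) (A : Set (ι → Fin 4)) : Set (ι → Fin 4) :=
  {x | gr A j x = α (x j)}

@[simp] theorem mem_act {α : Fin 4 → Fin 4} : x ∈ act j α A ↔ gr A j x = α (x j) := Iff.rfl

/-- `X` is an image of `A` under a permutation of the values of the coordinate `j`. -/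
def IsAct (j : ι) (A X : Set (ι → Fin 4)) : Prop := ∃ α, Function.Injective α ∧ X = act j α A

theorem IsCode.act (hA : IsCode A) {α : Fin 4 → Fin 4} (hα : Function.Injective α) :
    IsCode (act j α A) := by
  have hb := Finite.injective_iff_bijective.1 hα
  intro x i
  by_cases hij : i = j
  · subst hij
    obtain ⟨q, hq⟩ := hb.2 (gr A i x)
    refine ⟨q, by simp [hq], fun r hr => ?_⟩
    simp only [mem_act, gr_update, Function.update_self] at hr
    exact hα (by rw [hq, hr])
  · obtain ⟨q, hq⟩ := (hA.gr_bijective hij x).2 (α (x j))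
    refine ⟨q, by simpa [Function.update_of_ne (Ne.symm hij)] using hq, fun r hr => ?_⟩
    simp only [mem_act, Function.update_of_ne (Ne.symm hij)] at hr
    exact (hA.gr_bijective hij x).1 (hr.trans hq.symm)

theorem IsCode.apply_gr_act (hA : IsCode A) {α : Fin 4 → Fin 4} (hα : Function.Injective α)
    (x : ι → Fin 4) : α (gr (_root_.act j α A) j x) = gr A j x := by
  have := (hA.act (j := j) hα).gr_mem j x
  simpa using this.symm

theorem IsCode.act_act (hA : IsCode A) {α β : Fin 4 → Fin 4} (hα : Function.Injective α) :
    _root_.act j β (_root_.act j α A) = _root_.act j (α ∘ β) A := by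
  ext x
  rw [mem_act, mem_act, ← hA.apply_gr_act hα x, Function.comp_apply, hα.eq_iff]

theorem IsCode.act_id (hA : IsCode A) : _root_.act j id A = A := by
  ext x; rw [hA.mem_iff j]; rfl

theorem IsAct.refl (hA : IsCode A) (j : ι) : IsAct j A A := ⟨id, Function.injective_id, hA.act_id.symm⟩

theorem IsAct.trans (hA : IsCode A) (h : IsAct j A X) (h' : IsAct j X Y) : IsAct j A Y := by
  obtain ⟨α, hα, rfl⟩ := h
  obtain ⟨β, hβ, rfl⟩ := h'
  exact ⟨α ∘ β, hα.comp hβ, hA.act_act hα⟩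

theorem IsAct.symm (hA : IsCode A) (h : IsAct j A X) : IsAct j X A := by
  obtain ⟨α, hα, rfl⟩ := h
  have hb := Finite.injective_iff_bijective.1 hα
  let e := Equiv.ofBijective α hb
  refine ⟨e.symm, e.symm.injective, ?_⟩
  rw [hA.act_act hα]
  have : α ∘ e.symm = id := funext fun t => e.apply_symm_apply t
  rw [this, hA.act_id]

theorem IsAct.isCode (hA : IsCode A) (h : IsAct j A X) : IsCode X := by
  obtain ⟨α, hα, rfl⟩ := h
  exact hA.act hα

/-- Some point with prescribed `j`-th coordinate and prescribed position. -/
theorem IsCode.exists_point (hA : IsCode A) {i : ι} (hij : i ≠ j) (s t : Fin 4) :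
    ∃ x : ι → Fin 4, x j = t ∧ gr A j x = s := by
  obtain ⟨q, hq⟩ := (hA.gr_bijective hij (Function.update (fun _ => 0) j t)).2 s
  exact ⟨_, by simp [Function.update_of_ne (Ne.symm hij)], hq⟩

theorem IsCode.exists_mem (hA : IsCode A) {i : ι} (hij : i ≠ j) (t : Fin 4) :
    ∃ x ∈ A, x j = t :=
  ⟨_, hA.gr_mem i (Function.update (fun _ => 0) j t), by simp [Function.update_of_ne (Ne.symm hij)]⟩

theorem IsCode.act_ne (hA : IsCode A) {i : ι} (hij : i ≠ j) {α β : Fin 4 → Fin 4}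
    (h : ∀ x ∈ _root_.act j α A, x ∉ _root_.act j β A) (t : Fin 4) : α t ≠ β t := by
  intro e
  obtain ⟨x, hx, hx'⟩ := hA.exists_point hij (α t) t
  exact h x (by rw [mem_act, hx', hx]) (by rw [mem_act, hx', hx, e])

theorem IsCode.act_injective (hA : IsCode A) {i : ι} (hij : i ≠ j) {α β : Fin 4 → Fin 4}
    (h : _root_.act j α A = _root_.act j β A) : α = β := by
  funext t
  obtain ⟨x, hx, hx'⟩ := hA.exists_point hij (α t) t
  have : x ∈ _root_.act j β A := by rw [← h, mem_act, hx', hx]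
  rw [mem_act, hx', hx] at this
  exact this

/-- A code is an image of `A` if membership depends only on the coordinate and the position. -/
theorem IsCode.isAct_of_forall (hA : IsCode A) (hX : IsCode X) {i : ι} (hij : i ≠ j)
    (h : ∀ x y, x j = y j → gr A j x = gr A j y → x ∈ X → y ∈ X) : IsAct j A X := by
  -- A point of `X` over each value of the coordinate `j`; its position is the value of the
  -- permutation.
  have hex := fun t => hX.exists_mem hij t
  choose p hp hpt using hex
  have hval : ∀ x ∈ X, gr A j x = gr A j (p (x j)) := by
    intro x hx
    obtain ⟨q, hq⟩ := (hA.gr_bijective hij x).2 (gr A j (p (x j)))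
    simp only at hq
    have h1 : Function.update x i q ∈ X := h (p (x j)) _
      (by rw [hpt, Function.update_of_ne (Ne.symm hij)]) hq.symm (hp _)
    have h2 := (hX x i).unique h1 (y₂ := x i) (by simpa using hx)
    rw [← hq, h2, Function.update_eq_self]
  have hinj : Function.Injective fun t => gr A j (p t) := by
    intro s t hst
    simp only at hst
    have h1 : Function.update (p s) j t ∈ X := h (p t) _ (by simp [hpt]) (by simpa using hst.symm) (hp t)
    have h2 := (hX (p s) j).unique h1 (y₂ := p s j) (by simpa using hp s)
    rw [h2, hpt]
  refine ⟨_, hinj, ?_⟩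
  have : Nonempty ι := ⟨j⟩
  exact hX.eq_of_subset (hA.act hinj) fun x hx => hval x hx

/-- The complement of a code in a level set of a linear function. -/
theorem LinF.compl_eq_act (hF : LinF F) (hA : IsCode A) {c : ZMod 2} (hAF : ∀ x ∈ A, F x = c) (j : ι) :
    {x | F x = c ∧ x ∉ A} = act j (pairSwap (lab F j)) A := by
  ext x
  have h := hAF _ (hA.gr_mem j x)
  have hb := hF.bal_lab j
  have e : F x = c ↔ lab F j (x j) = lab F j (gr A j x) := by
    rw [← h, eq_comm, hF.update_eq_iff, eq_comm]
  rw [Set.mem_ofPred_eq, mem_act, e, hA.mem_iff j]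
  constructor
  · rintro ⟨h1, h2⟩
    exact hb.eq_pairSwap h1.symm h2
  · intro h1
    rw [h1]
    exact ⟨(hb.apply_pairSwap _).symm, hb.pairSwap_ne _⟩

theorem LinF.isAct_compl (hF : LinF F) (hA : IsCode A) {c : ZMod 2} (hAF : ∀ x ∈ A, F x = c) (j : ι) :
    IsAct j A {x | F x = c ∧ x ∉ A} :=
  ⟨_, (hF.bal_lab j).pairSwap_injective, hF.compl_eq_act hA hAF j⟩

theorem Conn.congr_fun {F' : (ι → Fin 4) → ZMod 2} {D : Set ι} (h : ∀ x y, F x = F y → F' x = F' y)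
    (hc : Conn F D x y) : Conn F' D x y := by
  refine Relation.ReflTransGen.mono ?_ _ _ hc
  rintro a b ⟨e, h'⟩
  exact ⟨h _ _ e, h'⟩

/-- A path of a function not depending on the coordinate `j` can be kept off `j`. -/
theorem Conn.off (h : Conn F Set.univ x y) (hF : ∀ z q, F (Function.update z j q) = F z) :
    Conn F {j}ᶜ x (Function.update y j (x j)) := by
  induction h with
  | refl => rw [Function.update_eq_self]; exact Conn.refl _ _ _
  | @tail y y1 h1 h ih =>
    obtain ⟨e, i, -, q, rfl⟩ := h
    by_cases hij : i = j
    · subst hij; rwa [Function.update_idem]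
    · refine Relation.ReflTransGen.tail ih ⟨by rw [hF, hF, e], i, hij, q, ?_⟩
      rw [Function.update_comm hij]

end Linear

/-! ### Isotopies: renaming coordinates and permuting values. -/

section Twist
variable {ι κ : Type*} [DecidableEq ι] [DecidableEq κ]

/-- Rename the coordinates and permute the values of each coordinate. -/
def twist (e : ι ≃ κ) (σ : ι → Equiv.Perm (Fin 4)) (x : κ → Fin 4) : ι → Fin 4 := fun k => σ k (x (e k))

/-- The inverse of `twist`. -/
def untwist (e : ι ≃ κ) (σ : ι → Equiv.Perm (Fin 4)) (y : ι → Fin 4) : κ → Fin 4 :=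
  fun k => (σ (e.symm k)).symm (y (e.symm k))

variable (e : ι ≃ κ) (σ : ι → Equiv.Perm (Fin 4))

@[simp] theorem twist_untwist (y : ι → Fin 4) : twist e σ (untwist e σ y) = y := by
  ext k; simp [twist, untwist]

@[simp] theorem untwist_twist (x : κ → Fin 4) : untwist e σ (twist e σ x) = x := by
  ext k; simp [twist, untwist]

theorem twist_update (x : κ → Fin 4) (k : ι) (q : Fin 4) :
    twist e σ (Function.update x (e k) q) = Function.update (twist e σ x) k (σ k q) := by
  ext i
  by_cases h : i = k
  · subst h; simp [twist]
  · simp [twist, h]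

theorem untwist_update (y : ι → Fin 4) (k : ι) (q : Fin 4) :
    untwist e σ (Function.update y k q) = Function.update (untwist e σ y) (e k) ((σ k).symm q) := by
  have := twist_update e σ (untwist e σ y) k ((σ k).symm q)
  rw [twist_untwist, Equiv.apply_symm_apply] at this
  rw [← this, untwist_twist]

theorem perm_bijOn {P : Fin 4 → Prop} (s : Equiv.Perm (Fin 4)) (h : ∃! q, P q) : ∃! q, P (s q) := by
  obtain ⟨q, hq, hu⟩ := h
  exact ⟨s.symm q, by simpa, fun r hr => by rw [← hu _ hr, Equiv.symm_apply_apply]⟩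

variable {F : (ι → Fin 4) → ZMod 2} {A : Set (ι → Fin 4)}

theorem IsCode.twist (hA : IsCode A) : IsCode {x | twist e σ x ∈ A} := by
  intro x k
  obtain ⟨i, rfl⟩ := e.surjective k
  simp only [Set.mem_ofPred_eq, twist_update]
  exact perm_bijOn (σ i) (hA _ i)

theorem IsCode.untwist {E : Set (κ → Fin 4)} (hE : IsCode E) : IsCode {x | untwist e σ x ∈ E} := by
  intro x i
  simp only [Set.mem_ofPred_eq, untwist_update]
  exact perm_bijOn (σ i).symm (hE _ (e i))

theorem LinF.twist (hF : LinF F) : LinF fun x => F (twist e σ x) := by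
  refine ⟨fun x k => ?_, fun x y k q r => ?_⟩
  · obtain ⟨i, rfl⟩ := e.surjective k
    simp only [twist_update]
    exact (hF.1 (_root_.twist e σ x) i).comp (σ i).bijective
  · obtain ⟨i, rfl⟩ := e.surjective k
    simp only [twist_update]
    exact hF.2 _ _ _ _ _

theorem LinF.untwist {F : (κ → Fin 4) → ZMod 2} (hF : LinF F) : LinF fun x => F (untwist e σ x) := by
  refine ⟨fun x i => ?_, fun x y i q r => ?_⟩
  · simp only [untwist_update]
    exact (hF.1 (_root_.untwist e σ x) (e i)).comp (σ i).symm.bijective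
  · simp only [untwist_update]
    exact hF.2 _ _ _ _ _

theorem Conn.untwist {D : Set ι} {x y : ι → Fin 4} (h : Conn F D x y) :
    Conn (fun x => F (twist e σ x)) (e '' D) (untwist e σ x) (untwist e σ y) := by
  induction h with
  | refl => exact Conn.refl _ _ _
  | tail _ h ih =>
    obtain ⟨h, i, hi, q, rfl⟩ := h
    exact Relation.ReflTransGen.tail ih ⟨by simpa using h, e i, ⟨i, hi, rfl⟩, _, untwist_update e σ _ i q⟩

theorem Conn.of_twist {x y : κ → Fin 4} (h : Conn F Set.univ (_root_.twist e σ x) (_root_.twist e σ y)) :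
    Conn (fun x => F (_root_.twist e σ x)) Set.univ x y := by
  have := h.untwist e σ
  rw [untwist_twist, untwist_twist] at this
  exact this.mono (Set.subset_univ _)

theorem IsCode.gr_twist (hA : IsCode A) (k : ι) (x : κ → Fin 4) :
    σ k (gr {x | _root_.twist e σ x ∈ A} (e k) x) = gr A k (_root_.twist e σ x) := by
  have := (hA.twist e σ).gr_mem (e k) x
  rw [Set.mem_ofPred_eq, twist_update] at this
  exact (hA.update_mem_iff.1 this).symm

theorem act_twist (hA : IsCode A) (k : ι) (α : Fin 4 → Fin 4) :
    {x | twist e σ x ∈ act k α A} = act (e k) (fun t => (σ k).symm (α (σ k t))) {x | twist e σ x ∈ A} := by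
  ext x
  rw [Set.mem_ofPred_eq, mem_act, mem_act, ← hA.gr_twist, Equiv.eq_symm_apply]
  rfl

end Twist

theorem dbl_congr {ι κ : Type*} {A B : Set (ι → Fin 4)} {C D : Set (κ → Fin 4)} {x : ι → Fin 4}
    {y : κ → Fin 4} (h : x ∈ A ∨ x ∈ B ↔ y ∈ C ∨ y ∈ D) : dbl A B x = dbl C D y := by
  unfold dbl; split_ifs <;> tauto

/-! ### Rigid codes, the objects of the induction on dimension. -/

section Rigid
variable {ι : Type*} [DecidableEq ι]

/-- The structure of a code in the zero set of a linear function that is used in the induction. -/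
structure Rigid (A : Set (ι → Fin 4)) (F : (ι → Fin 4) → ZMod 2) : Prop where
  code : IsCode A
  lin : LinF F
  sub : ∀ x ∈ A, F x = 0
  third : ∀ i j : ι, ∃ k, k ≠ i ∧ k ≠ j
  eq_of_sub : ∀ F', LinF F' → (∀ x ∈ A, F' x = 0) → F' = F
  conn_gr : ∀ (j : ι) (f : Fin 4 → ZMod 2), Bal f → ¬ SameLab f (lab F j) → ∀ x y,
    f (gr A j x) = f (gr A j y) → Conn (fun z => f (gr A j z)) Set.univ x y
  conn_dbl : ∀ E, IsCode E → (∀ x ∈ E, F x = 1) →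
    (∀ x y, dbl A E x = 0 → dbl A E y = 0 → Conn (dbl A E) Set.univ x y) ∨
    ∃ (j : ι) (f : Fin 4 → ZMod 2), Bal f ∧ ¬ SameLab f (lab F j) ∧ E = act j (pairSwap f) A

variable {κ : Type*} [DecidableEq κ] {A : Set (ι → Fin 4)} {F : (ι → Fin 4) → ZMod 2}

theorem lab_twist (hF : LinF F) (e : ι ≃ κ) (σ : ι → Equiv.Perm (Fin 4)) (k : ι) (s t : Fin 4) :
    lab (fun x => F (twist e σ x)) (e k) s = lab (fun x => F (twist e σ x)) (e k) t ↔
      lab F k (σ k s) = lab F k (σ k t) := by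
  simp only [lab, twist_update]
  have := hF.2 (twist e σ fun _ => 0) (fun _ => 0) k (σ k s) (σ k t)
  revert this
  generalize F _ = a1; generalize F _ = a2; generalize F _ = a3; generalize F _ = a4
  revert a1 a2 a3 a4; decide

theorem Rigid.twist (h : Rigid A F) (e : ι ≃ κ) (σ : ι → Equiv.Perm (Fin 4)) :
    Rigid {x | twist e σ x ∈ A} fun x => F (twist e σ x) where
  code := h.code.twist e σ
  lin := h.lin.twist e σ
  sub x hx := h.sub _ hx
  third i j := by
    obtain ⟨k, hk, hk'⟩ := h.third (e.symm i) (e.symm j)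
    exact ⟨e k, fun h => hk (by simp [← h]), fun h => hk' (by simp [← h])⟩
  eq_of_sub F' hF' hs := by
    have := h.eq_of_sub _ (hF'.untwist e σ) (fun x hx => hs _ (by simpa using hx))
    ext x
    simp only [← this, untwist_twist]
  conn_gr j f hf hl x y hxy := by
    obtain ⟨k, rfl⟩ := e.surjective j
    have e1 : ∀ z, f (gr {x | _root_.twist e σ x ∈ A} (e k) z) =
        (fun t => f ((σ k).symm t)) (gr A k (_root_.twist e σ z)) := by
      intro z
      simp only [← h.code.gr_twist, Equiv.symm_apply_apply]
    simp only [e1] at hxy ⊢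
    refine Conn.of_twist (F := fun z => f ((σ k).symm (gr A k z))) e σ
      (h.conn_gr k _ (hf.comp (σ k).symm.bijective) (fun hs => hl fun s t => ?_) _ _ hxy)
    rw [lab_twist h.lin]
    simpa using hs (σ k s) (σ k t)
  conn_dbl E hE hE1 := by
    have e1 : ∀ x, dbl {x | _root_.twist e σ x ∈ A} E x =
        dbl A {x | untwist e σ x ∈ E} (_root_.twist e σ x) := by
      intro x; exact dbl_congr (by simp)
    rcases h.conn_dbl {x | untwist e σ x ∈ E} (hE.untwist e σ) (fun x hx => by
      simpa using hE1 _ hx) with hc | ⟨k, f, hf, hl, hE'⟩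
    · left
      intro x y hx hy
      rw [funext e1]
      rw [e1] at hx hy
      exact Conn.of_twist e σ (hc _ _ hx hy)
    · right
      refine ⟨e k, fun t => f (σ k t), hf.comp (σ k).bijective, fun hs => hl fun s t => ?_, ?_⟩
      · have := hs ((σ k).symm s) ((σ k).symm t)
        rw [lab_twist h.lin] at this
        simpa using this
      · have : E = {x | _root_.twist e σ x ∈ act k (pairSwap f) A} := by
          rw [← hE']; ext x; simp
        rw [this, act_twist e σ h.code]
        congr 1
        ext t
        rw [← exists_pairSwap_conj hf (σ k).injective, Equiv.symm_apply_apply]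

theorem act_eq_twist {A : Set (ι → Fin 4)} (hA : IsCode A) (j : ι) (s : Equiv.Perm (Fin 4)) :
    act j s A = {x | twist (Equiv.refl ι) (Function.update (fun _ => Equiv.refl _) j s) x ∈ A} := by
  ext x
  rw [mem_act, Set.mem_ofPred_eq, ← hA.update_mem_iff]
  have : Function.update x j (s (x j)) =
      twist (Equiv.refl ι) (Function.update (fun _ => Equiv.refl _) j s) x := by
    ext k
    by_cases hk : k = j
    · subst hk; simp [twist]
    · simp [twist, hk]
  rw [this]

theorem Rigid.inhabited (h : Rigid A F) : ∀ j : ι, ∃ i, i ≠ j := fun j => by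
  obtain ⟨k, hk, -⟩ := h.third j j
  exact ⟨k, hk⟩

/-- In any coordinate, the complement in the zero set is the image of `A` under the involution of
the label, and this isotopy preserves `F`. -/
theorem Rigid.compl (h : Rigid A F) [hι : Nonempty ι] : Rigid {x | F x = 0 ∧ x ∉ A} F := by
  obtain ⟨j⟩ := hι
  have hb := h.lin.bal_lab j
  let s : Equiv.Perm (Fin 4) := ⟨pairSwap (lab F j), pairSwap (lab F j), hb.pairSwap_pairSwap, hb.pairSwap_pairSwap⟩
  have e1 : {x | F x = 0 ∧ x ∉ A} = act j s A := h.lin.compl_eq_act h.code h.sub j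
  have h2 := h.twist (Equiv.refl ι) (Function.update (fun _ => Equiv.refl _) j s)
  have e2 : (fun x => F (_root_.twist (Equiv.refl ι) (Function.update (fun _ => Equiv.refl _) j s) x)) = F := by
    ext x
    have : _root_.twist (Equiv.refl ι) (Function.update (fun _ => Equiv.refl _) j s) x =
        Function.update x j (s (x j)) := by
      ext k
      by_cases hk : k = j
      · subst hk; simp [_root_.twist]
      · simp [_root_.twist, hk]
    rw [this, h.lin.update_eq_iff]
    exact hb.apply_pairSwap _
  rw [e2, ← act_eq_twist h.code, ← e1] at h2
  exact h2

/-- Membership in a code confined, on a slice, to a level of `f ∘ gr A j` depends only on the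
position. -/
theorem Rigid.mem_of_gr_eq (h : Rigid A F) {X : Set (ι → Fin 4)} (hX : IsCode X) {j : ι}
    {f : Fin 4 → ZMod 2} (hf : Bal f) (hl : ¬ SameLab f (lab F j)) {t : Fin 4} {c : ZMod 2}
    (hc : ∀ x ∈ X, x j = t → f (gr A j x) = c) {x y : ι → Fin 4} (hxt : x j = t) (hyt : y j = t)
    (hxy : gr A j x = gr A j y) (hx : x ∈ X) : y ∈ X := by
  have hcx := hc x hx hxt
  have hcon := (h.conn_gr j f hf hl x y (by rw [hxy])).off (j := j) (fun z q => by simp only [gr_update])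
  rw [hxt, ← hyt, Function.update_eq_self] at hcon
  -- Inside the slice, every proper move on the level of `f ∘ gr A j` changes membership in `X` and
  -- also exchanges the two positions of the pair. The two therefore stay synchronised along the
  -- path.
  have key : ∀ z, Conn (fun z => f (gr A j z)) {j}ᶜ x z → (z ∈ X ↔ gr A j z = gr A j x) := by
    intro z hz
    induction hz with
    | refl => simp [hx]
    | @tail z z1 h1 hm ih =>
      have hzt : z j = t := by rw [Conn.eq_off h1 (by simp), hxt]
      have hlev : f (gr A j z) = c := by rw [← hcx]; exact (Conn.level h1).symm
      obtain ⟨e, i, hij, q, rfl⟩ := hm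
      have hij : i ≠ j := hij
      by_cases hq : q = z i
      · rwa [hq, Function.update_eq_self]
      have hbij := h.code.gr_bijective hij z
      have fl := hX.flip (hf.comp hbij) (fun s hs => hc _ hs (by
        rw [Function.update_of_ne hij.symm, hzt])) (c := c) (x := z) (i := i)
        (by simpa using hlev) (by rw [← hlev]; exact e.symm) hq
      rw [fl, ih]
      have hne : gr A j (Function.update z i q) ≠ gr A j z := by
        intro h'
        have := hbij.1 (a₁ := q) (a₂ := z i) (by simpa using h')
        exact hq this
      have h3 : f (gr A j (Function.update z i q)) = f (gr A j z) := e.symm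
      have h4 : f (gr A j z) = f (gr A j x) := by rw [hlev, hcx]
      have := hf.eq_pairSwap h3 hne
      rw [this]
      rcases hf.eq_or_eq_pairSwap h4 with h5 | h5
      · rw [h5]; simp [hf.pairSwap_ne]
      · rw [h5, hf.pairSwap_pairSwap]; simp [hf.pairSwap_ne]
  exact (key y hcon).2 hxy.symm

end Rigid

/-- Two different labels together identify the four symbols with the Klein group, and prescribed
changes of both labels amount to a translation. -/
theorem exists_perm_of_two_labels {f l : Fin 4 → ZMod 2} (hf : Bal f) (hl : Bal l)
    (h : ¬ SameLab f l) (c d : ZMod 2) : ∃ π : Fin 4 → Fin 4, Function.Injective π ∧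
      ∀ p q, f p + f q = c → l p + l q = d → q = π p := by
  have key : ∀ f : Fin 4 → ZMod 2, Bal f → ∀ l : Fin 4 → ZMod 2, Bal l → ¬ SameLab f l →
      ∀ p q : Fin 4, (f p = f q ∧ l p = l q → q = p) ∧ (f p = f q ∧ l p ≠ l q → q = pairSwap f p) ∧
        (f p ≠ f q ∧ l p = l q → q = pairSwap l p) ∧
        (f p ≠ f q ∧ l p ≠ l q → q = pairSwap f (pairSwap l p)) := by decide +kernel
  have key := key f hf l hl h
  have h0 : ∀ {a b : ZMod 2}, a + b = 0 → a = b := by decide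
  have h1 : ∀ {a b : ZMod 2}, a + b = 1 → a ≠ b := by decide
  have two : ∀ c : ZMod 2, c = 0 ∨ c = 1 := by decide
  rcases two c with rfl | rfl <;> rcases two d with rfl | rfl
  · exact ⟨id, Function.injective_id, fun p q e1 e2 => (key p q).1 ⟨h0 e1, h0 e2⟩⟩
  · exact ⟨_, hf.pairSwap_injective, fun p q e1 e2 => (key p q).2.1 ⟨h0 e1, h1 e2⟩⟩
  · exact ⟨_, hl.pairSwap_injective, fun p q e1 e2 => (key p q).2.2.1 ⟨h1 e1, h0 e2⟩⟩
  · exact ⟨_, hf.pairSwap_injective.comp hl.pairSwap_injective,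
      fun p q e1 e2 => (key p q).2.2.2 ⟨h1 e1, h1 e2⟩⟩

/-! ### Rigidity passes from a layer to a code that is not split. -/

section Step
variable {ι : Type*} [DecidableEq ι]

/-- All layers are images of each other under permutations of the values of one coordinate. -/
def IsSplit (C : Set (Option ι → Fin 4)) : Prop := ∃ j : ι, ∀ v w, IsAct j (layer C v) (layer C w)

variable {C E : Set (Option ι → Fin 4)} {F : (Option ι → Fin 4) → ZMod 2} {l₀ : Fin 4}

theorem isSplit_of_base (hC : IsCode C) {j : ι} (h : ∀ v, IsAct j (layer C l₀) (layer C v)) :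
    IsSplit C :=
  ⟨j, fun v w => ((h v).symm (hC.layer l₀)).trans (hC.layer v) (h w)⟩

@[simp] theorem gr_cons_some (C : Set (Option ι → Fin 4)) (i : ι) (v : Fin 4) (x : ι → Fin 4) :
    gr C (some i) (cons v x) = gr (layer C v) i x := by
  simp [gr]

theorem IsCode.gr_none_iff (hC : IsCode C) {v w : Fin 4} {x : ι → Fin 4} :
    gr C none (cons v x) = w ↔ x ∈ _root_.layer C w := by
  rw [← hC.update_mem_iff]; simp

theorem LinF.layer (hF : LinF F) (v : Fin 4) : LinF fun x => F (cons v x) := by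
  refine ⟨hF.1.layer v, fun x y i q r => ?_⟩
  simpa using hF.2 (cons v x) (cons v y) (some i) q r

theorem LinF.cons_add (hF : LinF F) (v w : Fin 4) (x : ι → Fin 4) :
    F (cons v x) = F (cons w x) + lab F none v + lab F none w := by
  have := hF.update (cons w x) none v
  simpa using this

theorem LinF.cons_eq_iff (hF : LinF F) {v w : Fin 4} {x : ι → Fin 4} :
    F (cons v x) = F (cons w x) ↔ lab F none v = lab F none w := by
  have := hF.update_eq_iff (x := cons w x) (j := none) (q := v)
  simpa using this

theorem LinF.sameLab_layer (hF : LinF F) (v : Fin 4) (i : ι) :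
    SameLab (lab F (some i)) (lab (fun x => F (cons v x)) i) := by
  intro s t
  have := hF.2 (fun _ => 0) (cons v fun _ => 0) (some i) s t
  simp only [update_cons_some] at this
  simp only [lab]
  revert this
  generalize F _ = a1; generalize F _ = a2; generalize F _ = a3; generalize F _ = a4
  revert a1 a2 a3 a4; decide

/-- The layer in the same class as `l₀` is the complement of the layer `l₀`. -/
theorem LinF.layer_partner (hC : IsCode C) [Nonempty ι] (hF : LinF F) (hCF : ∀ x ∈ C, F x = 0)
    {s : Fin 4} (hs : lab F none s = lab F none l₀) (hne : s ≠ l₀) :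
    _root_.layer C s = {x | F (cons l₀ x) = 0 ∧ x ∉ _root_.layer C l₀} := by
  refine (hC.layer s).eq_of_subset ((hC.layer l₀).compl (hF.1.layer l₀) fun x hx => hCF _ hx)
    fun x hx => ⟨?_, fun h => hC.layer_disjoint hne hx h⟩
  rw [← hF.cons_eq_iff.2 hs]
  exact hCF _ hx

/-- If the level set of `K` through `a` is connected within the subcube of the directions in `S`,
then these directions lie in one block. -/
theorem mem_blk_of_conn {K : (Option ι → Fin 4) → ZMod 2} (hK : BalF K) {a : ι → Fin 4} {S : Set ι}
    (H : ∀ x, (∀ i ∉ S, x i = a i) → K (cons l₀ x) = K (cons l₀ a) →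
      Conn K Set.univ (cons l₀ a) (cons l₀ x)) {k k' : ι} (hk : k ∈ S) (hk' : k' ∈ S) :
    some k' ∈ blk K (cons l₀ a) (some k) := by
  obtain ⟨q, hq⟩ := (hK (cons l₀ a) (some k)).exists_ne (K (cons l₀ a))
  refine ⟨q, hq, ?_⟩
  obtain ⟨r, hr⟩ := (hK (Function.update (cons l₀ a) (some k) q) (some k')).exists_eq (K (cons l₀ a))
  refine ⟨r, ?_⟩
  simp only [update_cons_some] at hr ⊢
  refine H _ (fun i hi => ?_) hr
  rw [Function.update_of_ne (by rintro rfl; exact hi hk'), Function.update_of_ne (by rintro rfl; exact hi hk)]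

/-- If `C ∪ E` is the same in all layers, up to complement, then `E` permutes the layers of `C`. -/
theorem exists_act_none [Nonempty ι] (hC : IsCode C) (hE : IsCode E) (hd : ∀ x ∈ C, x ∉ E)
    (h : ∀ v x y, dbl C E (cons v x) + dbl C E (cons v y) = dbl C E (cons l₀ x) + dbl C E (cons l₀ y)) :
    ∃ f, Bal f ∧ E = act none (pairSwap f) C := by
  have hH : BalF (dbl C E) := balF_dbl hC hE hd
  let z : ι → Fin 4 := fun _ => 0
  have hf : Bal fun v => dbl C E (cons v z) := by simpa using hH (cons 0 z) none
  refine ⟨_, hf, ?_⟩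
  refine hE.eq_of_subset (hC.act hf.pairSwap_injective) ?_
  suffices hs : ∀ v x, cons v x ∈ E → cons v x ∈ act none (pairSwap fun v => dbl C E (cons v z)) C from
    fun x hx => by rw [← cons_eta x] at hx ⊢; exact hs _ _ hx
  intro v x hx
  rw [mem_act, cons_none, hC.gr_none_iff, mem_layer]
  set w := pairSwap (fun v => dbl C E (cons v z)) v with hw
  have h1 : dbl C E (cons w z) = dbl C E (cons v z) := hf.apply_pairSwap v
  have h2 : dbl C E (cons w x) = 0 := by
    have e0 : dbl C E (cons v x) = 0 := dbl_eq_zero.2 (Or.inr hx)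
    have e1 := h v x z
    have e2 := h w x z
    rw [e0, ← h1, ← e2] at e1
    exact (add_right_cancel e1).symm
  rcases dbl_eq_zero.1 h2 with h3 | h3
  · exact h3
  · exact absurd (hE.layer_disjoint (hf.pairSwap_ne v) h3 hx) id

theorem LinF.isAct_layer_partner (hC : IsCode C) [Nonempty ι] (hF : LinF F) (hCF : ∀ x ∈ C, F x = 0)
    {s : Fin 4} (hs : lab F none s = lab F none l₀) (j : ι) :
    IsAct j (_root_.layer C l₀) (_root_.layer C s) := by
  by_cases hne : s = l₀
  · rw [hne]; exact IsAct.refl (hC.layer _) j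
  · rw [hF.layer_partner hC hCF hs hne]
    exact (hF.layer l₀).isAct_compl (hC.layer _) (fun x hx => hCF _ hx) j

variable [Finite ι] [Nonempty ι]

/-- In the layer `l₀` the level set is the union of the layers `l₀` and `b`. If it is not connected,
rigidity makes layer `b` an image of layer `l₀` in one coordinate. The two other layers are
complements of these in level sets of `F`, so they are images too, and `C` would be split. -/
theorem Rigid.conn_gr_none (hC : IsCode C) (hF : LinF F)
    (hCF : ∀ x ∈ C, F x = 0) (hns : ¬ IsSplit C) (hA : Rigid (layer C l₀) fun x => F (cons l₀ x))
    {f : Fin 4 → ZMod 2} (hf : Bal f) (hl : ¬ SameLab f (lab F none)) {x y : ι → Fin 4}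
    (hx : f (gr C none (cons l₀ x)) = f l₀) (hy : f (gr C none (cons l₀ y)) = f l₀) :
    Conn (fun z => f (gr C none z)) Set.univ (cons l₀ x) (cons l₀ y) := by
  set b := pairSwap f l₀ with hb
  have hlb : lab F none b ≠ lab F none l₀ := apply_pairSwap_ne hf (hF.bal_lab _) hl l₀
  have hiff : ∀ z : ι → Fin 4, dbl (layer C l₀) (layer C b) z = 0 ↔ f (gr C none (cons l₀ z)) = f l₀ := by
    intro z
    rw [dbl_eq_zero, ← hC.gr_none_iff (v := l₀), ← hC.gr_none_iff (v := l₀), hf.apply_eq_iff]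
  have hE1 : ∀ x ∈ layer C b, F (cons l₀ x) = 1 := by
    intro x hx
    have h0 : F (cons b x) = 0 := hCF _ hx
    refine ZMod.two_eq_add_one (c := 0) fun h => hlb ?_
    rw [← hF.cons_eq_iff (x := x), h0, h]
  rcases hA.conn_dbl _ (hC.layer b) hE1 with hc | ⟨j, g, hg, -, hE⟩
  · have := hc x y ((hiff x).2 hx) ((hiff y).2 hy)
    refine (Conn.cons (F := fun z => f (gr C none z)) (this.congr_fun fun a a' h => ?_)).mono
      (Set.subset_univ _)
    by_cases ha : dbl (layer C l₀) (layer C b) a = 0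
    · rw [(hiff a).1 ha, (hiff a').1 (h ▸ ha)]
    · exact ZMod.two_eq_of_ne (fun e => ha ((hiff a).2 e)) (fun e => ha (h ▸ (hiff a').2 e))
  · refine absurd (isSplit_of_base (l₀ := l₀) hC (j := j) fun v => ?_) hns
    have hAb : IsAct j (layer C l₀) (layer C b) := ⟨_, hg.pairSwap_injective, hE⟩
    by_cases hv : lab F none v = lab F none l₀
    · exact hF.isAct_layer_partner hC hCF hv j
    · exact hAb.trans (hC.layer _)
        (hF.isAct_layer_partner hC hCF (ZMod.two_eq_of_ne hv hlb) j)

/-- Rigidity of the layer puts all its directions except `i` into one block of the auxiliary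
function `H`. Either the new direction joins this block and paths exist, or `H` splits along it and
`C` is split. -/
theorem Rigid.conn_gr_some (hC : IsCode C) (hF : LinF F)
    (hCF : ∀ x ∈ C, F x = 0) (hns : ¬ IsSplit C) (hA : Rigid (layer C l₀) fun x => F (cons l₀ x))
    {i : ι} {f : Fin 4 → ZMod 2} (hf : Bal f) (hl : ¬ SameLab f (lab F (some i)))
    (x y : Option ι → Fin 4) (hxy : f (gr C (some i) x) = f (gr C (some i) y)) :
    Conn (fun z => f (gr C (some i) z)) Set.univ x y := by
  -- The position does not depend on the coordinate `some i`; the second summand makes the function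
  -- balanced in that direction too.
  let H : (Option ι → Fin 4) → ZMod 2 := fun z => f (gr C (some i) z) + f (z (some i))
  have hlA : ¬ SameLab f (lab (fun x => F (cons l₀ x)) i) :=
    fun h => hl (h.trans (hF.sameLab_layer l₀ i).symm)
  have hH : BalF H := by
    intro x k
    by_cases hk : k = some i
    · subst hk
      simp only [H, gr_update, Function.update_self]
      simpa only [add_comm] using hf.add_const (f (gr C (some i) x))
    · simp only [H, Function.update_of_ne (Ne.symm hk)]
      exact (hf.comp (hC.gr_bijective hk x)).add_const _
  let a : ι → Fin 4 := fun _ => 0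
  -- A move in direction `some i` on a level of `H` cannot change the class of that coordinate.
  -- Hence `some i` is not in the block of the other directions.
  have hinv : ∀ z w, Conn H Set.univ z w → f (w (some i)) = f (z (some i)) := by
    intro z w h
    induction h with
    | refl => rfl
    | tail h1 h ih =>
      obtain ⟨e, k, -, q, rfl⟩ := h
      rw [← ih]
      by_cases hk : k = some i
      · subst hk
        simp only [H, gr_update] at e
        exact (add_left_cancel e).symm
      · rw [Function.update_of_ne (Ne.symm hk)]
  have hblk : ∀ k k', k ≠ i → k' ≠ i → some k' ∈ blk H (cons l₀ a) (some k) := by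
    intro k k' hk hk'
    refine mem_blk_of_conn hH (S := {i}ᶜ) (fun x hx hHx => ?_) hk hk'
    have hxi : x i = a i := hx i (by simp)
    have h1 : f (gr (layer C l₀) i x) = f (gr (layer C l₀) i a) := by
      simpa [H, hxi] using hHx
    have h2 := (hA.conn_gr i f hf hlA a x h1.symm).off (j := i) (fun z q => by simp only [gr_update])
    rw [← hxi, Function.update_eq_self] at h2
    have h3 : ∀ w, Conn (fun z => f (gr (layer C l₀) i z)) {i}ᶜ a w →
        Conn H Set.univ (cons l₀ a) (cons l₀ w) := by
      intro w hw
      induction hw with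
      | refl => exact Conn.refl _ _ _
      | tail h1 h ih =>
        obtain ⟨e, k, hk, q, rfl⟩ := h
        refine Relation.ReflTransGen.tail ih ⟨?_, some k, Set.mem_univ _, q, by simp⟩
        have hk : i ≠ k := Ne.symm hk
        simp only at e
        simp only [H, gr_cons_some, cons_some, Function.update_of_ne hk]
        rw [e]
    exact h3 x h2
  have hnot : ∀ k, k ≠ i → some i ∉ blk H (cons l₀ a) (some k) := by
    rintro k hk ⟨q, hq, r, hr⟩
    have h1 := hinv _ _ hr
    simp only [Function.update_self, cons_some] at h1
    apply hq
    rw [hr.level]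
    simp only [H, gr_update, Function.update_self, h1]
    rw [Function.update_of_ne (by simpa using Ne.symm hk)]
    simp
  obtain ⟨k₀, hk₀⟩ := hA.inhabited i
  have hI := isBlk_blk hH (cons l₀ a) (some k₀)
  set I := blk H (cons l₀ a) (some k₀) with hIdef
  have hne : I.Nonempty := ⟨_, hblk k₀ k₀ hk₀ hk₀⟩
  have hmove : ∀ z w, Conn H Set.univ z w → Conn (fun z => f (gr C (some i) z)) Set.univ z w := by
    intro z w h
    induction h with
    | refl => exact Conn.refl _ _ _
    | tail h1 h ih =>
      obtain ⟨e, k, -, q, rfl⟩ := h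
      refine Relation.ReflTransGen.tail ih ⟨?_, k, Set.mem_univ _, q, rfl⟩
      by_cases hk : k = some i
      · subst hk; simp only [gr_update]
      · simp only [H, Function.update_of_ne (Ne.symm hk)] at e
        exact add_right_cancel e
  by_cases hnone : none ∈ I
  · have h1 : Conn (fun z => f (gr C (some i) z)) Set.univ x
        (Function.update x (some i) (y (some i))) :=
      Relation.ReflTransGen.single ⟨by simp only [gr_update], _, Set.mem_univ _, _, rfl⟩
    refine h1.trans (hmove _ _ ((hI.conn_coset' hH hne (fun h => hnot k₀ hk₀ ?_) ?_ ?_).mono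
      (Set.subset_univ _)))
    · rw [← hIdef, h]; exact Set.mem_univ _
    · intro j hj
      have : j = some i := by
        cases j with
        | none => exact absurd hnone hj
        | some k =>
          by_contra hk
          exact hj (hblk k₀ k hk₀ (fun e => hk (by rw [e])))
      subst this; simp
    · simp only [H, gr_update, Function.update_self, hxy]
  -- The new direction is outside the block: from layer `l₀` to layer `v` the label `f` of the
  -- position changes by a constant. So does its label for `F`, and the two constants determine a
  -- permutation of positions.
  · refine absurd (isSplit_of_base (l₀ := l₀) hC (j := i) fun v => ?_) hns
    have hs := hI.splitOn hH hne
    have h1 : ∀ u w, f (gr (layer C v) i u) + f (gr (layer C l₀) i u) =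
        f (gr (layer C v) i w) + f (gr (layer C l₀) i w) := by
      intro u w
      have := hs (cons v u) (cons v (Function.update w i (u i))) (cons l₀ u)
        (cons l₀ (Function.update w i (u i))) (fun k hk => ?_) (fun k hk => ?_)
      · simp only [H, gr_cons_some, gr_update, cons_some, Function.update_self] at this
        revert this
        generalize f _ = a1; generalize f _ = a2; generalize f _ = a3; generalize f _ = a4
        generalize f _ = a5
        revert a1 a2 a3 a4 a5; decide
      · cases k with
        | none => exact absurd hk hnone
        | some k => simp
      · cases k with
        | none => simp
        | some k =>
          have : k = i := by
            by_contra h; exact hk (hblk k₀ k hk₀ h)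
          subst this; simp
    have h2 : ∀ u w, lab F (some i) (gr (layer C v) i u) + lab F (some i) (gr (layer C l₀) i u) =
        lab F (some i) (gr (layer C v) i w) + lab F (some i) (gr (layer C l₀) i w) := by
      intro u w
      have e1 := hF.eq_lab hC hCF (some i)
      have a1 := e1 (cons v u); have a2 := e1 (cons l₀ u)
      have a3 := e1 (cons v w); have a4 := e1 (cons l₀ w)
      simp only [gr_cons_some, cons_some] at a1 a2 a3 a4
      have b1 := hF.cons_add v l₀ u
      have b2 := hF.cons_add v l₀ w
      rw [a1, a2] at b1; rw [a3, a4] at b2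
      revert b1 b2
      generalize lab F none v = c1; generalize lab F none l₀ = c2
      generalize lab F (some i) (u i) = c3; generalize lab F (some i) (w i) = c4
      generalize lab F (some i) _ = c5; generalize lab F (some i) _ = c6
      generalize lab F (some i) _ = c7; generalize lab F (some i) _ = c8
      revert c1 c2 c3 c4 c5 c6 c7 c8; decide
    obtain ⟨π, hπ, hp⟩ := exists_perm_of_two_labels hf (hF.bal_lab (some i)) hl
      (f (gr (layer C v) i a) + f (gr (layer C l₀) i a))
      (lab F (some i) (gr (layer C v) i a) + lab F (some i) (gr (layer C l₀) i a))
    refine ⟨π, hπ, ?_⟩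
    ext u
    have e := hp _ _ (h1 u a) (h2 u a)
    rw [(hC.layer v).mem_iff i, mem_act, e, hπ.eq_iff]

/-- When the layers of `C` and `E` at `l₀` are connected together, or `ι` lies in one block. -/
theorem Rigid.conn_dbl_of_range (hC : IsCode C) (hF : LinF F)
    (hCF : ∀ x ∈ C, F x = 0) (hE : IsCode E) (hE1 : ∀ x ∈ E, F x = 1) {a : ι → Fin 4}
    (ha : a ∈ layer C l₀) {k₀ : ι} (hb : ∀ k, some k ∈ blk (dbl C E) (cons l₀ a) (some k₀)) :
    (∀ x y, dbl C E x = 0 → dbl C E y = 0 → Conn (dbl C E) Set.univ x y) ∨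
    ∃ (j : Option ι) (f : Fin 4 → ZMod 2), Bal f ∧ ¬ SameLab f (lab F j) ∧ E = act j (pairSwap f) C := by
  have hd : ∀ x ∈ C, x ∉ E := fun x hx hx' => by
    have := (hCF x hx).symm.trans (hE1 x hx'); revert this; decide
  have hH : BalF (dbl C E) := balF_dbl hC hE hd
  have h0 : dbl C E (cons l₀ a) = 0 := dbl_eq_zero.2 (Or.inl ha)
  by_cases hn : none ∈ blk (dbl C E) (cons l₀ a) (some k₀)
  · left
    have hu : blk (dbl C E) (cons l₀ a) (some k₀) = Set.univ := by
      ext k; cases k <;> simp [hn, hb]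
    intro x y hx hy
    exact (conn_of_blk_univ hH hu (hx.trans h0.symm)).symm.trans
      (conn_of_blk_univ hH hu (hy.trans h0.symm))
  · right
    have hs := (isBlk_blk hH (cons l₀ a) (some k₀)).splitOn hH ⟨_, hb k₀⟩
    obtain ⟨f, hf, hEf⟩ := exists_act_none (l₀ := l₀) hC hE hd (fun v x y => by
      have := hs (cons v x) (cons v y) (cons l₀ x) (cons l₀ y) (fun k hk => by
        cases k with
        | none => exact absurd hk hn
        | some k => simp) (fun k hk => by
        cases k with
        | none => simp
        | some k => exact absurd (hb k) hk)
      revert this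
      generalize dbl C E _ = a1; generalize dbl C E _ = a2; generalize dbl C E _ = a3
      generalize dbl C E _ = a4
      revert a1 a2 a3 a4; decide)
    -- With the label of `F` itself, the permuted point would stay on the same level of `F`, but it
    -- goes from `E` to `C`.
    refine ⟨none, f, hf, fun hsl => ?_, hEf⟩
    obtain ⟨x, hx⟩ : ∃ x, x ∈ layer E l₀ := ⟨_, (hE.layer l₀).gr_mem k₀ a⟩
    have h1 : F (cons l₀ x) = 1 := hE1 _ hx
    have hx' : cons l₀ x ∈ act none (pairSwap f) C := by rw [← hEf]; exact hx
    rw [mem_act, cons_none, hC.gr_none_iff] at hx'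
    have h2 : F (cons (pairSwap f l₀) x) = 0 := hCF _ hx'
    have h3 := hF.cons_eq_iff (v := pairSwap f l₀) (w := l₀) (x := x)
    rw [h2, h1] at h3
    exact absurd (h3.2 ((hsl _ _).1 (hf.apply_pairSwap l₀))) (by decide)

/-- Rigidity of the layer puts either all its directions, or all but one direction `j`, into one
block of the union. When `j` is left out, the block decides: if it contains the new direction, `E`
is an image of `C` in the coordinate `j`; if not, `C` is split. -/
theorem Rigid.conn_dbl_step (hC : IsCode C) (hF : LinF F)
    (hCF : ∀ x ∈ C, F x = 0) (hns : ¬ IsSplit C) (hA : Rigid (layer C l₀) fun x => F (cons l₀ x))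
    (hE : IsCode E) (hE1 : ∀ x ∈ E, F x = 1) :
    (∀ x y, dbl C E x = 0 → dbl C E y = 0 → Conn (dbl C E) Set.univ x y) ∨
    ∃ (j : Option ι) (f : Fin 4 → ZMod 2), Bal f ∧ ¬ SameLab f (lab F j) ∧ E = act j (pairSwap f) C := by
  have hd : ∀ x ∈ C, x ∉ E := fun x hx hx' => by
    have := (hCF x hx).symm.trans (hE1 x hx'); revert this; decide
  have hH : BalF (dbl C E) := balF_dbl hC hE hd
  obtain ⟨i₀⟩ := ‹Nonempty ι›
  have : Nonempty ι := ⟨i₀⟩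
  obtain ⟨a, ha⟩ : ∃ a, a ∈ layer C l₀ := ⟨_, (hC.layer l₀).gr_mem i₀ fun _ => 0⟩
  have h0 : dbl C E (cons l₀ a) = 0 := dbl_eq_zero.2 (Or.inl ha)
  have hlay : ∀ v x, dbl C E (cons v x) = dbl (layer C v) (layer E v) x := fun v x => dbl_congr Iff.rfl
  rcases hA.conn_dbl _ (hE.layer l₀) (fun x hx => hE1 _ hx) with hc | ⟨j, f, hf, hl, hEj⟩
  · refine Rigid.conn_dbl_of_range (l₀ := l₀) (k₀ := i₀) hC hF hCF hE hE1 ha fun k => ?_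
    refine mem_blk_of_conn hH (S := Set.univ) (fun x _ hx => ?_) (Set.mem_univ _) (Set.mem_univ _)
    rw [h0] at hx
    have := hc a x (by rw [← hlay, h0]) (by rw [← hlay, hx])
    refine (Conn.cons (F := dbl C E) (this.congr_fun fun u w h => ?_)).mono (Set.subset_univ _)
    rw [hlay, hlay, h]
  · have hlF : ¬ SameLab f (lab F (some j)) := fun h => hl (h.trans (hF.sameLab_layer l₀ j))
    have hH0 : ∀ x, dbl C E (cons l₀ x) = f (gr (layer C l₀) j x) + f (x j) := by
      intro x
      have h1 : dbl C E (cons l₀ x) = 0 ↔ f (gr (layer C l₀) j x) = f (x j) := by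
        rw [hlay, dbl_eq_zero, hEj, mem_act, (hC.layer l₀).mem_iff j, hf.apply_eq_iff]
      have fin : ∀ d a b : ZMod 2, (d = 0 ↔ a = b) → d = a + b := by decide
      exact fin _ _ _ h1
    have hblk : ∀ k k', k ≠ j → k' ≠ j → some k' ∈ blk (dbl C E) (cons l₀ a) (some k) := by
      intro k k' hk hk'
      refine mem_blk_of_conn hH (S := {j}ᶜ) (fun x hx hHx => ?_) hk hk'
      have hxj : x j = a j := hx j (by simp)
      rw [hH0, hH0, hxj] at hHx
      have h2 := (hA.conn_gr j f hf hl a x (add_right_cancel hHx).symm).off (j := j)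
        (fun z q => by simp only [gr_update])
      rw [← hxj, Function.update_eq_self] at h2
      have h3 : ∀ w, Conn (fun z => f (gr (layer C l₀) j z)) {j}ᶜ a w →
          Conn (dbl C E) Set.univ (cons l₀ a) (cons l₀ w) := by
        intro w hw
        induction hw with
        | refl => exact Conn.refl _ _ _
        | tail h1 h ih =>
          obtain ⟨e, k, hk, q, rfl⟩ := h
          refine Relation.ReflTransGen.tail ih ⟨?_, some k, Set.mem_univ _, q, by simp⟩
          have hk : j ≠ k := Ne.symm hk
          simp only at e
          rw [hH0, hH0, Function.update_of_ne hk, e]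
      exact h3 x h2
    obtain ⟨k₀, hk₀⟩ := hA.inhabited j
    by_cases hj : some j ∈ blk (dbl C E) (cons l₀ a) (some k₀)
    · refine Rigid.conn_dbl_of_range (l₀ := l₀) (k₀ := k₀) hC hF hCF hE hE1 ha fun k => ?_
      by_cases hk : k = j
      · rwa [hk]
      · exact hblk _ _ hk₀ hk
    have hs := (isBlk_blk hH (cons l₀ a) (some k₀)).splitOn hH ⟨_, hblk k₀ k₀ hk₀ hk₀⟩
    by_cases hn : none ∈ blk (dbl C E) (cons l₀ a) (some k₀)
    · right
      refine ⟨some j, f, hf, hlF, ?_⟩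
      refine hE.eq_of_subset (hC.act hf.pairSwap_injective) fun z hz => ?_
      have h1 := hs z (cons l₀ (fun k => z (some k))) (Function.update z (some j) (pairSwap f (z (some j))))
        (cons l₀ (Function.update (fun k => z (some k)) j (pairSwap f (z (some j))))) (fun k hk => ?_)
        (fun k hk => ?_)
      · rw [hH0, hH0, gr_update, Function.update_self, hf.apply_pairSwap,
          dbl_eq_zero.2 (Or.inr hz)] at h1
        have h2 : dbl C E (Function.update z (some j) (pairSwap f (z (some j)))) = 0 := by
          revert h1
          generalize dbl C E _ = a1; generalize f _ = a2; generalize f _ = a3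
          revert a1 a2 a3; decide
        rw [mem_act, ← hC.update_mem_iff]
        rcases dbl_eq_zero.1 h2 with h3 | h3
        · exact h3
        · exfalso
          have := (hE z (some j)).unique h3 (y₂ := z (some j)) (by simpa using hz)
          exact hf.pairSwap_ne _ this
      · have hkj : k ≠ some j := by rintro rfl; exact hj hk
        refine ⟨by rw [Function.update_of_ne hkj], ?_⟩
        rw [← update_cons_some, Function.update_of_ne hkj]
      · cases k with
        | none => exact absurd hn hk
        | some k =>
          have : k = j := by
            by_contra h; exact hk (hblk _ _ hk₀ h)
          subst this; simp
    · refine absurd (isSplit_of_base (l₀ := l₀) hC (j := j) fun v => ?_) hns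
      have h1 : ∀ x y, x j = y j → dbl C E (cons v x) + dbl C E (cons v y) =
          f (gr (layer C l₀) j x) + f (gr (layer C l₀) j y) := by
        intro x y hxy
        have := hs (cons v x) (cons v y) (cons l₀ x) (cons l₀ y) (fun k hk => by
          cases k with
          | none => exact absurd hk hn
          | some k => simp) (fun k hk => by
          cases k with
          | none => simp
          | some k =>
            have : k = j := by
              by_contra h; exact hk (hblk _ _ hk₀ h)
            subst this; simpa using hxy)
        rw [hH0, hH0, hxy] at this
        revert this
        generalize dbl C E _ = a1; generalize dbl C E _ = a2; generalize f _ = a3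
        generalize f _ = a4; generalize f _ = a5
        revert a1 a2 a3 a4 a5; decide
      refine (hC.layer l₀).isAct_of_forall (hC.layer v) hk₀ fun x y hxy hg hx => ?_
      refine hA.mem_of_gr_eq (hC.layer v) hf hl (t := x j) (c := f (gr (layer C l₀) j x))
        (fun z hz hzx => ?_) rfl hxy.symm hg hx
      have := h1 z x hzx
      rw [hlay, hlay, dbl_eq_zero.2 (Or.inl hz), dbl_eq_zero.2 (Or.inl hx)] at this
      revert this
      generalize f _ = a3; generalize f _ = a4
      revert a3 a4; decide

/-- Connectivity comes from the preceding lemmas. The linear function is unique because it is unique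
on the layer `l₀`, and one point in each other layer fixes the remaining constant. -/
theorem Rigid.step {F₀ : (ι → Fin 4) → ZMod 2} (hC : IsCode C) (hS : Semi C) (hns : ¬ IsSplit C)
    (hA : Rigid (layer C l₀) F₀) :
    ∃ F, Rigid C F ∧ F₀ = fun x => F (cons l₀ x) := by
  obtain ⟨F, hF, hCF⟩ := hS
  have e0 := hA.eq_of_sub _ (hF.layer l₀) (fun x hx => hCF _ hx)
  subst e0
  refine ⟨F, ⟨hC, hF, hCF, ?_, ?_, ?_, fun E hE hE1 => Rigid.conn_dbl_step hC hF hCF hns hA hE hE1⟩, rfl⟩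
  · obtain ⟨i₀⟩ := ‹Nonempty ι›
    intro i j
    obtain ⟨k, hk, hk'⟩ := hA.third (i.getD i₀) (j.getD i₀)
    refine ⟨some k, ?_, ?_⟩
    · rintro rfl; exact hk rfl
    · rintro rfl; exact hk' rfl
  · intro F' hF' hs
    have e1 := hA.eq_of_sub _ (hF'.layer l₀) (fun x hx => hs _ hx)
    obtain ⟨i₀⟩ := ‹Nonempty ι›
    suffices h : ∀ v x, F' (cons v x) = F (cons v x) by
      ext z; rw [← cons_eta z]; exact h _ _
    intro v x
    have hp := (hC.layer v).gr_mem i₀ x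
    have h1 := hCF _ hp
    have h2 := hs _ hp
    rw [hF.cons_add v l₀] at h1 ⊢
    rw [hF'.cons_add v l₀] at h2 ⊢
    rw [congrFun e1 x]
    rw [congrFun e1 _, ← h1] at h2
    rw [add_assoc, add_assoc] at h2 ⊢
    rw [add_left_cancel h2]
  · intro j f hf hl x y hxy
    cases j with
    | some i => exact hA.conn_gr_some hC hF hCF hns hf hl x y hxy
    | none =>
      have hm : ∀ w (z : Option ι → Fin 4), Conn (fun z => f (gr C none z)) Set.univ z
          (cons w fun k => z (some k)) := by
        intro w z
        refine Relation.ReflTransGen.single ⟨?_, none, Set.mem_univ _, w, ?_⟩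
        · simp only
          rw [← gr_update C none z w]
          congr 2
          conv_lhs => rw [← cons_eta z]
          simp
        · conv_rhs => rw [← cons_eta z]
          simp
      -- For the level of `f` not containing `l₀`, the partner layer is used. It is the complement
      -- of the layer `l₀`, hence rigid, and it lies in the other class of `f` because the labels
      -- are transversal.
      have hgoal : ∃ v, f (gr C none x) = f v ∧ Rigid (layer C v) fun x => F (cons v x) := by
        by_cases hx : f (gr C none x) = f l₀
        · exact ⟨l₀, hx, hA⟩
        · set s := pairSwap (lab F none) l₀ with hs
          have hb := hF.bal_lab none
          have h1 : f s ≠ f l₀ := apply_pairSwap_ne hb hf (fun h => hl h.symm) l₀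
          have e1 : lab F none s = lab F none l₀ := hb.apply_pairSwap l₀
          refine ⟨s, ZMod.two_eq_of_ne hx h1, ?_⟩
          rw [hF.layer_partner hC hCF e1 (hb.pairSwap_ne _),
            show (fun x => F (cons s x)) = fun x => F (cons l₀ x) from
              funext fun x => hF.cons_eq_iff.2 e1]
          exact hA.compl
      obtain ⟨v, hv, hR⟩ := hgoal
      refine (hm v x).trans (Conn.trans ?_ (hm v y).symm)
      have h1 := (hm v x).level
      have h2 := (hm v y).level
      exact hR.conn_gr_none hC hF hCF hns hf hl (h1.symm.trans hv) (h2.symm.trans (hxy.symm.trans hv))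

end Step

/-! ### Extension of a code by one dimension. -/

section Extends
variable {ι κ : Type*} [DecidableEq ι] [DecidableEq κ]

/-- Every code with a layer `A` lies in the zero set of a linear function or is split. -/
def Extends (A : Set (ι → Fin 4)) : Prop :=
  ∀ C : Set (Option ι → Fin 4), IsCode C → ∀ v, layer C v = A → Semi C ∨ IsSplit C

theorem Extends.twist {A : Set (ι → Fin 4)} (h : Extends A) (e : ι ≃ κ) (σ : ι → Equiv.Perm (Fin 4)) :
    Extends {x | twist e σ x ∈ A} := by
  intro C hC v hv
  let E := Equiv.optionCongr e
  let S : Option ι → Equiv.Perm (Fin 4) := fun o => o.elim (Equiv.refl _) σ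
  have hu : ∀ w x, untwist E S (cons w x) = cons w (untwist e σ x) := by
    intro w x; funext o; cases o <;> rfl
  have hl : ∀ w, layer {x | untwist E S x ∈ C} w = {x | untwist e σ x ∈ layer C w} := by
    intro w; ext x; simp [hu]
  have hl' : ∀ w, layer C w = {x | _root_.twist e σ x ∈ layer {x | untwist E S x ∈ C} w} := by
    intro w; rw [hl]; ext x; simp
  have hC' : C = {x | _root_.twist E S x ∈ {x | untwist E S x ∈ C}} := by ext x; simp
  rcases h _ (hC.untwist E S) v (by rw [hl, hv]; ext x; simp) with ⟨F, hF, hs⟩ | ⟨j, hj⟩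
  · left
    exact ⟨_, hF.twist E S, fun x hx => hs _ (by simpa using hx)⟩
  · right
    refine ⟨e j, fun v w => ?_⟩
    obtain ⟨α, hα, h⟩ := hj v w
    refine ⟨fun t => (σ j).symm (α (σ j t)), (σ j).symm.injective.comp (hα.comp (σ j).injective), ?_⟩
    rw [hl' w, hl' v, h, act_twist e σ ((hC.untwist E S).layer v)]

end Extends

/-! ### Finite facts about permutations of four symbols. -/

section Fin4
set_option synthInstance.maxHeartbeats 400000
set_option synthInstance.maxSize 5000
variable {f : Fin 4 → ZMod 2}

theorem Bal.third_eq (hf : Bal f) {t a b c : Fin 4} (h1 : f a ≠ f t) (h2 : f b ≠ f t) (hab : a ≠ b)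
    (hca : c ≠ a) (hcb : c ≠ b) (hct : c ≠ t) : c = pairSwap f t := by
  have key : ∀ f : Fin 4 → ZMod 2, Bal f → ∀ t a b c, (f a ≠ f t ∧ f b ≠ f t ∧ a ≠ b ∧
    c ≠ a ∧ c ≠ b ∧ c ≠ t) → c = pairSwap f t := by decide +kernel
  exact key f hf t a b c ⟨h1, h2, hab, hca, hcb, hct⟩

theorem Bal.eq_pairSwap_of_cover (hf : Bal f) {t a b : Fin 4} (h : ∀ g, f g ≠ f t → g = a ∨ g = b)
    (hab : a ≠ b) : b = pairSwap f a := by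
  have key : ∀ f : Fin 4 → ZMod 2, Bal f → ∀ t a b, ((∀ g, f g ≠ f t → g = a ∨ g = b) ∧
    a ≠ b) → b = pairSwap f a := by decide +kernel
  exact key f hf t a b ⟨h, hab⟩

theorem exists_fourth {a b c : Fin 4} (hab : a ≠ b) (hac : a ≠ c) (hbc : b ≠ c) :
    ∃ d, d ≠ a ∧ d ≠ b ∧ d ≠ c ∧ ∀ e, e = a ∨ e = b ∨ e = c ∨ e = d := by
  revert a b c; decide

theorem exists_others {a b : Fin 4} (hab : a ≠ b) :
    ∃ c d, c ≠ d ∧ c ≠ a ∧ c ≠ b ∧ d ≠ a ∧ d ≠ b ∧ ∀ e, e = a ∨ e = b ∨ e = c ∨ e = d := by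
  revert a b; decide

/-- Each of `α` and `β` takes the value `g` once, at different arguments, so two arguments remain,
`t` and `t'`. If both were of the paired kind, all four would be, against `h₀`. It serves to
transfer a question over `t` to `t'`. -/
theorem exists_other_position (hf : Bal f) {α β : Fin 4 → Fin 4} (hα : Function.Injective α)
    (hβ : Function.Injective β) (hαβ : ∀ r, α r ≠ β r) {t₀ : Fin 4}
    (h₀ : β t₀ ≠ pairSwap f (α t₀)) {t g : Fin 4} (ht : β t = pairSwap f (α t)) (h1 : g ≠ α t)
    (h2 : g ≠ β t) : ∃ t', t' ≠ t ∧ β t' ≠ pairSwap f (α t') ∧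
      ∀ r, g ≠ α r → g ≠ β r → r = t ∨ r = t' := by
  obtain ⟨a, ha⟩ := (Finite.injective_iff_bijective.1 hα).2 g
  obtain ⟨b, hb⟩ := (Finite.injective_iff_bijective.1 hβ).2 g
  have hta : a ≠ t := by rintro rfl; exact h1 ha.symm
  have htb : b ≠ t := by rintro rfl; exact h2 hb.symm
  have hab : a ≠ b := by rintro rfl; exact hαβ a (ha.trans hb.symm)
  obtain ⟨t', h3, h4, h5, h6⟩ := exists_fourth hta.symm htb.symm hab
  refine ⟨t', h3, fun hu => ?_, fun r hr hr' => ?_⟩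
  · have key : ∀ f : Fin 4 → ZMod 2, Bal f → ∀ x1 x2 g : Fin 4, (x1 ≠ x2 ∧ g ≠ x1 ∧ g ≠ x2 ∧
        g ≠ pairSwap f x1 ∧ g ≠ pairSwap f x2) → ∀ x3, (x3 ≠ x1 ∧ x3 ≠ x2 ∧ x3 ≠ g) → ∀ y3,
        (y3 ≠ pairSwap f x1 ∧ y3 ≠ pairSwap f x2 ∧ y3 ≠ g) → y3 = pairSwap f g ∧ g = pairSwap f x3 := by
      decide +kernel
    have hg' : g ≠ β t' := fun h => h5 (hβ (h.symm.trans hb.symm))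
    have hg : g ≠ α t' := fun h => h4 (hα (h.symm.trans ha.symm))
    obtain ⟨k1, k2⟩ := key f hf (α t) (α t') g ⟨fun h => h3 (hα h).symm, h1, hg, ht ▸ h2, hu ▸ hg'⟩ (α b)
      ⟨fun h => htb (hα h), fun h => h5 (hα h).symm, fun h => hab (hα (ha.trans h.symm))⟩ (β a)
      ⟨fun h => hta (hβ (h.trans ht.symm)), fun h => h4 (hβ (h.trans hu.symm)).symm,
        fun h => hab (hβ (h.trans hb.symm))⟩
    apply h₀
    rcases h6 t₀ with rfl | rfl | rfl | rfl
    · exact ht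
    · rw [k1, ha]
    · rw [hb, k2]
    · exact hu
  · rcases h6 r with rfl | rfl | rfl | rfl
    · exact Or.inl rfl
    · exact absurd ha.symm hr
    · exact absurd hb.symm hr'
    · exact Or.inr rfl

/-- Three permutations which with the identity form a Latin square avoiding a given pair swap. -/
structure LatinTriple (f : Fin 4 → ZMod 2) (a b c : Fin 4 → Fin 4) : Prop where
  inj : Function.Injective a ∧ Function.Injective b ∧ Function.Injective c
  ne : ∀ t, a t ≠ t ∧ b t ≠ t ∧ c t ≠ t ∧ a t ≠ b t ∧ a t ≠ c t ∧ b t ≠ c t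
  ne_swap : a ≠ pairSwap f ∧ b ≠ pairSwap f ∧ c ≠ pairSwap f

/-- The permutations of `Fin 4` without fixed points. -/
def derangements4 : List (Fin 4 → Fin 4) :=
  [![1,0,3,2], ![1,2,3,0], ![1,3,0,2], ![2,0,3,1], ![2,3,0,1], ![2,3,1,0], ![3,0,1,2], ![3,2,0,1],
   ![3,2,1,0]]

theorem mem_derangements4 {a : Fin 4 → Fin 4} (h : Function.Injective a) (h' : ∀ t, a t ≠ t) :
    a ∈ derangements4 := by
  have key : ∀ x0 x1 x2 x3 : Fin 4, x0 ≠ 0 → x1 ≠ 1 → x2 ≠ 2 → x3 ≠ 3 → x0 ≠ x1 → x0 ≠ x2 → x0 ≠ x3 →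
    x1 ≠ x2 → x1 ≠ x3 → x2 ≠ x3 → (![x0, x1, x2, x3] : Fin 4 → Fin 4) ∈ derangements4 := by decide +kernel
  have e : a = ![a 0, a 1, a 2, a 3] := by
    ext i; fin_cases i <;> rfl
  rw [e]
  exact key _ _ _ _ (h' 0) (h' 1) (h' 2) (h' 3) (fun h1 => by simpa using h h1)
    (fun h1 => by simpa using h h1) (fun h1 => by simpa using h h1) (fun h1 => by simpa using h h1)
    (fun h1 => by simpa using h h1) (fun h1 => by simpa using h h1)

/-- The balanced functions. -/
def balList : List (Fin 4 → ZMod 2) := [![0,0,1,1], ![0,1,0,1], ![0,1,1,0], ![1,0,0,1], ![1,0,1,0], ![1,1,0,0]]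

/-- Exhaustive check. The first alternative places a cell of a column on the opposite level; the
second names a value over which a neighbouring cell has no position left. -/
theorem LatinTriple.swap_or_slice {a b c : Fin 4 → Fin 4} (hf : Bal f) (h : LatinTriple f a b c) :
    ((∃ f', Bal f' ∧ ¬ SameLab f' f ∧ b = pairSwap f') ∨ ∃ f', Bal f' ∧ ¬ SameLab f' f ∧ c = pairSwap f') ∨
    ∃ t, ∀ g, f g ≠ f t → g = b t ∨ ∃ t', t' ≠ t ∧ f g ≠ f t' ∧ g = c t' := by
  have key : ∀ f : Fin 4 → ZMod 2, Bal f → ∀ a ∈ derangements4, a ≠ pairSwap f →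
      ∀ b ∈ derangements4, b ≠ pairSwap f → (∀ t, a t ≠ b t) → ∀ c ∈ derangements4, c ≠ pairSwap f →
      (∀ t, a t ≠ c t ∧ b t ≠ c t) →
      ((∃ f' ∈ balList, Bal f' ∧ ¬ SameLab f' f ∧ b = pairSwap f') ∨
        ∃ f' ∈ balList, Bal f' ∧ ¬ SameLab f' f ∧ c = pairSwap f') ∨
      ∃ t, ∀ g, f g ≠ f t → g = b t ∨ ∃ t', t' ≠ t ∧ f g ≠ f t' ∧ g = c t' := by decide +kernel
  have := key f hf a (mem_derangements4 h.inj.1 fun t => (h.ne t).1) h.ne_swap.1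
    b (mem_derangements4 h.inj.2.1 fun t => (h.ne t).2.1) h.ne_swap.2.1 (fun t => (h.ne t).2.2.2.1)
    c (mem_derangements4 h.inj.2.2 fun t => (h.ne t).2.2.1) h.ne_swap.2.2
    (fun t => ⟨(h.ne t).2.2.2.2.1, (h.ne t).2.2.2.2.2⟩)
  rcases this with (⟨f', -, h⟩ | ⟨f', -, h⟩) | h
  · exact Or.inl (Or.inl ⟨f', h⟩)
  · exact Or.inl (Or.inr ⟨f', h⟩)
  · exact Or.inr h

theorem LatinTriple.exists_swap {a b c : Fin 4 → Fin 4} (hf : Bal f) (h : LatinTriple f a b c) :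
    ∃ f', Bal f' ∧ ¬ SameLab f' f ∧ (a = pairSwap f' ∨ b = pairSwap f' ∨ c = pairSwap f') := by
  have key : ∀ f : Fin 4 → ZMod 2, Bal f → ∀ a ∈ derangements4, a ≠ pairSwap f →
      ∀ b ∈ derangements4, b ≠ pairSwap f → (∀ t, a t ≠ b t) → ∀ c ∈ derangements4, c ≠ pairSwap f →
      (∀ t, a t ≠ c t ∧ b t ≠ c t) →
      ∃ f' ∈ balList, Bal f' ∧ ¬ SameLab f' f ∧ (a = pairSwap f' ∨ b = pairSwap f' ∨ c = pairSwap f') := by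
    decide +kernel
  obtain ⟨f', -, h⟩ := key f hf a (mem_derangements4 h.inj.1 fun t => (h.ne t).1) h.ne_swap.1
    b (mem_derangements4 h.inj.2.1 fun t => (h.ne t).2.1) h.ne_swap.2.1 (fun t => (h.ne t).2.2.2.1)
    c (mem_derangements4 h.inj.2.2 fun t => (h.ne t).2.2.1) h.ne_swap.2.2
    (fun t => ⟨(h.ne t).2.2.2.2.1, (h.ne t).2.2.2.2.2⟩)
  exact ⟨f', h⟩

/-- Exhaustive check. In every pair of `f` at least one element behaves as for a pair involution,
which is enough to compare two columns over half of the values. -/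
theorem LatinTriple.exists_half {a b c : Fin 4 → Fin 4} (hf : Bal f) (h : LatinTriple f a b c) :
    ∃ f', Bal f' ∧ ∀ t, pairSwap f (a t) = pairSwap f' t ∨
      pairSwap f (a (pairSwap f t)) = pairSwap f' (pairSwap f t) := by
  have key : ∀ f : Fin 4 → ZMod 2, Bal f → ∀ a ∈ derangements4, a ≠ pairSwap f →
      ∀ b ∈ derangements4, b ≠ pairSwap f → (∀ t, a t ≠ b t) → ∀ c ∈ derangements4, c ≠ pairSwap f →
      (∀ t, a t ≠ c t ∧ b t ≠ c t) →
      ∃ f' ∈ balList, Bal f' ∧ ∀ t, pairSwap f (a t) = pairSwap f' t ∨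
      pairSwap f (a (pairSwap f t)) = pairSwap f' (pairSwap f t) := by
    decide +kernel
  obtain ⟨f', -, h⟩ := key f hf a (mem_derangements4 h.inj.1 fun t => (h.ne t).1) h.ne_swap.1
    b (mem_derangements4 h.inj.2.1 fun t => (h.ne t).2.1) h.ne_swap.2.1 (fun t => (h.ne t).2.2.2.1)
    c (mem_derangements4 h.inj.2.2 fun t => (h.ne t).2.2.1) h.ne_swap.2.2
    (fun t => ⟨(h.ne t).2.2.2.2.1, (h.ne t).2.2.2.2.2⟩)
  exact ⟨f', h⟩

theorem exists_third_label {f₁ : Fin 4 → ZMod 2} (hf : Bal f) (hf₁ : Bal f₁) (h : ¬ SameLab f₁ f) :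
    ∃ f₂, Bal f₂ ∧ ¬ SameLab f₂ f ∧ ∀ t, pairSwap f (pairSwap f₁ t) = pairSwap f₂ t := by
  have key : ∀ f : Fin 4 → ZMod 2, Bal f → ∀ f₁ : Fin 4 → ZMod 2, Bal f₁ → ¬ SameLab f₁ f →
    ∃ f₂ ∈ balList, Bal f₂ ∧ ¬ SameLab f₂ f ∧ ∀ t, pairSwap f (pairSwap f₁ t) = pairSwap f₂ t := by
    decide +kernel
  obtain ⟨f₂, -, h⟩ := key f hf f₁ hf₁ h
  exact ⟨f₂, h⟩

end Fin4

/-- The function vanishing exactly at `a` and `b`. -/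
def ind2 (a b g : Fin 4) : ZMod 2 := if g = a ∨ g = b then 0 else 1

theorem ind2_eq_zero {a b g : Fin 4} : ind2 a b g = 0 ↔ g = a ∨ g = b := by
  unfold ind2; split_ifs with h <;> simp [h]

theorem ind2_eq_one {a b g : Fin 4} : ind2 a b g = 1 ↔ g ≠ a ∧ g ≠ b := by
  unfold ind2; split_ifs with h
  · simp; tauto
  · simpa using h

theorem bal_ind2 {a b : Fin 4} (h : a ≠ b) : Bal (ind2 a b) := bal_of_zeros h fun _ => ind2_eq_zero

/-! ### Codes avoiding two images of a rigid code; actions in two coordinates. -/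

section RigidExtra
variable {ι : Type*} [DecidableEq ι] {A X : Set (ι → Fin 4)} {F : (ι → Fin 4) → ZMod 2} {j : ι}

/-- A code avoiding, over each value of the coordinate `j`, two positions that do not always form a
class of the label of `F`. -/
theorem Rigid.isAct_of_avoid (h : Rigid A F) (hX : IsCode X) {α β : Fin 4 → Fin 4}
    (hα : Function.Injective α) (hβ : Function.Injective β) (hαβ : ∀ t, α t ≠ β t) {t₀ : Fin 4}
    (h₀ : β t₀ ≠ pairSwap (lab F j) (α t₀))
    (hav : ∀ x ∈ X, gr A j x ≠ α (x j) ∧ gr A j x ≠ β (x j)) : IsAct j A X := by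
  have hb := h.lin.bal_lab j
  have key : ∀ t, β t ≠ pairSwap (lab F j) (α t) → ∀ x y, x j = t → y j = t → gr A j x = gr A j y →
      x ∈ X → y ∈ X := by
    intro t ht x y hx hy hxy hmem
    have hl : ¬ SameLab (ind2 (α t) (β t)) (lab F j) := by
      intro hs
      have := (hs (β t) (α t)).1 (by rw [ind2_eq_zero.2 (Or.inr rfl), ind2_eq_zero.2 (Or.inl rfl)])
      exact ht (hb.eq_pairSwap this (hαβ t).symm)
    refine h.mem_of_gr_eq hX (bal_ind2 (hαβ t)) hl (t := t) (c := 1) (fun z hz hzt => ?_) hx hy hxy hmem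
    have := hav z hz
    rw [hzt] at this
    exact ind2_eq_one.2 this
  obtain ⟨i, hi⟩ := h.inhabited j
  refine h.code.isAct_of_forall hX hi fun x y hxy hg hmem => ?_
  -- If the forbidden pair is a class of the label, connectivity says nothing over `x j`. Membership
  -- there is then the negation of membership over a second value `t'`, where connectivity does
  -- apply.
  by_cases ht : β (x j) = pairSwap (lab F j) (α (x j))
  · obtain ⟨h1, h2⟩ := hav x hmem
    obtain ⟨t', ht', hn, hr⟩ := exists_other_position hb hα hβ hαβ h₀ ht h1 h2
    have alt : ∀ z, z j = x j → gr A j z = gr A j x → (z ∈ X ↔ Function.update z j t' ∉ X) := by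
      intro z hz hgz
      constructor
      · intro hzX hz'
        exact ht' ((hX z j).unique hz' (y₂ := z j) (by simpa using hzX) |>.trans hz)
      · intro hz'
        have hp := hX.gr_mem j z
        have := hav _ hp
        simp only [gr_update, Function.update_self, hgz] at this
        rcases hr _ this.1 this.2 with e | e
        · rw [e, ← hz, Function.update_eq_self] at hp; exact hp
        · rw [e] at hp; exact absurd hp hz'
    rw [alt x rfl rfl] at hmem
    rw [alt y hxy.symm hg.symm]
    exact fun hy => hmem (key t' hn (Function.update y j t') _ (by simp) (by simp) (by simp [hg]) hy)
  · exact key _ ht x y rfl hxy.symm hg hmem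

/-- The two images of `A` would be equal, so swapping the coordinate `j'` inside its pair preserves
`f ∘ gr A j`. Then `f' (x j')` is constant on the connected level sets of this function. But a third
direction reaches the same level from any value of `x j'`. -/
theorem Rigid.false_of_double (h : Rigid A F) {j' : ι} (hj : j ≠ j') {f f' : Fin 4 → ZMod 2}
    (hf : Bal f) (hf' : Bal f') (hl : ¬ SameLab f (lab F j))
    (hd : ∀ x, gr A j' x = pairSwap f' (x j') → gr A j x = pairSwap f (x j)) : False := by
  have : Nonempty ι := ⟨j⟩
  have hset : act j' (pairSwap f') A = act j (pairSwap f) A :=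
    (h.code.act hf'.pairSwap_injective).eq_of_subset (h.code.act hf.pairSwap_injective) hd
  have hinv : ∀ x, f (gr A j (Function.update x j' (pairSwap f' (x j')))) = f (gr A j x) := by
    intro x
    have hp := h.code.gr_mem j x
    set r := Function.update x j (pairSwap f (gr A j x)) with hr
    have h1 : r ∈ act j (pairSwap f) A := by simp [hr, hf.pairSwap_pairSwap]
    rw [← hset, mem_act, ← h.code.update_mem_iff] at h1
    have h2 : r j' = x j' := Function.update_of_ne hj.symm _ _
    rw [h2, hr, Function.update_comm hj, h.code.update_mem_iff] at h1
    rw [h1, hf.apply_pairSwap]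
  have hconst : ∀ x y, f (gr A j x) = f (gr A j y) → f' (x j') = f' (y j') := by
    intro x y hxy
    have hc := h.conn_gr j f hf hl x y hxy
    clear hxy
    induction hc with
    | refl => rfl
    | @tail z z1 h1 hm ih =>
      rw [ih]
      obtain ⟨e, i, -, q, rfl⟩ := hm
      by_cases hi : i = j'
      · subst hi
        rw [Function.update_self]
        have hb : Bal fun t => f (gr A j (Function.update z i t)) := hf.comp (h.code.gr_bijective hj.symm z)
        have := hb.mem_pair (a := pairSwap f' (z i)) (b := z i) (c := f (gr A j z)) (t := q)
          (hf'.pairSwap_ne _) (hinv z) (by simp) e.symm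
        rcases this with rfl | rfl
        · exact (hf'.apply_pairSwap _).symm
        · rfl
      · rw [Function.update_of_ne (Ne.symm hi)]
  obtain ⟨i, hij, hij'⟩ := h.third j j'
  let x : ι → Fin 4 := fun _ => 0
  obtain ⟨q, hq⟩ := hf'.exists_ne (f' (x j'))
  have hb : Bal fun t => f (gr A j (Function.update (Function.update x j' q) i t)) :=
    hf.comp (h.code.gr_bijective hij _)
  obtain ⟨r, hr⟩ := hb.exists_eq (f (gr A j x))
  have := hconst _ _ hr
  rw [Function.update_of_ne hij'.symm, Function.update_self] at this
  exact hq this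

end RigidExtra

/-! ### Arrays of cells, given by two added coordinates. -/

section Array
variable {ι : Type*} [DecidableEq ι]

/-- The layer with first coordinates `v`, `l`. -/
def cell (D : Set (Option (Option ι) → Fin 4)) (v l : Fin 4) : Set (ι → Fin 4) := layer (layer D v) l

variable {D : Set (Option (Option ι) → Fin 4)} {C C' : Set (Option ι → Fin 4)}

theorem LinF.extend {F : (ι → Fin 4) → ZMod 2} (hF : LinF F) {e : Fin 4 → ZMod 2} (he : Bal e) :
    LinF fun z : Option ι → Fin 4 => F (fun i => z (some i)) + e (z none) := by
  have hu : ∀ (z : Option ι → Fin 4) i q, (fun k => Function.update z (some i) q (some k)) =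
      Function.update (fun k => z (some k)) i q := by
    intro z i q; ext k
    by_cases hk : k = i
    · subst hk; simp
    · simp [hk]
  refine ⟨fun z i => ?_, fun z w i q r => ?_⟩
  · cases i with
    | none =>
      simp only [Function.update_self, ne_eq, reduceCtorEq, not_false_eq_true, Function.update_of_ne]
      rw [show (fun t => F (fun i => z (some i)) + e t) = fun t => e t + F (fun i => z (some i)) from
        funext fun _ => add_comm _ _]
      exact he.add_const _
    | some i =>
      simp only [hu, ne_eq, reduceCtorEq, not_false_eq_true, Function.update_of_ne]
      exact (hF.1 _ i).add_const _
  · have fin : ∀ a b c d e f : ZMod 2, a + b = c + d → a + e + (b + e) = c + f + (d + f) := by decide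
    have fin' : ∀ a b c d : ZMod 2, a + c + (a + d) = b + c + (b + d) := by decide
    cases i with
    | none =>
      simp only [Function.update_self, ne_eq, reduceCtorEq, not_false_eq_true, Function.update_of_ne]
      exact fin' _ _ _ _
    | some i =>
      simp only [hu, ne_eq, reduceCtorEq, not_false_eq_true, Function.update_of_ne]
      exact fin _ _ _ _ _ _ (hF.2 _ _ _ _ _)

/-- The witness adds to `F` a label of the new coordinate that separates `v, p` from the other two
values. -/
theorem semi_of_layer {D : Set (Option ι → Fin 4)} (hD : IsCode D) {F : (ι → Fin 4) → ZMod 2} (hF : LinF F) {v p : Fin 4}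
    (hvp : v ≠ p) (hv : ∀ x ∈ layer D v, F x = 0) (hp : layer D p = {x | F x = 0 ∧ x ∉ layer D v}) :
    Semi D := by
  refine ⟨_, hF.extend (bal_ind2 hvp), ?_⟩
  rw [forall_cons]
  intro w x hx
  have hw : x ∈ layer D w := hx
  simp only [cons_some, cons_none]
  by_cases h1 : w = v
  · subst h1
    rw [ind2_eq_zero.2 (Or.inl rfl), add_zero]; exact hv x hw
  by_cases h2 : w = p
  · subst h2
    rw [hp] at hw
    rw [ind2_eq_zero.2 (Or.inr rfl), add_zero]; exact hw.1
  · rw [ind2_eq_one.2 ⟨h1, h2⟩]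
    have : F x ≠ 0 := by
      intro h0
      by_cases h3 : x ∈ layer D v
      · exact hD.layer_disjoint h1 hw h3
      · exact hD.layer_disjoint h2 hw (by rw [hp]; exact ⟨h0, h3⟩)
    have e : F (fun i => x i) = 0 + 1 := ZMod.two_eq_add_one this
    rw [e]; rfl

theorem IsCode.isAct_none (hC : IsCode C) {α : Fin 4 → Fin 4} (hα : Function.Injective α)
    (h : ∀ k, _root_.layer C' k = _root_.layer C (α k)) : IsAct none C C' := by
  refine ⟨α, hα, layer_injective fun k => ?_⟩
  ext x
  rw [h, ← hC.gr_none_iff (v := k)]; rfl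

theorem layer_act_some (C : Set (Option ι → Fin 4)) (j : ι) (α : Fin 4 → Fin 4) (v : Fin 4) :
    layer (act (some j) α C) v = act j α (layer C v) := by
  ext x; simp [act]

/-- Two layers `l₀`, `s` of the row `v₀` of an array of codes, filling a level set of a linear
function. -/
structure Arr (D : Set (Option (Option ι) → Fin 4)) (F : (Option ι → Fin 4) → ZMod 2)
    (v₀ l₀ s : Fin 4) : Prop where
  code : IsCode D
  lin : LinF F
  sub : ∀ x ∈ layer D v₀, F x = 0
  lab_eq : lab F none s = lab F none l₀
  ne : s ≠ l₀
  rigid : Rigid (cell D v₀ l₀) fun x => F (cons l₀ x)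
  rigid' : Rigid (cell D v₀ s) fun x => F (cons s x)

variable {F : (Option ι → Fin 4) → ZMod 2} {v₀ l₀ s : Fin 4}

theorem Arr.symm (h : Arr D F v₀ l₀ s) : Arr D F v₀ s l₀ :=
  ⟨h.code, h.lin, h.sub, h.lab_eq.symm, h.ne.symm, h.rigid', h.rigid⟩

theorem Arr.cons_eq (h : Arr D F v₀ l₀ s) : (fun x => F (cons s x)) = fun x => F (cons l₀ x) :=
  funext fun x => h.lin.cons_eq_iff.2 h.lab_eq

theorem IsCode.cell (hD : IsCode D) (v l : Fin 4) : IsCode (cell D v l) := (hD.layer v).layer l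

theorem IsCode.row_disjoint (hD : IsCode D) {v l l' : Fin 4} (h : l ≠ l') {x : ι → Fin 4}
    (h1 : x ∈ _root_.cell D v l) (h2 : x ∈ _root_.cell D v l') : False :=
  (hD.layer v).layer_disjoint h h1 h2

theorem IsCode.col_disjoint (hD : IsCode D) {v v' l : Fin 4} (h : v ≠ v') {x : ι → Fin 4}
    (h1 : x ∈ _root_.cell D v l) (h2 : x ∈ _root_.cell D v' l) : False :=
  hD.layer_disjoint (x := cons l x) h h1 h2

theorem IsCode.row_exists (hD : IsCode D) (v : Fin 4) (x : ι → Fin 4) : ∃ l, x ∈ _root_.cell D v l :=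
  ((hD.layer v).layer_unique x).exists

theorem IsCode.col_exists (hD : IsCode D) (l : Fin 4) (x : ι → Fin 4) : ∃ v, x ∈ _root_.cell D v l :=
  (hD.layer_unique (cons l x)).exists

theorem IsCode.col (hD : IsCode D) (l : Fin 4) : IsCode (glue fun v => _root_.cell D v l) :=
  isCode_of_layers (fun v => hD.cell v l) fun x => hD.layer_unique (cons l x)

variable [Finite ι] [Nonempty ι]

theorem Arr.cell_partner (h : Arr D F v₀ l₀ s) :
    cell D v₀ s = {x | F (cons l₀ x) = 0 ∧ x ∉ cell D v₀ l₀} :=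
  h.lin.layer_partner (h.code.layer v₀) h.sub h.lab_eq h.ne

theorem Arr.mem_or (h : Arr D F v₀ l₀ s) {x : ι → Fin 4} :
    x ∈ cell D v₀ l₀ ∨ x ∈ cell D v₀ s ↔ F (cons l₀ x) = 0 := by
  rw [h.cell_partner]
  constructor
  · rintro (hx | hx)
    · exact h.rigid.sub x hx
    · exact hx.1
  · intro hx; by_cases h' : x ∈ cell D v₀ l₀
    · exact Or.inl h'
    · exact Or.inr ⟨hx, h'⟩

theorem Arr.isAct_partner (h : Arr D F v₀ l₀ s) (j : ι) : IsAct j (cell D v₀ l₀) (cell D v₀ s) := by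
  rw [h.cell_partner]
  exact (h.lin.layer l₀).isAct_compl h.rigid.code h.rigid.sub j

theorem Arr.cell_partner_eq (h : Arr D F v₀ l₀ s) (j : ι) :
    cell D v₀ s = act j (pairSwap (lab (fun x => F (cons l₀ x)) j)) (cell D v₀ l₀) := by
  rw [h.cell_partner]
  exact (h.lin.layer l₀).compl_eq_act h.rigid.code h.rigid.sub j

/-- Row `p` agrees in two cells with the complement of row `v₀` in the zero set. By
`eq_or_compl_of_layers` it equals that complement; the alternative fails since both rows cover the
same points by these two cells. -/
theorem Arr.semi_of_cells (h : Arr D F v₀ l₀ s) {p : Fin 4} (h1 : cell D p l₀ = cell D v₀ s)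
    (h2 : cell D p s = cell D v₀ l₀) : Semi D := by
  obtain ⟨j⟩ := ‹Nonempty ι›
  have : Nonempty ι := ⟨j⟩
  have hv : v₀ ≠ p := by
    rintro rfl
    have := (h.code.cell v₀ l₀).gr_mem j fun _ => 0
    exact h.code.row_disjoint h.ne (by rw [← h1]; exact this) this
  refine semi_of_layer h.code h.lin hv h.sub ?_
  have hR : IsCode {x | F x = 0 ∧ x ∉ layer D v₀} := (h.code.layer v₀).compl h.lin.1 h.sub
  rcases eq_or_compl_of_layers (h.code.layer p) hR (h.code.layer v₀)
    (fun x hx hx' => h.code.layer_disjoint hv hx' hx) (fun x hx => hx.2) (a := l₀) (b := s) h.ne.symm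
    (by
      change cell D p l₀ = _
      rw [h1, h.cell_partner]; rfl)
    (by
      change cell D p s = _
      rw [h2]; ext x
      have : F (cons s x) = F (cons l₀ x) := congrFun h.cons_eq x
      simp only [mem_layer, Set.mem_ofPred_eq, this]
      change _ ↔ _ ∧ x ∉ cell D v₀ s
      rw [h.cell_partner]
      simp only [Set.mem_ofPred_eq, not_and, not_not]
      exact ⟨fun hx => ⟨h.rigid.sub x hx, fun _ => hx⟩, fun hx => hx.2 hx.1⟩) with e | e
  · exact e
  · exfalso
    have hx := (h.code.cell v₀ l₀).gr_mem j fun _ => 0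
    have := (e (Function.update (fun _ => 0) j (gr (cell D v₀ l₀) j fun _ => 0))).1 (Or.inr (by
      change _ ∈ cell D p s; rw [h2]; exact hx))
    exact this (Or.inl hx)

/-- Both columns are images of one cell in the same coordinate `j`, by permutations `α v` and `β v`.
If the pair is always a class of the label, the rows are either recovered as images of row `v₀` or
contain its partner. If not, two rows violate this, and their remaining cells force row `v₀` to be
split or lead to a contradiction. -/
theorem Arr.of_isAct (h : Arr D F v₀ l₀ s) (hns : ¬ IsSplit (layer D v₀)) {j : ι}
    (hA : ∀ v, IsAct j (cell D v₀ l₀) (cell D v l₀)) (hB : ∀ v, IsAct j (cell D v₀ l₀) (cell D v s)) :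
    Semi D ∨ IsSplit D := by
  choose α hα eα using hA
  choose β hβ eβ using hB
  have hD := h.code
  set A := cell D v₀ l₀ with hAdef
  have hAc : IsCode A := h.rigid.code
  obtain ⟨i, hi⟩ := h.rigid.inhabited j
  set f := lab (fun x => F (cons l₀ x)) j with hfdef
  have hf : Bal f := (h.lin.layer l₀).bal_lab j
  have hFx : ∀ x, F (cons l₀ x) = f (gr A j x) + f (x j) := fun x =>
    (h.lin.layer l₀).eq_lab hAc h.rigid.sub j x
  have hαne : ∀ v w, v ≠ w → ∀ t, α v t ≠ α w t := fun v w hvw t =>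
    hAc.act_ne hi (fun x hx hx' => hD.col_disjoint hvw (by rw [eα v]; exact hx) (by rw [eα w]; exact hx')) t
  have hβne : ∀ v w, v ≠ w → ∀ t, β v t ≠ β w t := fun v w hvw t =>
    hAc.act_ne hi (fun x hx hx' => hD.col_disjoint hvw (by rw [eβ v]; exact hx) (by rw [eβ w]; exact hx')) t
  have hαβ : ∀ v t, α v t ≠ β v t := fun v t =>
    hAc.act_ne hi (fun x hx hx' => hD.row_disjoint h.ne.symm (by rw [eα v]; exact hx)
      (by rw [eβ v]; exact hx')) t
  have hα0 : α v₀ = id := hAc.act_injective hi ((eα v₀).symm.trans hAc.act_id.symm)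
  have hβ0 : β v₀ = pairSwap f := hAc.act_injective hi ((eβ v₀).symm.trans (h.cell_partner_eq j))
  by_cases hU : ∀ v t, β v t = pairSwap f (α v t)
  · by_cases hp : ∃ p, α p = pairSwap f
    · obtain ⟨p, hp⟩ := hp
      left
      refine h.semi_of_cells (p := p) (by rw [eα p, hp, h.cell_partner_eq j]) ?_
      rw [eβ p, show β p = id from funext fun t => by rw [hU, hp, hf.pairSwap_pairSwap]; rfl, hAc.act_id]
    · right
      push Not at hp
      have hC : IsCode (layer D v₀) := hD.layer v₀
      have good : ∀ v t, f (α v t) = f t → layer D v = act (some j) (α v) (layer D v₀) := by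
        intro v t ht
        by_cases hv : v = v₀
        · rw [hv, hα0, hC.act_id]
        rcases eq_or_compl_of_layers (hD.layer v) (hC.act (j := some j) (hα v)) hC
          (fun x hx hx' => hD.layer_disjoint hv hx hx') (fun x hx hx' => by
            rw [hC.mem_iff (some j)] at hx'
            rw [mem_act, hx'] at hx
            exact hαne v₀ v (Ne.symm hv) (x (some j)) (by rw [hα0]; exact hx)) (a := l₀) (b := s) h.ne.symm
          (by rw [layer_act_some]; exact eα v)
          (by
            rw [layer_act_some]
            change cell D v s = act j (α v) (cell D v₀ s)
            rw [eβ v, h.cell_partner_eq j, hAc.act_act hf.pairSwap_injective]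
            congr 1
            exact funext fun t => hU v t) with e | e
        · exact e
        · exfalso
          obtain ⟨x, hx, hx'⟩ := hAc.exists_point hi (α v t) t
          refine (e x).1 (Or.inl ?_) (h.mem_or.2 ?_)
          · change x ∈ cell D v l₀
            rw [eα v, mem_act, hx', hx]
          · rw [hFx, hx', hx, ht]; generalize f t = c; revert c; decide
      refine isSplit_of_base (l₀ := v₀) hD (j := some j) fun v => ⟨α v, hα v, ?_⟩
      -- Two rows failing this would force the remaining row to have `α = pairSwap f`, which is
      -- excluded. So at most one row fails, and it consists of what the other three leave.
      by_cases hbad : ∃ t, f (α v t) = f t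
      · obtain ⟨t, ht⟩ := hbad; exact good v t ht
      push Not at hbad
      have hv : v ≠ v₀ := by
        rintro rfl; exact hbad 0 (by rw [hα0]; rfl)
      have hother : ∀ w, w ≠ v → layer D w = act (some j) (α w) (layer D v₀) := by
        intro w hw
        by_cases hbw : ∃ t, f (α w t) = f t
        · obtain ⟨t, ht⟩ := hbw; exact good w t ht
        exfalso
        push Not at hbw
        have hw0 : w ≠ v₀ := by
          rintro rfl; exact hbw 0 (by rw [hα0]; rfl)
        obtain ⟨c, hc1, hc2, hc3, -⟩ := exists_fourth hv hw.symm hw0.symm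
        refine hp c (funext fun t => hf.third_eq (hbad t) (hbw t) (hαne _ _ hw.symm t)
          (hαne _ _ hc1 t) (hαne _ _ hc3 t) ?_)
        have := hαne _ _ hc2 t
        rwa [hα0] at this
      have hsurj : ∀ t, Function.Surjective fun w => α w t := fun t =>
        Finite.injective_iff_surjective.1 fun w w' hww => by
          by_contra hne; exact hαne w w' hne t hww
      ext x
      rw [mem_act]
      obtain ⟨w, hw⟩ := hsurj (x (some j)) (gr (layer D v₀) (some j) x)
      simp only at hw
      constructor
      · intro hx
        by_cases hwv : w = v
        · rw [← hwv, hw]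
        · exact absurd (hD.layer_disjoint hwv (by rw [hother w hwv, mem_act, hw]) hx) id
      · intro hx
        obtain ⟨w', hw'⟩ := (hD.layer_unique x).exists
        by_cases hwv : w' = v
        · rwa [← hwv]
        · rw [hother w' hwv, mem_act, hx] at hw'
          exact absurd hw' (hαne v w' (Ne.symm hwv) _)
  · exfalso
    push Not at hU
    obtain ⟨v₁, t₁, h1⟩ := hU
    -- A single exceptional row is impossible: another row would take in the second column the value
    -- expected of `v₁` at `t₁`, and would collide with `v₁` in the first.
    obtain ⟨v₂, hv12, t₂, h2⟩ : ∃ v₂, v₂ ≠ v₁ ∧ ∃ t, β v₂ t ≠ pairSwap f (α v₂ t) := by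
      by_contra! hcon
      have hsurj : Function.Surjective fun w => β w t₁ :=
        Finite.injective_iff_surjective.1 fun w w' hww => by
          by_contra hne; exact hβne w w' hne t₁ hww
      obtain ⟨w, hw⟩ := hsurj (pairSwap f (α v₁ t₁))
      simp only at hw
      by_cases hwv : w = v₁
      · rw [hwv] at hw; exact h1 hw
      · rw [hcon w hwv t₁] at hw
        exact hαne w v₁ hwv t₁ (hf.pairSwap_injective hw)
    have nonunif : ∀ v t, β v t ≠ pairSwap f (α v t) → ∀ l, IsAct j A (cell D v l) := by
      intro v t hvt l
      by_cases hl : l = l₀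
      · rw [hl]; exact ⟨_, hα v, eα v⟩
      by_cases hl' : l = s
      · rw [hl']; exact ⟨_, hβ v, eβ v⟩
      refine h.rigid.isAct_of_avoid (hD.cell v l) (hα v) (hβ v) (hαβ v) hvt fun x hx => ⟨fun e => ?_, fun e => ?_⟩
      · exact hD.row_disjoint hl hx (by rw [eα v]; exact e)
      · exact hD.row_disjoint hl' hx (by rw [eβ v]; exact e)
    have hv10 : v₁ ≠ v₀ := by rintro rfl; exact h1 (by rw [hα0, hβ0]; rfl)
    have hv20 : v₂ ≠ v₀ := by rintro rfl; exact h2 (by rw [hα0, hβ0]; rfl)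
    -- The cell of row `v₀` in column `l` avoids those of the rows `v₁` and `v₂`, which are images
    -- of `A`. Either `Rigid.isAct_of_avoid` applies, or the forbidden positions always form a class
    -- of the label, which places the cell of row `v₁` in the zero set.
    have key : ∀ l, l ≠ l₀ → l ≠ s → IsAct j A (cell D v₀ l) ∨ ∀ x ∈ cell D v₁ l, F (cons l₀ x) = 0 := by
      intro l hl hl'
      obtain ⟨γ, hγ, eγ⟩ := nonunif v₁ t₁ h1 l
      obtain ⟨δ, hδ, eδ⟩ := nonunif v₂ t₂ h2 l
      have hγδ : ∀ t, γ t ≠ δ t := fun t => hAc.act_ne hi (fun x hx hx' =>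
        hD.col_disjoint hv12.symm (by rw [eγ]; exact hx) (by rw [eδ]; exact hx')) t
      have hav : ∀ x ∈ cell D v₀ l, gr A j x ≠ γ (x j) ∧ gr A j x ≠ δ (x j) := fun x hx =>
        ⟨fun e => hD.col_disjoint hv10 (by rw [eγ]; exact e) hx,
          fun e => hD.col_disjoint hv20 (by rw [eδ]; exact e) hx⟩
      by_cases hu : ∀ t, δ t = pairSwap f (γ t)
      · right
        have hft : ∀ t, f (γ t) = f t := by
          intro t
          obtain ⟨x, hx, hxt⟩ := (hD.cell v₀ l).exists_mem hi t
          obtain ⟨e1, e2⟩ := hav x hx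
          have e3 : f (gr A j x) ≠ f (γ (x j)) := fun e => by
            rcases hf.eq_or_eq_pairSwap e with e | e
            · exact e1 e
            · exact e2 (e.trans (hu _).symm)
          have e4 : F (cons l₀ x) ≠ 0 := fun e => by
            rcases h.mem_or.2 e with e | e
            · exact hD.row_disjoint hl hx e
            · exact hD.row_disjoint hl' hx e
          rw [hFx] at e4
          rw [hxt] at e3 e4
          revert e3 e4
          generalize f (gr A j x) = a; generalize f (γ t) = b; generalize f t = c
          revert a b c; decide
        intro x hx
        rw [eγ, mem_act] at hx
        rw [hFx, hx, hft]
        generalize f (x j) = c; revert c; decide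
      · left
        push Not at hu
        obtain ⟨t, ht⟩ := hu
        exact h.rigid.isAct_of_avoid (hD.cell v₀ l) hγ hδ hγδ ht hav
    obtain ⟨l, l', hll', hl1, hl2, hl3, hl4, hall⟩ := exists_others h.ne.symm
    have hC : IsCode (layer D v₀) := hD.layer v₀
    have hlab : lab F none l = lab F none l' := by
      have hb := h.lin.bal_lab none
      have e1 := h.lab_eq
      have fin : ∀ g : Fin 4 → ZMod 2, Bal g → ∀ a b c d : Fin 4, (a ≠ b ∧ c ≠ d ∧ c ≠ a ∧ c ≠ b ∧
        d ≠ a ∧ d ≠ b ∧ g b = g a) → g c = g d := by decide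
      exact fin _ hb l₀ s l l' ⟨h.ne.symm, hll', hl1, hl2, hl3, hl4, e1⟩
    have hsplit : ∀ m m', (m = l ∧ m' = l') ∨ (m = l' ∧ m' = l) → ¬ IsAct j A (cell D v₀ m) := by
      intro m m' hm hact
      refine hns (isSplit_of_base (l₀ := l₀) hC (j := j) fun k => ?_)
      have hm' : IsAct j A (cell D v₀ m') := by
        refine hact.trans hAc (h.lin.isAct_layer_partner hC h.sub ?_ j)
        rcases hm with ⟨rfl, rfl⟩ | ⟨rfl, rfl⟩
        · exact hlab.symm
        · exact hlab
      rcases hall k with rfl | rfl | rfl | rfl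
      · exact IsAct.refl hAc j
      · exact h.isAct_partner j
      · rcases hm with ⟨rfl, rfl⟩ | ⟨rfl, rfl⟩ <;> assumption
      · rcases hm with ⟨rfl, rfl⟩ | ⟨rfl, rfl⟩ <;> assumption
    have z1 := (key l hl1 hl2).resolve_left (hsplit l l' (Or.inl ⟨rfl, rfl⟩))
    have z2 := (key l' hl3 hl4).resolve_left (hsplit l' l (Or.inr ⟨rfl, rfl⟩))
    -- The last two cells of row `v₁` lie in the zero set, so the first two cover the opposite level
    -- and form a class of the label after all.
    refine h1 (hf.eq_pairSwap_of_cover (t := t₁) (fun g hg => ?_) (hαβ v₁ t₁))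
    obtain ⟨x, hx, hx'⟩ := hAc.exists_point hi g t₁
    have hx1 : F (cons l₀ x) ≠ 0 := by
      rw [hFx, hx', hx]
      intro e; apply hg
      revert e; generalize f g = a; generalize f t₁ = b; revert a b; decide
    obtain ⟨k, hk⟩ := hD.row_exists v₁ x
    rcases hall k with rfl | rfl | rfl | rfl
    · left; rw [eα v₁, mem_act, hx', hx] at hk; exact hk
    · right; rw [eβ v₁, mem_act, hx', hx] at hk; exact hk
    · exact absurd (z1 x hk) hx1
    · exact absurd (z2 x hk) hx1

end Array

theorem injective_of_table {a b c : Fin 4} (hab : a ≠ b) (hac : a ≠ c) (hbc : b ≠ c) {p q r u : Fin 4}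
    (h : p ≠ q ∧ p ≠ r ∧ p ≠ u ∧ q ≠ r ∧ q ≠ u ∧ r ≠ u) :
    Function.Injective fun k => if k = a then p else if k = b then q else if k = c then r else u := by
  obtain ⟨d, h1, h2, h3, hd⟩ := exists_fourth hab hac hbc
  obtain ⟨k1, k2, k3, k4, k5, k6⟩ := h
  intro x y hxy
  simp only at hxy
  have ea : ∀ k, k = d → k ≠ a ∧ k ≠ b ∧ k ≠ c := by rintro k rfl; exact ⟨h1, h2, h3⟩
  grind

/-! ### Arrays according to whether each column contains the partner cell. -/

section Array
variable {ι : Type*} [DecidableEq ι] [Finite ι] [Nonempty ι]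
variable {D : Set (Option (Option ι) → Fin 4)} {F : (Option ι → Fin 4) → ZMod 2} {v₀ l₀ s : Fin 4}

theorem Arr.lev_one (h : Arr D F v₀ l₀ s) {x : ι → Fin 4} (h1 : x ∉ cell D v₀ l₀)
    (h2 : x ∉ cell D v₀ s) : F (cons l₀ x) = 1 :=
  ZMod.two_eq_add_one (c := 0) fun h0 => by rcases h.mem_or.2 h0 with h' | h' <;> contradiction

/-- The case where both columns contain the partner code, in different rows, and the remaining
unions are connected. -/
theorem Arr.split_of_conn (h : Arr D F v₀ l₀ s) {p q r : Fin 4} (hp0 : p ≠ v₀) (hq0 : q ≠ v₀)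
    (hpq : p ≠ q) (hr0 : r ≠ v₀) (hrp : r ≠ p) (hrq : r ≠ q) (hpB : cell D p l₀ = cell D v₀ s)
    (hqA : cell D q s = cell D v₀ l₀) (hrE : cell D r s = cell D q l₀) (hpD : cell D p s = cell D r l₀)
    (hAE : ∀ X, IsCode X → (∀ x ∈ X, x ∈ cell D v₀ l₀ ∨ x ∈ cell D q l₀) → X = cell D v₀ l₀ ∨ X = cell D q l₀)
    (hBD : ∀ X, IsCode X → (∀ x ∈ X, x ∈ cell D v₀ s ∨ x ∈ cell D r l₀) → X = cell D v₀ s ∨ X = cell D r l₀)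
    {l l' : Fin 4} (hl0 : l ≠ l₀) (hls : l ≠ s) (hl'0 : l' ≠ l₀) (hl's : l' ≠ s) (hll' : l ≠ l')
    (hpl : cell D p l = cell D v₀ l₀) : IsSplit D := by
  have hD := h.code
  obtain ⟨i₀⟩ := ‹Nonempty ι›
  have hne : Nonempty ι := ⟨i₀⟩
  have pt : ∀ v l, ∃ x, x ∈ cell D v l := fun v l => ⟨_, (hD.cell v l).gr_mem i₀ fun _ => 0⟩
  have cover : ∀ x, x ∈ cell D v₀ l₀ ∨ x ∈ cell D v₀ s ∨ x ∈ cell D q l₀ ∨ x ∈ cell D r l₀ := by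
    intro x
    obtain ⟨v, hv⟩ := hD.col_exists l₀ x
    obtain ⟨e, -, -, -, he⟩ := exists_fourth hp0 hpq hq0.symm
    have hall : v = p ∨ v = v₀ ∨ v = q ∨ v = r := by
      rcases he v with rfl | rfl | rfl | rfl
      · tauto
      · tauto
      · tauto
      · rcases he r with h | h | h | h
        · exact absurd h hrp
        · exact absurd h hr0
        · exact absurd h hrq
        · tauto
    rcases hall with rfl | rfl | rfl | rfl
    · right; left; rw [← hpB]; exact hv
    · exact Or.inl hv
    · tauto
    · tauto
  have hABdisj : ∀ x, x ∈ cell D v₀ l₀ → x ∈ cell D v₀ s → False := fun x h1 h2 =>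
    hD.row_disjoint h.ne h2 h1
  have hAEdisj : ∀ x, x ∈ cell D v₀ l₀ → x ∈ cell D q l₀ → False := fun x h1 h2 =>
    hD.col_disjoint hq0 h2 h1
  have hADdisj : ∀ x, x ∈ cell D v₀ l₀ → x ∈ cell D r l₀ → False := fun x h1 h2 =>
    hD.col_disjoint hr0 h2 h1
  have hEDdisj : ∀ x, x ∈ cell D q l₀ → x ∈ cell D r l₀ → False := fun x h1 h2 =>
    hD.col_disjoint hrq h2 h1
  have hBEdisj : ∀ x, x ∈ cell D v₀ s → x ∈ cell D q l₀ → False := fun x h1 h2 =>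
    hD.col_disjoint hpq (hpB ▸ h1) h2
  have hBDdisj : ∀ x, x ∈ cell D v₀ s → x ∈ cell D r l₀ → False := fun x h1 h2 =>
    hD.col_disjoint hrp h2 (hpB ▸ h1)
  -- row `p`
  have hpl' : cell D p l' = cell D q l₀ := by
    refine (hAE _ (hD.cell p l') fun x hx => ?_).resolve_left fun e => ?_
    · rcases cover x with h1 | h1 | h1 | h1
      · exact Or.inl h1
      · exact absurd (hD.row_disjoint hl'0 hx (by rw [hpB]; exact h1)) id
      · exact Or.inr h1
      · exact absurd (hD.row_disjoint hl's hx (by rw [hpD]; exact h1)) id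
    · obtain ⟨x, hx⟩ := pt p l
      exact hD.row_disjoint hll' hx (by rw [e, ← hpl]; exact hx)
  -- row `q`
  have hq : ∀ m, m ≠ l₀ → m ≠ s → cell D q m = cell D v₀ s ∨ cell D q m = cell D r l₀ := by
    intro m hm hm'
    refine hBD _ (hD.cell q m) fun x hx => ?_
    rcases cover x with h1 | h1 | h1 | h1
    · exact absurd (hD.row_disjoint hm' hx (by rw [hqA]; exact h1)) id
    · exact Or.inl h1
    · exact absurd (hD.row_disjoint hm hx h1) id
    · exact Or.inr h1
  have hrow : ∀ m, m ≠ l₀ → m ≠ s → ∀ x ∈ cell D r m, x ∈ cell D v₀ l₀ ∨ x ∈ cell D v₀ s := by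
    intro m hm hm' x hx
    rcases cover x with h1 | h1 | h1 | h1
    · exact Or.inl h1
    · exact Or.inr h1
    · exact absurd (hD.row_disjoint hm' hx (by rw [hrE]; exact h1)) id
    · exact absurd (hD.row_disjoint hm hx h1) id
  have hrow0 : ∀ m, m ≠ l₀ → m ≠ s → ∀ x ∈ cell D v₀ m, x ∈ cell D q l₀ ∨ x ∈ cell D r l₀ := by
    intro m hm hm' x hx
    rcases cover x with h1 | h1 | h1 | h1
    · exact absurd (hD.row_disjoint hm hx h1) id
    · exact absurd (hD.row_disjoint hm' hx h1) id
    · exact Or.inl h1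
    · exact Or.inr h1
  have hql : cell D q l = cell D r l₀ := by
    refine (hq l hl0 hls).resolve_left fun e => ?_
    obtain ⟨x, hx⟩ := pt r l
    rcases hrow l hl0 hls x hx with h1 | h1
    · exact hD.col_disjoint hrp hx (by rw [hpl]; exact h1)
    · exact hD.col_disjoint hrq hx (by rw [e]; exact h1)
  have hql' : cell D q l' = cell D v₀ s := by
    refine (hq l' hl'0 hl's).resolve_right fun e => ?_
    obtain ⟨x, hx⟩ := pt q l
    exact hD.row_disjoint hll' hx (by rw [e, ← hql]; exact hx)
  have hrl : cell D r l = cell D v₀ s := by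
    refine (hD.cell r l).eq_of_subset (hD.cell v₀ s) fun x hx => ?_
    rcases hrow l hl0 hls x hx with h1 | h1
    · exact absurd (hD.col_disjoint hrp hx (by rw [hpl]; exact h1)) id
    · exact h1
  have hrl' : cell D r l' = cell D v₀ l₀ := by
    refine (hD.cell r l').eq_of_subset (hD.cell v₀ l₀) fun x hx => ?_
    rcases hrow l' hl'0 hl's x hx with h1 | h1
    · exact h1
    · exact absurd (hD.col_disjoint hrq hx (by rw [hql']; exact h1)) id
  have h0l : cell D v₀ l = cell D q l₀ := by
    refine (hD.cell v₀ l).eq_of_subset (hD.cell q l₀) fun x hx => ?_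
    rcases hrow0 l hl0 hls x hx with h1 | h1
    · exact h1
    · exact absurd (hD.col_disjoint hq0 (by rw [hql]; exact h1) hx) id
  have h0l' : cell D v₀ l' = cell D r l₀ := by
    refine (hD.cell v₀ l').eq_of_subset (hD.cell r l₀) fun x hx => ?_
    rcases hrow0 l' hl'0 hl's x hx with h1 | h1
    · exact absurd (hD.col_disjoint hp0 (by rw [hpl']; exact h1) hx) id
    · exact h1
  obtain ⟨w, hw1, hw2, hw3, hall⟩ := exists_fourth h.ne.symm hl0.symm hls.symm
  have hlast : ∀ k, k = l₀ ∨ k = s ∨ k = l ∨ k = l' := by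
    have : l' = w := by
      rcases hall l' with h | h | h | h
      · exact absurd h hl'0
      · exact absurd h hl's
      · exact absurd h.symm hll'
      · exact h
    rw [this]; exact hall
  have hvall : ∀ v, v = v₀ ∨ v = p ∨ v = q ∨ v = r := by
    obtain ⟨e, -, -, -, he⟩ := exists_fourth hp0.symm hq0.symm hpq
    intro v
    have : r = e := by
      rcases he r with h | h | h | h
      · exact absurd h hr0
      · exact absurd h hrp
      · exact absurd h hrq
      · exact h
    rw [this]; exact he v
  have mk : ∀ v a b c d, (a ≠ b ∧ a ≠ c ∧ a ≠ d ∧ b ≠ c ∧ b ≠ d ∧ c ≠ d) →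
      cell D v l₀ = cell D v₀ a → cell D v s = cell D v₀ b → cell D v l = cell D v₀ c →
      cell D v l' = cell D v₀ d → IsAct none (layer D v₀) (layer D v) := by
    intro v a b c d hd e1 e2 e3 e4
    refine (hD.layer v₀).isAct_none (injective_of_table h.ne.symm hl0.symm hls.symm hd) fun k => ?_
    rcases hlast k with rfl | rfl | rfl | rfl
    · rw [if_pos rfl]; exact e1
    · rw [if_neg h.ne, if_pos rfl]; exact e2
    · rw [if_neg hl0, if_neg hls, if_pos rfl]; exact e3
    · rw [if_neg hl'0, if_neg hl's, if_neg hll'.symm]; exact e4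
  refine isSplit_of_base (l₀ := v₀) hD (j := none) fun v => ?_
  have hne' := h.ne
  rcases hvall v with rfl | rfl | rfl | rfl
  · exact IsAct.refl (hD.layer v) none
  · exact mk v s l' l₀ l (by tauto) hpB (hpD.trans h0l'.symm) hpl (hpl'.trans h0l.symm)
  · exact mk v l l₀ l' s (by tauto) h0l.symm hqA (hql.trans h0l'.symm) hql'
  · exact mk v l' l s l₀ (by tauto) h0l'.symm (hrE.trans h0l.symm) hrl hrl'

theorem eq_or_eq_of_conn {A E X : Set (ι → Fin 4)} (hA : IsCode A) (hE : IsCode E)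
    (hd : ∀ x ∈ A, x ∉ E) (hc : ∀ x y, dbl A E x = 0 → dbl A E y = 0 → Conn (dbl A E) Set.univ x y)
    (hX : IsCode X) (hs : ∀ x ∈ X, x ∈ A ∨ x ∈ E) : X = A ∨ X = E := by
  have hB := balF_dbl hA hE hd
  obtain ⟨i₀⟩ := ‹Nonempty ι›
  have ha := hA.gr_mem i₀ fun _ => 0
  set a : ι → Fin 4 := Function.update (fun _ => 0) i₀ (gr A i₀ fun _ => 0)
  have h0 : dbl A E a = 0 := dbl_eq_zero.2 (Or.inl ha)
  by_cases hx : a ∈ X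
  · left
    exact hX.eq_of_conn hB hA (fun x h => dbl_eq_zero.2 (hs x h)) (fun x h => dbl_eq_zero.2 (Or.inl h)) hc h0
      (by simp [hx, ha])
  · right
    exact hX.eq_of_conn hB hE (fun x h => dbl_eq_zero.2 (hs x h)) (fun x h => dbl_eq_zero.2 (Or.inr h)) hc h0
      (by simp [hx, hd a ha])

/-- The case where both columns contain the partner code. -/
theorem Arr.of_partners (h : Arr D F v₀ l₀ s) (hns : ¬ IsSplit (layer D v₀)) {p q : Fin 4}
    (hpB : cell D p l₀ = cell D v₀ s) (hqA : cell D q s = cell D v₀ l₀) : Semi D ∨ IsSplit D := by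
  have hD := h.code
  by_cases hpq : p = q
  · subst hpq; exact Or.inl (h.semi_of_cells hpB hqA)
  obtain ⟨i₀⟩ := ‹Nonempty ι›
  have hne : Nonempty ι := ⟨i₀⟩
  have pt : ∀ v l, ∃ x, x ∈ cell D v l := fun v l => ⟨_, (hD.cell v l).gr_mem i₀ fun _ => 0⟩
  have hp0 : p ≠ v₀ := by
    rintro rfl
    obtain ⟨x, hx⟩ := pt p l₀
    exact hD.row_disjoint h.ne (by rw [← hpB]; exact hx) hx
  have hq0 : q ≠ v₀ := by
    rintro rfl
    obtain ⟨x, hx⟩ := pt q s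
    exact hD.row_disjoint h.ne hx (by rw [← hqA]; exact hx)
  obtain ⟨r, hr0, hrp, hrq, hvall⟩ := exists_fourth hp0.symm hq0.symm hpq
  have hE1 : ∀ x ∈ cell D q l₀, F (cons l₀ x) = 1 := fun x hx =>
    h.lev_one (fun h' => hD.col_disjoint hq0 hx h')
      (fun h' => hD.col_disjoint hpq (by rw [hpB]; exact h') hx)
  have hD1 : ∀ x ∈ cell D r l₀, F (cons l₀ x) = 1 := fun x hx =>
    h.lev_one (fun h' => hD.col_disjoint hr0 hx h')
      (fun h' => hD.col_disjoint hrp hx (by rw [hpB]; exact h'))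
  have cov : ∀ x, F (cons l₀ x) = 1 → x ∈ cell D q l₀ ∨ x ∈ cell D r l₀ := by
    intro x hx
    have h0 : F (cons l₀ x) ≠ 0 := by rw [hx]; decide
    obtain ⟨v, hv⟩ := hD.col_exists l₀ x
    rcases hvall v with rfl | rfl | rfl | rfl
    · exact absurd (h.mem_or.1 (Or.inl hv)) h0
    · exact absurd (h.mem_or.1 (Or.inr (hpB ▸ hv))) h0
    · exact Or.inl hv
    · exact Or.inr hv
  have hrE : cell D r s = cell D q l₀ := by
    refine (hD.cell r s).eq_of_subset (hD.cell q l₀) fun x hx => ?_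
    refine (cov x (h.lev_one (fun h' => hD.col_disjoint hrq hx (by rw [hqA]; exact h'))
      (fun h' => hD.col_disjoint hr0 hx h'))).resolve_right fun h' => hD.row_disjoint h.ne hx h'
  have hpD : cell D p s = cell D r l₀ := by
    refine (hD.cell p s).eq_of_subset (hD.cell r l₀) fun x hx => ?_
    refine (cov x (h.lev_one (fun h' => hD.col_disjoint hpq hx (by rw [hqA]; exact h'))
      (fun h' => hD.col_disjoint hp0 hx h'))).resolve_left fun h' =>
        hD.col_disjoint hrp (by rw [hrE]; exact h') hx
  have hDcompl : cell D r l₀ = {x | F (cons l₀ x) = 1 ∧ x ∉ cell D q l₀} := by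
    ext x
    exact ⟨fun hx => ⟨hD1 x hx, fun h' => hD.col_disjoint hrq hx h'⟩,
      fun hx => (cov x hx.1).resolve_left hx.2⟩
  have hlin := h.lin.layer l₀
  have hED : ∀ j, IsAct j (cell D q l₀) (cell D r l₀) := fun j => by
    rw [hDcompl]; exact hlin.isAct_compl (hD.cell q l₀) hE1 j
  have fin : ∀ j, IsAct j (cell D v₀ l₀) (cell D q l₀) → Semi D ∨ IsSplit D := by
    intro j hj
    have hB := h.isAct_partner j
    have hr := hj.trans h.rigid.code (hED j)
    refine h.of_isAct hns (j := j) (fun v => ?_) (fun v => ?_)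
    · rcases hvall v with rfl | rfl | rfl | rfl
      · exact IsAct.refl h.rigid.code j
      · rw [hpB]; exact hB
      · exact hj
      · exact hr
    · rcases hvall v with rfl | rfl | rfl | rfl
      · exact hB
      · rw [hpD]; exact hr
      · rw [hqA]; exact IsAct.refl h.rigid.code j
      · rw [hrE]; exact hj
  -- If one of the two unions is disconnected, rigidity supplies an image in one coordinate, the
  -- case of `Arr.of_isAct`. If both are connected, a code inside a union is one of its two parts
  -- and the array can be filled in.
  rcases h.rigid.conn_dbl _ (hD.cell q l₀) hE1 with hc1 | ⟨j, f, hf, -, e⟩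
  · rcases h.rigid'.conn_dbl _ (hD.cell r l₀) (fun x hx => by
      rw [show F (cons s x) = F (cons l₀ x) from congrFun h.cons_eq x]; exact hD1 x hx) with hc2 | ⟨j, f, hf, -, e⟩
    · right
      have hAE := fun X hX => eq_or_eq_of_conn (X := X) (hD.cell v₀ l₀) (hD.cell q l₀)
        (fun x h1 h2 => hD.col_disjoint hq0 h2 h1) hc1 hX
      have hBD := fun X hX => eq_or_eq_of_conn (X := X) (hD.cell v₀ s) (hD.cell r l₀)
        (fun x h1 h2 => hD.col_disjoint hrp h2 (by rw [hpB]; exact h1)) hc2 hX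
      obtain ⟨l, l', hll', hl1, hl2, hl3, hl4, -⟩ := exists_others h.ne.symm
      have hsub : ∀ m, m ≠ l₀ → m ≠ s → ∀ x ∈ cell D p m, x ∈ cell D v₀ l₀ ∨ x ∈ cell D q l₀ := by
        intro m hm hm' x hx
        by_cases h0 : F (cons l₀ x) = 0
        · rcases h.mem_or.2 h0 with h1 | h1
          · exact Or.inl h1
          · exact absurd (hD.row_disjoint hm hx (by rw [hpB]; exact h1)) id
        · rcases cov x (ZMod.two_eq_add_one h0) with h1 | h1
          · exact Or.inr h1
          · exact absurd (hD.row_disjoint hm' hx (by rw [hpD]; exact h1)) id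
      rcases hAE _ (hD.cell p l) (hsub l hl1 hl2) with e | e
      · exact h.split_of_conn hp0 hq0 hpq hr0 hrp hrq hpB hqA hrE hpD hAE hBD hl1 hl2 hl3 hl4 hll' e
      · refine h.split_of_conn hp0 hq0 hpq hr0 hrp hrq hpB hqA hrE hpD hAE hBD hl3 hl4 hl1 hl2 hll'.symm
          ((hAE _ (hD.cell p l') (hsub l' hl3 hl4)).resolve_right fun e' => ?_)
        obtain ⟨x, hx⟩ := pt p l
        exact hD.row_disjoint hll' hx (by rw [e', ← e]; exact hx)
    · have hBr : IsAct j (cell D v₀ s) (cell D r l₀) := ⟨_, hf.pairSwap_injective, e⟩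
      exact fin j (((h.isAct_partner j).trans h.rigid.code hBr).trans h.rigid.code
        ((hED j).symm (hD.cell q l₀)))
  · exact fin j ⟨_, hf.pairSwap_injective, e⟩

/-- The permutations describing a split column without the partner code. -/
theorem Arr.exists_perms (h : Arr D F v₀ l₀ s) {j : ι}
    (hA : ∀ v, IsAct j (cell D v₀ l₀) (cell D v l₀)) (hnp : ∀ p, cell D p l₀ ≠ cell D v₀ s) :
    ∃ α : Fin 4 → Fin 4 → Fin 4, (∀ v, Function.Injective (α v)) ∧
      (∀ v, cell D v l₀ = act j (α v) (cell D v₀ l₀)) ∧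
      ∀ a b c, a ≠ v₀ → b ≠ v₀ → c ≠ v₀ → a ≠ b → a ≠ c → b ≠ c →
        LatinTriple (lab (fun x => F (cons l₀ x)) j) (α a) (α b) (α c) := by
  choose α hα eα using hA
  have hAc := h.rigid.code
  obtain ⟨i, hi⟩ := h.rigid.inhabited j
  have hne : ∀ v w, v ≠ w → ∀ t, α v t ≠ α w t := fun v w hvw t =>
    hAc.act_ne hi (fun x hx hx' => h.code.col_disjoint hvw (by rw [eα v]; exact hx) (by rw [eα w]; exact hx')) t
  have hα0 : α v₀ = id := hAc.act_injective hi ((eα v₀).symm.trans hAc.act_id.symm)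
  have hne0 : ∀ v, v ≠ v₀ → ∀ t, α v t ≠ t := fun v hv t => by
    have := hne v v₀ hv t; rwa [hα0] at this
  have hsw : ∀ v, α v ≠ pairSwap (lab (fun x => F (cons l₀ x)) j) := fun v e =>
    hnp v (by rw [eα v, e, h.cell_partner_eq j])
  exact ⟨α, hα, eα, fun a b c ha hb hc hab hac hbc => ⟨⟨hα a, hα b, hα c⟩, fun t =>
    ⟨hne0 a ha t, hne0 b hb t, hne0 c hc t, hne a b hab t, hne a c hac t, hne b c hbc t⟩, hsw a, hsw b, hsw c⟩⟩

/-- The case where the column of `l₀` contains the partner code and the other column is split. -/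
theorem Arr.of_partner_split (h : Arr D F v₀ l₀ s) (hns : ¬ IsSplit (layer D v₀)) {p : Fin 4}
    (hpB : cell D p l₀ = cell D v₀ s) (hnA : ∀ q, cell D q s ≠ cell D v₀ l₀) {j : ι}
    (hB : ∀ v, IsAct j (cell D v₀ s) (cell D v s)) : Semi D ∨ IsSplit D := by
  have hD := h.code
  obtain ⟨i, hi⟩ := h.rigid.inhabited j
  have pt : ∀ v l, ∃ x, x ∈ cell D v l := fun v l => ⟨_, (hD.cell v l).gr_mem i fun _ => 0⟩
  have hp0 : p ≠ v₀ := by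
    rintro rfl
    obtain ⟨x, hx⟩ := pt p l₀
    exact hD.row_disjoint h.ne (by rw [← hpB]; exact hx) hx
  obtain ⟨q, r, hqr, hq0, hqp, hr0, hrp, hvall⟩ := exists_others hp0.symm
  obtain ⟨β, hβ, eβ, hlat⟩ := h.symm.exists_perms hB hnA
  have lat := hlat p q r hp0 hq0 hr0 hqp.symm hrp.symm hqr
  rw [h.cons_eq] at lat
  set f := lab (fun x => F (cons l₀ x)) j with hfdef
  have hf : Bal f := (h.lin.layer l₀).bal_lab j
  have hlin := h.lin.layer l₀
  have hBc := hD.cell v₀ s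
  have hBsub : ∀ x ∈ cell D v₀ s, F (cons l₀ x) = 0 := fun x hx => h.mem_or.1 (Or.inr hx)
  have hFx : ∀ x, F (cons l₀ x) = f (gr (cell D v₀ s) j x) + f (x j) := fun x =>
    hlin.eq_lab hBc hBsub j x
  have cov : ∀ x, F (cons l₀ x) = 1 ↔ x ∈ cell D q l₀ ∨ x ∈ cell D r l₀ := by
    intro x
    constructor
    · intro hx
      have h0 : F (cons l₀ x) ≠ 0 := by rw [hx]; decide
      obtain ⟨v, hv⟩ := hD.col_exists l₀ x
      rcases hvall v with rfl | rfl | rfl | rfl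
      · exact absurd (h.mem_or.1 (Or.inl hv)) h0
      · exact absurd (h.mem_or.1 (Or.inr (hpB ▸ hv))) h0
      · exact Or.inl hv
      · exact Or.inr hv
    · rintro (hx | hx)
      · exact h.lev_one (fun h' => hD.col_disjoint hq0 hx h')
          (fun h' => hD.col_disjoint hqp hx (by rw [hpB]; exact h'))
      · exact h.lev_one (fun h' => hD.col_disjoint hr0 hx h')
          (fun h' => hD.col_disjoint hrp hx (by rw [hpB]; exact h'))
  -- If `β q` is the involution of a label transversal to `f`, the cell `(q, s)` lies on the
  -- opposite level. Complements inside that level then give the cells `(q, l₀)` and `(r, l₀)`, and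
  -- the column of `l₀` is also split in `j`.
  have sw : ∀ q r, q ≠ r → q ≠ p → q ≠ v₀ → r ≠ v₀ → (∀ v, v = v₀ ∨ v = p ∨ v = q ∨ v = r) →
      (∀ x, F (cons l₀ x) = 1 ↔ x ∈ cell D q l₀ ∨ x ∈ cell D r l₀) →
      (∃ f', Bal f' ∧ ¬ SameLab f' f ∧ β q = pairSwap f') → Semi D ∨ IsSplit D := by
    rintro q r hqr hqp hq0 hr0 hvall cov ⟨f', hf', hl, hq⟩
    have hX1 : ∀ x ∈ cell D q s, F (cons l₀ x) = 1 := by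
      intro x hx
      rw [eβ q, mem_act, hq] at hx
      rw [hFx, hx]
      have := apply_pairSwap_ne hf' hf hl (x j)
      revert this
      generalize f _ = a; generalize f _ = b; revert a b; decide
    have hE : cell D q l₀ = {x | F (cons l₀ x) = 1 ∧ x ∉ cell D q s} :=
      (hD.cell q l₀).eq_of_subset ((hD.cell q s).compl hlin.1 hX1) fun x hx =>
        ⟨(cov x).2 (Or.inl hx), fun h' => hD.row_disjoint h.ne h' hx⟩
    have hr : cell D r l₀ = {x | F (cons l₀ x) = 1 ∧ x ∉ cell D q l₀} := by
      ext x
      exact ⟨fun hx => ⟨(cov x).2 (Or.inr hx), fun h' => hD.col_disjoint hqr h' hx⟩,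
        fun hx => ((cov x).1 hx.1).resolve_left hx.2⟩
    have a1 : IsAct j (cell D v₀ l₀) (cell D v₀ s) := h.isAct_partner j
    have a2 : IsAct j (cell D v₀ l₀) (cell D q l₀) := by
      rw [hE]
      exact (a1.trans h.rigid.code (hB q)).trans h.rigid.code (hlin.isAct_compl (hD.cell q s) hX1 j)
    have a3 : IsAct j (cell D v₀ l₀) (cell D r l₀) := by
      rw [hr]
      exact a2.trans h.rigid.code (hlin.isAct_compl (hD.cell q l₀) (fun x hx => (cov x).2 (Or.inl hx)) j)
    refine h.of_isAct hns (j := j) (fun v => ?_) (fun v => a1.trans h.rigid.code (hB v))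
    rcases hvall v with rfl | rfl | rfl | rfl
    · exact IsAct.refl h.rigid.code j
    · rw [hpB]; exact a1
    · exact a2
    · exact a3
  rcases lat.swap_or_slice hf with (hq | hr) | ⟨t, ht⟩
  · exact sw q r hqr hqp hq0 hr0 hvall cov hq
  · exact sw r q hqr.symm hrp hr0 hq0 (fun v => by have := hvall v; tauto)
      (fun x => by rw [cov x, or_comm]) hr
  -- Over the value `t` the cell `(q, l₀)` has no position left: each one belongs to `(q, s)`, or a
  -- move to `t'` produces a point in both `(r, l₀)` and `(r, s)`.
  · exfalso
    obtain ⟨x, hx, hxt⟩ := (hD.cell q l₀).exists_mem hi t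
    have h1 := (cov x).2 (Or.inl hx)
    have hlev : ∀ y, F (cons l₀ y) = 1 ↔ f (gr (cell D v₀ s) j y) ≠ f (y j) := by
      intro y; rw [hFx]
      generalize f _ = a; generalize f _ = b; revert a b; decide
    rw [hlev, hxt] at h1
    rcases ht _ h1 with h2 | ⟨t', htt', h2, h3⟩
    · exact hD.row_disjoint h.ne (by rw [eβ q, mem_act, hxt]; exact h2) hx
    · have h4 : F (cons l₀ (Function.update x j t')) = 1 := by
        rw [hlev]; simpa using h2
      rcases (cov _).1 h4 with h5 | h5
      · have := (hD.cell q l₀ x j).unique h5 (y₂ := x j) (by simpa using hx)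
        exact htt' (this.trans hxt)
      · exact hD.row_disjoint h.ne (by rw [eβ r, mem_act]; simpa using h3) h5

/-- Two columns split in different coordinates `j` and `j'` cannot coexist. Disjointness of the two
cells in row `q` makes an involution action on `A` in `j` agree with one in `j'` over half of the
values of `x j'`, then over the other half, which `Rigid.false_of_double` forbids. -/
theorem Arr.of_splits (h : Arr D F v₀ l₀ s) (hns : ¬ IsSplit (layer D v₀))
    (hnB : ∀ p, cell D p l₀ ≠ cell D v₀ s) (hnA : ∀ q, cell D q s ≠ cell D v₀ l₀) {j j' : ι}
    (hA : ∀ v, IsAct j (cell D v₀ l₀) (cell D v l₀)) (hB : ∀ v, IsAct j' (cell D v₀ s) (cell D v s)) :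
    Semi D ∨ IsSplit D := by
  have hD := h.code
  by_cases hjj : j = j'
  · subst hjj
    exact h.of_isAct hns hA fun v => (h.isAct_partner j).trans h.rigid.code (hB v)
  exfalso
  obtain ⟨α, hα, eα, hlat⟩ := h.exists_perms hA hnB
  obtain ⟨β, hβ, eβ, hlat'⟩ := h.symm.exists_perms hB hnA
  rw [h.cons_eq] at hlat'
  have hlin := h.lin.layer l₀
  have hf : Bal (lab (fun x => F (cons l₀ x)) j) := hlin.bal_lab j
  have hf' : Bal (lab (fun x => F (cons l₀ x)) j') := hlin.bal_lab j'
  set f := lab (fun x => F (cons l₀ x)) j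
  set f' := lab (fun x => F (cons l₀ x)) j'
  set A := cell D v₀ l₀ with hAdef
  have hAc : IsCode A := h.rigid.code
  obtain ⟨q, hq0, f₁, hf₁, hl₁, hq⟩ : ∃ q, q ≠ v₀ ∧ ∃ f₁, Bal f₁ ∧ ¬ SameLab f₁ f ∧ α q = pairSwap f₁ := by
    have : ∃ a b c : Fin 4, a ≠ v₀ ∧ b ≠ v₀ ∧ c ≠ v₀ ∧ a ≠ b ∧ a ≠ c ∧ b ≠ c := by
      clear_value A; clear * -; revert v₀; decide
    obtain ⟨a, b, c, ha, hb, hc, hab, hac, hbc⟩ := this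
    obtain ⟨f₁, h1, h2, h3 | h3 | h3⟩ := (hlat a b c ha hb hc hab hac hbc).exists_swap hf
    · exact ⟨a, ha, f₁, h1, h2, h3⟩
    · exact ⟨b, hb, f₁, h1, h2, h3⟩
    · exact ⟨c, hc, f₁, h1, h2, h3⟩
  obtain ⟨f₃, hf₃, hhalf⟩ : ∃ f₃, Bal f₃ ∧ ∀ t, pairSwap f' (β q t) = pairSwap f₃ t ∨
      pairSwap f' (β q (pairSwap f' t)) = pairSwap f₃ (pairSwap f' t) := by
    have : ∃ b c : Fin 4, b ≠ v₀ ∧ c ≠ v₀ ∧ q ≠ b ∧ q ≠ c ∧ b ≠ c := by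
      clear_value A; clear * - hq0; revert v₀ q; decide
    obtain ⟨b, c, hb, hc, hab, hac, hbc⟩ := this
    exact (hlat' q b c hq0 hb hc hab hac hbc).exists_half hf'
  obtain ⟨f₂, hf₂, hl₂, h12⟩ := exists_third_label hf hf₁ hl₁
  have hBA := h.cell_partner_eq j'
  have hgrB : ∀ x, gr (cell D v₀ s) j' x = pairSwap f' (gr A j' x) := by
    intro x
    have := hAc.apply_gr_act (j := j') hf'.pairSwap_injective x
    rw [← hBA] at this
    rw [← this, hf'.pairSwap_pairSwap]
  have hFx : ∀ x, F (cons l₀ x) = f (gr A j x) + f (x j) := fun x => hlin.eq_lab hAc h.rigid.sub j x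
  have hFx' : ∀ x, F (cons l₀ x) = f' (gr A j' x) + f' (x j') := fun x => hlin.eq_lab hAc h.rigid.sub j' x
  have hdis : ∀ x, gr A j x = pairSwap f₁ (x j) → gr A j' x ≠ pairSwap f' (β q (x j')) := by
    intro x h1 h2
    refine hD.row_disjoint (x := x) (v := q) h.ne.symm ?_ ?_
    · rw [eα q, mem_act, hq, h1]
    · rw [eβ q, mem_act, hgrB, h2, hf'.pairSwap_pairSwap]
  -- the two codes agree over half of the values of `x j'`
  have hne12 : ∀ t g, f g ≠ f t → g ≠ pairSwap f₁ t → g = pairSwap f₂ t := by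
    intro t g h1 h2
    rw [← h12]
    have h3 := apply_pairSwap_ne hf₁ hf hl₁ t
    exact hf.eq_pairSwap (ZMod.two_eq_of_ne h1 h3) h2
  have half : ∀ x, pairSwap f' (β q (x j')) = pairSwap f₃ (x j') → gr A j' x = pairSwap f₃ (x j') →
      gr A j x = pairSwap f₂ (x j) := by
    intro x hx h1
    have h2 : gr A j x ≠ pairSwap f₁ (x j) := fun h2 => hdis x h2 (h1.trans hx.symm)
    refine hne12 _ _ (fun e => ?_) h2
    have h0 : F (cons l₀ x) = 0 := by
      rw [hFx, e]; generalize f (x j) = c; revert c; decide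
    rw [hFx', h1] at h0
    have h3 : f' (pairSwap f₃ (x j')) = f' (x j') := by
      revert h0; generalize f' _ = a; generalize f' _ = b; revert a b; decide
    -- then `β q` fixes a point or is the forbidden swap there
    rcases hf'.eq_or_eq_pairSwap h3 with h4 | h4
    · exact hf₃.pairSwap_ne _ h4
    · rw [← hx] at h4
      have h5 := hf'.pairSwap_injective h4
      have : ∃ b c : Fin 4, b ≠ v₀ ∧ c ≠ v₀ ∧ q ≠ b ∧ q ≠ c ∧ b ≠ c := by
        clear_value A; clear * - hq0; revert v₀ q; decide
      obtain ⟨b, c, hb, hc, hab, hac, hbc⟩ := this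
      exact ((hlat' q b c hq0 hb hc hab hac hbc).ne (x j')).1 h5
  obtain ⟨k, hk, -⟩ := h.rigid.third j' j'
  have half' : ∀ x, pairSwap f' (β q (x j')) = pairSwap f₃ (x j') → gr A j x = pairSwap f₂ (x j) →
      gr A j' x = pairSwap f₃ (x j') := by
    intro x hx h1
    have c3 := hAc.act (j := j') hf₃.pairSwap_injective
    have c2 := hAc.act (j := j) hf₂.pairSwap_injective
    have hp := c3.gr_mem k x
    set r := gr (act j' (pairSwap f₃) A) k x
    have hpj : Function.update x k r j' = x j' := Function.update_of_ne hk.symm _ _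
    have h2 := half _ (by rw [hpj]; exact hx) hp
    have := (c2 x k).unique h2 (y₂ := x k) (by rw [Function.update_eq_self]; exact h1)
    rw [this, Function.update_eq_self] at hp
    exact hp
  refine h.rigid.false_of_double hjj hf₂ hf₃ hl₂ fun x h1 => ?_
  rcases hhalf (x j') with hx | hx
  · exact half x hx h1
  -- The other half is reached by swapping the coordinate `j'` inside its pair. In direction `j`
  -- this acts on positions as `pairSwap f`, since both swaps produce the partner cell.
  · set x' := Function.update x j' (pairSwap f' (x j')) with hx'
    have hx'j : x' j' = pairSwap f' (x j') := by simp [hx']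
    have hx'j2 : x' j = x j := by rw [hx', Function.update_of_ne hjj]
    -- relation between the positions at `x` and `x'`
    have hrel : gr A j x' = pairSwap f (gr A j x) := by
      have hp := hAc.gr_mem j x
      have e1 : Function.update x' j (gr A j x) ∈ cell D v₀ s := by
        rw [hBA, mem_act, hx', Function.update_comm (Ne.symm hjj), gr_update, Function.update_self,
          hf'.pairSwap_pairSwap, (hAc.mem_iff j').1 hp, Function.update_of_ne (Ne.symm hjj)]
      rw [h.cell_partner_eq j, mem_act, gr_update, Function.update_self] at e1
      exact e1
    have hF1 : F (cons l₀ x') = F (cons l₀ x) := by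
      rw [hx']; exact hlin.update_eq_iff.2 (hf'.apply_pairSwap _)
    have h6 : gr A j' x' = gr A j' x := by rw [hx', gr_update]
    have hcomm : pairSwap f₃ (pairSwap f' (x j')) = pairSwap f' (pairSwap f₃ (x j')) := by
      have key : ∀ f : Fin 4 → ZMod 2, Bal f → ∀ g : Fin 4 → ZMod 2, Bal g → ∀ t,
        pairSwap f (pairSwap g t) = pairSwap g (pairSwap f t) := by decide +kernel
      exact key _ hf₃ _ hf' _
    have h7 : gr A j' x' ≠ pairSwap f₃ (x' j') := by
      rw [h6, h1, hx'j, hcomm]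
      exact (hf'.pairSwap_ne _).symm
    have h8 : gr A j x' ≠ pairSwap f₂ (x' j) := fun e => h7 (half' x' (by rw [hx'j]; exact hx) e)
    have h9 : f (gr A j x') ≠ f (x' j) := by
      intro e
      have h0 : F (cons l₀ x') = 0 := by
        rw [hFx, e]; generalize f (x' j) = c; revert c; decide
      rw [hFx', h6, h1, hx'j, hf'.apply_pairSwap] at h0
      have h3 : f' (pairSwap f₃ (x j')) = f' (x j') := by
        revert h0; generalize f' _ = a; generalize f' _ = b; revert a b; decide
      rcases hf'.eq_or_eq_pairSwap h3 with h4 | h4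
      · exact hf₃.pairSwap_ne _ h4
      · rw [hcomm, h4, hf'.pairSwap_pairSwap] at hx
        have h5 : β q (pairSwap f' (x j')) = pairSwap f' (x j') := by
          rw [← hf'.pairSwap_pairSwap (β q (pairSwap f' (x j'))), hx]
        have : ∃ b c : Fin 4, b ≠ v₀ ∧ c ≠ v₀ ∧ q ≠ b ∧ q ≠ c ∧ b ≠ c := by
          clear_value A; clear * - hq0; revert v₀ q; decide
        obtain ⟨b, c, hb, hc, hab, hac, hbc⟩ := this
        exact ((hlat' q b c hq0 hb hc hab hac hbc).ne _).1 h5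
    rw [hx'j2] at h8 h9
    have h10 : gr A j x' = pairSwap f₁ (x j) := by
      by_contra h10
      exact h8 (hne12 _ _ h9 h10)
    have h11 : pairSwap f (gr A j x) = pairSwap f (pairSwap f₂ (x j)) := by
      rw [← hrel, h10, ← h12, hf.pairSwap_pairSwap]
    exact hf.pairSwap_injective h11

/-- The extension property passes to codes with a rigid layer that are not split. -/
theorem Extends.step {C : Set (Option ι → Fin 4)} (hC : IsCode C) (hF : LinF F) (hCF : ∀ x ∈ C, F x = 0)
    (hns : ¬ IsSplit C) (hA : Rigid (layer C l₀) fun x => F (cons l₀ x))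
    (e1 : Extends (layer C l₀)) (e2 : Extends {x | F (cons l₀ x) = 0 ∧ x ∉ layer C l₀}) : Extends C := by
  intro D hD v₀ hv
  subst hv
  have hb := hF.bal_lab none
  set s := pairSwap (lab F none) l₀ with hs
  have hlab : lab F none s = lab F none l₀ := hb.apply_pairSwap l₀
  have hne : s ≠ l₀ := hb.pairSwap_ne l₀
  have hpart := hF.layer_partner hC hCF hlab hne
  have hR : Rigid (cell D v₀ s) fun x => F (cons s x) := by
    rw [show (fun x => F (cons s x)) = fun x => F (cons l₀ x) from
      funext fun x => hF.cons_eq_iff.2 hlab]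
    have := hA.compl
    rw [← hpart] at this
    exact this
  have h : Arr D F v₀ l₀ s := ⟨hD, hF, hCF, hlab, hne, hA, hR⟩
  -- A semilinear column has, on the cell `(v₀, l₀)`, the same linear function as the row, by
  -- uniqueness; so the complement of that cell occurs in the column.
  have partner : ∀ l₀ s, Arr D F v₀ l₀ s → Semi (glue fun v => cell D v l₀) →
      ∃ p, cell D p l₀ = cell D v₀ s := by
    rintro l₀ s h ⟨G, hG, hGs⟩
    have e := h.rigid.eq_of_sub _ (hG.layer v₀) (fun x hx => hGs _ hx)
    have hb := hG.bal_lab none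
    refine ⟨pairSwap (lab G none) v₀, ?_⟩
    have := hG.layer_partner (hD.col l₀) hGs (hb.apply_pairSwap v₀) (hb.pairSwap_ne v₀)
    have e' : ∀ x, G (cons v₀ x) = F (cons l₀ x) := congrFun e
    simp only [e'] at this
    rw [h.cell_partner]
    exact this
  have spl : ∀ l, IsSplit (glue fun v => cell D v l) → ∃ j, ∀ v, IsAct j (cell D v₀ l) (cell D v l) :=
    fun l ⟨j, hj⟩ => ⟨j, fun v => hj v₀ v⟩
  have c1 : (∃ p, cell D p l₀ = cell D v₀ s) ∨ ∃ j, ∀ v, IsAct j (cell D v₀ l₀) (cell D v l₀) := by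
    rcases e1 _ (hD.col l₀) v₀ rfl with hS | hS
    · exact Or.inl (partner _ _ h hS)
    · exact Or.inr (spl _ hS)
  have c2 : (∃ p, cell D p s = cell D v₀ l₀) ∨ ∃ j, ∀ v, IsAct j (cell D v₀ s) (cell D v s) := by
    rcases e2 _ (hD.col s) v₀ hpart with hS | hS
    · exact Or.inl (partner _ _ h.symm hS)
    · exact Or.inr (spl _ hS)
  by_cases p1 : ∃ p, cell D p l₀ = cell D v₀ s <;> by_cases p2 : ∃ p, cell D p s = cell D v₀ l₀
  · obtain ⟨p, hp⟩ := p1; obtain ⟨q, hq⟩ := p2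
    exact h.of_partners hns hp hq
  · obtain ⟨p, hp⟩ := p1
    obtain ⟨j, hj⟩ := c2.resolve_left p2
    exact h.of_partner_split hns hp (fun q hq => p2 ⟨q, hq⟩) hj
  · obtain ⟨p, hp⟩ := p2
    obtain ⟨j, hj⟩ := c1.resolve_left p1
    exact h.symm.of_partner_split hns hp (fun q hq => p1 ⟨q, hq⟩) hj
  · obtain ⟨j, hj⟩ := c1.resolve_left p1
    obtain ⟨j', hj'⟩ := c2.resolve_left p2
    exact h.of_splits hns (fun q hq => p1 ⟨q, hq⟩) (fun q hq => p2 ⟨q, hq⟩) hj hj'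

end Array

/-! ### Stiff codes. -/

section Stiff
variable {ι κ : Type*} [DecidableEq ι] [DecidableEq κ]

/-- A rigid code with the extension property. -/
def Stiff (A : Set (ι → Fin 4)) : Prop := Extends A ∧ ∃ F, Rigid A F

theorem Stiff.isCode {A : Set (ι → Fin 4)} (h : Stiff A) : IsCode A := h.2.elim fun _ hF => hF.code

theorem Stiff.semi {A : Set (ι → Fin 4)} (h : Stiff A) : Semi A :=
  h.2.elim fun F hF => ⟨F, hF.lin, hF.sub⟩

theorem Stiff.twist {A : Set (ι → Fin 4)} (h : Stiff A) (e : ι ≃ κ) (σ : ι → Equiv.Perm (Fin 4)) :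
    Stiff {x | twist e σ x ∈ A} :=
  ⟨h.1.twist e σ, h.2.elim fun F hF => ⟨_, hF.twist e σ⟩⟩

theorem Stiff.reindex {A : Set (ι → Fin 4)} (h : Stiff A) (e : ι ≃ κ) : Stiff {x : κ → Fin 4 | x ∘ e ∈ A} :=
  h.twist e fun _ => Equiv.refl _

theorem Stiff.act {A : Set (ι → Fin 4)} (h : Stiff A) (j : ι) {α : Fin 4 → Fin 4}
    (hα : Function.Injective α) : Stiff (act j α A) := by
  let s : Equiv.Perm (Fin 4) := Equiv.ofBijective α (Finite.injective_iff_bijective.1 hα)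
  have : _root_.act j α A = _root_.act j s A := rfl
  rw [this, act_eq_twist h.isCode]
  exact h.twist _ _

theorem Stiff.of_isAct {A B : Set (ι → Fin 4)} (h : Stiff A) {j : ι} (hB : IsAct j A B) : Stiff B := by
  obtain ⟨α, hα, rfl⟩ := hB
  exact h.act j hα

/-- The extension property makes a non-split code semilinear. Then `Rigid.step` and `Extends.step`
lift both halves of stiffness; the latter also needs the complementary layer, which is an image of
the given one. -/
theorem Stiff.of_layer [Finite ι] [Nonempty ι] {C : Set (Option ι → Fin 4)} (hC : IsCode C) {v : Fin 4}
    (h : Stiff (layer C v)) : Stiff C ∨ IsSplit C := by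
  by_cases hns : IsSplit C
  · exact Or.inr hns
  have hS := (h.1 C hC v rfl).resolve_right hns
  obtain ⟨F₀, hF₀⟩ := h.2
  obtain ⟨F, hF, rfl⟩ := Rigid.step hC hS hns hF₀
  refine Or.inl ⟨?_, F, hF⟩
  refine Extends.step hC hF.lin hF.sub hns hF₀ h.1 ?_
  obtain ⟨j⟩ := ‹Nonempty ι›
  rw [show {x | F (cons v x) = 0 ∧ x ∉ layer C v} = _ from hF₀.lin.compl_eq_act hF₀.code hF₀.sub j]
  exact (h.act j (hF₀.lin.bal_lab j).pairSwap_injective).1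

end Stiff

/-! ### Three-dimensional codes as bit masks of length 64. -/

section Mask

/-- The place value of a coordinate in the index of a point. -/
def stride : Fin 3 → ℕ := ![16, 4, 1]

/-- The index of a point of the three-dimensional space. -/
def idx (x : Fin 3 → Fin 4) : ℕ := 16 * (x 0).val + 4 * (x 1).val + (x 2).val

/-- The mask of the slice on which a coordinate vanishes. -/
def sliceMask : Fin 3 → ℕ := ![65535, 4222189076152335, 1229782938247303441]

/-- The set with a given bit mask. -/
def maskSet (M : ℕ) : Set (Fin 3 → Fin 4) := {x | M.testBit (idx x) = true}

theorem mem_maskSet {M : ℕ} {x : Fin 3 → Fin 4} : x ∈ maskSet M ↔ M.testBit (idx x) = true := Iff.rfl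

/-- The preimage of a mask under the substitution of `a` into the coordinate `j`. -/
def actMask (j : Fin 3) (a : Fin 4 → Fin 4) (M : ℕ) : ℕ :=
  ((((M >>> (stride j * (a 0).val)) &&& sliceMask j) <<< (stride j * 0)) |||
    (((M >>> (stride j * (a 1).val)) &&& sliceMask j) <<< (stride j * 1))) |||
  ((((M >>> (stride j * (a 2).val)) &&& sliceMask j) <<< (stride j * 2)) |||
    (((M >>> (stride j * (a 3).val)) &&& sliceMask j) <<< (stride j * 3)))

theorem slice_iff : ∀ (j : Fin 3) (x : Fin 3 → Fin 4) (t : Fin 4),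
    ((stride j * t.val ≤ idx x) ∧ (sliceMask j).testBit (idx x - stride j * t.val) = true) ↔ t = x j := by
  decide +kernel

theorem idx_update : ∀ (j : Fin 3) (x : Fin 3 → Fin 4) (s : Fin 4),
    stride j * s.val + (idx x - stride j * (x j).val) = idx (Function.update x j s) := by
  decide +kernel

theorem testBit_slice (j : Fin 3) (M : ℕ) (x : Fin 3 → Fin 4) (t s : Fin 4) :
    (((M >>> (stride j * s.val)) &&& sliceMask j) <<< (stride j * t.val)).testBit (idx x) = true ↔
      t = x j ∧ M.testBit (idx (Function.update x j s)) = true := by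
  rw [Nat.testBit_shiftLeft, Bool.and_eq_true, Nat.testBit_and, Nat.testBit_shiftRight, Bool.and_eq_true,
    decide_eq_true_iff, ← slice_iff j x t]
  constructor
  · rintro ⟨h1, h2, h3⟩
    have ht := (slice_iff j x t).1 ⟨h1, h3⟩
    refine ⟨⟨h1, h3⟩, ?_⟩
    rw [← idx_update, ← ht]; exact h2
  · rintro ⟨⟨h1, h3⟩, h2⟩
    have ht := (slice_iff j x t).1 ⟨h1, h3⟩
    rw [← idx_update, ← ht] at h2
    exact ⟨h1, h2, h3⟩

theorem testBit_actMask (j : Fin 3) (a : Fin 4 → Fin 4) (M : ℕ) (x : Fin 3 → Fin 4) :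
    (actMask j a M).testBit (idx x) = true ↔ M.testBit (idx (Function.update x j (a (x j)))) = true := by
  have h0 := testBit_slice j M x 0 (a 0)
  have h1 := testBit_slice j M x 1 (a 1)
  have h2 := testBit_slice j M x 2 (a 2)
  have h3 := testBit_slice j M x 3 (a 3)
  rw [actMask, Nat.testBit_or, Nat.testBit_or, Nat.testBit_or, Bool.or_eq_true, Bool.or_eq_true,
    Bool.or_eq_true]
  rw [show stride j * 0 = stride j * (0 : Fin 4).val from rfl, show stride j * 1 = stride j * (1 : Fin 4).val from rfl,
    show stride j * 2 = stride j * (2 : Fin 4).val from rfl, show stride j * 3 = stride j * (3 : Fin 4).val from rfl,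
    h0, h1, h2, h3]
  have : ∀ t : Fin 4, t = 0 ∨ t = 1 ∨ t = 2 ∨ t = 3 := by decide
  rcases this (x j) with h | h | h | h <;> simp [h]

theorem maskSet_actMask (j : Fin 3) (a : Fin 4 → Fin 4) {M : ℕ} (hM : IsCode (maskSet M)) :
    maskSet (actMask j a M) = act j a (maskSet M) := by
  ext x
  rw [mem_maskSet, testBit_actMask, mem_act, ← hM.update_mem_iff]; rfl

theorem mem_maskSet_or {M N : ℕ} {x : Fin 3 → Fin 4} : x ∈ maskSet (M ||| N) ↔ x ∈ maskSet M ∨ x ∈ maskSet N := by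
  rw [mem_maskSet, Nat.testBit_or, Bool.or_eq_true]; rfl

theorem mem_maskSet_and {M N : ℕ} {x : Fin 3 → Fin 4} : x ∈ maskSet (M &&& N) ↔ x ∈ maskSet M ∧ x ∈ maskSet N := by
  rw [mem_maskSet, Nat.testBit_and, Bool.and_eq_true]; rfl

theorem exists_idx {i : ℕ} (h : i < 64) : ∃ x : Fin 3 → Fin 4, idx x = i :=
  ⟨![⟨i / 16, by omega⟩, ⟨i / 4 % 4, by omega⟩, ⟨i % 4, by omega⟩], by simp [idx]; omega⟩

theorem idx_lt : ∀ x : Fin 3 → Fin 4, idx x < 64 := by decide +kernel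

/-- Equality of masks, up to irrelevant bits. -/
theorem mod_eq_of_maskSet {M N : ℕ} (h : ∀ x, x ∈ maskSet M ↔ x ∈ maskSet N) : M % 2 ^ 64 = N % 2 ^ 64 := by
  refine Nat.eq_of_testBit_eq fun i => ?_
  rw [Nat.testBit_mod_two_pow, Nat.testBit_mod_two_pow]
  by_cases hi : i < 64
  · obtain ⟨x, rfl⟩ := exists_idx hi
    rw [Bool.eq_iff_iff, Bool.and_eq_true, Bool.and_eq_true]
    exact and_congr_right fun _ => h x
  · simp [hi]

theorem and_mod_of_disjoint {M N : ℕ} (h : ∀ x ∈ maskSet M, x ∉ maskSet N) : (M &&& N) % 2 ^ 64 = 0 := by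
  have := @mod_eq_of_maskSet (M &&& N) 0 fun x => by
    rw [mem_maskSet_and]
    simp only [maskSet, Nat.zero_testBit, Set.mem_ofPred_eq]
    constructor
    · rintro ⟨h1, h2⟩; exact (h x h1 h2).elim
    · intro h; cases h
  simpa using this

/-- The permutations of the alphabet. -/
def permList : List (Fin 4 → Fin 4) :=
  [![0,1,2,3], ![0,1,3,2], ![0,2,1,3], ![0,2,3,1], ![0,3,1,2], ![0,3,2,1],
   ![1,0,2,3], ![1,0,3,2], ![1,2,0,3], ![1,2,3,0], ![1,3,0,2], ![1,3,2,0],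
   ![2,0,1,3], ![2,0,3,1], ![2,1,0,3], ![2,1,3,0], ![2,3,0,1], ![2,3,1,0],
   ![3,0,1,2], ![3,0,2,1], ![3,1,0,2], ![3,1,2,0], ![3,2,0,1], ![3,2,1,0]]

theorem mem_permList {a : Fin 4 → Fin 4} (h : Function.Injective a) : a ∈ permList := by
  have : ∀ p q r s : Fin 4, (p ≠ q ∧ p ≠ r ∧ p ≠ s ∧ q ≠ r ∧ q ≠ s ∧ r ≠ s) → ![p, q, r, s] ∈ permList := by
    decide +kernel
  have e : a = ![a 0, a 1, a 2, a 3] := by ext i; fin_cases i <;> rfl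
  rw [e]
  refine this _ _ _ _ ⟨?_, ?_, ?_, ?_, ?_, ?_⟩ <;> exact fun h' => absurd (h h') (by decide)

/-- The mask of the graph of a permutation. -/
def rowMask (r : Fin 4 → Fin 4) : ℕ :=
  2 ^ (r 0).val ||| 2 ^ (4 + (r 1).val) ||| 2 ^ (8 + (r 2).val) ||| 2 ^ (12 + (r 3).val)

def rowMasks : List ℕ := permList.map rowMask

theorem testBit_rowMask : ∀ r ∈ permList, ∀ b c : Fin 4,
    (rowMask r).testBit (4 * b.val + c.val) = true ↔ c = r b := by
  decide +kernel

theorem rowMask_and : ∀ r ∈ permList, ∀ s ∈ permList, (∀ b, r b ≠ s b) → rowMask r &&& rowMask s = 0 := by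
  decide +kernel

/-- The masks of all codes in three dimensions. -/
def allCodes : List ℕ :=
  rowMasks.flatMap fun p => (rowMasks.filter fun q => q &&& p == 0).flatMap fun q =>
    (rowMasks.filter fun r => r &&& (p ||| q) == 0).flatMap fun r =>
      (rowMasks.filter fun s => s &&& ((p ||| q) ||| r) == 0).map fun s =>
        (p ||| (q <<< 16)) ||| ((r <<< 32) ||| (s <<< 48))

theorem rowMask_lt : ∀ r ∈ permList, rowMask r < 2 ^ 16 := by decide +kernel

/-- A code is the graph of a Latin square. Its rows are four permutations that pairwise differ
everywhere, and the list is built from such rows. -/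
theorem exists_mask {A : Set (Fin 3 → Fin 4)} (hA : IsCode A) : ∃ M ∈ allCodes, A = maskSet M := by
  have inj : ∀ a : Fin 4, Function.Injective fun b : Fin 4 => gr A 2 ![a, b, 0] := by
    intro a
    have h := (hA.gr_bijective (i := 1) (j := 2) (by decide) ![a, 0, 0]).1
    intro b b' hb
    refine h ?_
    have e : ∀ b : Fin 4, Function.update ![a, 0, 0] 1 b = ![a, b, 0] := by
      intro b; ext i; fin_cases i <;> rfl
    simpa only [e] using hb
  have inj' : ∀ b a a' : Fin 4, a ≠ a' → gr A 2 ![a, b, 0] ≠ gr A 2 ![a', b, 0] := by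
    intro b a a' haa hb
    have h := (hA.gr_bijective (i := 0) (j := 2) (by decide) ![0, b, 0]).1
    have e : ∀ a : Fin 4, Function.update ![0, b, 0] 0 a = ![a, b, 0] := by
      intro b; ext i; fin_cases i <;> rfl
    exact haa (h (by simpa only [e] using hb))
  set r : Fin 4 → Fin 4 → Fin 4 := fun a b => gr A 2 ![a, b, 0] with hr
  have hp : ∀ a, r a ∈ permList := fun a => mem_permList (inj a)
  have hm : ∀ a, rowMask (r a) ∈ rowMasks := fun a => List.mem_map_of_mem (hp a)
  have hd : ∀ a a', a ≠ a' → rowMask (r a) &&& rowMask (r a') = 0 := fun a a' h =>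
    rowMask_and _ (hp a) _ (hp a') fun b => inj' b a a' h
  refine ⟨(rowMask (r 0) ||| (rowMask (r 1) <<< 16)) ||| ((rowMask (r 2) <<< 32) ||| (rowMask (r 3) <<< 48)), ?_, ?_⟩
  · simp only [allCodes, List.mem_flatMap, List.mem_filter, List.mem_map, beq_iff_eq]
    refine ⟨_, hm 0, _, ⟨hm 1, hd 1 0 (by decide)⟩, _, ⟨hm 2, ?_⟩, _, ⟨hm 3, ?_⟩, rfl⟩
    · rw [Nat.and_or_distrib_left, hd 2 0 (by decide), hd 2 1 (by decide)]; rfl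
    · rw [Nat.and_or_distrib_left, Nat.and_or_distrib_left, hd 3 0 (by decide), hd 3 1 (by decide),
        hd 3 2 (by decide)]; rfl
  · ext x
    have e : x = ![x 0, x 1, x 2] := by ext i; fin_cases i <;> rfl
    have h1 : x ∈ A ↔ x 2 = r (x 0) (x 1) := by
      rw [hA.mem_iff 2, hr]
      have : gr A 2 x = gr A 2 ![x 0, x 1, 0] := by
        have := gr_update A 2 x 0
        rw [show Function.update x 2 0 = ![x 0, x 1, 0] by ext i; fin_cases i <;> rfl] at this
        exact this.symm
      rw [this]; exact eq_comm
    rw [h1, mem_maskSet]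
    have h2 : idx x = 16 * (x 0).val + (4 * (x 1).val + (x 2).val) := by rw [idx]; ring
    have h3 := (x 1).isLt
    have h4 := (x 2).isLt
    have lo : ∀ a k, 16 ≤ k → (rowMask (r a)).testBit k = false := fun a k hk =>
      Nat.testBit_lt_two_pow ((rowMask_lt _ (hp a)).trans_le (Nat.pow_le_pow_right (by norm_num) hk))
    have hh : ∀ a, (rowMask (r a)).testBit (4 * (x 1).val + (x 2).val) = true ↔ x 2 = r a (x 1) :=
      fun a => testBit_rowMask _ (hp a) _ _
    simp only [Nat.testBit_or, Nat.testBit_shiftLeft, Bool.or_eq_true, Bool.and_eq_true, decide_eq_true_iff, h2]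
    have : ∀ t : Fin 4, t = 0 ∨ t = 1 ∨ t = 2 ∨ t = 3 := by decide
    generalize x 1 = b at *
    generalize x 2 = c at *
    have hk : 4 * b.val + c.val < 16 := by omega
    generalize 4 * b.val + c.val = k at *
    rcases this (x 0) with h | h | h | h <;> rw [h, ← hh] <;>
      simp only [Fin.val_zero, Fin.val_one, Fin.val_two, Fin.isValue, show (3 : Fin 4).val = 3 from rfl]
    · rw [show 16 * 0 + k = k by omega]
      constructor
      · exact fun H => Or.inl (Or.inl H)
      · rintro ((H | H) | (H | H)) <;> first | exact H | omega
    · rw [lo 0 _ (by omega), show 16 * 1 + k - 16 = k by omega]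
      constructor
      · exact fun H => Or.inl (Or.inr ⟨by omega, H⟩)
      · rintro ((H | H) | (H | H)) <;> first | exact H.2 | omega | exact absurd H (by simp)
    · rw [lo 0 _ (by omega), lo 1 _ (by omega), show 16 * 2 + k - 32 = k by omega]
      constructor
      · exact fun H => Or.inr (Or.inl ⟨by omega, H⟩)
      · rintro ((H | H) | (H | H)) <;> first | exact H.2 | omega | exact absurd H (by simp)
    · rw [lo 0 _ (by omega), lo 1 _ (by omega), lo 2 _ (by omega), show 16 * 3 + k - 48 = k by omega]
      constructor
      · exact fun H => Or.inr (Or.inr ⟨by omega, H⟩)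
      · rintro ((H | H) | (H | H)) <;> first | exact H.2 | exact absurd H (by simp)

end Mask

/-! ### Addition modulo four is a stiff code. -/

section Std

theorem mem_balList {f : Fin 4 → ZMod 2} (hf : Bal f) : f ∈ balList := by
  have key : ∀ p q r s : ZMod 2, Bal ![p, q, r, s] → (![p, q, r, s] : Fin 4 → ZMod 2) ∈ balList := by
    decide +kernel
  have e : f = ![f 0, f 1, f 2, f 3] := by ext i; fin_cases i <;> rfl
  rw [e]
  exact key _ _ _ _ (e ▸ hf)

/-- The mask of the code `x₀ + x₁ + x₂ = 0` over the integers modulo four. -/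
def stdMask : ℕ := 5193355312237126785

/-- The mask of the code `x₀ + x₁ + x₂ = 2`. -/
def stdPartner : ℕ := 1317343028684423460

def stdCode : Set (Fin 3 → Fin 4) := maskSet stdMask

theorem stdCode_isCode : IsCode stdCode := by
  have : ∀ (x : Fin 3 → Fin 4) (i : Fin 3), ∃ q, stdMask.testBit (idx (Function.update x i q)) = true ∧
      ∀ q', stdMask.testBit (idx (Function.update x i q')) = true → q' = q := by decide +kernel
  exact this

def par : Fin 4 → ZMod 2 := ![0, 1, 0, 1]

def stdF (x : Fin 3 → Fin 4) : ZMod 2 := par (x 0) + par (x 1) + par (x 2)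

theorem lab_stdF (j : Fin 3) : lab stdF j = par := by
  funext t
  revert j t
  decide +kernel

theorem stdF_lin : LinF stdF := by
  have h : ∀ (x : Fin 3 → Fin 4) (i : Fin 3) (q : Fin 4), stdF (Function.update x i q) = stdF x + par (x i) + par q := by
    decide +kernel
  refine ⟨fun x i => ?_, fun x y i q r => ?_⟩
  · simp only [h]
    have : ∀ c, Bal fun t => c + par t := by decide +kernel
    exact this _
  · simp only [h]
    generalize stdF x = a; generalize stdF y = b; generalize par (x i) = c
    generalize par (y i) = d; generalize par q = u; generalize par r = v
    revert a b c d u v; decide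

theorem stdF_zero : ∀ x : Fin 3 → Fin 4, stdF x = 0 ↔ x ∈ maskSet (stdMask ||| stdPartner) := by
  have : ∀ x : Fin 3 → Fin 4, stdF x = 0 ↔ (stdMask ||| stdPartner).testBit (idx x) = true := by
    decide +kernel
  exact this

/-- The union of the lines in direction `j` meeting the set. -/
def spread (j : Fin 3) (M : ℕ) : ℕ :=
  (actMask j (fun _ => 0) M ||| actMask j (fun _ => 1) M) |||
    (actMask j (fun _ => 2) M ||| actMask j (fun _ => 3) M)

theorem mem_spread {j : Fin 3} {M : ℕ} {x : Fin 3 → Fin 4} (h : x ∈ maskSet (spread j M)) :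
    ∃ t, Function.update x j t ∈ maskSet M := by
  rw [spread, mem_maskSet_or, mem_maskSet_or, mem_maskSet_or, mem_maskSet, mem_maskSet, mem_maskSet,
    mem_maskSet, testBit_actMask, testBit_actMask, testBit_actMask, testBit_actMask] at h
  rcases h with (h | h) | (h | h) <;> exact ⟨_, h⟩

/-- One step of the search for the component of a set of points within `L`. -/
def grow (L R : ℕ) : ℕ := R ||| (L &&& ((spread 0 R ||| spread 1 R) ||| spread 2 R))

def growIter (L : ℕ) : ℕ → ℕ → ℕ
  | 0, R => R
  | n + 1, R => growIter L n (grow L R)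

/-- A flood fill from the highest point of the mask; twelve rounds suffice for all masks tested. -/
def connCheck (L : ℕ) : Bool := decide (Nat.log2 L < 64) && (growIter L 12 (2 ^ Nat.log2 L) == L)

theorem growIter_sound {F : (Fin 3 → Fin 4) → ZMod 2} {L : ℕ} {a : Fin 3 → Fin 4}
    (hL : ∀ x ∈ maskSet L, F x = F a) (n : ℕ) : ∀ R, (∀ x ∈ maskSet R, Conn F Set.univ a x) →
    ∀ x ∈ maskSet (growIter L n R), Conn F Set.univ a x := by
  induction n with
  | zero => exact fun R h => h
  | succ n ih =>
    refine fun R h => ih _ fun x hx => ?_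
    rw [grow, mem_maskSet_or, mem_maskSet_and, mem_maskSet_or, mem_maskSet_or] at hx
    have key : ∀ j, x ∈ maskSet L → x ∈ maskSet (spread j R) → Conn F Set.univ a x := by
      intro j h1 h2
      obtain ⟨t, ht⟩ := mem_spread h2
      have hc := h _ ht
      have := hc.update (i := j) (Set.mem_univ j) (q := x j) (by simp [← hc.level, hL x h1])
      simpa using this
    rcases hx with hx | ⟨h1, (hx | hx) | hx⟩
    · exact h x hx
    all_goals exact key _ h1 hx

theorem idx_injective {x y : Fin 3 → Fin 4} (h : idx x = idx y) : x = y := by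
  have h0 := (x 0).isLt; have h1 := (x 1).isLt; have h2 := (x 2).isLt
  have h0' := (y 0).isLt; have h1' := (y 1).isLt; have h2' := (y 2).isLt
  unfold idx at h
  ext i
  fin_cases i
  · show (x 0).val = (y 0).val; omega
  · show (x 1).val = (y 1).val; omega
  · show (x 2).val = (y 2).val; omega

theorem conn_of_check {F : (Fin 3 → Fin 4) → ZMod 2} {L : ℕ} {c : ZMod 2} (h : connCheck L = true)
    (hL : ∀ x, x ∈ maskSet L ↔ F x = c) (x y : Fin 3 → Fin 4) (hx : F x = c) (hy : F y = c) :
    Conn F Set.univ x y := by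
  rw [connCheck, Bool.and_eq_true, decide_eq_true_iff, beq_iff_eq] at h
  obtain ⟨a, ha⟩ := exists_idx h.1
  have hLne : L ≠ 0 := by
    rintro rfl
    have := (hL x).2 hx
    rw [mem_maskSet, Nat.zero_testBit] at this; cases this
  have haL : F a = c := (hL a).1 (by
    rw [mem_maskSet, ha]; exact Nat.testBit_log2 hLne)
  have := growIter_sound (F := F) (L := L) (a := a) (fun x hx => by rw [haL]; exact (hL x).1 hx) 12
    (2 ^ Nat.log2 L) (fun x hx => by
      rw [mem_maskSet, Nat.testBit_two_pow, decide_eq_true_iff, ← ha] at hx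
      rw [idx_injective hx]; exact Conn.refl _ _ _)
  rw [h.2] at this
  exact (this x ((hL x).2 hx)).symm.trans (this y ((hL y).2 hy))

/-- The mask of the set where `f` composed with the position in direction `j` equals `c`. -/
def levelMask (M : ℕ) (j : Fin 3) (f : Fin 4 → ZMod 2) (c : ZMod 2) : ℕ :=
  ((if f 0 = c then actMask j (fun _ => 0) M else 0) ||| (if f 1 = c then actMask j (fun _ => 1) M else 0)) |||
  ((if f 2 = c then actMask j (fun _ => 2) M else 0) ||| (if f 3 = c then actMask j (fun _ => 3) M else 0))

theorem mem_levelMask {M : ℕ} (hM : IsCode (maskSet M)) {j : Fin 3} {f : Fin 4 → ZMod 2} {c : ZMod 2}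
    {x : Fin 3 → Fin 4} : x ∈ maskSet (levelMask M j f c) ↔ f (gr (maskSet M) j x) = c := by
  have h : ∀ t : Fin 4, x ∈ maskSet (if f t = c then actMask j (fun _ => t) M else 0) ↔
      f t = c ∧ gr (maskSet M) j x = t := by
    intro t
    split_ifs with h
    · rw [mem_maskSet, testBit_actMask, ← mem_maskSet, hM.update_mem_iff]
      simp [h, eq_comm]
    · simp [h, maskSet]
  rw [levelMask, mem_maskSet_or, mem_maskSet_or, mem_maskSet_or, h, h, h, h]
  have : ∀ t : Fin 4, t = 0 ∨ t = 1 ∨ t = 2 ∨ t = 3 := by decide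
  rcases this (gr (maskSet M) j x) with h | h | h | h <;> simp [h]

theorem std_levels : ∀ j : Fin 3, ∀ f ∈ balList, f 0 ≠ f 2 → ∀ c : ZMod 2,
    connCheck (levelMask stdMask j f c) = true := by
  decide +kernel

theorem not_sameLab_par {f : Fin 4 → ZMod 2} (hf : Bal f) : ¬ SameLab f par ↔ f 0 ≠ f 2 := by
  have : ∀ f ∈ balList, (¬ (∀ s t, f s = f t ↔ par s = par t) ↔ f 0 ≠ f 2) := by decide +kernel
  exact this f (mem_balList hf)

def disjCode (M : ℕ) : List ℕ := allCodes.filter fun E => (E &&& M) % 2 ^ 64 == 0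

theorem std_doubles : ∀ E ∈ disjCode (stdMask ||| stdPartner), connCheck (stdMask ||| E) = true ∨
    ∃ j : Fin 3, ∃ f ∈ balList, f 0 ≠ f 2 ∧ E = actMask j (pairSwap f) stdMask := by
  decide +kernel

/-- Exhaustive check of the extension property: the three other layers are pairwise disjoint codes
avoiding the standard one. -/
theorem std_extends : ∀ E ∈ disjCode stdMask, ∀ E' ∈ disjCode stdMask, (E &&& E') % 2 ^ 64 = 0 →
    ∀ E'' ∈ disjCode stdMask, (E &&& E'') % 2 ^ 64 = 0 → (E' &&& E'') % 2 ^ 64 = 0 →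
    E = stdPartner ∨ E' = stdPartner ∨ E'' = stdPartner ∨ ∃ j : Fin 3,
      (∃ a ∈ derangements4, E = actMask j a stdMask) ∧ (∃ a ∈ derangements4, E' = actMask j a stdMask) ∧
      (∃ a ∈ derangements4, E'' = actMask j a stdMask) := by
  decide +kernel

theorem mem_disjCode {A : Set (Fin 3 → Fin 4)} {M : ℕ} (hA : IsCode A) (h : ∀ x ∈ A, x ∉ maskSet M) :
    ∃ E ∈ disjCode M, A = maskSet E := by
  obtain ⟨E, hE, rfl⟩ := exists_mask hA
  exact ⟨E, List.mem_filter.2 ⟨hE, by rw [beq_iff_eq]; exact and_mod_of_disjoint h⟩, rfl⟩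

theorem derangements4_injective : ∀ a ∈ derangements4, Function.Injective a := by
  have : ∀ a ∈ derangements4, ∀ s t, a s = a t → s = t := by decide +kernel
  exact fun a ha s t h => this a ha s t h

theorem stdF_unique {F : (Fin 3 → Fin 4) → ZMod 2} (hF : LinF F) (h : ∀ x ∈ stdCode, F x = 0) : F = stdF := by
  have key : ∀ f ∈ balList, ∀ g ∈ balList, ∀ k ∈ balList, ∀ c : ZMod 2,
      (∀ x : Fin 3 → Fin 4, stdMask.testBit (idx x) = true → c + f (x 0) + g (x 1) + k (x 2) = 0) →
      ∀ p q r, c + f p + g q + k r = par p + par q + par r := by decide +kernel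
  have e : ∀ x, F x = F (fun _ => 0) + lab F 0 0 + lab F 1 0 + lab F 2 0 + lab F 0 (x 0) + lab F 1 (x 1) + lab F 2 (x 2) := by
    intro x
    have e1 : x = Function.update (Function.update (Function.update (fun _ => 0) 0 (x 0)) 1 (x 1)) 2 (x 2) := by
      ext i; fin_cases i <;> rfl
    conv_lhs => rw [e1]
    rw [hF.update, hF.update, hF.update]
    simp [Function.update]
    ring
  have := key _ (mem_balList (hF.bal_lab 0)) _ (mem_balList (hF.bal_lab 1)) _ (mem_balList (hF.bal_lab 2))
    (F (fun _ => 0) + lab F 0 0 + lab F 1 0 + lab F 2 0) (fun x hx => by rw [← e]; exact h x hx)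
  funext x
  rw [e, this]; rfl

theorem std_rigid : Rigid stdCode stdF where
  code := stdCode_isCode
  lin := stdF_lin
  sub x hx := (stdF_zero x).2 (mem_maskSet_or.2 (Or.inl hx))
  third := by decide
  eq_of_sub F' h1 h2 := stdF_unique h1 h2
  conn_gr j f hf hne x y hxy := by
    rw [lab_stdF, not_sameLab_par hf] at hne
    exact conn_of_check (std_levels j f (mem_balList hf) hne _) (fun z => mem_levelMask stdCode_isCode)
      x y rfl hxy.symm
  conn_dbl E hE hEF := by
    obtain ⟨M, hM, rfl⟩ := mem_disjCode hE (M := stdMask ||| stdPartner) fun x hx h => by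
      have := (stdF_zero x).2 h
      rw [hEF x hx] at this; exact absurd this (by decide)
    rcases std_doubles M hM with h | ⟨j, f, hf, h, rfl⟩
    · left
      exact conn_of_check h fun x => by rw [mem_maskSet_or, dbl_eq_zero]; rfl
    · right
      have hf' : Bal f := by
        have : ∀ f ∈ balList, Bal f := by decide +kernel
        exact this f hf
      exact ⟨j, f, hf', by rwa [lab_stdF, not_sameLab_par hf'], maskSet_actMask j _ stdCode_isCode⟩

theorem stdPartner_eq : maskSet stdPartner = {x | stdF x = 0 ∧ x ∉ stdCode} := by
  ext x
  rw [Set.mem_ofPred_eq, stdF_zero, mem_maskSet_or]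
  have : (stdMask &&& stdPartner) = 0 := by decide +kernel
  have h : ¬ (x ∈ maskSet stdMask ∧ x ∈ maskSet stdPartner) := by
    rw [← mem_maskSet_and, this, mem_maskSet, Nat.zero_testBit]; simp
  have e : x ∈ stdCode ↔ x ∈ maskSet stdMask := Iff.rfl
  tauto

theorem std_ext : Extends stdCode := by
  intro C hC v hv
  obtain ⟨a, b, c, hab, hac, hbc, hva, hvb, hvc, hall⟩ : ∃ a b c : Fin 4, a ≠ b ∧ a ≠ c ∧ b ≠ c ∧ v ≠ a ∧ v ≠ b ∧
      v ≠ c ∧ ∀ w, w = v ∨ w = a ∨ w = b ∨ w = c := by clear hv; revert v; decide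
  have cand : ∀ w, v ≠ w → ∃ E ∈ disjCode stdMask, layer C w = maskSet E := fun w hw =>
    mem_disjCode (hC.layer w) fun x hx h => hC.layer_disjoint hw (by rw [hv]; exact h) hx
  obtain ⟨A, hA, eA⟩ := cand a hva
  obtain ⟨B, hB, eB⟩ := cand b hvb
  obtain ⟨D, hD, eD⟩ := cand c hvc
  have dj : ∀ {p q : Fin 4} {M N : ℕ}, p ≠ q → layer C p = maskSet M → layer C q = maskSet N →
      (M &&& N) % 2 ^ 64 = 0 := fun {p q M N} hpq h1 h2 => and_mod_of_disjoint fun x hx hx' =>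
    hC.layer_disjoint hpq (by rw [h1]; exact hx) (by rw [h2]; exact hx')
  have sem : ∀ {p}, v ≠ p → layer C p = maskSet stdPartner → Semi C := fun {p} hp h =>
    semi_of_layer hC stdF_lin hp (by rw [hv]; exact std_rigid.sub) (by rw [h, hv, stdPartner_eq])
  rcases std_extends A hA B hB (dj hab eA eB) D hD (dj hac eA eD) (dj hbc eB eD) with h | h | h | ⟨j, h1, h2, h3⟩
  · exact Or.inl (sem hva (by rw [eA, h]))
  · exact Or.inl (sem hvb (by rw [eB, h]))
  · exact Or.inl (sem hvc (by rw [eD, h]))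
  · right
    have ac : ∀ {w M}, layer C w = maskSet M → (∃ α ∈ derangements4, M = actMask j α stdMask) →
        IsAct j (layer C v) (layer C w) := by
      rintro w M h1 ⟨α, hα, rfl⟩
      exact ⟨α, derangements4_injective α hα, by rw [h1, hv]; exact maskSet_actMask j _ stdCode_isCode⟩
    refine isSplit_of_base (l₀ := v) hC (j := j) fun w => ?_
    rcases hall w with rfl | rfl | rfl | rfl
    · exact IsAct.refl (hC.layer _) j
    · exact ac eA h1
    · exact ac eB h2
    · exact ac eD h3

theorem std_stiff : Stiff stdCode := ⟨std_ext, _, std_rigid⟩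

end Std

/-! ### Faces of a code, and linearity tested on two-dimensional faces. -/

section Face
variable {ι κ : Type*} [DecidableEq ι] [DecidableEq κ]

/-- The restriction of a set to the face through `y` spanned by the coordinates in the range of `e`. -/
def face (C : Set (ι → Fin 4)) (e : κ ↪ ι) (y : ι → Fin 4) : Set (κ → Fin 4) :=
  {x | Function.extend e x y ∈ C}

theorem extend_update (e : κ ↪ ι) (x : κ → Fin 4) (y : ι → Fin 4) (k : κ) (q : Fin 4) :
    Function.extend e (Function.update x k q) y = Function.update (Function.extend e x y) (e k) q := by
  funext i
  by_cases h : ∃ k', e k' = i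
  · obtain ⟨k', rfl⟩ := h
    rw [e.injective.extend_apply]
    by_cases hk : k' = k
    · subst hk; simp
    · rw [Function.update_of_ne hk, Function.update_of_ne (fun h => hk (e.injective h)), e.injective.extend_apply]
  · rw [Function.extend_apply' _ _ _ h, Function.update_of_ne, Function.extend_apply' _ _ _ h]
    rintro rfl; exact h ⟨k, rfl⟩

theorem extend_comp_self (e : κ ↪ ι) (y : ι → Fin 4) : Function.extend e (y ∘ e) y = y := by
  funext i
  by_cases h : ∃ k', e k' = i
  · obtain ⟨k', rfl⟩ := h
    rw [e.injective.extend_apply]; rfl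
  · rw [Function.extend_apply' _ _ _ h]

theorem IsCode.face {C : Set (ι → Fin 4)} (hC : IsCode C) (e : κ ↪ ι) (y : ι → Fin 4) :
    IsCode (face C e y) := by
  intro x k
  have := hC (Function.extend e x y) (e k)
  simpa only [_root_.face, Set.mem_ofPred_eq, extend_update] using this

theorem gr_face (C : Set (ι → Fin 4)) (e : κ ↪ ι) (y : ι → Fin 4) (k : κ) (x : κ → Fin 4) :
    gr (face C e y) k x = gr C (e k) (Function.extend e x y) := by
  simp only [gr, face, Set.mem_ofPred_eq, extend_update]

theorem linF_of_squares [Finite ι] {F : (ι → Fin 4) → ZMod 2} (hF : BalF F)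
    (h : ∀ x i j, i ≠ j → ∀ q r s, F (Function.update (Function.update x j s) i q) +
      F (Function.update (Function.update x j s) i r) = F (Function.update x i q) + F (Function.update x i r)) :
    LinF F := by
  refine ⟨hF, fun x y i q r => ?_⟩
  refine mem_of_closed (P := fun y => F (Function.update x i q) + F (Function.update x i r) =
    F (Function.update y i q) + F (Function.update y i r)) (D := Set.univ) (x := x) ?_ rfl ?_
  · intro z hz j _ s
    rw [hz]
    by_cases hij : i = j
    · subst hij; simp
    · exact (h z i j hij q r s).symm
  · intro i hi; exact absurd (Set.mem_univ _) hi

/-- Adding the label of the coordinate `k` takes care of direction `k`, on which the position does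
not depend. Only squares in two other directions remain. -/
theorem linF_gr [Finite ι] {C : Set (ι → Fin 4)} (hC : IsCode C) {f : Fin 4 → ZMod 2} (hf : Bal f) (k : ι)
    (h : ∀ x i j, i ≠ j → i ≠ k → j ≠ k → ∀ q r s, f (gr C k (Function.update (Function.update x j s) i q)) +
      f (gr C k (Function.update (Function.update x j s) i r)) =
      f (gr C k (Function.update x i q)) + f (gr C k (Function.update x i r))) :
    LinF fun x => f (gr C k x) + f (x k) := by
  have fin2 : ∀ a b : ZMod 2, a + b + (a + b) = 0 := by decide
  have fin4 : ∀ a b c d e : ZMod 2, a + b = c + d → a + e + (b + e) = c + e + (d + e) := by decide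
  have fin4' : ∀ a b c d e e' : ZMod 2, a + b = c + d → a + e' + (b + e') = c + e + (d + e) := by decide
  refine linF_of_squares (fun x i => ?_) fun x i j hij q r s => ?_
  · by_cases hik : i = k
    · subst hik
      simp only [gr_update, Function.update_self]
      rw [show (fun t => f (gr C i x) + f t) = fun t => f t + f (gr C i x) from funext fun _ => add_comm _ _]
      exact hf.add_const _
    · simp only [Function.update_of_ne (Ne.symm hik)]
      exact (hf.comp (hC.gr_bijective hik x)).add_const _
  · by_cases hik : i = k
    · subst hik
      simp only [gr_update, Function.update_self]
      generalize f (gr C i (Function.update x j s)) = a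
      generalize f (gr C i x) = b
      generalize f q = c
      generalize f r = d
      revert a b c d; decide
    · simp only [Function.update_of_ne (Ne.symm hik)]
      by_cases hjk : j = k
      · subst hjk
        have e : ∀ q, gr C j (Function.update (Function.update x j s) i q) = gr C j (Function.update x i q) := by
          intro q; rw [Function.update_comm (Ne.symm hij), gr_update]
        simp only [Function.update_self, e]
        exact fin4' _ _ _ _ _ _ rfl
      · simp only [Function.update_of_ne (Ne.symm hjk)]
        exact fin4 _ _ _ _ _ (h x i j hij hik hjk q r s)

theorem IsCode.gr_add_eq_zero {C : Set (ι → Fin 4)} (hC : IsCode C) (f : Fin 4 → ZMod 2) (k : ι) :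
    ∀ x ∈ C, f (gr C k x) + f (x k) = 0 := by
  intro x hx
  rw [(hC.mem_iff k).1 hx]
  exact CharTwo.add_self_eq_zero _

end Face

/-! ### Classification in dimension three. -/

section Classify

def lab₁ : Fin 4 → ZMod 2 := ![0, 0, 1, 1]
def lab₂ : Fin 4 → ZMod 2 := ![0, 1, 0, 1]

/-- The masks of the codes equivalent to the standard one. -/
def stdOrbit : List ℕ :=
  permList.flatMap fun a => (permList.take 6).flatMap fun b =>
    [![0,1,2,3], ![0,2,1,3], ![0,1,3,2]].map fun c => actMask 0 a (actMask 1 b (actMask 2 c stdMask))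

/-- Tests additivity of the label of the position in the two free coordinates, comparing each pair
of values with the origin. -/
def quadCheck (f : Fin 4 → ZMod 2) (M : ℕ) : Bool :=
  let L := levelMask M 2 f 0
  (List.finRange 4).all fun a => (List.finRange 4).all fun b =>
    ((L.testBit (16 * a.val + 4 * b.val) ^^ L.testBit (4 * b.val)) ^^ (L.testBit (16 * a.val) ^^ L.testBit 0)) == false

/-- The two cases are the tables isotopic to the Klein group and those isotopic to the cyclic group.
The orbit list has `24 * 6 * 3` entries; permutations fixing zero in the second coordinate and three
representatives in the third are enough. -/
theorem classify : ∀ M ∈ allCodes, (quadCheck lab₁ M = true ∧ quadCheck lab₂ M = true) ∨ M ∈ stdOrbit := by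
  decide +kernel

theorem linF_of_quadCheck {f : Fin 4 → ZMod 2} (hf : Bal f) {M : ℕ} (hM : IsCode (maskSet M))
    (h : quadCheck f M = true) : LinF fun x => f (gr (maskSet M) 2 x) + f (x 2) := by
  set g : Fin 4 → Fin 4 → ZMod 2 := fun a b => f (gr (maskSet M) 2 ![a, b, 0]) with hg
  have e : ∀ x : Fin 3 → Fin 4, f (gr (maskSet M) 2 x) = g (x 0) (x 1) := by
    intro x
    have := gr_update (maskSet M) 2 x 0
    rw [show Function.update x 2 0 = ![x 0, x 1, 0] by ext i; fin_cases i <;> rfl] at this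
    rw [hg, ← this]
  have hb : ∀ a b : Fin 4, (levelMask M 2 f 0).testBit (16 * a.val + 4 * b.val) = true ↔ g a b = 0 :=
    fun a b => mem_levelMask (x := ![a, b, 0]) hM
  have hq : ∀ a b, g a b + g 0 b + (g a 0 + g 0 0) = 0 := by
    intro a b
    rw [quadCheck, List.all_eq_true] at h
    have h1 := h a (List.mem_finRange a)
    rw [List.all_eq_true] at h1
    have h2 := h1 b (List.mem_finRange b)
    have e1 := hb a b
    have e2 := hb 0 b
    have e3 := hb a 0
    have e4 := hb 0 0
    simp only [Fin.val_zero, mul_zero, add_zero, zero_add] at e2 e3 e4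
    rw [beq_iff_eq] at h2
    have fin : ∀ c1 c2 c3 c4 : ZMod 2, ((decide (c1 = 0) ^^ decide (c2 = 0)) ^^
      (decide (c3 = 0) ^^ decide (c4 = 0))) = false → c1 + c2 + (c3 + c4) = 0 := by decide
    have tr : ∀ {b : Bool} {c : ZMod 2}, (b = true ↔ c = 0) → b = decide (c = 0) := by
      intro b c h; rw [Bool.eq_iff_iff, h, decide_eq_true_iff]
    rw [tr e1, tr e2, tr e3, tr e4] at h2
    exact fin _ _ _ _ h2
  have fin : ∀ a b c d e f g h i : ZMod 2, a + b + (c + i) = 0 → d + b + (e + i) = 0 → f + g + (c + i) = 0 →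
      h + g + (e + i) = 0 → a + d = f + h := by decide
  have key : ∀ a a' b b', g a b + g a' b = g a b' + g a' b' := fun a a' b b' =>
    fin _ _ _ _ _ _ _ _ _ (hq a b) (hq a' b) (hq a b') (hq a' b')
  have fin' : ∀ a b c d : ZMod 2, a + b = c + d → a + c = b + d := by decide
  refine linF_gr hM hf 2 fun x i j hij hi hj q r s => ?_
  simp only [e]
  fin_cases i <;> fin_cases j <;> simp at hij hi hj
  · simpa [Function.update] using key _ _ _ _
  · simpa [Function.update] using fin' _ _ _ _ (key _ _ _ _)

/-- A code in three dimensions is equivalent to the standard one, or linear for two labels. -/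
theorem std_or_linear {E : Set (Fin 3 → Fin 4)} (hE : IsCode E) :
    ((LinF fun x => lab₁ (gr E 2 x) + lab₁ (x 2)) ∧ LinF fun x => lab₂ (gr E 2 x) + lab₂ (x 2)) ∨
    ∃ σ : Fin 3 → Equiv.Perm (Fin 4), E = {x | twist (Equiv.refl _) σ x ∈ stdCode} := by
  obtain ⟨M, hM, rfl⟩ := exists_mask hE
  rcases classify M hM with ⟨h1, h2⟩ | h
  · exact Or.inl ⟨linF_of_quadCheck (by decide) hE h1, linF_of_quadCheck (by decide) hE h2⟩
  · right
    simp only [stdOrbit, List.mem_flatMap, List.mem_map] at h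
    obtain ⟨a, ha, b, hb, c, hc, rfl⟩ := h
    have inj : ∀ a ∈ permList, Function.Bijective a := by
      have : ∀ a ∈ permList, ∀ s t, a s = a t → s = t := by decide +kernel
      exact fun a ha => Finite.injective_iff_bijective.1 fun s t => this a ha s t
    have hb' := List.mem_of_mem_take hb
    have hc' : c ∈ permList := by
      have : ∀ c ∈ ([![0,1,2,3], ![0,2,1,3], ![0,1,3,2]] : List (Fin 4 → Fin 4)), c ∈ permList := by decide +kernel
      exact this c hc
    refine ⟨![Equiv.ofBijective a (inj a ha), Equiv.ofBijective b (inj b hb'), Equiv.ofBijective c (inj c hc')], ?_⟩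
    ext x
    rw [mem_maskSet, testBit_actMask, testBit_actMask, testBit_actMask, Set.mem_ofPred_eq, stdCode, mem_maskSet]
    rw [show Function.update (Function.update (Function.update x 0 (a (x 0))) 1
      (b (Function.update x 0 (a (x 0)) 1))) 2 (c (Function.update (Function.update x 0 (a (x 0))) 1
      (b (Function.update x 0 (a (x 0)) 1)) 2)) = twist (Equiv.refl (Fin 3)) ![Equiv.ofBijective a (inj a ha),
        Equiv.ofBijective b (inj b hb'), Equiv.ofBijective c (inj c hc')] x by
      ext i; fin_cases i <;> rfl]

/-- If no three-dimensional face is isotopic to the standard code, each is linear for `lab₁`. Then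
the label of the position is additive on every square, and the whole code is semilinear. -/
theorem exists_stiff_face {ι : Type*} [DecidableEq ι] [Finite ι] [Nonempty ι] {C : Set (ι → Fin 4)} (hC : IsCode C)
    (hS : ¬ Semi C) : ∃ (e : Fin 3 ↪ ι) (y : ι → Fin 4), Stiff (face C e y) := by
  by_contra hcon
  push Not at hcon
  obtain ⟨k⟩ := ‹Nonempty ι›
  refine hS ⟨_, linF_gr hC (show Bal lab₁ by decide) k fun x i j hij hik hjk q r s => ?_, hC.gr_add_eq_zero lab₁ k⟩
  let e : Fin 3 ↪ ι := ⟨![i, j, k], by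
    intro a b hab
    fin_cases a <;> fin_cases b <;> simp_all [eq_comm]⟩
  have hl := ((std_or_linear (hC.face e x)).resolve_right fun ⟨σ, hσ⟩ => hcon e x (by
    rw [hσ]; exact std_stiff.twist (Equiv.refl _) σ)).1
  have h := hl.2 (Function.update (x ∘ e) 1 s) (x ∘ e) 0 q r
  simp only [gr_face, extend_update, extend_comp_self] at h
  have fin : ∀ a b c d t u : ZMod 2, a + t + (b + t) = c + u + (d + u) → a + b = c + d := by decide
  exact fin _ _ _ _ _ _ h

/-- Otherwise two different linear functions would vanish on the code, against uniqueness. -/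
theorem Stiff.eq_twist_std {E : Set (Fin 3 → Fin 4)} (h : Stiff E) :
    ∃ σ : Fin 3 → Equiv.Perm (Fin 4), E = {x | _root_.twist (Equiv.refl _) σ x ∈ stdCode} := by
  refine (std_or_linear h.isCode).resolve_left fun ⟨h1, h2⟩ => ?_
  obtain ⟨F, hF⟩ := h.2
  have e := (hF.eq_of_sub _ h1 (h.isCode.gr_add_eq_zero lab₁ 2)).trans
    (hF.eq_of_sub _ h2 (h.isCode.gr_add_eq_zero lab₂ 2)).symm
  have e0 := congrFun e (Function.update (fun _ => 0) 2 0)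
  have e1 := congrFun e (Function.update (fun _ => 0) 2 1)
  simp only [gr_update, Function.update_self] at e0 e1
  have : ∀ a b : ZMod 2, a + lab₁ 0 = b + lab₂ 0 → a + lab₁ 1 = b + lab₂ 1 → False := by decide
  exact this _ _ e0 e1

end Classify

/-! ### Neighbours of a code and their layers. -/

section Nb
variable {ι κ : Type*} [DecidableEq ι] [DecidableEq κ]

/-- `B` is disjoint from `A` and arises from it by a permutation in one coordinate. -/
def Nb (A B : Set (ι → Fin 4)) : Prop := (∃ j, IsAct j A B) ∧ ∀ x ∈ B, x ∉ A

theorem IsCode.ne_of_act_disjoint {A : Set (ι → Fin 4)} (hA : IsCode A) {i j : ι} (hij : i ≠ j)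
    {α : Fin 4 → Fin 4} (h : ∀ x ∈ _root_.act j α A, x ∉ A) (t : Fin 4) : α t ≠ t := by
  intro ht
  obtain ⟨x, hx, hg⟩ := hA.exists_point hij t t
  have h1 : x ∈ A := (hA.mem_iff j).2 (by rw [hg, hx])
  exact h x (by rw [mem_act, hg, hx, ht]) h1

theorem Nb.twist {A B : Set (ι → Fin 4)} (hA : IsCode A) (h : Nb A B) (e : ι ≃ κ) (σ : ι → Equiv.Perm (Fin 4)) :
    Nb {x | twist e σ x ∈ A} {x | twist e σ x ∈ B} := by
  obtain ⟨⟨j, α, hα, rfl⟩, hd⟩ := h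
  refine ⟨⟨e j, fun t => (σ j).symm (α (σ j t)), (σ j).symm.injective.comp (hα.comp (σ j).injective), ?_⟩,
    fun x h1 h2 => hd _ h1 h2⟩
  rw [act_twist e σ hA]

theorem eq_of_three_layers {C C' : Set (Option ι → Fin 4)} (hC : IsCode C) (hC' : IsCode C') {a b c : Fin 4}
    (hab : a ≠ b) (hac : a ≠ c) (hbc : b ≠ c) (ha : layer C a = layer C' a) (hb : layer C b = layer C' b)
    (hc : layer C c = layer C' c) : C = C' := by
  obtain ⟨d, h1, h2, h3, hd⟩ := exists_fourth hab hac hbc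
  have key : ∀ {C C' : Set (Option ι → Fin 4)}, IsCode C → IsCode C' → layer C a = layer C' a →
      layer C b = layer C' b → layer C c = layer C' c → layer C d ⊆ layer C' d := by
    intro C C' hC hC' ha hb hc x hx
    obtain ⟨e, he⟩ := (hC'.layer_unique x).exists
    rcases hd e with rfl | rfl | rfl | rfl
    · exact (hC.layer_disjoint h1 hx (by rw [ha]; exact he)).elim
    · exact (hC.layer_disjoint h2 hx (by rw [hb]; exact he)).elim
    · exact (hC.layer_disjoint h3 hx (by rw [hc]; exact he)).elim
    · exact he
  refine layer_injective fun e => ?_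
  rcases hd e with rfl | rfl | rfl | rfl
  · exact ha
  · exact hb
  · exact hc
  · exact (key hC hC' ha hb hc).antisymm (key hC' hC ha.symm hb.symm hc.symm)

/-- Counting codes disjoint from a given one by pairs of their layers. -/
theorem ncard_le_of_layers [Finite ι] {A : Set (Option ι → Fin 4)} (hA : IsCode A)
    {S : Set (Set (Option ι → Fin 4))} (hS : ∀ B ∈ S, IsCode B) (hd : ∀ B ∈ S, ∀ x ∈ B, x ∉ A) {a b c : Fin 4}
    (hab : a ≠ b) (hac : a ≠ c) (hbc : b ≠ c) (P X : Set (Set (ι → Fin 4) × Set (ι → Fin 4)))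
    (hP : ∀ B ∈ S, (layer B a, layer B b) ∈ P)
    (hX : ∀ B ∈ S, (∀ x, (x ∈ layer B a ∨ x ∈ layer B b) ↔ ¬ (x ∈ layer A a ∨ x ∈ layer A b)) →
      (layer B a, layer B c) ∈ X) : S.ncard ≤ P.ncard + X.ncard := by
  -- Codes whose two layers complement those of `A` are exceptional. The others are determined by
  -- the layers `a` and `b`, by `eq_or_compl_of_layers`. For an exceptional code layer `b` follows
  -- from layer `a`, so the layers `a` and `c` suffice.
  set exc : Set (Option ι → Fin 4) → Prop := fun B =>
    ∀ x, (x ∈ layer B a ∨ x ∈ layer B b) ↔ ¬ (x ∈ layer A a ∨ x ∈ layer A b) with he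
  have e : S = {B | B ∈ S ∧ ¬ exc B} ∪ {B | B ∈ S ∧ exc B} := by
    ext B; simp only [Set.mem_union, Set.mem_ofPred_eq]; by_cases h : exc B <;> simp [h]
  rw [e]
  refine (Set.ncard_union_le _ _).trans (Nat.add_le_add ?_ ?_)
  · refine Set.ncard_le_ncard_of_injOn (fun B => (layer B a, layer B b)) (fun B hB => hP B hB.1) ?_ (Set.toFinite _)
    intro B hB B' hB' h
    rw [Prod.mk.injEq] at h
    exact (eq_or_compl_of_layers (hS B hB.1) (hS B' hB'.1) hA (hd B hB.1) (hd B' hB'.1) hab h.1 h.2).resolve_right hB.2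
  · refine Set.ncard_le_ncard_of_injOn (fun B => (layer B a, layer B c)) (fun B hB => hX B hB.1 hB.2) ?_ (Set.toFinite _)
    intro B hB B' hB' h
    rw [Prod.mk.injEq] at h
    refine eq_of_three_layers (hS B hB.1) (hS B' hB'.1) hab hac hbc h.1 ?_ h.2
    ext x
    have h1 := hB.2 x
    have h2 := hB'.2 x
    have h3 : x ∈ layer B a ↔ x ∈ layer B' a := by rw [h.1]
    have h4 : x ∈ layer B a → x ∉ layer B b := fun u v => (hS B hB.1).layer_disjoint hab u v
    have h5 : x ∈ layer B' a → x ∉ layer B' b := fun u v => (hS B' hB'.1).layer_disjoint hab u v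
    tauto

end Nb

/-! ### Counting neighbours next to the standard code. -/

section NbStd

/-- The masks of the neighbours of a code. -/
def nbMasks (M : ℕ) : List ℕ :=
  ((List.finRange 3).flatMap fun j => derangements4.map fun a => actMask j a M % 2 ^ 64).dedup

theorem maskSet_mod (M : ℕ) : maskSet (M % 2 ^ 64) = maskSet M := by
  ext x
  rw [mem_maskSet, Nat.testBit_mod_two_pow, mem_maskSet]
  simp [idx_lt x]

theorem Nb.exists_mask {M : ℕ} (hM : IsCode (maskSet M)) {B : Set (Fin 3 → Fin 4)} (h : Nb (maskSet M) B) :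
    ∃ N ∈ nbMasks M, B = maskSet N := by
  obtain ⟨⟨j, α, hα, rfl⟩, hd⟩ := h
  obtain ⟨i, hij⟩ : ∃ i, i ≠ j := by clear hd; revert j; decide
  refine ⟨actMask j α M % 2 ^ 64, ?_, by rw [maskSet_mod, maskSet_actMask j α hM]⟩
  rw [nbMasks, List.mem_dedup, List.mem_flatMap]
  exact ⟨j, List.mem_finRange j, List.mem_map.2 ⟨α, mem_derangements4 hα (hM.ne_of_act_disjoint hij hd), rfl⟩⟩

theorem mod_of_mem_nbMasks {M N : ℕ} (h : N ∈ nbMasks M) : N % 2 ^ 64 = N := by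
  rw [nbMasks, List.mem_dedup, List.mem_flatMap] at h
  obtain ⟨j, -, h⟩ := h
  obtain ⟨a, -, rfl⟩ := List.mem_map.1 h
  exact Nat.mod_mod _ _

/-- Masks of the pairs of disjoint neighbours of the standard code and of `D`. -/
def pairMasks (D : ℕ) : List (ℕ × ℕ) :=
  (nbMasks stdMask).flatMap fun E =>
    let L := nbMasks E
    ((nbMasks D).filter fun E' => L.elem E').map fun E' => (E, E')

/-- Candidates for the layers `a` and `c` of an exceptional code: the first avoids both given
layers, and the second lies in their union. -/
def excMasks (D : ℕ) : List (ℕ × ℕ) :=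
  ((nbMasks stdMask).filter fun E => (E &&& D) % 2 ^ 64 == 0).flatMap fun E =>
    ((nbMasks E).filter fun E' => (E' &&& (stdMask ||| D)) % 2 ^ 64 == E' % 2 ^ 64).map fun E' => (E, E')

/-- The excluded permutation adds two and produces the partner code. The bound 125 matters because
its double is below `256`; the generic estimate by derangements is too weak here. -/
theorem pair_bound : ∀ j : Fin 3, ∀ a ∈ derangements4, a ≠ ![2, 3, 0, 1] →
    (pairMasks (actMask j a stdMask)).length + (excMasks (actMask j a stdMask)).length ≤ 125 := by
  decide +kernel

theorem ncard_le_length {S : Set (Set (Fin 3 → Fin 4) × Set (Fin 3 → Fin 4))} {L : List (ℕ × ℕ)}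
    (h : ∀ p ∈ S, ∃ m ∈ L, p = (maskSet m.1, maskSet m.2)) : S.ncard ≤ L.length := by
  have : S ⊆ (fun m : ℕ × ℕ => (maskSet m.1, maskSet m.2)) '' (L.toFinset : Set (ℕ × ℕ)) := by
    intro p hp
    obtain ⟨m, hm, rfl⟩ := h p hp
    exact ⟨m, by simpa using hm, rfl⟩
  refine (Set.ncard_le_ncard this (Set.toFinite _)).trans ?_
  refine (Set.ncard_image_le (Set.toFinite _)).trans ?_
  rw [Set.ncard_coe_finset]
  exact L.toFinset_card_le

/-- Pairs of disjoint neighbours of `A` and of `D`. -/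
def nbPairs (A D : Set (Fin 3 → Fin 4)) : Set (Set (Fin 3 → Fin 4) × Set (Fin 3 → Fin 4)) :=
  {p | Nb A p.1 ∧ Nb D p.2 ∧ Nb p.1 p.2}

def excPairs (A D : Set (Fin 3 → Fin 4)) : Set (Set (Fin 3 → Fin 4) × Set (Fin 3 → Fin 4)) :=
  {p | Nb A p.1 ∧ (∀ x ∈ p.1, x ∉ D) ∧ Nb p.1 p.2 ∧ ∀ x ∈ p.2, x ∈ A ∨ x ∈ D}

theorem Nb.isCode {ι : Type*} [DecidableEq ι] {A B : Set (ι → Fin 4)} (hA : IsCode A) (h : Nb A B) : IsCode B :=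
  h.1.elim fun _ hj => hj.isCode hA

theorem nbPairs_std {j : Fin 3} {α : Fin 4 → Fin 4} (hα : Function.Injective α) (hd : ∀ t, α t ≠ t)
    (hu : α ≠ ![2, 3, 0, 1]) :
    (nbPairs stdCode (act j α stdCode)).ncard + (excPairs stdCode (act j α stdCode)).ncard ≤ 125 := by
  refine le_trans (Nat.add_le_add ?_ ?_) (pair_bound j α (mem_derangements4 hα hd) hu)
  all_goals
    have hDc : IsCode (act j α stdCode) := stdCode_isCode.act hα
    rw [show act j α stdCode = maskSet (actMask j α stdMask) from (maskSet_actMask j α stdCode_isCode).symm] at hDc ⊢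
    refine ncard_le_length ?_
  · rintro ⟨E, E'⟩ ⟨h1, h2, h3⟩
    obtain ⟨M, hM, rfl⟩ := h1.exists_mask stdCode_isCode
    obtain ⟨N, hN, rfl⟩ := h2.exists_mask hDc
    obtain ⟨N', hN', e⟩ := h3.exists_mask (h1.isCode stdCode_isCode)
    simp only at e
    have e2 := mod_eq_of_maskSet (M := N) (N := N') fun x => by rw [e]
    rw [mod_of_mem_nbMasks hN, mod_of_mem_nbMasks hN'] at e2
    subst e2
    refine ⟨(M, N), ?_, rfl⟩
    rw [pairMasks, List.mem_flatMap]
    exact ⟨M, hM, List.mem_map.2 ⟨N, List.mem_filter.2 ⟨hN, List.elem_eq_true_of_mem hN'⟩, rfl⟩⟩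
  · rintro ⟨E, E'⟩ ⟨h1, h2, h3, h4⟩
    obtain ⟨M, hM, rfl⟩ := h1.exists_mask stdCode_isCode
    obtain ⟨N, hN, rfl⟩ := h3.exists_mask (h1.isCode stdCode_isCode)
    refine ⟨(M, N), ?_, rfl⟩
    rw [excMasks, List.mem_flatMap]
    refine ⟨M, List.mem_filter.2 ⟨hM, ?_⟩, List.mem_map.2 ⟨N, List.mem_filter.2 ⟨hN, ?_⟩, rfl⟩⟩
    · rw [beq_iff_eq]; exact and_mod_of_disjoint h2
    · rw [beq_iff_eq]
      refine mod_eq_of_maskSet fun x => ?_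
      rw [mem_maskSet_and, mem_maskSet_or]
      exact ⟨fun h => h.1, fun h => ⟨h, h4 x h⟩⟩

/-- The bound for an arbitrary code equivalent to the standard one. -/
theorem nbPairs_le {A D : Set (Fin 3 → Fin 4)} (hA : Stiff A) (hD : Nb A D)
    (hu : ∀ F, LinF F → (∀ x ∈ A, F x = 0) → D ≠ {x | F x = 0 ∧ x ∉ A}) :
    (nbPairs A D).ncard + (excPairs A D).ncard ≤ 125 := by
  obtain ⟨σ, hσ⟩ := hA.eq_twist_std
  -- The inverse isotopy carries everything to the standard code.
  let τ : Fin 3 → Equiv.Perm (Fin 4) := fun k => (σ k).symm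
  let T : Set (Fin 3 → Fin 4) → Set (Fin 3 → Fin 4) := fun X => {x | twist (Equiv.refl _) τ x ∈ X}
  have hτσ : ∀ x, twist (Equiv.refl _) σ (twist (Equiv.refl _) τ x) = x := fun x => by
    funext k; simp [twist, τ]
  have hστ : ∀ x, twist (Equiv.refl _) τ (twist (Equiv.refl _) σ x) = x := fun x => by
    funext k; simp [twist, τ]
  have hT : Function.Injective T := by
    intro X Y h
    ext x
    have : twist (Equiv.refl _) σ x ∈ T X ↔ twist (Equiv.refl _) σ x ∈ T Y := by rw [h]
    simpa only [T, Set.mem_ofPred_eq, hστ] using this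
  have hTA : T A = stdCode := by
    ext x
    simp only [T, Set.mem_ofPred_eq, hσ, hτσ]
  have hAc := hA.isCode
  have hDc := hD.isCode hAc
  have hTD : Nb stdCode (T D) := hTA ▸ hD.twist hAc _ τ
  obtain ⟨⟨j, α, hα, eα⟩, hdis⟩ := hTD
  obtain ⟨i, hij⟩ : ∃ i, i ≠ j := by clear eα; revert j; decide
  have hd := stdCode_isCode.ne_of_act_disjoint hij (α := α) (by rw [← eα]; exact hdis)
  have hne : α ≠ ![2, 3, 0, 1] := by
    rintro rfl
    refine hu (fun x => stdF (twist (Equiv.refl _) σ x)) (stdF_lin.twist _ σ)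
      (fun x hx => std_rigid.sub _ (by rw [hσ] at hx; exact hx)) ?_
    have h1 := stdF_lin.compl_eq_act stdCode_isCode std_rigid.sub j
    rw [lab_stdF, show pairSwap par = ![2, 3, 0, 1] by decide, ← eα] at h1
    ext x
    have : x ∈ D ↔ twist (Equiv.refl _) σ x ∈ T D := by simp only [T, Set.mem_ofPred_eq, hστ]
    rw [this, ← h1, hσ]; rfl
  refine le_trans (Nat.add_le_add ?_ ?_) (nbPairs_std (j := j) hα hd hne)
  · rw [← eα]
    refine Set.ncard_le_ncard_of_injOn (Prod.map T T) ?_ (hT.prodMap hT).injOn (Set.toFinite _)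
    rintro ⟨E, E'⟩ ⟨h1, h2, h3⟩
    exact ⟨hTA ▸ h1.twist hAc _ τ, h2.twist hDc _ τ, h3.twist (h1.isCode hAc) _ τ⟩
  · rw [← eα]
    refine Set.ncard_le_ncard_of_injOn (Prod.map T T) ?_ (hT.prodMap hT).injOn (Set.toFinite _)
    rintro ⟨E, E'⟩ ⟨h1, h2, h3, h4⟩
    exact ⟨hTA ▸ h1.twist hAc _ τ, fun x hx => h2 _ hx, h3.twist (h1.isCode hAc) _ τ,
      fun x hx => by rw [← hTA]; exact h4 _ hx⟩

end NbStd

/-! ### Towers of stiff faces and the number of their neighbours. -/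

section Tower

/-- An index type with `t` coordinates adjoined to `Fin n`. -/
def Tow (n : ℕ) : ℕ → Type
  | 0 => Fin n
  | t + 1 => Option (Tow n t)

instance Tow.decEq (n : ℕ) : ∀ t, DecidableEq (Tow n t)
  | 0 => inferInstanceAs (DecidableEq (Fin n))
  | t + 1 => haveI := Tow.decEq n t; inferInstanceAs (DecidableEq (Option (Tow n t)))

instance Tow.finite (n : ℕ) : ∀ t, Finite (Tow n t)
  | 0 => inferInstanceAs (Finite (Fin n))
  | t + 1 => haveI := Tow.finite n t; inferInstanceAs (Finite (Option (Tow n t)))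

theorem Tow.card (n t : ℕ) : Nat.card (Tow n t) = n + t := by
  induction t with
  | zero => exact Nat.card_fin n
  | succ t ih => exact (Finite.card_option (α := Tow n t)).trans (by rw [ih]; rfl)

/-- Corresponding faces of the two codes differ by a permutation in one coordinate. -/
def FaceRel (n : ℕ) : ∀ t, Set (Tow n t → Fin 4) → Set (Tow n t → Fin 4) → Prop
  | 0, A, B => ∃ j, IsAct j A B
  | t + 1, A, B => ∀ v, FaceRel n t (layer A v) (layer B v)

/-- All faces are stiff, and parallel neighbouring faces differ by a permutation in one coordinate. -/
def Good (n : ℕ) : ∀ t, Set (Tow n t → Fin 4) → Prop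
  | 0, A => Stiff A
  | t + 1, A => (∀ v, Good n t (layer A v)) ∧ ∀ v w, FaceRel n t (layer A v) (layer A w)

def Nbrs (n t : ℕ) (A : Set (Tow n t → Fin 4)) : Set (Set (Tow n t → Fin 4)) :=
  {B | IsCode B ∧ Good n t B ∧ FaceRel n t A B ∧ ∀ x ∈ B, x ∉ A}

variable {n t : ℕ}

theorem Nbrs.layer {A B : Set (Tow n (t + 1) → Fin 4)} (h : B ∈ Nbrs n (t + 1) A) (v : Fin 4) :
    layer B v ∈ Nbrs n t (layer A v) :=
  ⟨IsCode.layer (ι := Tow n t) h.1 v, h.2.1.1 v, h.2.2.1 v, fun x hx hx' => h.2.2.2 _ hx hx'⟩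

theorem nbrs_succ {d : ℕ} {A : Set (Tow n (t + 1) → Fin 4)} (hA : IsCode A)
    (h : ∀ v, (Nbrs n t (layer A v)).ncard ≤ d) : (Nbrs n (t + 1) A).ncard ≤ 2 * d ^ 2 := by
  have := ncard_le_of_layers (ι := Tow n t) hA (S := Nbrs n (t + 1) A) (fun B hB => hB.1) (fun B hB => hB.2.2.2)
    (a := 0) (b := 1) (c := 2) (by decide) (by decide) (by decide)
    (Nbrs n t (layer A 0) ×ˢ Nbrs n t (layer A 1)) (Nbrs n t (layer A 0) ×ˢ Nbrs n t (layer A 2))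
    (fun B hB => ⟨Nbrs.layer hB 0, Nbrs.layer hB 1⟩) (fun B hB _ => ⟨Nbrs.layer hB 0, Nbrs.layer hB 2⟩)
  rw [Set.ncard_prod, Set.ncard_prod] at this
  calc _ ≤ _ := this
    _ ≤ d * d + d * d := Nat.add_le_add (Nat.mul_le_mul (h 0) (h 1)) (Nat.mul_le_mul (h 0) (h 2))
    _ = 2 * d ^ 2 := by ring

/-- In one more dimension the count `d` becomes at most `2 * d ^ 2`, so its double is squared. -/
theorem nbrs_iterate {d s : ℕ} (h : ∀ A : Set (Tow n s → Fin 4), IsCode A → Good n s A → (Nbrs n s A).ncard ≤ d)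
    (t : ℕ) : ∀ A : Set (Tow n (s + t) → Fin 4), IsCode A → Good n (s + t) A →
      2 * (Nbrs n (s + t) A).ncard ≤ (2 * d) ^ 2 ^ t := by
  induction t with
  | zero => intro A hA hG; rw [pow_zero, pow_one]; exact Nat.mul_le_mul_left 2 (h A hA hG)
  | succ t ih =>
    intro A hA hG
    have := nbrs_succ (n := n) (t := s + t) (d := (2 * d) ^ 2 ^ t / 2) hA fun v =>
      (Nat.le_div_iff_mul_le (by norm_num)).2
        (by rw [mul_comm]; exact ih _ (IsCode.layer (ι := Tow n (s + t)) hA v) (hG.1 v))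
    calc 2 * (Nbrs n (s + t + 1) A).ncard ≤ 2 * (2 * ((2 * d) ^ 2 ^ t / 2) ^ 2) := Nat.mul_le_mul_left 2 this
      _ = (2 * ((2 * d) ^ 2 ^ t / 2)) ^ 2 := by ring
      _ ≤ ((2 * d) ^ 2 ^ t) ^ 2 := Nat.pow_le_pow_left (Nat.mul_div_le _ _) 2
      _ = (2 * d) ^ 2 ^ (t + 1) := by rw [← pow_mul, pow_succ]

/-- A coordinate and one of the nine derangements of four symbols. -/
theorem nbrs_zero {A : Set (Tow n 0 → Fin 4)} (hA : Stiff (ι := Fin n) A) : (Nbrs n 0 A).ncard ≤ 9 * n := by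
  have hc : derangements4.toFinset.card ≤ 9 := derangements4.toFinset_card_le
  have : Nbrs n 0 A ⊆ (fun p : Fin n × (Fin 4 → Fin 4) => act (ι := Fin n) p.1 p.2 A) ''
      (((Finset.univ : Finset (Fin n)) ×ˢ derangements4.toFinset : Finset _) : Set _) := by
    rintro B ⟨-, -, ⟨j, α, hα, rfl⟩, hd⟩
    obtain ⟨F, hF⟩ := hA.2
    obtain ⟨i, hij⟩ := hF.inhabited j
    exact ⟨(j, α), Finset.mem_coe.2 (Finset.mem_product.2 ⟨Finset.mem_univ _,
      List.mem_toFinset.2 (mem_derangements4 hα (hF.code.ne_of_act_disjoint hij hd))⟩), rfl⟩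
  refine (Set.ncard_le_ncard this (Set.toFinite _)).trans ((Set.ncard_image_le (Set.toFinite _)).trans ?_)
  rw [Set.ncard_coe_finset, Finset.card_product, Finset.card_univ, Fintype.card_fin, mul_comm]
  exact Nat.mul_le_mul_right n hc

/-- At most one layer is the partner of layer `0`. A layer `w` that is not the partner is available,
and the sharper bound of `nbPairs_le` applies to the layers `0` and `w`. -/
theorem nbrs_three_one {A : Set (Tow 3 1 → Fin 4)} (hA : IsCode A) (hG : Good 3 1 A) : (Nbrs 3 1 A).ncard ≤ 125 := by
  replace hA : IsCode (ι := Option (Fin 3)) A := hA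
  have hst : ∀ v, Stiff (ι := Fin 3) (layer A v) := hG.1
  have hrel : ∀ v w, ∃ j, IsAct (ι := Fin 3) j (layer A v) (layer A w) := hG.2
  obtain ⟨F, hF⟩ := (hst 0).2
  obtain ⟨w, c, hw, hc, hwc, hu⟩ : ∃ w c : Fin 4, 0 ≠ w ∧ 0 ≠ c ∧ w ≠ c ∧
      layer A w ≠ {x | F x = 0 ∧ x ∉ layer A 0} := by
    by_cases h : layer A 1 = {x | F x = 0 ∧ x ∉ layer A 0}
    · refine ⟨2, 3, by decide, by decide, by decide, fun h2 => ?_⟩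
      obtain ⟨x, hx⟩ : ∃ x, x ∈ layer A 1 := ⟨_, (hst 1).isCode.gr_mem (0 : Fin 3) (fun _ => 0)⟩
      exact hA.layer_disjoint (by decide : (1 : Fin 4) ≠ 2) hx (by rw [h2, ← h]; exact hx)
    · exact ⟨1, 2, by decide, by decide, by decide, h⟩
  have hnb : Nb (layer A 0) (layer A w) := ⟨hrel 0 w, fun x hx h => hA.layer_disjoint hw h hx⟩
  refine (ncard_le_of_layers hA (S := Nbrs 3 1 A) (fun B hB => hB.1) (fun B hB => hB.2.2.2) hw hc hwc
    (nbPairs (layer A 0) (layer A w)) (excPairs (layer A 0) (layer A w)) ?_ ?_).trans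
    (nbPairs_le (hst 0) hnb fun F' h1 h2 => by rw [hF.eq_of_sub F' h1 h2]; exact hu)
  · intro B hB
    have hBc : IsCode (ι := Option (Fin 3)) B := hB.1
    exact ⟨⟨hB.2.2.1 0, fun x hx hx' => hB.2.2.2 _ hx hx'⟩, ⟨hB.2.2.1 w, fun x hx hx' => hB.2.2.2 _ hx hx'⟩,
      hB.2.1.2 0 w, fun x hx h => hBc.layer_disjoint hw h hx⟩
  · intro B hB he
    have hBc : IsCode (ι := Option (Fin 3)) B := hB.1
    refine ⟨⟨hB.2.2.1 0, fun x hx hx' => hB.2.2.2 _ hx hx'⟩, fun x hx hx' => ?_,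
      ⟨hB.2.1.2 0 c, fun x hx h => hBc.layer_disjoint hc h hx⟩, fun x hx => ?_⟩
    · exact (he x).1 (Or.inl hx) (Or.inr hx')
    · by_contra hcon
      rcases (he x).2 hcon with h | h
      · exact hBc.layer_disjoint hc h hx
      · exact hBc.layer_disjoint hwc h hx

theorem nbrs_le_of_four {n : ℕ} (t : ℕ) {A : Set (Tow n t → Fin 4)} (hA : IsCode A) (hG : Good n t A) :
    2 * (Nbrs n t A).ncard ≤ (18 * n) ^ 2 ^ t := by
  have := nbrs_iterate (n := n) (s := 0) (d := 9 * n) (fun A _ hG => nbrs_zero hG) t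
  rw [zero_add] at this
  rw [show 18 * n = 2 * (9 * n) by ring]
  exact this A hA hG

theorem nbrs_le_of_three (t : ℕ) {A : Set (Tow 3 (1 + t) → Fin 4)} (hA : IsCode A) (hG : Good 3 (1 + t) A) :
    2 * (Nbrs 3 (1 + t) A).ncard ≤ 250 ^ 2 ^ t :=
  nbrs_iterate (n := 3) (s := 1) (d := 125) (fun A h hG => nbrs_three_one h hG) t A hA hG

end Tower

/-! ### Composition of faces; codes without stiff faces of a given dimension. -/

section Faces
variable {ι κ μ : Type*} [DecidableEq ι] [DecidableEq κ] [DecidableEq μ]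

theorem face_face (C : Set (ι → Fin 4)) (j : κ ↪ ι) (y : ι → Fin 4) (e : μ ↪ κ) (z : κ → Fin 4) :
    face (face C j y) e z = face C (e.trans j) (Function.extend j z y) := by
  ext x
  have : Function.extend j (Function.extend e x z) y = Function.extend (e.trans j) x (Function.extend j z y) := by
    funext i
    by_cases h : ∃ k, j k = i
    · obtain ⟨k, rfl⟩ := h
      rw [j.injective.extend_apply]
      by_cases h' : ∃ m, e m = k
      · obtain ⟨m, rfl⟩ := h'
        rw [e.injective.extend_apply]
        exact ((e.trans j).injective.extend_apply x _ m).symm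
      · rw [Function.extend_apply' _ _ _ h', Function.extend_apply', j.injective.extend_apply]
        rintro ⟨m, hm⟩
        exact h' ⟨m, j.injective hm⟩
    · rw [Function.extend_apply' _ _ _ h, Function.extend_apply', Function.extend_apply' _ _ _ h]
      rintro ⟨m, hm⟩
      exact h ⟨e m, hm⟩
  simp only [face, Set.mem_ofPred_eq, this]

theorem layer_eq_face (C : Set (Option ι → Fin 4)) (v : Fin 4) :
    layer C v = face C Function.Embedding.some fun _ => v := by
  ext x
  have : cons v x = Function.extend (Function.Embedding.some (α := ι)) x fun _ => v := by
    funext o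
    cases o with
    | none => rw [Function.extend_apply' _ _ _ (by rintro ⟨i, hi⟩; cases hi)]; rfl
    | some i => exact (Function.Embedding.some.injective.extend_apply x _ i).symm
  show cons v x ∈ C ↔ _
  rw [this]; rfl

theorem reindex_eq_face (C : Set (ι → Fin 4)) (e : ι ≃ κ) :
    {x : κ → Fin 4 | x ∘ e ∈ C} = face C e.symm.toEmbedding fun _ => 0 := by
  ext x
  have : x ∘ e = Function.extend e.symm.toEmbedding x fun _ => 0 := by
    funext i
    have := e.symm.toEmbedding.injective.extend_apply x (fun _ => 0) (e i)
    simpa using this.symm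
  show x ∘ e ∈ C ↔ _
  rw [this]; rfl

/-- No face of dimension `n + 1` is stiff. -/
def NoStiff (n : ℕ) (C : Set (ι → Fin 4)) : Prop :=
  ∀ (e : Option (Fin n) ↪ ι) (y : ι → Fin 4), ¬ Stiff (face C e y)

theorem NoStiff.face {n : ℕ} {C : Set (ι → Fin 4)} (h : NoStiff n C) (e : κ ↪ ι) (y : ι → Fin 4) :
    NoStiff n (face C e y) := by
  intro e' y'
  rw [face_face]
  exact h _ _

/-- The code formed by the layers with value `u` in the second added coordinate. -/
theorem glue_cell_eq_face (D : Set (Option (Option ι) → Fin 4)) (u : Fin 4) :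
    (glue fun v => cell D v u) = face D (Function.Embedding.optionMap Function.Embedding.some) fun _ => u := by
  refine layer_injective fun v => ?_
  ext x
  have : cons v (cons u x) = Function.extend (Function.Embedding.optionMap (Function.Embedding.some (α := ι)))
      (cons v x) fun _ => u := by
    funext o
    rcases o with _ | _ | i
    · exact ((Function.Embedding.optionMap (Function.Embedding.some (α := ι))).injective.extend_apply
        (cons v x) (fun _ => u) none).symm
    · rw [Function.extend_apply' _ _ _ (by rintro ⟨_ | i, hi⟩ <;> simp at hi)]; rfl
    · exact ((Function.Embedding.optionMap (Function.Embedding.some (α := ι))).injective.extend_apply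
        (cons v x) (fun _ => u) (some i)).symm
  have h1 : x ∈ layer (glue fun v => cell D v u) v ↔ cons v (cons u x) ∈ D := Iff.rfl
  rw [h1, this]; rfl

theorem NoStiff.layer {n : ℕ} {C : Set (Option ι → Fin 4)} (h : NoStiff n C) (v : Fin 4) :
    NoStiff n (layer C v) := by
  rw [layer_eq_face]; exact h.face _ _

theorem NoStiff.glue_cell {n : ℕ} {D : Set (Option (Option ι) → Fin 4)} (h : NoStiff n D) (u : Fin 4) :
    NoStiff n (glue fun v => cell D v u) := by
  rw [glue_cell_eq_face]; exact h.face _ _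

end Faces

/-! ### A code that is not semilinear is a tower over a maximal stiff face. -/

section TowerFaces
variable {n : ℕ}

def HasStiff (n : ℕ) : ∀ t, Set (Tow n t → Fin 4) → Prop
  | 0, A => Stiff A
  | t + 1, A => ∃ v, HasStiff n t (layer A v)

/-- Stiff faces of the first code differ from the corresponding ones of the second by a
permutation in one coordinate. -/
def CondRel (n : ℕ) : ∀ t, Set (Tow n t → Fin 4) → Set (Tow n t → Fin 4) → Prop
  | 0, A, B => Stiff A → ∃ j, IsAct j A B
  | t + 1, A, B => ∀ v, CondRel n t (layer A v) (layer B v)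

theorem Good.rel : ∀ {t} {A B : Set (Tow n t → Fin 4)}, Good n t A → CondRel n t A B →
    FaceRel n t A B ∧ HasStiff n t B
  | 0, A, B, h, hc => by
    obtain ⟨j, hj⟩ := hc h
    exact ⟨⟨j, hj⟩, Stiff.of_isAct (ι := Fin n) h hj⟩
  | t + 1, A, B, h, hc => ⟨fun v => (Good.rel (h.1 v) (hc v)).1, 0, (Good.rel (h.1 0) (hc 0)).2⟩

/-- In dimension `n + 1`, `Stiff.of_layer` leaves only the split case. Higher up, the relation is
read off the subfaces that contain the new direction. -/
theorem condRel_of_noStiff (hn : n ≠ 0) : ∀ t (D : Set (Option (Tow n t) → Fin 4)), IsCode D → NoStiff n D →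
    ∀ v w, CondRel n t (layer D v) (layer D w)
  | 0, D, hD, hN, v, w => by
    intro hS
    have : Nonempty (Fin n) := ⟨⟨0, by omega⟩⟩
    rcases Stiff.of_layer (ι := Fin n) hD hS with h | ⟨j, h⟩
    · have := hN (Function.Embedding.refl _) fun _ => 0
      refine (this ?_).elim
      have e : face D (Function.Embedding.refl _) (fun _ => 0) = D := by
        ext x
        have : Function.extend (Function.Embedding.refl (Option (Tow n 0))) x (fun _ => 0) = x :=
          funext fun i => (Function.Embedding.refl _).injective.extend_apply x _ i
        show _ ∈ D ↔ _
        rw [this]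
      exact e.symm ▸ h
    · exact ⟨j, h v w⟩
  | t + 1, D, hD, hN, v, w => by
    intro u
    have h := condRel_of_noStiff hn t (glue fun v => cell (ι := Tow n t) D v u) (IsCode.col (ι := Tow n t) hD u)
      (NoStiff.glue_cell (ι := Tow n t) hN u) v w
    exact h

/-- An image of a stiff face is stiff, so stiffness spreads from one face to all parallel ones. -/
theorem good_of_noStiff (hn : n ≠ 0) : ∀ t (C : Set (Tow n t → Fin 4)), IsCode C → NoStiff n C → HasStiff n t C →
    Good n t C
  | 0, C, hC, hN, h => h
  | t + 1, C, hC, hN, h => by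
    have ih : ∀ v, HasStiff n t (layer C v) → Good n t (layer C v) := fun v hv =>
      good_of_noStiff hn t _ (IsCode.layer (ι := Tow n t) hC v) (NoStiff.layer (ι := Tow n t) hN v) hv
    have hc := condRel_of_noStiff hn t C hC hN
    obtain ⟨v, hv⟩ := h
    have hg : ∀ w, Good n t (layer C w) := fun w => ih w (Good.rel (ih v hv) (hc v w)).2
    exact ⟨hg, fun v w => (Good.rel (hg v) (hc v w)).1⟩

/-- The coordinates outside the face are adjoined one at a time, so that the stiff face becomes the
base of the tower. -/
theorem exists_tower : ∀ (t : ℕ) {ι : Type} [DecidableEq ι] [Finite ι], Nat.card ι = n + t →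
    ∀ (C : Set (ι → Fin 4)) (e : Fin n ↪ ι) (y : ι → Fin 4), Stiff (face C e y) →
      ∃ E : ι ≃ Tow n t, HasStiff n t {x | x ∘ E ∈ C}
  | 0, ι, _, _, hc, C, e, y, h => by
    have hb : Function.Bijective e := by
      cases nonempty_fintype ι
      rw [Fintype.bijective_iff_injective_and_card]
      refine ⟨e.injective, ?_⟩
      rw [Fintype.card_fin, ← Nat.card_eq_fintype_card (α := ι), hc]; rfl
    have : {x : Fin n → Fin 4 | x ∘ (Equiv.ofBijective e hb).symm ∈ C} = face C e y := by
      ext x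
      have : x ∘ (Equiv.ofBijective e hb).symm = Function.extend e x y := by
        funext i
        obtain ⟨k, rfl⟩ := hb.2 i
        rw [e.injective.extend_apply]
        show x ((Equiv.ofBijective e hb).symm (Equiv.ofBijective e hb k)) = _
        rw [Equiv.symm_apply_apply]
      show x ∘ _ ∈ C ↔ _
      rw [this]; rfl
    have key : Stiff {x : Fin n → Fin 4 | x ∘ (Equiv.ofBijective e hb).symm ∈ C} := by rw [this]; exact h
    exact ⟨(Equiv.ofBijective e hb).symm, key⟩
  | t + 1, ι, _, _, hc, C, e, y, h => by
    obtain ⟨i, hi⟩ : ∃ i, ∀ k, e k ≠ i := by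
      by_contra hcon
      push Not at hcon
      have := Nat.card_le_card_of_surjective e hcon
      rw [hc, Nat.card_fin] at this
      omega
    let α := {k : ι // k ≠ i}
    let o : ι ≃ Option α := (Equiv.optionSubtypeNe i).symm
    have oi : o i = none := Equiv.optionSubtypeNe_symm_self i
    have ok : ∀ k : α, o k.1 = some k := fun k => Equiv.optionSubtypeNe_symm_of_ne k.2
    have hcα : Nat.card α = n + t := by
      have := Nat.card_congr o
      rw [hc, Finite.card_option] at this
      omega
    let e' : Fin n ↪ α := ⟨fun k => ⟨e k, hi k⟩, fun k l h => e.injective (congrArg Subtype.val h)⟩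
    let C' : Set (α → Fin 4) := {x | cons (y i) x ∘ o ∈ C}
    have hf : face C' e' (fun k => y k.1) = face C e y := by
      ext x
      have : cons (y i) (Function.extend e' x fun k => y k.1) ∘ o = Function.extend e x y := by
        funext k
        by_cases hk : k = i
        · subst hk
          rw [Function.extend_apply' _ _ _ (by rintro ⟨m, hm⟩; exact hi m hm), Function.comp_apply, oi]; rfl
        · rw [Function.comp_apply, ok ⟨k, hk⟩]
          rw [cons_some]
          by_cases hm : ∃ m, e m = k
          · obtain ⟨m, rfl⟩ := hm
            rw [e.injective.extend_apply]
            exact e'.injective.extend_apply x _ m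
          · rw [Function.extend_apply' _ _ _ hm, Function.extend_apply']
            rintro ⟨m, hm'⟩
            exact hm ⟨m, congrArg Subtype.val hm'⟩
      show cons (y i) _ ∘ o ∈ C ↔ _
      rw [this]; rfl
    obtain ⟨E, hE⟩ := exists_tower t hcα C' e' (fun k => y k.1) (by rw [hf]; exact h)
    refine ⟨o.trans (Equiv.optionCongr E), y i, ?_⟩
    have key : ∀ {β : Type} (E : α ≃ β), layer {x | x ∘ (o.trans (Equiv.optionCongr E)) ∈ C} (y i) = {x | x ∘ E ∈ C'} := by
      intro β E
      ext x
      have : cons (y i) x ∘ (o.trans (Equiv.optionCongr E)) = cons (y i) (x ∘ E) ∘ o := by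
        funext k
        show cons (y i) x (Equiv.optionCongr E (o k)) = cons (y i) (x ∘ E) (o k)
        cases o k <;> rfl
      show cons (y i) x ∘ _ ∈ C ↔ _
      rw [this]; rfl
    exact (key E).symm ▸ hE

/-- A code outside all linear sets is a tower of mutually related stiff faces. -/
theorem exists_good {ι : Type} [DecidableEq ι] [Finite ι] [Nonempty ι] {C : Set (ι → Fin 4)} (hC : IsCode C)
    (hS : ¬ Semi C) : ∃ n t, 3 ≤ n ∧ Nat.card ι = n + (t + 1) ∧ ∃ E : ι ≃ Tow n (t + 1), Good n (t + 1) {x | x ∘ E ∈ C} := by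
  classical
  let P : ℕ → Prop := fun n => ∃ (e : Fin n ↪ ι) (y : ι → Fin 4), Stiff (face C e y)
  have h3 : P 3 := exists_stiff_face hC hS
  have hle : ∀ m, P m → m ≤ Nat.card ι := by
    rintro m ⟨e, -⟩
    simpa using Nat.card_le_card_of_injective e e.injective
  -- The largest dimension of a stiff face.
  set n := Nat.findGreatest P (Nat.card ι) with hn
  have hPn : P n := Nat.findGreatest_spec (hle 3 h3) h3
  have hn3 : 3 ≤ n := Nat.le_findGreatest (hle 3 h3) h3
  obtain ⟨e, y, hst⟩ := hPn
  have hnc := hle n ⟨e, y, hst⟩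
  have hN : NoStiff n C := by
    intro e' y' hst'
    have : P (n + 1) := by
      let f : Fin (n + 1) ≃ Option (Fin n) := finSuccEquiv n
      refine ⟨f.toEmbedding.trans e', y', ?_⟩
      have h1 := hst'.reindex f.symm
      rw [reindex_eq_face, face_face] at h1
      have key : face C (f.symm.symm.toEmbedding.trans e') (Function.extend e' (fun _ => 0) y') =
          face C (f.toEmbedding.trans e') y' := by
        ext x
        have : Function.extend (f.symm.symm.toEmbedding.trans e') x (Function.extend e' (fun _ => 0) y') =
            Function.extend (f.toEmbedding.trans e') x y' := by
          funext i
          by_cases h : ∃ m, (f.toEmbedding.trans e') m = i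
          · obtain ⟨m, rfl⟩ := h
            rw [(f.toEmbedding.trans e').injective.extend_apply]
            exact (f.symm.symm.toEmbedding.trans e').injective.extend_apply x _ m
          · rw [Function.extend_apply' x y' i h]
            refine (Function.extend_apply' x _ i (f := f.symm.symm.toEmbedding.trans e') h).trans ?_
            rw [Function.extend_apply']
            rintro ⟨m, hm⟩
            exact h ⟨f.symm m, by simpa using hm⟩
        show _ ∈ C ↔ _ ∈ C
        rw [this]
      rw [← key]; exact h1
    have := Nat.le_findGreatest (hle _ this) this
    omega
  -- A stiff code is semilinear, so the whole code is not stiff and at least one coordinate is left.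
  have hlt : n ≠ Nat.card ι := by
    intro heq
    obtain ⟨E, hE⟩ := exists_tower (n := n) 0 (by omega) C e y hst
    have h1 : Stiff (ι := Fin n) {x | x ∘ E ∈ C} := hE
    obtain ⟨F, hF, h2⟩ := h1.semi
    refine hS ⟨_, hF.twist (κ := ι) (Equiv.symm E) (fun _ => Equiv.refl _), fun x hx => h2 _ ?_⟩
    show _ ∘ E ∈ C
    have : twist (Equiv.symm E) (fun _ => Equiv.refl _) x ∘ E = x := by
      funext i; simp [twist]
    rw [this]; exact hx
  obtain ⟨t, ht⟩ : ∃ t, Nat.card ι = n + (t + 1) := ⟨Nat.card ι - n - 1, by omega⟩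
  obtain ⟨E, hE⟩ := exists_tower (n := n) (t + 1) ht C e y hst
  refine ⟨n, t, hn3, ht, E, good_of_noStiff (by omega) _ _ (hC.reindex E) ?_ hE⟩
  rw [reindex_eq_face]
  exact hN.face _ _

end TowerFaces

/-! ### Counting semilinear codes and codes with connected unions of layers. -/

section Counting

theorem ncard_le_mul {α β : Type*} [Finite α] [Finite β] {S : Set α} {U : Set β} (R : α → β → Prop) {m : ℕ}
    (h1 : ∀ a ∈ S, ∃ b ∈ U, R a b) (h2 : ∀ b ∈ U, {a | a ∈ S ∧ R a b}.ncard ≤ m) : S.ncard ≤ m * U.ncard := by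
  classical
  cases nonempty_fintype α
  cases nonempty_fintype β
  have hsub : S.toFinset ⊆ U.toFinset.biUnion fun b => {a | a ∈ S ∧ R a b}.toFinset := by
    intro a ha
    obtain ⟨b, hb, hR⟩ := h1 a (Set.mem_toFinset.1 ha)
    exact Finset.mem_biUnion.2 ⟨b, Set.mem_toFinset.2 hb, Set.mem_toFinset.2 ⟨Set.mem_toFinset.1 ha, hR⟩⟩
  rw [Set.ncard_eq_toFinset_card', Set.ncard_eq_toFinset_card', mul_comm]
  refine (Finset.card_le_card hsub).trans (Finset.card_biUnion_le_card_mul _ _ _ fun b hb => ?_)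
  rw [← Set.ncard_eq_toFinset_card']
  exact h2 b (Set.mem_toFinset.1 hb)

/-- The number of codes with coordinates in `ι`. -/
noncomputable def numC (ι : Type*) [DecidableEq ι] : ℕ := {C : Set (ι → Fin 4) | IsCode C}.ncard

variable {ι κ : Type*} [DecidableEq ι] [DecidableEq κ] [Finite ι] [Finite κ]

theorem numC_le (e : ι ≃ κ) : numC ι ≤ numC κ :=
  Set.ncard_le_ncard_of_injOn (fun X => {x : κ → Fin 4 | x ∘ e ∈ X}) (fun X hX => IsCode.reindex e hX)
    (preimage_comp_injective e).injOn (Set.toFinite _)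

theorem numC_eq_of_card {N : ℕ} (h : Nat.card ι = N) : numC ι = numC (Fin N) := by
  have e : ι ≃ Fin N := (Finite.equivFin ι).trans (finCongr h)
  exact le_antisymm (numC_le e) (numC_le e.symm)

theorem LinF.eq_of_lab {F G : (ι → Fin 4) → ZMod 2} (hF : LinF F) (hG : LinF G)
    (h0 : F (fun _ => 0) = G fun _ => 0) (h : ∀ j, lab F j = lab G j) : F = G := by
  funext x
  refine mem_of_closed (P := fun x => F x = G x) (D := Set.univ) (x := fun _ => 0) ?_ h0 (by simp)
  intro z hz i _ q
  rw [hF.update, hG.update, hz, h]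

theorem Bal.eq_of_pairSwap {f g : Fin 4 → ZMod 2} (hf : Bal f) (hg : Bal g) (h0 : f 0 = g 0)
    (h : pairSwap f 0 = pairSwap g 0) : f = g := by
  have key : ∀ f ∈ balList, ∀ g ∈ balList, f 0 = g 0 → pairSwap f 0 = pairSwap g 0 → f = g := by decide +kernel
  exact key f (mem_balList hf) g (mem_balList hg) h0 h

/-- The value at the origin and, for each coordinate, the partner of the symbol `0` determine the
function. -/
theorem ncard_linF_le : {F : (ι → Fin 4) → ZMod 2 | LinF F}.ncard ≤ 2 * 3 ^ Nat.card ι := by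
  classical
  cases nonempty_fintype ι
  have h3 : (2 * 3 ^ Nat.card ι) = (Set.univ : Set (ZMod 2 × (ι → {t : Fin 4 // t ≠ 0}))).ncard := by
    rw [Set.ncard_univ, Nat.card_prod, Nat.card_pi, Finset.prod_const, Nat.card_eq_fintype_card,
      Nat.card_eq_fintype_card, Nat.card_eq_fintype_card, Finset.card_univ]
    rfl
  rw [h3]
  -- The default value `1` never occurs, since the partner of `0` differs from `0`.
  refine Set.ncard_le_ncard_of_injOn (fun F => (F fun _ => 0, fun j =>
    if h : pairSwap (lab F j) 0 ≠ 0 then ⟨pairSwap (lab F j) 0, h⟩ else ⟨1, by decide⟩)) (fun _ _ => Set.mem_univ _) ?_ (Set.toFinite _)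
  intro F hF G hG h
  rw [Prod.mk.injEq] at h
  refine LinF.eq_of_lab hF hG h.1 fun j => ?_
  refine (LinF.bal_lab hF j).eq_of_pairSwap (LinF.bal_lab hG j) ?_ ?_
  · have : Function.update (fun _ : ι => (0 : Fin 4)) j 0 = fun _ => 0 := Function.update_eq_self j _
    simp only [lab, this, h.1]
  · have := congrFun h.2 j
    rw [dif_pos ((LinF.bal_lab hF j).pairSwap_ne 0), dif_pos ((LinF.bal_lab hG j).pairSwap_ne 0)] at this
    exact congrArg Subtype.val this

theorem ncard_semi_le {ι : Type} [DecidableEq ι] [Finite ι] :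
    {C : Set (ι → Fin 4) | IsCode C ∧ Semi C}.ncard ≤ 2 ^ 2 ^ (Nat.card ι - 1) * (2 * 3 ^ Nat.card ι) := by
  refine (ncard_le_mul (U := {F : (ι → Fin 4) → ZMod 2 | LinF F}) (fun C F => ∀ x ∈ C, F x = 0)
    (m := 2 ^ 2 ^ (Nat.card ι - 1)) ?_ ?_).trans (Nat.mul_le_mul_left _ ncard_linF_le)
  · rintro C ⟨-, F, hF, h⟩
    exact ⟨F, hF, h⟩
  · intro F hF
    refine le_trans (Set.ncard_le_ncard ?_ (Set.toFinite _)) (numSub_le hF.1)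
    rintro C ⟨⟨h1, -⟩, h2⟩
    exact ⟨h1, h2⟩

/-- The zero set of `F` is connected. -/
def LevelConn (F : (ι → Fin 4) → ZMod 2) : Prop := ∀ x y, F x = 0 → F y = 0 → Conn F Set.univ x y


theorem LevelConn.reindex {F : (ι → Fin 4) → ZMod 2} (h : LevelConn F) (e : ι ≃ κ) :
    LevelConn fun x : κ → Fin 4 => F (x ∘ e) := by
  intro x y hx hy
  have := (h _ _ hx hy).reindex e
  simpa [Function.comp_assoc] using this

/-- The unions of two parallel layers are connected. -/
def AllConn {M : ℕ} (C : Set (Fin (M + 1) → Fin 4)) : Prop :=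
  ∀ E : Fin (M + 1) ≃ Option (Fin M), ∀ v w, v ≠ w →
    LevelConn (dbl (layer {x | x ∘ E ∈ C} v) (layer {x | x ∘ E ∈ C} w))

theorem AllConn.conn {M : ℕ} {C : Set (Fin (M + 1) → Fin 4)} (h : AllConn C) {κ : Type} [DecidableEq κ] [Finite κ]
    (E : Fin (M + 1) ≃ Option κ) {v w : Fin 4} (hvw : v ≠ w) :
    LevelConn (dbl (layer {x | x ∘ E ∈ C} v) (layer {x | x ∘ E ∈ C} w)) := by
  have hc : Nat.card κ = M := by
    have := Nat.card_congr E
    rw [Nat.card_fin, Finite.card_option] at this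
    omega
  let e : κ ≃ Fin M := (Finite.equivFin κ).trans (finCongr hc)
  have := (h (E.trans (Equiv.optionCongr e)) v w hvw).reindex e.symm
  have key : ∀ v (x : κ → Fin 4), cons v (x ∘ e.symm) ∘ (E.trans (Equiv.optionCongr e)) = cons v x ∘ E := by
    intro v x
    funext i
    show cons v (x ∘ e.symm) (Equiv.optionCongr e (E i)) = cons v x (E i)
    cases E i <;> simp
  have h2 : (fun x : κ → Fin 4 => dbl (layer {x | x ∘ (E.trans (Equiv.optionCongr e)) ∈ C} v)
      (layer {x | x ∘ (E.trans (Equiv.optionCongr e)) ∈ C} w) (x ∘ e.symm)) =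
      dbl (layer {x | x ∘ E ∈ C} v) (layer {x | x ∘ E ∈ C} w) := by
    funext x
    refine dbl_congr (or_congr ?_ ?_)
    · show cons v _ ∘ _ ∈ C ↔ cons v x ∘ E ∈ C
      rw [key]
    · show cons w _ ∘ _ ∈ C ↔ cons w x ∘ E ∈ C
      rw [key]
  rw [h2] at this
  exact this

/-- The number of codes with connected unions of two layers, given the choices for the second layer. -/
theorem ncard_le_of_two_layers {S : Set (Set (Option ι → Fin 4))} {d : ℕ} (N : Set (ι → Fin 4) → Set (Set (ι → Fin 4)))
    (hS : ∀ C ∈ S, IsCode C ∧ layer C 1 ∈ N (layer C 0) ∧ (N (layer C 0)).ncard ≤ d ∧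
      LevelConn (dbl (layer C 2) (layer C 3))) : S.ncard ≤ 2 * d * numC ι := by
  refine ncard_le_mul (U := {A : Set (ι → Fin 4) | IsCode A}) (fun C A => layer C 0 = A)
    (fun C hC => ⟨_, (hS C hC).1.layer 0, rfl⟩) fun A hA => ?_
  by_cases hd : (N A).ncard ≤ d
  swap
  · rw [Set.ncard_eq_zero (Set.toFinite _) |>.2]
    · exact Nat.zero_le _
    · refine Set.eq_empty_of_forall_notMem ?_
      rintro C ⟨hC, rfl⟩
      exact hd (hS C hC).2.2.1
  refine (ncard_le_mul (U := N A) (fun C B => layer C 1 = B) (m := 2) ?_ fun B hB => ?_).trans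
    (Nat.mul_le_mul_left 2 hd)
  · rintro C ⟨hC, rfl⟩
    exact ⟨_, (hS C hC).2.1, rfl⟩
  rcases Set.eq_empty_or_nonempty {C | C ∈ {C | C ∈ S ∧ layer C 0 = A} ∧ layer C 1 = B} with h | ⟨C₀, ⟨h₀, h1⟩, h2⟩
  · rw [h, Set.ncard_empty]; exact Nat.zero_le _
  have hc₀ := (hS C₀ h₀).1
  have hb : BalF (dbl (layer C₀ 2) (layer C₀ 3)) := balF_dbl (hc₀.layer 2) (hc₀.layer 3) fun x h h' =>
    hc₀.layer_disjoint (by decide) h h'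
  -- The layers `0` and `1` fix the union of the other two. Connectedness leaves two choices for
  -- layer `2`, and layer `3` is the rest.
  refine le_trans ?_ (numSub_le_two hb (hS C₀ h₀).2.2.2)
  refine Set.ncard_le_ncard_of_injOn (fun C => layer C 2) ?_ ?_ (Set.toFinite _)
  · rintro C ⟨⟨hC, e0⟩, e1⟩
    refine ⟨(hS C hC).1.layer 2, fun x hx => dbl_eq_zero.2 ?_⟩
    have hn0 : x ∉ layer C₀ 0 := by
      rw [h1, ← e0]; exact fun h => (hS C hC).1.layer_disjoint (by decide : (0 : Fin 4) ≠ 2) h hx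
    have hn1 : x ∉ layer C₀ 1 := by
      rw [h2, ← e1]; exact fun h => (hS C hC).1.layer_disjoint (by decide : (1 : Fin 4) ≠ 2) h hx
    obtain ⟨v, hv⟩ := (hc₀.layer_unique x).exists
    have : ∀ v : Fin 4, v = 0 ∨ v = 1 ∨ v = 2 ∨ v = 3 := by decide
    rcases this v with rfl | rfl | rfl | rfl
    · exact absurd hv hn0
    · exact absurd hv hn1
    · exact Or.inl hv
    · exact Or.inr hv
  · rintro C ⟨⟨hC, e0⟩, e1⟩ C' ⟨⟨hC', e0'⟩, e1'⟩ e2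
    exact eq_of_three_layers (hS C hC).1 (hS C' hC').1 (a := 0) (b := 1) (c := 2) (by decide) (by decide) (by decide)
      (e0.trans e0'.symm) (e1.trans e1'.symm) e2

/-- The bound for codes without disconnected unions of two layers. -/
theorem ncard_irreducible_le {M d : ℕ} (hd : ∀ n t, 3 ≤ n → n + t = M → ∀ A : Set (Tow n t → Fin 4), IsCode A →
    Good n t A → 2 * (Nbrs n t A).ncard ≤ d) :
    {C : Set (Fin (M + 1) → Fin 4) | IsCode C ∧ ¬ Semi C ∧ AllConn C}.ncard ≤
      (d * numC (Fin M)) * ((M + 1) * (M + 1).factorial) := by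
  -- A fixed identification for each base dimension, so that a tower is recorded by its base
  -- dimension and a permutation of the coordinates.
  have hE : ∀ n : Fin (M + 1), Nonempty (Fin (M + 1) ≃ Tow n (M - n + 1)) := fun n =>
    ⟨(Finite.equivFinOfCardEq (by rw [Tow.card]; omega)).symm⟩
  let E := fun n => (hE n).some
  have hU : (Set.univ : Set (Fin (M + 1) × Equiv.Perm (Fin (M + 1)))).ncard = (M + 1) * (M + 1).factorial := by
    rw [Set.ncard_univ, Nat.card_prod, Nat.card_perm, Nat.card_fin]
  rw [← hU]
  refine ncard_le_mul (fun C p => 3 ≤ p.1.val ∧ Good p.1 (M - p.1 + 1) {x | x ∘ (p.2.trans (E p.1)) ∈ C}) ?_ ?_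
  · rintro C ⟨hC, hS, -⟩
    obtain ⟨n, t, hn, hc, e, hg⟩ := exists_good hC hS
    rw [Nat.card_fin] at hc
    obtain rfl : t = M - n := by omega
    refine ⟨(⟨n, by omega⟩, e.trans (E ⟨n, by omega⟩).symm), Set.mem_univ _, hn, ?_⟩
    have : (e.trans (E ⟨n, by omega⟩).symm).trans (E ⟨n, by omega⟩) = e := by
      ext x; simp
    simp only [this]
    exact hg
  · rintro ⟨n, σ⟩ -
    by_cases hn : 3 ≤ n.val
    swap
    · have : {C | C ∈ {C : Set (Fin (M + 1) → Fin 4) | IsCode C ∧ ¬ Semi C ∧ AllConn C} ∧ 3 ≤ n.val ∧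
          Good n (M - n + 1) {x | x ∘ (σ.trans (E n)) ∈ C}} = ∅ :=
        Set.eq_empty_of_forall_notMem fun C hC => hn hC.2.1
      rw [this, Set.ncard_empty]; exact Nat.zero_le _
    have hnt : n.val + (M - n.val) = M := by omega
    set e : Fin (M + 1) ≃ Option (Tow n (M - n)) := σ.trans (E n) with he
    refine le_trans (Set.ncard_le_ncard_of_injOn (fun C => {x : Option (Tow n (M - n)) → Fin 4 | x ∘ e ∈ C})
      (t := {D | IsCode (ι := Option (Tow n (M - n))) D ∧ Good n (M - n + 1) D ∧ LevelConn (dbl (layer D 2) (layer D 3))})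
      ?_ (preimage_comp_injective e).injOn (Set.toFinite _)) ?_
    · rintro C ⟨⟨hC, hS, ha⟩, -, hg⟩
      exact ⟨hC.reindex e, hg, ha.conn e (by decide)⟩
    · refine (ncard_le_of_two_layers (ι := Tow n (M - n)) (d := d / 2)
        (fun A => {B | B ∈ Nbrs n (M - n) A ∧ Good n (M - n) A ∧ IsCode A}) ?_).trans ?_
      · rintro D ⟨hD, hg, hl⟩
        have hg' : (∀ v, Good n (M - n) (layer D v)) ∧ ∀ v w, FaceRel n (M - n) (layer D v) (layer D w) := hg
        refine ⟨hD, ⟨⟨hD.layer 1, hg'.1 1, hg'.2 0 1, fun x h h' => hD.layer_disjoint (by decide) h h'⟩, hg'.1 0, hD.layer 0⟩,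
          (Set.ncard_le_ncard (t := Nbrs n (M - n) (layer D 0)) (fun B hB => hB.1) (Set.toFinite _)).trans ?_, hl⟩
        rw [Nat.le_div_iff_mul_le (by norm_num), mul_comm]
        exact hd n (M - n) hn hnt _ (hD.layer 0) (hg'.1 0)
      · rw [numC_eq_of_card (ι := Tow n (M - n)) (N := M) (by rw [Tow.card]; exact hnt)]
        exact Nat.mul_le_mul_right _ (Nat.mul_div_le _ _)

end Counting

/-! ### Counting codes with a disconnected union of two layers. -/

section Reducible

theorem linF_of_splitOn {ι : Type*} [DecidableEq ι] {F : (ι → Fin 4) → ZMod 2} (hF : BalF F)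
    (h : ∀ i, SplitOn F {i}) : LinF F := by
  refine ⟨hF, fun x y i q r => ?_⟩
  have := h i (Function.update x i q) (Function.update x i r) (Function.update y i q) (Function.update y i r)
    (by rintro k rfl; simp) (fun k hk => by
      have : k ≠ i := hk
      simp [this])
  have fin : ∀ a b c d : ZMod 2, a + b + c + d = 0 → a + b = c + d := by decide
  exact fin _ _ _ _ this

theorem semi_of_dbl {κ : Type*} [DecidableEq κ] {D : Set (Option κ → Fin 4)} (hD : IsCode D) {v w : Fin 4}
    (hvw : v ≠ w) (hF : LinF (dbl (layer D v) (layer D w))) : Semi D := by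
  refine ⟨_, hF.extend (bal_ind2 hvw), ?_⟩
  rw [forall_cons]
  intro u x hx
  have hu : x ∈ layer D u := hx
  simp only [cons_some, cons_none]
  by_cases h : u = v ∨ u = w
  · rw [ind2_eq_zero.2 h, dbl_eq_zero.2]
    · rfl
    · rcases h with rfl | rfl
      · exact Or.inl hu
      · exact Or.inr hu
  · push Not at h
    rw [ind2_eq_one.2 h, dbl_ne_zero.2]
    · rfl
    · exact ⟨fun h' => hD.layer_disjoint h.1 hu h', fun h' => hD.layer_disjoint h.2 hu h'⟩

/-- A block containing all directions would make the zero set connected. If all blocks were single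
directions, the function would be linear and the code semilinear. -/
theorem exists_block {κ : Type*} [DecidableEq κ] [Finite κ] {D : Set (Option κ → Fin 4)} (hD : IsCode D)
    (hS : ¬ Semi D) {v w : Fin 4} (hvw : v ≠ w) (hc : ¬ LevelConn (dbl (layer D v) (layer D w))) :
    ∃ I a, IsBlk (dbl (layer D v) (layer D w)) a I ∧ 2 ≤ I.ncard ∧ I ≠ Set.univ := by
  have hF : BalF (dbl (layer D v) (layer D w)) := balF_dbl (hD.layer v) (hD.layer w) fun x h h' =>
    hD.layer_disjoint hvw h h'
  set F := dbl (layer D v) (layer D w) with hFd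
  unfold LevelConn at hc
  push Not at hc
  obtain ⟨x, y, hx, hy, hn⟩ := hc
  have hu : ∀ i, blk F x i ≠ Set.univ := fun i h => hn (conn_of_blk_univ hF h (hy.trans hx.symm))
  by_cases h : ∀ i, blk F x i = {i}
  · exact (hS (semi_of_dbl hD hvw (linF_of_splitOn hF fun i => by
      have := isBlk_blk hF x i
      rw [h i] at this
      exact this.splitOn hF ⟨i, rfl⟩))).elim
  · push Not at h
    obtain ⟨i, hi⟩ := h
    refine ⟨blk F x i, x, isBlk_blk hF x i, ?_, hu i⟩
    have h1 := self_mem_blk (a := x) hF i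
    by_contra hcon
    have h2 : (blk F x i).ncard = 1 := by
      have : (blk F x i).ncard ≠ 0 := by
        rw [Ne, Set.ncard_eq_zero (Set.toFinite _)]
        exact Set.nonempty_iff_ne_empty.1 ⟨i, h1⟩
      omega
    obtain ⟨j, hj⟩ := Set.ncard_eq_one.1 h2
    rw [hj] at h1
    rw [hj, Set.mem_singleton_iff.1 h1] at hi
    exact hi rfl

theorem layer_face_optionMap {κ μ : Type*} (D : Set (Option κ → Fin 4)) (j : μ ↪ κ) (v : Fin 4) :
    layer (face D (Function.Embedding.optionMap j) fun _ => 0) v = face (layer D v) j fun _ => 0 := by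
  ext x
  have : Function.extend (Function.Embedding.optionMap j) (cons v x) (fun _ => 0) =
      cons v (Function.extend j x fun _ => 0) := by
    funext o
    cases o with
    | none => exact (Function.Embedding.optionMap j).injective.extend_apply (cons v x) _ none
    | some k =>
      rw [cons_some]
      by_cases h : ∃ m, j m = k
      · obtain ⟨m, rfl⟩ := h
        rw [j.injective.extend_apply]
        exact (Function.Embedding.optionMap j).injective.extend_apply (cons v x) _ (some m)
      · rw [Function.extend_apply' _ _ _ h, Function.extend_apply']
        rintro ⟨_ | m, hm⟩
        · simp at hm
        · exact h ⟨m, by simpa using hm⟩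
  show _ ∈ D ↔ cons v _ ∈ D
  rw [this]

theorem numSub_add_const_le {n : ℕ} {ι : Type} [Finite ι] [DecidableEq ι] {F : (ι → Fin 4) → ZMod 2}
    (hF : BalF F) {I : Set ι} (hn : Iᶜ.ncard = n)
    (hI : ∀ x y, (∀ i ∉ I, y i = x i) → F x = F y → Conn F I x y) (c : ZMod 2) :
    numSub (fun x => F x + c) ≤ 2 ^ 2 ^ n :=
  numSub_le_of_block (hF.add_const c) hn fun x y h e =>
    Conn.congr_fun (fun _ _ h => by rw [h]) (hI x y h (add_right_cancel e))

/-- The number of codes in which the union of two given layers has a given block. -/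
theorem ncard_le_of_block {κ : Type} [DecidableEq κ] [Finite κ] {v w : Fin 4} (hvw : v ≠ w) {I : Set κ} {p q : ℕ}
    (hp : I.ncard = p) (hq : Iᶜ.ncard = q) (hp0 : p ≠ 0) (hq0 : q ≠ 0) :
    {D : Set (Option κ → Fin 4) | IsCode D ∧ ∃ a, IsBlk (dbl (layer D v) (layer D w)) a I}.ncard ≤
      (2 ^ 2 ^ q * 2 ^ 2 ^ q) * (numC (Fin (p + 1)) * numC (Fin (q + 1))) := by
  classical
  have hne : I.Nonempty := Set.nonempty_of_ncard_ne_zero (by omega)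
  have hIu : I ≠ Set.univ := by
    rintro rfl
    rw [Set.compl_univ, Set.ncard_empty] at hq
    omega
  let jI : I ↪ κ := Function.Embedding.subtype _
  let jJ : (Iᶜ : Set κ) ↪ κ := Function.Embedding.subtype _
  have cI : numC (Option I) = numC (Fin (p + 1)) := numC_eq_of_card (by rw [Finite.card_option, Nat.card_coe_set_eq, hp])
  have cJ : numC (Option (Iᶜ : Set κ)) = numC (Fin (q + 1)) :=
    numC_eq_of_card (by rw [Finite.card_option, Nat.card_coe_set_eq, hq])
  rw [← cI, ← cJ, numC, numC, ← Set.ncard_prod]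
  let G : Set (Option κ → Fin 4) → (κ → Fin 4) → ZMod 2 := fun D => dbl (layer D v) (layer D w)
  refine ncard_le_mul (fun D p => face D (Function.Embedding.optionMap jI) (fun _ => 0) = p.1 ∧
    face D (Function.Embedding.optionMap jJ) (fun _ => 0) = p.2) ?_ ?_
  · rintro D ⟨hD, -⟩
    exact ⟨(_, _), ⟨hD.face _ _, hD.face _ _⟩, rfl, rfl⟩
  · rintro ⟨P, P'⟩ -
    have hbal : ∀ {D : Set (Option κ → Fin 4)}, IsCode D → BalF (G D) := fun {D} hD =>
      balF_dbl (hD.layer v) (hD.layer w) fun x h h' => hD.layer_disjoint hvw h h'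
    rcases Set.eq_empty_or_nonempty {D | D ∈ {D : Set (Option κ → Fin 4) | IsCode D ∧ ∃ a, IsBlk (G D) a I} ∧
        face D (Function.Embedding.optionMap jI) (fun _ => 0) = P ∧
        face D (Function.Embedding.optionMap jJ) (fun _ => 0) = P'} with h | ⟨D₀, ⟨hD₀, a₀, hb₀⟩, e₀, e₀'⟩
    · exact (le_of_eq_of_le (congrArg Set.ncard h) (by simp))
    have hF := hbal hD₀
    have hcon := fun x y => hb₀.conn_coset' hF hne hIu (x := x) (y := y)
    -- The block splits the function, so its restrictions to the two faces through the origin, along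
    -- `I` and along the complement, determine it.
    have split : ∀ {D : Set (Option κ → Fin 4)} {a}, IsCode D → IsBlk (G D) a I → ∀ x,
        G D x = G D (Function.extend jI (x ∘ jI) fun _ => 0) + G D (Function.extend jJ (x ∘ jJ) fun _ => 0) +
          G D (Function.extend jI ((fun _ => 0) ∘ jI) fun _ => 0) := by
      intro D a hD hb x
      have inI : ∀ (y : κ → Fin 4) i, i ∈ I → Function.extend jI (y ∘ jI) (fun _ => 0) i = y i := fun y i hi =>
        jI.injective.extend_apply (y ∘ jI) _ ⟨i, hi⟩
      have offI : ∀ (y : κ → Fin 4) i, i ∉ I → Function.extend jI (y ∘ jI) (fun _ => 0) i = 0 := fun y i hi =>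
        Function.extend_apply' _ _ _ (by rintro ⟨⟨k, hk⟩, rfl⟩; exact hi hk)
      have inJ : ∀ (y : κ → Fin 4) i, i ∉ I → Function.extend jJ (y ∘ jJ) (fun _ => 0) i = y i := fun y i hi =>
        jJ.injective.extend_apply (y ∘ jJ) _ ⟨i, hi⟩
      have offJ : ∀ (y : κ → Fin 4) i, i ∈ I → Function.extend jJ (y ∘ jJ) (fun _ => 0) i = 0 := fun y i hi =>
        Function.extend_apply' _ _ _ (by rintro ⟨⟨k, hk⟩, rfl⟩; exact hk hi)
      have := hb.splitOn (hbal hD) hne x (Function.extend jJ (x ∘ jJ) fun _ => 0)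
        (Function.extend jI (x ∘ jI) fun _ => 0) (Function.extend jI ((fun _ => 0) ∘ jI) fun _ => 0)
        (fun i hi => ⟨(inI x i hi).symm, by rw [offJ x i hi, inI _ i hi]⟩)
        (fun i hi => ⟨(inJ x i hi).symm, by rw [offI x i hi, offI _ i hi]⟩)
      have fin : ∀ a b c d : ZMod 2, a + b + c + d = 0 → a = c + b + d := by decide
      exact fin _ _ _ _ this
    have det : ∀ {D : Set (Option κ → Fin 4)} {a}, IsCode D → IsBlk (G D) a I →
        face D (Function.Embedding.optionMap jI) (fun _ => 0) = P →
        face D (Function.Embedding.optionMap jJ) (fun _ => 0) = P' → G D = G D₀ := by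
      intro D a hD hb e e'
      have f1 : ∀ (y : I → Fin 4), G D (Function.extend jI y fun _ => 0) = G D₀ (Function.extend jI y fun _ => 0) := by
        intro y
        have h1 : ∀ u, face (layer D u) jI (fun _ => 0) = face (layer D₀ u) jI fun _ => 0 := fun u => by
          rw [← layer_face_optionMap, ← layer_face_optionMap, e, e₀]
        exact dbl_congr (or_congr (Set.ext_iff.1 (h1 v) y) (Set.ext_iff.1 (h1 w) y))
      have f2 : ∀ (y : (Iᶜ : Set κ) → Fin 4), G D (Function.extend jJ y fun _ => 0) =
          G D₀ (Function.extend jJ y fun _ => 0) := by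
        intro y
        have h1 : ∀ u, face (layer D u) jJ (fun _ => 0) = face (layer D₀ u) jJ fun _ => 0 := fun u => by
          rw [← layer_face_optionMap, ← layer_face_optionMap, e', e₀']
        exact dbl_congr (or_congr (Set.ext_iff.1 (h1 v) y) (Set.ext_iff.1 (h1 w) y))
      funext x
      rw [split hD hb, split hD₀ hb₀, f1, f1, f2]
    obtain ⟨c, hcv, hcw⟩ : ∃ c, v ≠ c ∧ w ≠ c := by clear * -; revert v w; decide
    have n0 : numSub (fun x => G D₀ x + 0) ≤ 2 ^ 2 ^ q := numSub_add_const_le hF hq hcon 0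
    have n1 : numSub (fun x => G D₀ x + 1) ≤ 2 ^ 2 ^ q := numSub_add_const_le hF hq hcon 1
    refine le_trans ?_ (Nat.mul_le_mul n0 n1)
    rw [numSub, numSub, ← Set.ncard_prod]
    -- With the union known, layer `v` is a code in its zero set and a third layer `c` is a code in
    -- the opposite level; layer `w` and the last layer follow.
    refine Set.ncard_le_ncard_of_injOn (fun D => (layer D v, layer D c)) ?_ ?_ (Set.toFinite _)
    · rintro D ⟨⟨hD, a, hb⟩, e, e'⟩
      have hG := det hD hb e e'
      refine ⟨⟨hD.layer v, fun x hx => ?_⟩, ⟨hD.layer c, fun x hx => ?_⟩⟩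
      · rw [← hG, add_zero]; exact dbl_eq_zero.2 (Or.inl hx)
      · have : G D x = 1 := dbl_ne_zero.2 ⟨fun h => hD.layer_disjoint hcv h hx, fun h => hD.layer_disjoint hcw h hx⟩
        rw [← hG, this]; rfl
    · rintro D ⟨⟨hD, a, hb⟩, e, e'⟩ D' ⟨⟨hD', a', hb'⟩, f, f'⟩ h
      rw [Prod.mk.injEq] at h
      have hG := (det hD hb e e').trans (det hD' hb' f f').symm
      refine eq_of_three_layers hD hD' hvw hcv hcw h.1 ?_ h.2
      ext x
      have h1 : G D x = 0 ↔ G D' x = 0 := by rw [hG]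
      rw [dbl_eq_zero, dbl_eq_zero] at h1
      have h3 : x ∈ layer D v ↔ x ∈ layer D' v := by rw [h.1]
      have h4 : x ∈ layer D v → x ∉ layer D w := fun u v => hD.layer_disjoint hvw u v
      have h5 : x ∈ layer D' v → x ∉ layer D' w := fun u v => hD'.layer_disjoint hvw u v
      tauto

/-- The bound for codes with a disconnected union of two layers. -/
theorem ncard_reducible_le {M m : ℕ} (hm : ∀ p q, 2 ≤ p → 1 ≤ q → p + q = M →
      (2 ^ 2 ^ q * 2 ^ 2 ^ q) * (numC (Fin (p + 1)) * numC (Fin (q + 1))) ≤ m) :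
    {C : Set (Fin (M + 1) → Fin 4) | IsCode C ∧ ¬ Semi C ∧ ¬ AllConn C}.ncard ≤
      m * ((M + 1).factorial * (16 * 2 ^ M)) := by
  let E₀ : Fin (M + 1) ≃ Option (Fin M) := finSuccEquiv M
  have hU : (Set.univ : Set (Equiv.Perm (Fin (M + 1)) × ((Fin 4 × Fin 4) × Set (Fin M)))).ncard =
      (M + 1).factorial * (16 * 2 ^ M) := by
    rw [Set.ncard_univ, Nat.card_prod, Nat.card_perm, Nat.card_prod, Nat.card_prod, Nat.card_fin, Nat.card_fin,
      Nat.card_eq_fintype_card (α := Set (Fin M)), Fintype.card_set, Fintype.card_fin]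
  rw [← hU]
  refine ncard_le_mul (fun C b => b.2.1.1 ≠ b.2.1.2 ∧ 2 ≤ b.2.2.ncard ∧ b.2.2 ≠ Set.univ ∧
    IsCode {x | x ∘ (b.1.trans E₀) ∈ C} ∧
    ∃ a, IsBlk (dbl (layer {x | x ∘ (b.1.trans E₀) ∈ C} b.2.1.1) (layer {x | x ∘ (b.1.trans E₀) ∈ C} b.2.1.2)) a b.2.2) ?_ ?_
  · rintro C ⟨hC, hS, ha⟩
    unfold AllConn at ha
    push Not at ha
    obtain ⟨E, v, w, hvw, hl⟩ := ha
    have hSD : ¬ Semi {x : Option (Fin M) → Fin 4 | x ∘ E ∈ C} := by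
      rintro ⟨F, hF, h⟩
      refine hS ⟨_, hF.twist E.symm (fun _ => Equiv.refl _), fun x hx => h _ ?_⟩
      have : twist E.symm (fun _ => Equiv.refl _) x ∘ E = x := by
        funext i; simp [twist]
      show _ ∘ E ∈ C
      rw [this]; exact hx
    obtain ⟨I, a, hb, h2, hu⟩ := exists_block (hC.reindex E) hSD hvw hl
    refine ⟨(E.trans E₀.symm, (v, w), I), Set.mem_univ _, hvw, h2, hu, ?_⟩
    have : (E.trans E₀.symm).trans E₀ = E := by ext x; simp
    simp only [this]
    exact ⟨hC.reindex E, a, hb⟩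
  · rintro ⟨σ, ⟨v, w⟩, I⟩ -
    by_cases hyp : v ≠ w ∧ 2 ≤ I.ncard ∧ I ≠ Set.univ
    swap
    · exact le_of_eq_of_le (congrArg Set.ncard (Set.eq_empty_of_forall_notMem fun C hC =>
        hyp ⟨hC.2.1, hC.2.2.1, hC.2.2.2.1⟩)) (by simp)
    obtain ⟨hvw, h2, hu⟩ := hyp
    have hc := Set.ncard_add_ncard_compl I
    rw [Nat.card_fin] at hc
    have hq : Iᶜ.ncard ≠ 0 := by
      rw [Ne, Set.ncard_eq_zero (Set.toFinite _), Set.compl_empty_iff]; exact hu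
    refine le_trans ?_ ((ncard_le_of_block hvw (I := I) rfl rfl (by omega) hq).trans (hm _ _ h2 (by omega) hc))
    refine Set.ncard_le_ncard_of_injOn (fun C => {x | x ∘ (σ.trans E₀) ∈ C}) ?_
      (preimage_comp_injective _).injOn (Set.toFinite _)
    rintro C ⟨-, -, -, -, h⟩
    exact h

end Reducible

/-! ### Numerical bounds, and the count in the Hamming graph. -/

section Bounds

theorem factorial_le_two_pow (N : ℕ) : N.factorial ≤ 2 ^ N ^ 2 :=
  calc N.factorial ≤ N ^ N := N.factorial_le_pow
    _ ≤ (2 ^ N) ^ N := Nat.pow_le_pow_left (Nat.lt_two_pow_self).le N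
    _ = 2 ^ N ^ 2 := by rw [← pow_mul, sq]

theorem numC_le_of_small (N : ℕ) : numC (Fin N) ≤ 2 ^ 4 ^ N := by
  refine (Set.ncard_le_ncard (Set.subset_univ _) (Set.toFinite _)).trans ?_
  rw [Set.ncard_univ, Nat.card_eq_fintype_card (α := Set (Fin N → Fin 4)), Fintype.card_set, Fintype.card_pi,
    Finset.prod_const, Fintype.card_fin, Finset.card_univ, Fintype.card_fin]

/-- The worst case is `p = 2`, where equality holds. The leading coefficient is three quarters of `2
^ M`, so reducible codes are negligible. -/
theorem pow_split_le {p q M : ℕ} (hp : 2 ≤ p) (hq : 1 ≤ q) (h : p + q = M) :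
    2 ^ p + 3 * 2 ^ q ≤ 3 * 2 ^ (M - 2) + 4 := by
  obtain ⟨s, rfl⟩ : ∃ s, p = 2 + s := ⟨p - 2, by omega⟩
  obtain ⟨r, rfl⟩ : ∃ r, q = 1 + r := ⟨q - 1, by omega⟩
  have e : M - 2 = s + (1 + r) := by omega
  rw [e, pow_add, pow_add, pow_add, pow_add]
  have h1 : 1 ≤ 2 ^ s := Nat.one_le_two_pow
  have h2 : 1 ≤ 2 ^ r := Nat.one_le_two_pow
  nlinarith [Nat.mul_le_mul h1 h2]

theorem cube_split_le {p q M : ℕ} (hp : 2 ≤ p) (hq : 1 ≤ q) (h : p + q = M) :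
    (p + 1) ^ 3 + (q + 1) ^ 3 ≤ M ^ 3 + 8 := by
  obtain ⟨s, rfl⟩ : ∃ s, p = 2 + s := ⟨p - 2, by omega⟩
  obtain ⟨r, rfl⟩ : ∃ r, q = 1 + r := ⟨q - 1, by omega⟩
  subst h
  have h1 : 0 ≤ s * r := Nat.zero_le _
  have h2 : 0 ≤ s * r ^ 2 := Nat.zero_le _
  have h3 : 0 ≤ s ^ 2 * r := Nat.zero_le _
  have h4 : 0 ≤ r ^ 2 := Nat.zero_le _
  nlinarith

/-- At `n = 4` the base is `72 ≤ 2 ^ 7`. Raising `n` by one halves the outer exponent, while the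
base at most doubles. -/
theorem tower_base_le {n M : ℕ} (hn : 4 ≤ n) (h : n ≤ M) : (18 * n) ^ 2 ^ (M - n) ≤ 250 ^ 2 ^ (M - 4) := by
  have key : ∀ k, 18 * (k + 4) ≤ 2 ^ (7 * 2 ^ k) := by
    intro k
    induction k with
    | zero => norm_num
    | succ k ih =>
      calc 18 * (k + 1 + 4) ≤ 2 * (18 * (k + 4)) := by omega
        _ ≤ 2 * 2 ^ (7 * 2 ^ k) := Nat.mul_le_mul_left 2 ih
        _ = 2 ^ (7 * 2 ^ k + 1) := by rw [pow_succ, mul_comm]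
        _ ≤ 2 ^ (7 * 2 ^ (k + 1)) := by
          refine Nat.pow_le_pow_right (by norm_num) ?_
          have : 1 ≤ 2 ^ k := Nat.one_le_two_pow
          rw [pow_succ]; omega
  obtain ⟨k, rfl⟩ : ∃ k, n = k + 4 := ⟨n - 4, by omega⟩
  calc (18 * (k + 4)) ^ 2 ^ (M - (k + 4)) ≤ (2 ^ (7 * 2 ^ k)) ^ 2 ^ (M - (k + 4)) := Nat.pow_le_pow_left (key k) _
    _ = (2 ^ 7) ^ 2 ^ (M - 4) := by
      rw [← pow_mul, ← pow_mul, mul_assoc, ← pow_add]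
      congr 3; omega
    _ ≤ 250 ^ 2 ^ (M - 4) := Nat.pow_le_pow_left (by norm_num) _

theorem irreducible_bound {M : ℕ} (hM : 4 ≤ M) :
    {C : Set (Fin (M + 1) → Fin 4) | IsCode C ∧ ¬ Semi C ∧ AllConn C}.ncard ≤
      (250 ^ 2 ^ (M - 4) * numC (Fin M)) * ((M + 1) * (M + 1).factorial) := by
  refine ncard_irreducible_le fun n t hn hnt A hA hG => ?_
  rcases Nat.lt_or_ge n 4 with h | h
  · obtain rfl : n = 3 := by omega
    obtain ⟨s, rfl⟩ : ∃ s, t = 1 + s := ⟨t - 1, by omega⟩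
    have e : M - 4 = s := by omega
    rw [e]
    exact nbrs_le_of_three s hA hG
  · refine (nbrs_le_of_four t hA hG).trans ?_
    have e : t = M - n := by omega
    rw [e]
    exact tower_base_le h (by omega)

theorem reducible_bound {M : ℕ} (hM : 4 ≤ M)
    (ih : ∀ k ≤ M, numC (Fin k) ≤ 2 ^ (2 ^ (k - 1) + 10 * k ^ 3)) :
    {C : Set (Fin (M + 1) → Fin 4) | IsCode C ∧ ¬ Semi C ∧ ¬ AllConn C}.ncard ≤
      2 ^ (3 * 2 ^ (M - 2) + (10 * M ^ 3 + (M + 1) ^ 2 + M + 88)) := by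
  refine (ncard_reducible_le (m := 2 ^ (3 * 2 ^ (M - 2) + (10 * M ^ 3 + 84))) fun p q hp hq hpq => ?_).trans ?_
  · have h1 := ih (p + 1) (by omega)
    have h2 := ih (q + 1) (by omega)
    rw [Nat.add_sub_cancel] at h1 h2
    refine (Nat.mul_le_mul_left _ (Nat.mul_le_mul h1 h2)).trans ?_
    rw [← pow_add, ← pow_add, ← pow_add]
    refine Nat.pow_le_pow_right (by norm_num) ?_
    have := pow_split_le hp hq hpq
    have := cube_split_le hp hq hpq
    omega
  · have : (M + 1).factorial * (16 * 2 ^ M) ≤ 2 ^ ((M + 1) ^ 2 + (4 + M)) := by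
      rw [pow_add, pow_add]
      exact Nat.mul_le_mul (factorial_le_two_pow _) (le_of_eq (by norm_num))
    refine (Nat.mul_le_mul_left _ this).trans ?_
    rw [← pow_add]
    exact Nat.pow_le_pow_right (by norm_num) (by omega)

theorem nonsemi_split (M : ℕ) : {C : Set (Fin (M + 1) → Fin 4) | IsCode C ∧ ¬ Semi C}.ncard ≤
    {C : Set (Fin (M + 1) → Fin 4) | IsCode C ∧ ¬ Semi C ∧ AllConn C}.ncard +
    {C : Set (Fin (M + 1) → Fin 4) | IsCode C ∧ ¬ Semi C ∧ ¬ AllConn C}.ncard := by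
  refine le_trans (Set.ncard_le_ncard ?_ (Set.toFinite _)) (Set.ncard_union_le _ _)
  rintro C ⟨h1, h2⟩
  by_cases h : AllConn C
  · exact Or.inl ⟨h1, h2, h⟩
  · exact Or.inr ⟨h1, h2, h⟩

theorem mul_factorial_le (M : ℕ) : (M + 1) * (M + 1).factorial ≤ 2 ^ ((M + 1) + (M + 1) ^ 2) := by
  rw [pow_add]
  exact Nat.mul_le_mul (Nat.lt_two_pow_self).le (factorial_le_two_pow _)

theorem poly_le {M : ℕ} (hM : 4 ≤ M) : 10 * M ^ 3 + (M + 1) ^ 2 + M + 91 ≤ 10 * (M + 1) ^ 3 := by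
  nlinarith

/-- An upper bound for the number of codes. -/
theorem numC_bound (N : ℕ) : numC (Fin N) ≤ 2 ^ (2 ^ (N - 1) + 10 * N ^ 3) := by
  induction N using Nat.strong_induction_on with
  | _ N ih =>
    rcases Nat.lt_or_ge N 5 with h | h
    · refine (numC_le_of_small N).trans (Nat.pow_le_pow_right (by norm_num) ?_)
      interval_cases N <;> norm_num
    obtain ⟨M, rfl⟩ : ∃ M, N = M + 1 := ⟨N - 1, by omega⟩
    have hM : 4 ≤ M := by omega
    rw [Nat.add_sub_cancel]
    have hpoly := poly_le hM
    have hpow : 2 ^ M = 4 * 2 ^ (M - 2) := by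
      rw [show (4 : ℕ) = 2 ^ 2 by norm_num, ← pow_add]; congr 1; omega
    -- Each of the three classes gets at most a quarter of the target; this is the subtraction of
    -- two in the exponent.
    have h1 : {C : Set (Fin (M + 1) → Fin 4) | IsCode C ∧ Semi C}.ncard ≤ 2 ^ (2 ^ M + (10 * (M + 1) ^ 3 - 2)) := by
      have := ncard_semi_le (ι := Fin (M + 1))
      rw [Nat.card_fin, Nat.add_sub_cancel] at this
      refine this.trans ?_
      rw [pow_add 2 (2 ^ M)]
      refine Nat.mul_le_mul_left _ ?_
      calc 2 * 3 ^ (M + 1) ≤ 2 * (2 ^ 2) ^ (M + 1) := Nat.mul_le_mul_left 2 (Nat.pow_le_pow_left (by norm_num) _)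
        _ = 2 ^ (2 * (M + 1) + 1) := by rw [← pow_mul, pow_succ, mul_comm]
        _ ≤ _ := Nat.pow_le_pow_right (by norm_num) (by
          have := Nat.le_self_pow two_ne_zero (M + 1)
          omega)
    have h2 : {C : Set (Fin (M + 1) → Fin 4) | IsCode C ∧ ¬ Semi C ∧ AllConn C}.ncard ≤
        2 ^ (2 ^ M + (10 * (M + 1) ^ 3 - 2)) := by
      refine (irreducible_bound hM).trans ?_
      -- Here `250 ≤ 2 ^ 8` gives the exponent `2 ^ (M - 1)`, which together with that of `numC (Fin
      -- M)` just makes `2 ^ M`.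
      have e1 : 250 ^ 2 ^ (M - 4) ≤ 2 ^ (2 * 2 ^ (M - 2)) := by
        calc 250 ^ 2 ^ (M - 4) ≤ (2 ^ 8) ^ 2 ^ (M - 4) := Nat.pow_le_pow_left (by norm_num) _
          _ = 2 ^ (2 * 2 ^ (M - 2)) := by
            rw [← pow_mul]
            congr 1
            rw [show M - 2 = (M - 4) + 2 by omega, pow_add]; ring
      have e2 := ih M (by omega)
      have e3 := mul_factorial_le M
      refine (Nat.mul_le_mul (Nat.mul_le_mul e1 e2) e3).trans ?_
      rw [← pow_add, ← pow_add]
      refine Nat.pow_le_pow_right (by norm_num) ?_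
      have : 2 ^ (M - 1) = 2 * 2 ^ (M - 2) := by
        rw [← pow_succ']; congr 1; omega
      omega
    have h3 : {C : Set (Fin (M + 1) → Fin 4) | IsCode C ∧ ¬ Semi C ∧ ¬ AllConn C}.ncard ≤
        2 ^ (2 ^ M + (10 * (M + 1) ^ 3 - 2)) := by
      refine (reducible_bound hM fun k hk => ih k (by omega)).trans (Nat.pow_le_pow_right (by norm_num) ?_)
      omega
    have h4 : numC (Fin (M + 1)) ≤ {C : Set (Fin (M + 1) → Fin 4) | IsCode C ∧ Semi C}.ncard +
        {C : Set (Fin (M + 1) → Fin 4) | IsCode C ∧ ¬ Semi C}.ncard := by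
      refine le_trans (Set.ncard_le_ncard ?_ (Set.toFinite _)) (Set.ncard_union_le _ _)
      intro C hC
      by_cases h : Semi C
      · exact Or.inl ⟨hC, h⟩
      · exact Or.inr ⟨hC, h⟩
    have h5 := nonsemi_split M
    have h6 : 2 ^ (2 ^ M + 10 * (M + 1) ^ 3) = 4 * 2 ^ (2 ^ M + (10 * (M + 1) ^ 3 - 2)) := by
      rw [show (4 : ℕ) = 2 ^ 2 by norm_num, ← pow_add]; congr 1; omega
    rw [h6]
    omega

/-- Almost all codes lie in zero sets of linear functions. -/
theorem nonsemi_bound {N : ℕ} (hN : 10 ≤ N) :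
    {C : Set (Fin N → Fin 4) | IsCode C ∧ ¬ Semi C}.ncard * 2 ^ 2 ^ (N - 10) ≤ 2 ^ (2 ^ (N - 1) + 10 * N ^ 3) := by
  obtain ⟨M, rfl⟩ : ∃ M, N = M + 1 := ⟨N - 1, by omega⟩
  have hM : 9 ≤ M := by omega
  have hpoly := poly_le (M := M) (by omega)
  rw [show M + 1 - 10 = M - 9 by omega, Nat.add_sub_cancel]
  set K := 2 ^ (M - 9) with hK
  have hp2 : 2 ^ (M - 2) = 128 * K := by
    rw [hK, show (128 : ℕ) = 2 ^ 7 by norm_num, ← pow_add]; congr 1; omega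
  have hp1 : 2 ^ (M - 1) = 256 * K := by
    rw [hK, show (256 : ℕ) = 2 ^ 8 by norm_num, ← pow_add]; congr 1; omega
  have hp0 : 2 ^ M = 512 * K := by
    rw [hK, show (512 : ℕ) = 2 ^ 9 by norm_num, ← pow_add]; congr 1; omega
  have h2 : {C : Set (Fin (M + 1) → Fin 4) | IsCode C ∧ ¬ Semi C ∧ AllConn C}.ncard ≤
      2 ^ (511 * K + (10 * (M + 1) ^ 3 - 2)) := by
    refine (irreducible_bound (by omega)).trans ?_
    -- The strict gain: `250 ^ 32 ≤ 2 ^ 255` instead of `2 ^ 256`. It leaves a saving of `K` in the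
    -- exponent, which beats all polynomial terms.
    have e1 : 250 ^ 2 ^ (M - 4) ≤ 2 ^ (255 * K) := by
      have : 2 ^ (M - 4) = 32 * K := by
        rw [hK, show (32 : ℕ) = 2 ^ 5 by norm_num, ← pow_add]; congr 1; omega
      rw [this, pow_mul, pow_mul]
      exact Nat.pow_le_pow_left (by norm_num) _
    refine (Nat.mul_le_mul (Nat.mul_le_mul e1 (numC_bound M)) (mul_factorial_le M)).trans ?_
    rw [← pow_add, ← pow_add]
    refine Nat.pow_le_pow_right (by norm_num) ?_
    omega
  have h3 : {C : Set (Fin (M + 1) → Fin 4) | IsCode C ∧ ¬ Semi C ∧ ¬ AllConn C}.ncard ≤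
      2 ^ (511 * K + (10 * (M + 1) ^ 3 - 2)) := by
    refine (reducible_bound (by omega) fun k hk => numC_bound k).trans (Nat.pow_le_pow_right (by norm_num) ?_)
    omega
  have h5 := (nonsemi_split M).trans (Nat.add_le_add h2 h3)
  refine (Nat.mul_le_mul_right _ h5).trans ?_
  rw [← two_mul, ← pow_succ', ← pow_add]
  refine Nat.pow_le_pow_right (by norm_num) ?_
  omega

end Bounds

/-! ### Maximum independent sets of the Shrikhande graph as four by four tables. -/

section Shrikhande

abbrev Shr : Type := ZMod 4 × ZMod 4

def vcode (v : Shr) : ℕ := 4 * v.1.val + v.2.val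

/-- The masks of the independent sets of size four of the Shrikhande graph. -/
def cqMasks : List ℕ := [1285, 2565, 16705, 9345, 1290, 2570, 18450, 33410, 5140, 33060, 10280, 4680,
  20560, 41040, 20640, 41120]

def IsCq (f : Shr → Prop) : Prop := ∃ M ∈ cqMasks, ∀ v, f v ↔ M.testBit (vcode v) = true

/-- The vertices associated with a cell of the table. -/
def cellPts : Fin 4 → Fin 4 → List Shr :=
  ![![[(0,0)], [(0,1)], [(1,1)], [(0,0), (0,1), (1,1)]],
    ![[(0,3)], [(0,2)], [(0,2), (1,3), (0,3)], [(1,3)]],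
    ![[(3,3)], [(3,3), (2,2), (2,3)], [(2,2)], [(2,3)]],
    ![[(3,1), (2,1), (2,0)], [(3,1)], [(2,1)], [(2,0)]]]

/-- The cells of the table that correspond to triangles. -/
def cellTri (r s : Fin 4) : Bool := r.val + s.val == 3

/-- The transformation of a set of vertices of the Shrikhande graph into a subset of the four by four table. -/
def tab (f : Shr → Prop) (r s : Fin 4) : Prop :=
  if cellTri r s then ∀ v ∈ cellPts r s, ¬ f v else ∀ v ∈ cellPts r s, f v

def tabM (M : ℕ) (r s : Fin 4) : Bool :=
  if cellTri r s then (cellPts r s).all fun v => !M.testBit (vcode v) else (cellPts r s).all fun v => M.testBit (vcode v)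

theorem tab_iff {f : Shr → Prop} {M : ℕ} (h : ∀ v, f v ↔ M.testBit (vcode v) = true) (r s : Fin 4) :
    tab f r s ↔ tabM M r s = true := by
  unfold tab tabM
  split_ifs
  · rw [List.all_eq_true]
    exact forall₂_congr fun v _ => by rw [h]; simp
  · rw [List.all_eq_true]
    exact forall₂_congr fun v _ => by rw [h]

/-- The labels of a coordinate of the complete graph. -/
def lb : Fin 3 → Fin 4 → ZMod 2 := ![![0, 0, 1, 1], ![0, 1, 0, 1], ![0, 1, 1, 0]]

/-- The parity of a residue modulo four. -/
def par4 (a : ZMod 4) : ZMod 2 := if a.val % 2 = 0 then 0 else 1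

/-- The corresponding labels of a coordinate of the Shrikhande graph. -/
def chr (l : Fin 3) (v : Shr) : ZMod 2 := ![par4 v.1, par4 v.1 + par4 v.2, par4 v.2] l

theorem tabM_row : ∀ M ∈ cqMasks, ∀ r, ∃ s, tabM M r s = true ∧ ∀ s', tabM M r s' = true → s' = s := by decide +kernel

theorem tabM_col : ∀ M ∈ cqMasks, ∀ s, ∃ r, tabM M r s = true ∧ ∀ r', tabM M r' s = true → r' = r := by decide +kernel

theorem tabM_injective : ∀ M ∈ cqMasks, ∀ M' ∈ cqMasks, (∀ r s, tabM M r s = tabM M' r s) → M = M' := by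
  decide +kernel

/-- A Shrikhande label corresponds to the same label on both new coordinates; this is why linear
functions transfer. -/
theorem tabM_label : ∀ M ∈ cqMasks, ∀ l : Fin 3, ∀ c : ZMod 2,
    (∀ v : Shr, M.testBit (vcode v) = true → chr l v = c) ↔ ∀ r s, tabM M r s = true → lb l r + lb l s = c := by
  decide +kernel

/-- With different labels on the two new coordinates, two fixed cells already determine the table.
-/
theorem tabM_bad : ∀ l l' : Fin 3, l ≠ l' → ∃ r s r' s' : Fin 4, ∀ c : ZMod 2, ∀ M ∈ cqMasks,
    (∀ r s, tabM M r s = true → lb l r + lb l' s = c) → ∀ M' ∈ cqMasks,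
    (∀ r s, tabM M' r s = true → lb l r + lb l' s = c) →
    tabM M r s = tabM M' r s → tabM M r' s' = tabM M' r' s' → M = M' := by
  decide +kernel

/-- Needed for the triangle cells: three disjoint maximum independent sets leave a fourth one. -/
theorem cq_compl : ∀ M ∈ cqMasks, ∀ M' ∈ cqMasks, M &&& M' = 0 → ∀ M'' ∈ cqMasks, M &&& M'' = 0 → M' &&& M'' = 0 →
    65535 - M - M' - M'' ∈ cqMasks ∧ ∀ v : Shr, (65535 - M - M' - M'').testBit (vcode v) =
      (!M.testBit (vcode v) && (!M'.testBit (vcode v) && !M''.testBit (vcode v))) := by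
  decide +kernel

theorem cq_disjoint : ∀ M ∈ cqMasks, ∀ M' ∈ cqMasks,
    (∀ v : Shr, M.testBit (vcode v) = true → M'.testBit (vcode v) = false) → M &&& M' = 0 := by
  decide +kernel

/-- Adjacency in the Shrikhande graph. -/
def shrAdj (u v : Shr) : Prop := v - u ∈ [((0 : ZMod 4), (1 : ZMod 4)), (1, 0), (1, 1), (0, 3), (3, 0), (3, 3)]

instance : DecidableRel shrAdj := fun _ _ => inferInstanceAs (Decidable (_ ∈ _))

theorem cq_indep : ∀ M ∈ cqMasks, ∀ u v : Shr, shrAdj u v → M.testBit (vcode u) = true → M.testBit (vcode v) = false := by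
  decide +kernel

theorem cell_points : ∀ r s, (cellTri r s = false ∧ ∃ v, cellPts r s = [v]) ∨
    (cellTri r s = true ∧ ∃ a b c, cellPts r s = [a, b, c] ∧ shrAdj a b ∧ shrAdj a c ∧ shrAdj b c) := by
  decide +kernel

theorem IsCq.compl {f g h : Shr → Prop} (hf : IsCq f) (hg : IsCq g) (hh : IsCq h) (d1 : ∀ v, f v → ¬ g v)
    (d2 : ∀ v, f v → ¬ h v) (d3 : ∀ v, g v → ¬ h v) : IsCq fun v => ¬ f v ∧ ¬ g v ∧ ¬ h v := by
  obtain ⟨M, hM, eM⟩ := hf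
  obtain ⟨M', hM', eM'⟩ := hg
  obtain ⟨M'', hM'', eM''⟩ := hh
  have key := cq_compl M hM M' hM' (cq_disjoint M hM M' hM' fun v h => by
      have := d1 v ((eM v).2 h); rw [eM'] at this; simpa using this)
    M'' hM'' (cq_disjoint M hM M'' hM'' fun v h => by
      have := d2 v ((eM v).2 h); rw [eM''] at this; simpa using this)
    (cq_disjoint M' hM' M'' hM'' fun v h => by
      have := d3 v ((eM' v).2 h); rw [eM''] at this; simpa using this)
  refine ⟨_, key.1, fun v => ?_⟩
  show (¬ f v ∧ ¬ g v ∧ ¬ h v) ↔ _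
  rw [key.2 v, eM, eM', eM'']
  simp

theorem lb_zero : ∀ l, lb l 0 = 0 := by decide +kernel
theorem bal_add_lb : ∀ (l : Fin 3) (c : ZMod 2), Bal fun t => c + lb l t := by decide +kernel
theorem Bal.exists_lb {f : Fin 4 → ZMod 2} (hf : Bal f) : ∃ l, ∀ p q, f p + f q = lb l p + lb l q := by
  have : ∀ f ∈ balList, ∃ l, ∀ p q, f p + f q = lb l p + lb l q := by decide +kernel
  exact this f (mem_balList hf)

end Shrikhande

/-! ### Trading a Shrikhande coordinate for two coordinates of `K₄`. -/

section DoobCode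

variable {m : ℕ} {ι : Type} [DecidableEq ι]

/-- The codes of minimum distance two in the product of `m` Shrikhande graphs and complete graphs. -/
structure DCode (C : Set ((Fin m → Shr) × (ι → Fin 4))) : Prop where
  shr : ∀ x y i, IsCq fun v => (Function.update x i v, y) ∈ C
  ham : ∀ x y k, ∃! q, (x, Function.update y k q) ∈ C

/-- The point with two further coordinates `r` and `s`. -/
def cons₂ (r s : Fin 4) (y : ι → Fin 4) : Option (Option ι) → Fin 4 := cons r (cons s y)

theorem cons₂_eta (y : Option (Option ι) → Fin 4) : cons₂ (y none) (y (some none)) (fun k => y (some (some k))) = y := by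
  funext o; rcases o with _ | _ | k <;> rfl

theorem cons₂_update (r s : Fin 4) (y : ι → Fin 4) (k : ι) (q : Fin 4) :
    Function.update (cons₂ r s y) (some (some k)) q = cons₂ r s (Function.update y k q) := by
  funext o
  rcases o with _ | _ | j
  · simp [cons₂]
  · simp [cons₂]
  · by_cases h : j = k
    · subst h; simp [cons₂]
    · simp [cons₂, h]

theorem cons₂_update_none (r s t : Fin 4) (y : ι → Fin 4) : Function.update (cons₂ r s y) none t = cons₂ t s y := by
  funext o; rcases o with _ | _ | j <;> simp [cons₂]

theorem cons₂_update_some_none (r s t : Fin 4) (y : ι → Fin 4) :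
    Function.update (cons₂ r s y) (some none) t = cons₂ r t y := by
  funext o; rcases o with _ | _ | j <;> simp [cons₂]

/-- The replacement of the first Shrikhande coordinate by two coordinates of complete graphs. -/
def phi (C : Set ((Fin (m + 1) → Shr) × (ι → Fin 4))) : Set ((Fin m → Shr) × (Option (Option ι) → Fin 4)) :=
  {p | tab (fun v => (Fin.cons v p.1, fun k => p.2 (some (some k))) ∈ C) (p.2 none) (p.2 (some none))}

theorem mem_phi {C : Set ((Fin (m + 1) → Shr) × (ι → Fin 4))} {x : Fin m → Shr} {r s : Fin 4} {y : ι → Fin 4} :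
    (x, cons₂ r s y) ∈ phi C ↔ tab (fun v => ((Fin.cons v x : Fin (m + 1) → Shr), y) ∈ C) r s := Iff.rfl

variable {C C' : Set ((Fin (m + 1) → Shr) × (ι → Fin 4))}

theorem DCode.fibre (hC : DCode C) (x : Fin m → Shr) (y : ι → Fin 4) :
    IsCq fun v => ((Fin.cons v x : Fin (m + 1) → Shr), y) ∈ C := by
  have := hC.shr (Fin.cons 0 x) y 0
  simpa only [Fin.update_cons_zero] using this

theorem DCode.not_adj (hC : DCode C) {x : Fin m → Shr} {y : ι → Fin 4} {u v : Shr} (h : shrAdj u v)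
    (hu : ((Fin.cons u x : Fin (m + 1) → Shr), y) ∈ C) : ((Fin.cons v x : Fin (m + 1) → Shr), y) ∉ C := by
  obtain ⟨M, hM, e⟩ := hC.fibre x y
  intro hv
  have := (e v).1 hv
  rw [cq_indep M hM u v h ((e u).1 hu)] at this
  cases this

/-- In the two new directions the tables are permutation matrices. In the old directions a cell of
the table is a fibre over one vertex, or the complement of the fibres over a triangle; these three
are disjoint because the vertices are adjacent, so the complement is again of the required kind. -/
theorem DCode.phi (hC : DCode C) : DCode (phi C) := by
  constructor
  · intro x y i
    obtain ⟨r, s, z, rfl⟩ : ∃ r s z, y = cons₂ r s z := ⟨_, _, _, (cons₂_eta y).symm⟩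
    simp only [mem_phi]
    have hs : ∀ a, IsCq fun v => ((Fin.cons a (Function.update x i v) : Fin (m + 1) → Shr), z) ∈ C := by
      intro a
      have := hC.shr (Fin.cons a x) z i.succ
      simpa only [← Fin.cons_update] using this
    rcases cell_points r s with ⟨h1, v, hv⟩ | ⟨h1, a, b, c, hv, ab, ac, bc⟩
    · simp only [tab, h1, hv]
      simpa using hs v
    · simp only [tab, h1, hv]
      simpa using (hs a).compl (hs b) (hs c) (fun v h => hC.not_adj ab h) (fun v h => hC.not_adj ac h)
        (fun v h => hC.not_adj bc h)
  · intro x y k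
    obtain ⟨r, s, z, rfl⟩ : ∃ r s z, y = cons₂ r s z := ⟨_, _, _, (cons₂_eta y).symm⟩
    rcases k with _ | _ | k
    · simp only [cons₂_update_none, mem_phi]
      obtain ⟨M, hM, e⟩ := hC.fibre x z
      simp only [tab_iff e]
      obtain ⟨r', h1, h2⟩ := tabM_col M hM s
      exact ⟨r', h1, h2⟩
    · simp only [cons₂_update_some_none, mem_phi]
      obtain ⟨M, hM, e⟩ := hC.fibre x z
      simp only [tab_iff e]
      obtain ⟨r', h1, h2⟩ := tabM_row M hM r
      exact ⟨r', h1, h2⟩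
    · simp only [cons₂_update, mem_phi]
      have hs := fun a => hC.ham (Fin.cons a x) z k
      rcases cell_points r s with ⟨h1, v, hv⟩ | ⟨h1, a, b, c, hv, ab, ac, bc⟩
      · simp only [tab, h1, hv]
        simpa using hs v
      · simp only [tab, h1, hv]
        obtain ⟨p, hp, hp'⟩ := hs a
        obtain ⟨q, hq, hq'⟩ := hs b
        obtain ⟨t, ht, ht'⟩ := hs c
        have e : ∀ {a : Shr} {p : Fin 4}, ((Fin.cons a x : Fin (m + 1) → Shr), Function.update z k p) ∈ C →
            (∀ q, ((Fin.cons a x : Fin (m + 1) → Shr), Function.update z k q) ∈ C → q = p) →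
            ∀ q, ((Fin.cons a x : Fin (m + 1) → Shr), Function.update z k q) ∈ C ↔ q = p :=
          fun h h' q => ⟨h' q, by rintro rfl; exact h⟩
        have hpq : p ≠ q := by rintro rfl; exact hC.not_adj ab hp hq
        have hpt : p ≠ t := by rintro rfl; exact hC.not_adj ac hp ht
        have hqt : q ≠ t := by rintro rfl; exact hC.not_adj bc hq ht
        obtain ⟨d, d1, d2, d3, hd⟩ := exists_fourth hpq hpt hqt
        refine ⟨d, ?_, fun w hw => ?_⟩
        · simp [e hp hp', e hq hq', e ht ht', d1, d2, d3]
        · simp [e hp hp', e hq hq', e ht ht'] at hw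
          rcases hd w with h | h | h | h
          · exact (hw.1 h).elim
          · exact (hw.2.1 h).elim
          · exact (hw.2.2 h).elim
          · exact h

theorem eq_of_fibres (h : ∀ (x : Fin m → Shr) (y : ι → Fin 4) v, ((Fin.cons v x : Fin (m + 1) → Shr), y) ∈ C ↔
    ((Fin.cons v x : Fin (m + 1) → Shr), y) ∈ C') : C = C' := by
  ext ⟨x, y⟩
  rw [← Fin.cons_self_tail x]
  exact h _ _ _

theorem phi_injOn : Set.InjOn (phi (m := m) (ι := ι)) {C | DCode C} := by
  intro C hC C' hC' h
  refine eq_of_fibres fun x y v => ?_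
  obtain ⟨M, hM, e⟩ := DCode.fibre hC x y
  obtain ⟨M', hM', e'⟩ := DCode.fibre hC' x y
  have : M = M' := tabM_injective M hM M' hM' fun r s => by
    rw [Bool.eq_iff_iff, ← tab_iff e, ← tab_iff e', ← mem_phi, ← mem_phi, h]
  exact (e v).trans (by rw [this]; exact (e' v).symm)

end DoobCode

/-! ### The upper bound for products with Shrikhande factors. -/

section DoobUpper

variable {m : ℕ} {ι : Type} [DecidableEq ι] [Fintype ι]

theorem zmod_two_swap {a b c : ZMod 2} : a + b = c ↔ b = a + c := by
  revert a b c; decide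

theorem zmod_two_add_eq_zero {a b : ZMod 2} : a + b = 0 ↔ b = a := by
  revert a b; decide

/-- The linear function with given constant and labels. -/
def dlin (c : ZMod 2) (l : Fin m → Fin 3) (μ : ι → Fin 3) (z : (Fin m → Shr) × (ι → Fin 4)) : ZMod 2 :=
  c + (∑ i, chr (l i) (z.1 i) + ∑ k, lb (μ k) (z.2 k))

/-- The codes in the zero set of a linear function. -/
def DSemi (C : Set ((Fin m → Shr) × (ι → Fin 4))) : Prop := ∃ c l μ, ∀ z ∈ C, dlin c l μ z = 0

/-- The labelling with two further labels. -/
def labels₂ (a b : Fin 3) (μ : ι → Fin 3) : Option (Option ι) → Fin 3 := fun o => o.elim a fun o => o.elim b μ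

theorem labels₂_eta (μ : Option (Option ι) → Fin 3) :
    labels₂ (μ none) (μ (some none)) (fun k => μ (some (some k))) = μ := by
  funext o; rcases o with _ | _ | k <;> rfl

theorem dlin_labels₂ (c : ZMod 2) (l : Fin m → Fin 3) (a b : Fin 3) (μ : ι → Fin 3) (x : Fin m → Shr) (r s : Fin 4)
    (y : ι → Fin 4) : dlin c l (labels₂ a b μ) (x, cons₂ r s y) = dlin c l μ (x, y) + (lb a r + lb b s) := by
  simp only [dlin, Fintype.sum_option, labels₂, cons₂, cons_none, cons_some, Option.elim_none, Option.elim_some]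
  ring

theorem dlin_cons (c : ZMod 2) (l : Fin (m + 1) → Fin 3) (μ : ι → Fin 3) (v : Shr) (x : Fin m → Shr) (y : ι → Fin 4) :
    dlin c l μ ((Fin.cons v x : Fin (m + 1) → Shr), y) = dlin c (Fin.tail l) μ (x, y) + chr (l 0) v := by
  simp only [dlin, Fin.sum_univ_succ, Fin.cons_zero, Fin.cons_succ, Fin.tail]
  ring

theorem dlin_const (c d : ZMod 2) (l : Fin m → Fin 3) (μ : ι → Fin 3) (z : (Fin m → Shr) × (ι → Fin 4)) :
    dlin (c + d) l μ z = dlin c l μ z + d := by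
  simp only [dlin]; ring

/-- The codes in the zero set of `F`. -/
def DSub (F : (Fin m → Shr) × (ι → Fin 4) → ZMod 2) : Set (Set ((Fin m → Shr) × (ι → Fin 4))) :=
  {C | DCode C ∧ ∀ z ∈ C, F z = 0}

theorem DCode.phi_dlin {C : Set ((Fin (m + 1) → Shr) × (ι → Fin 4))} (hC : DCode C) (c : ZMod 2)
    (l : Fin (m + 1) → Fin 3) (μ : ι → Fin 3) : (∀ z ∈ C, dlin c l μ z = 0) ↔
      ∀ p ∈ _root_.phi C, dlin c (Fin.tail l) (labels₂ (l 0) (l 0) μ) p = 0 := by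
  have key : ∀ x y, (∀ v, ((Fin.cons v x : Fin (m + 1) → Shr), y) ∈ C →
      dlin c l μ ((Fin.cons v x : Fin (m + 1) → Shr), y) = 0) ↔
      ∀ r s, (x, cons₂ r s y) ∈ _root_.phi C → dlin c (Fin.tail l) (labels₂ (l 0) (l 0) μ) (x, cons₂ r s y) = 0 := by
    intro x y
    obtain ⟨M, hM, e⟩ := hC.fibre x y
    have := tabM_label M hM (l 0) (dlin c (Fin.tail l) μ (x, y))
    simp only [mem_phi, tab_iff e, dlin_labels₂, dlin_cons, zmod_two_add_eq_zero]
    rw [← this]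
    exact forall_congr' fun v => by rw [← e v]
  constructor
  · rintro h ⟨x, y⟩ hp
    rw [← cons₂_eta y] at hp ⊢
    exact (key _ _).1 (fun v hv => h _ hv) _ _ hp
  · rintro h ⟨x, y⟩ hp
    rw [← Fin.cons_self_tail x] at hp ⊢
    exact (key _ _).2 (fun r s hv => h _ hv) _ hp

theorem sum_update_zmod_two {α : Type*} (f : ι → α → ZMod 2) (x : ι → α) (i : ι) (q : α) :
    ∑ k, f k (Function.update x i q k) = (∑ k, f k (x k) + f i (x i)) + f i q := by
  rw [← Finset.add_sum_erase _ _ (Finset.mem_univ i), ← Finset.add_sum_erase _ (fun k => f k (x k)) (Finset.mem_univ i),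
    Function.update_self, Finset.sum_congr rfl (g := fun k => f k (x k)) (fun k hk => by
      rw [Function.update_of_ne (Finset.ne_of_mem_erase hk)])]
  generalize ∑ k ∈ Finset.univ.erase i, f k (x k) = s
  generalize f i (x i) = a
  generalize f i q = b
  revert s a b; decide

theorem balF_dlin (c : ZMod 2) (l : Fin m → Fin 3) (μ : ι → Fin 3) (x : Fin m → Shr) :
    BalF fun y => dlin c l μ (x, y) := by
  intro y k
  have := bal_add_lb (μ k) (c + (∑ i, chr (l i) (x i) + (∑ j, lb (μ j) (y j) + lb (μ k) (y k))))
  convert this using 2 with t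
  simp only [dlin, sum_update_zmod_two fun k => lb (μ k)]
  ring

theorem LinF.exists_dlin {F : (ι → Fin 4) → ZMod 2} (hF : LinF F) :
    ∃ (c : ZMod 2) (μ : ι → Fin 3), ∀ y, F y = c + ∑ k, lb (μ k) (y k) := by
  choose μ hμ using fun k => (hF.bal_lab k).exists_lb
  refine ⟨F fun _ => 0, μ, fun y => ?_⟩
  refine mem_of_closed (P := fun y => F y = F (fun _ => 0) + ∑ k, lb (μ k) (y k)) (D := Set.univ)
    (x := fun _ => 0) ?_ ?_ (fun i hi => (hi trivial).elim)
  · intro x hx i _ q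
    rw [hF.update, sum_update_zmod_two fun k => lb (μ k), hx, add_assoc, hμ i q (x i)]
    ring
  · simp [lb_zero]

/-- Restriction to the complete graphs when there is no other coordinate. -/
def unShr (C : Set ((Fin 0 → Shr) × (ι → Fin 4))) : Set (ι → Fin 4) := {y | (Fin.elim0, y) ∈ C}

theorem unShr_injective : Function.Injective (unShr (ι := ι)) := by
  intro C C' h
  ext ⟨x, y⟩
  rw [Subsingleton.elim x Fin.elim0]
  exact Set.ext_iff.1 h y

theorem DCode.unShr {C : Set ((Fin 0 → Shr) × (ι → Fin 4))} (hC : DCode C) : IsCode (_root_.unShr C) :=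
  fun y k => hC.ham _ y k

/-- `phi` removes the Shrikhande coordinates one by one, until `numSub_le` applies. -/
theorem ncard_dSub_le (c : ZMod 2) (l : Fin m → Fin 3) (μ : ι → Fin 3) :
    (DSub (dlin c l μ)).ncard ≤ 2 ^ 2 ^ (2 * m + Nat.card ι - 1) := by
  induction m generalizing ι with
  | zero =>
    rw [mul_zero, zero_add]
    refine le_trans ?_ (numSub_le (balF_dlin c l μ Fin.elim0))
    exact Set.ncard_le_ncard_of_injOn unShr (fun C hC => ⟨hC.1.unShr, fun y hy => hC.2 _ hy⟩)
      unShr_injective.injOn (Set.toFinite _)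
  | succ m ih =>
    have := ih (ι := Option (Option ι)) (Fin.tail l) (labels₂ (l 0) (l 0) μ)
    rw [Finite.card_option, Finite.card_option] at this
    rw [show 2 * (m + 1) + Nat.card ι - 1 = 2 * m + (Nat.card ι + 1 + 1) - 1 by ring_nf]
    refine le_trans ?_ this
    exact Set.ncard_le_ncard_of_injOn phi (fun C hC => ⟨hC.1.phi, (hC.1.phi_dlin c l μ).1 hC.2⟩)
      (phi_injOn.mono fun C hC => hC.1) (Set.toFinite _)

/-- A layer of a code with two further coordinates. -/
def layer₂ (r s : Fin 4) (D : Set ((Fin m → Shr) × (Option (Option ι) → Fin 4))) :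
    Set ((Fin m → Shr) × (ι → Fin 4)) := {p | (p.1, cons₂ r s p.2) ∈ D}

theorem DCode.layer₂ {D : Set ((Fin m → Shr) × (Option (Option ι) → Fin 4))} (hD : DCode D) (r s : Fin 4) :
    DCode (_root_.layer₂ r s D) := by
  constructor
  · intro x y i
    exact hD.shr x (cons₂ r s y) i
  · intro x y k
    have := hD.ham x (cons₂ r s y) (some (some k))
    simp only [cons₂_update] at this
    exact this

theorem layer₂_dlin {D : Set ((Fin m → Shr) × (Option (Option ι) → Fin 4))} {c : ZMod 2} {l : Fin m → Fin 3}
    {a b : Fin 3} {μ : ι → Fin 3} (hD : ∀ p ∈ D, dlin c l (labels₂ a b μ) p = 0) (r s : Fin 4) :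
    ∀ p ∈ layer₂ r s D, dlin (c + (lb a r + lb b s)) l μ p = 0 := by
  intro p hp
  rw [dlin_const, ← dlin_labels₂]
  exact hD _ hp

/-- By `tabM_bad` such a code is determined by two layers of its image. Each is a code in the zero
set of a linear function with two coordinates fewer than the image. -/
theorem ncard_bad_le (c : ZMod 2) (l : Fin m → Fin 3) {a b : Fin 3} (hab : a ≠ b) (μ : ι → Fin 3) :
    {C : Set ((Fin (m + 1) → Shr) × (ι → Fin 4)) | DCode C ∧ ∀ p ∈ phi C, dlin c l (labels₂ a b μ) p = 0}.ncard ≤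
      2 ^ 2 ^ (2 * m + Nat.card ι - 1) * 2 ^ 2 ^ (2 * m + Nat.card ι - 1) := by
  obtain ⟨r, s, r', s', key⟩ := tabM_bad a b hab
  refine le_trans ?_ (Nat.mul_le_mul (ncard_dSub_le (c + (lb a r + lb b s)) l μ)
    (ncard_dSub_le (c + (lb a r' + lb b s')) l μ))
  rw [← Set.ncard_prod]
  refine Set.ncard_le_ncard_of_injOn (fun C => (layer₂ r s (phi C), layer₂ r' s' (phi C))) ?_ ?_ (Set.toFinite _)
  · rintro C ⟨hC, h⟩
    exact ⟨⟨hC.phi.layer₂ r s, layer₂_dlin h r s⟩, ⟨hC.phi.layer₂ r' s', layer₂_dlin h r' s'⟩⟩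
  · rintro C ⟨hC, h⟩ C' ⟨hC', h'⟩ e
    obtain ⟨e1, e2⟩ := Prod.mk.inj e
    refine eq_of_fibres fun x y v => ?_
    obtain ⟨M, hM, f⟩ := DCode.fibre hC x y
    obtain ⟨M', hM', f'⟩ := DCode.fibre hC' x y
    have hl : ∀ {C : Set ((Fin (m + 1) → Shr) × (ι → Fin 4))} {M : ℕ},
        (∀ p ∈ phi C, dlin c l (labels₂ a b μ) p = 0) →
        (∀ v, ((Fin.cons v x : Fin (m + 1) → Shr), y) ∈ C ↔ M.testBit (vcode v) = true) →
        ∀ r s, tabM M r s = true → lb a r + lb b s = dlin c l μ (x, y) := by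
      intro C M h f r s hrs
      rw [← tab_iff f, ← mem_phi] at hrs
      have := h _ hrs
      rwa [dlin_labels₂, zmod_two_add_eq_zero] at this
    have : M = M' := by
      refine key _ M hM (hl h f) M' hM' (hl h' f') ?_ ?_
      · rw [Bool.eq_iff_iff, ← tab_iff f, ← tab_iff f', ← mem_phi, ← mem_phi]
        exact Set.ext_iff.1 e1 (x, y)
      · rw [Bool.eq_iff_iff, ← tab_iff f, ← tab_iff f', ← mem_phi, ← mem_phi]
        exact Set.ext_iff.1 e2 (x, y)
    exact (f v).trans (by rw [this]; exact (f' v).symm)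

theorem ncard_univ_params : (Set.univ : Set (ZMod 2 × (Fin m → Fin 3) × (ι → Fin 3))).ncard =
    2 * 3 ^ (m + Nat.card ι) := by
  rw [Set.ncard_univ, Nat.card_eq_fintype_card, Nat.card_eq_fintype_card]
  simp only [Fintype.card_prod, Fintype.card_fun, Fintype.card_fin, ZMod.card, pow_add]

theorem ncard_dSemi_le : {C : Set ((Fin m → Shr) × (ι → Fin 4)) | DCode C ∧ DSemi C}.ncard ≤
    2 ^ 2 ^ (2 * m + Nat.card ι - 1) * (2 * 3 ^ (m + Nat.card ι)) := by
  rw [← ncard_univ_params]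
  refine ncard_le_mul (fun C b => ∀ z ∈ C, dlin b.1 b.2.1 b.2.2 z = 0) ?_ ?_
  · rintro C ⟨_, c, l, μ, h⟩
    exact ⟨(c, l, μ), trivial, h⟩
  · rintro ⟨c, l, μ⟩ _
    refine le_trans (Set.ncard_le_ncard ?_ (Set.toFinite _)) (ncard_dSub_le c l μ)
    exact fun C hC => ⟨hC.1.1, hC.2⟩

/-- If the image is semilinear, equal labels on the two new coordinates would pull back to a linear
function vanishing on `C`. So the labels differ, and these codes form the second term. -/
theorem ncard_not_dSemi_succ_le :
    {C : Set ((Fin (m + 1) → Shr) × (ι → Fin 4)) | DCode C ∧ ¬ DSemi C}.ncard ≤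
      {C : Set ((Fin m → Shr) × (Option (Option ι) → Fin 4)) | DCode C ∧ ¬ DSemi C}.ncard +
      2 ^ 2 ^ (2 * m + Nat.card ι - 1) * 2 ^ 2 ^ (2 * m + Nat.card ι - 1) * (2 * 3 ^ (m + (Nat.card ι + 2))) := by
  have hsub : {C : Set ((Fin (m + 1) → Shr) × (ι → Fin 4)) | DCode C ∧ ¬ DSemi C} ⊆
      {C | DCode C ∧ ¬ DSemi (phi C)} ∪ {C | (DCode C ∧ ¬ DSemi C) ∧ DSemi (phi C)} := by
    intro C hC
    by_cases h : DSemi (phi C)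
    · exact Or.inr ⟨hC, h⟩
    · exact Or.inl ⟨hC.1, h⟩
  refine (Set.ncard_le_ncard hsub (Set.toFinite _)).trans ((Set.ncard_union_le _ _).trans (Nat.add_le_add ?_ ?_))
  · exact Set.ncard_le_ncard_of_injOn phi (fun C hC => ⟨hC.1.phi, hC.2⟩) (phi_injOn.mono fun C hC => hC.1)
      (Set.toFinite _)
  · have hc : (Set.univ : Set (ZMod 2 × (Fin m → Fin 3) × (Option (Option ι) → Fin 3))).ncard =
        2 * 3 ^ (m + (Nat.card ι + 2)) := by
      rw [ncard_univ_params, Finite.card_option, Finite.card_option]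
    rw [← hc]
    refine ncard_le_mul (fun C b => ∀ z ∈ phi C, dlin b.1 b.2.1 b.2.2 z = 0) ?_ ?_
    · rintro C ⟨_, c, l, μ, h⟩
      exact ⟨(c, l, μ), trivial, h⟩
    · rintro ⟨c, l, μ⟩ _
      rw [← labels₂_eta μ]
      by_cases hμ : μ none = μ (some none)
      · convert Nat.zero_le _
        rw [Set.ncard_eq_zero, Set.eq_empty_iff_forall_notMem]
        rintro C ⟨⟨⟨hC, hn⟩, _⟩, h⟩
        refine hn ⟨c, Fin.cons (μ none) l, fun k => μ (some (some k)), ?_⟩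
        rw [hC.phi_dlin]
        rw [← hμ] at h
        exact h
      · refine le_trans (Set.ncard_le_ncard ?_ (Set.toFinite _)) (ncard_bad_le c l hμ fun k => μ (some (some k)))
        exact fun C hC => ⟨hC.1.1.1, hC.2⟩

theorem ncard_not_dSemi_le {N : ℕ} (hN : 3 ≤ N) (h : 2 * m + Nat.card ι = N) :
    {C : Set ((Fin m → Shr) × (ι → Fin 4)) | DCode C ∧ ¬ DSemi C}.ncard ≤
      {C : Set (Fin N → Fin 4) | IsCode C ∧ ¬ Semi C}.ncard + m * (2 ^ 2 ^ (N - 2) * (2 * 3 ^ N)) := by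
  induction m generalizing ι with
  | zero =>
    rw [zero_mul, add_zero]
    rw [mul_zero, zero_add, Nat.card_eq_fintype_card] at h
    let e : ι ≃ Fin N := Fintype.equivFinOfCardEq h
    refine Set.ncard_le_ncard_of_injOn (fun C => {x : Fin N → Fin 4 | x ∘ e ∈ unShr C}) ?_ ?_ (Set.toFinite _)
    · rintro C ⟨hC, hn⟩
      refine ⟨hC.unShr.reindex e, ?_⟩
      rintro ⟨F, hF, h⟩
      obtain ⟨c, μ, hc⟩ := hF.exists_dlin
      refine hn ⟨c, Fin.elim0, μ ∘ e, ?_⟩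
      rintro ⟨x, y⟩ hz
      have hy : (y ∘ e.symm) ∘ e = y := by funext k; simp
      have := h (y ∘ e.symm) (by
        show (y ∘ e.symm) ∘ e ∈ unShr C
        rw [hy]
        show (Fin.elim0, y) ∈ C
        rwa [← Subsingleton.elim x Fin.elim0])
      rw [hc] at this
      rw [← this, dlin, Finset.univ_eq_empty, Finset.sum_empty, zero_add]
      congr 1
      exact Fintype.sum_equiv e _ _ fun k => by simp
    · exact ((preimage_comp_injective e).comp unShr_injective).injOn
  | succ m ih =>
    have h1 := ih (ι := Option (Option ι)) (by rw [Finite.card_option, Finite.card_option]; omega)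
    refine (ncard_not_dSemi_succ_le).trans ((Nat.add_le_add_right h1 _).trans ?_)
    rw [add_mul, one_mul, add_assoc]
    refine Nat.add_le_add_left (Nat.add_le_add_left (Nat.mul_le_mul (le_of_eq ?_) ?_) _) _
    · rw [← pow_add, ← two_mul, ← pow_succ']
      congr 2; omega
    · exact Nat.mul_le_mul_left _ (Nat.pow_le_pow_right (by norm_num) (by omega))

theorem ncard_dCode_le {N : ℕ} (hN : 3 ≤ N) (h : 2 * m + Nat.card ι = N) :
    {C : Set ((Fin m → Shr) × (ι → Fin 4)) | DCode C}.ncard ≤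
      2 * 3 ^ (m + Nat.card ι) * 2 ^ 2 ^ (N - 1) +
      ({C : Set (Fin N → Fin 4) | IsCode C ∧ ¬ Semi C}.ncard + m * (2 ^ 2 ^ (N - 2) * (2 * 3 ^ N))) := by
  have hsub : {C : Set ((Fin m → Shr) × (ι → Fin 4)) | DCode C} ⊆
      {C | DCode C ∧ DSemi C} ∪ {C | DCode C ∧ ¬ DSemi C} := by
    intro C hC
    by_cases h : DSemi C
    · exact Or.inl ⟨hC, h⟩
    · exact Or.inr ⟨hC, h⟩
  refine (Set.ncard_le_ncard hsub (Set.toFinite _)).trans ((Set.ncard_union_le _ _).trans (Nat.add_le_add ?_ ?_))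
  · refine ncard_dSemi_le.trans (le_of_eq ?_)
    rw [h, mul_comm]
  · exact ncard_not_dSemi_le hN h

end DoobUpper

/-! ### Independent sets of the Shrikhande graph. -/

section ShrikhandeIndependent

/-- The sublists of a list of vertices without adjacent elements. -/
def indepSublists : List Shr → List (List Shr)
  | [] => [[]]
  | v :: t => indepSublists t ++ ((indepSublists t).filter fun L => L.all fun u => !decide (shrAdj v u)).map (v :: ·)

theorem filter_mem_indepSublists (f : Shr → Bool) (hf : ∀ u v, shrAdj u v → f u = true → f v = false) (l : List Shr) :
    l.filter f ∈ indepSublists l := by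
  induction l with
  | nil => simp [indepSublists]
  | cons v t ih =>
    rw [indepSublists, List.mem_append]
    cases h : f v with
    | false => left; rwa [List.filter_cons_of_neg (by simp [h])]
    | true =>
      right
      rw [List.filter_cons_of_pos h]
      refine List.mem_map_of_mem (List.mem_filter.2 ⟨ih, ?_⟩)
      rw [List.all_eq_true]
      intro u hu
      have h1 := (List.mem_filter.1 hu).2
      by_contra hc
      have h2 : shrAdj v u := by simpa using hc
      rw [hf v u h2 h] at h1
      cases h1

/-- The vertices of the Shrikhande graph. -/
def shrList : List Shr := [(0,0),(0,1),(0,2),(0,3),(1,0),(1,1),(1,2),(1,3),(2,0),(2,1),(2,2),(2,3),(3,0),(3,1),(3,2),(3,3)]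

theorem indepSublists_shrList : ∀ L ∈ indepSublists shrList, L.length ≤ 4 ∧
    (L.length = 4 → ∃ M ∈ cqMasks, ∀ v : Shr, v ∈ L ↔ M.testBit (vcode v) = true) := by decide +kernel

theorem shr_indep {f : Shr → Prop} (hf : ∀ u v, shrAdj u v → f u → ¬ f v) :
    {v | f v}.ncard ≤ 4 ∧ ({v | f v}.ncard = 4 → IsCq f) := by
  classical
  have h1 := filter_mem_indepSublists (fun v => decide (f v)) (fun u v h h' => by simpa using hf u v h (by simpa using h')) shrList
  have hm : ∀ v, v ∈ shrList := by decide +kernel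
  have hn : shrList.Nodup := by decide +kernel
  have h2 : {v | f v} = ((shrList.filter fun v => decide (f v)).toFinset : Set Shr) := by
    ext v; simp [hm]
  obtain ⟨h3, h4⟩ := indepSublists_shrList _ h1
  rw [h2, Set.ncard_coe_finset, List.toFinset_card_of_nodup (hn.filter _)]
  refine ⟨h3, fun h => ?_⟩
  obtain ⟨M, hM, e⟩ := h4 h
  refine ⟨M, hM, fun v => ?_⟩
  rw [← e]
  simp [hm]

theorem IsCq.ncard {f : Shr → Prop} (hf : IsCq f) : {v | f v}.ncard = 4 := by
  obtain ⟨M, hM, e⟩ := hf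
  have : ∀ M ∈ cqMasks, (Finset.univ.filter fun v : Shr => M.testBit (vcode v) = true).card = 4 := by decide +kernel
  rw [← this M hM, ← Set.ncard_coe_finset]
  congr 1
  ext v
  simpa using e v

end ShrikhandeIndependent

/-! ### Double counting along lines. -/

section Fibres

variable {V Q : Type*} [Fintype V] [Fintype Q]

/-- Double counting of the points of a set on the lines of one direction. -/
theorem sum_ncard_fibre (upd : V → Q → V) (get : V → Q) (h1 : ∀ z, upd z (get z) = z)
    (h2 : ∀ z q r, upd (upd z q) r = upd z r) (h3 : ∀ z q, get (upd z q) = q) (C : Set V) :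
    ∑ z, {q | upd z q ∈ C}.ncard = Fintype.card Q * C.ncard := by
  classical
  have e : ∀ z, {q | upd z q ∈ C}.ncard = ∑ q, if upd z q ∈ C then 1 else 0 := by
    intro z
    rw [← Finset.card_filter, ← Set.ncard_coe_finset]
    congr 1; ext q; simp
  simp_rw [e]
  rw [← Fintype.sum_prod_type' (f := fun z q => if upd z q ∈ C then 1 else 0), ← Finset.card_filter, mul_comm,
    Set.ncard_eq_toFinset_card', ← Finset.card_univ, ← Finset.card_product]
  refine Finset.card_nbij' (fun p => (upd p.1 p.2, get p.1)) (fun p => (upd p.1 p.2, get p.1)) ?_ ?_ ?_ ?_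
  · intro p hp
    simpa using hp
  · intro p hp
    have : p.1 ∈ C := by simpa using hp
    simpa [h2, h1] using this
  · intro p _
    simp [h2, h1, h3]
  · intro p _
    simp [h2, h1, h3]

theorem mul_ncard_le_of_fibre (upd : V → Q → V) (get : V → Q) (h1 : ∀ z, upd z (get z) = z)
    (h2 : ∀ z q r, upd (upd z q) r = upd z r) (h3 : ∀ z q, get (upd z q) = q) {C : Set V} {c : ℕ}
    (hc : ∀ z, {q | upd z q ∈ C}.ncard ≤ c) : Fintype.card Q * C.ncard ≤ Fintype.card V * c ∧
      (Fintype.card Q * C.ncard = Fintype.card V * c ↔ ∀ z, {q | upd z q ∈ C}.ncard = c) := by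
  rw [← sum_ncard_fibre upd get h1 h2 h3, ← smul_eq_mul (Fintype.card V), ← Finset.card_univ, ← Finset.sum_const]
  refine ⟨Finset.sum_le_sum fun z _ => hc z, ?_⟩
  rw [Finset.sum_eq_sum_iff_of_le fun z _ => hc z]
  simp

end Fibres

/-! ### Codes as independent sets of density one quarter. -/

section Independent

variable {m : ℕ} {ι : Type} [DecidableEq ι] [Fintype ι]

/-- Independent sets in the product of Shrikhande graphs and complete graphs. -/
structure DIndep (C : Set ((Fin m → Shr) × (ι → Fin 4))) : Prop where
  shr : ∀ x y i u v, shrAdj u v → (Function.update x i u, y) ∈ C → (Function.update x i v, y) ∉ C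
  ham : ∀ x y k p q, p ≠ q → (x, Function.update y k p) ∈ C → (x, Function.update y k q) ∉ C

variable {C : Set ((Fin m → Shr) × (ι → Fin 4))}

theorem DCode.indep (hC : DCode C) : DIndep C := by
  constructor
  · intro x y i u v h hu hv
    obtain ⟨M, hM, e⟩ := hC.shr x y i
    have := (e v).1 hv
    rw [cq_indep M hM u v h ((e u).1 hu)] at this
    cases this
  · intro x y k p q h hp hq
    exact h ((hC.ham x y k).unique hp hq)

theorem DIndep.shr_line (hC : DIndep C) (i : Fin m) : 4 * C.ncard ≤ Fintype.card ((Fin m → Shr) × (ι → Fin 4)) ∧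
    (4 * C.ncard = Fintype.card ((Fin m → Shr) × (ι → Fin 4)) ↔ ∀ x y, IsCq fun v => (Function.update x i v, y) ∈ C) := by
  have key := fun x y => shr_indep (f := fun v => (Function.update x i v, y) ∈ C) (hC.shr x y i)
  have := mul_ncard_le_of_fibre (fun (z : (Fin m → Shr) × (ι → Fin 4)) q => (Function.update z.1 i q, z.2))
    (fun z => z.1 i) (by simp) (by simp) (by simp) (C := C) (c := 4) fun z => (key z.1 z.2).1
  rw [show Fintype.card Shr = 16 from rfl] at this
  refine ⟨by omega, ?_⟩
  rw [show (∀ x y, IsCq fun v => (Function.update x i v, y) ∈ C) ↔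
    ∀ z : (Fin m → Shr) × (ι → Fin 4), {q | (Function.update z.1 i q, z.2) ∈ C}.ncard = 4 from
    ⟨fun h z => (h z.1 z.2).ncard, fun h x y => (key x y).2 (h (x, y))⟩, ← this.2]
  omega

theorem DIndep.ham_line (hC : DIndep C) (k : ι) : 4 * C.ncard ≤ Fintype.card ((Fin m → Shr) × (ι → Fin 4)) ∧
    (4 * C.ncard = Fintype.card ((Fin m → Shr) × (ι → Fin 4)) ↔ ∀ x y, ∃! q, (x, Function.update y k q) ∈ C) := by
  have := mul_ncard_le_of_fibre (fun (z : (Fin m → Shr) × (ι → Fin 4)) q => (z.1, Function.update z.2 k q))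
    (fun z => z.2 k) (by simp) (by simp) (by simp) (C := C) (c := 1) fun z => by
      rw [Set.ncard_le_one_iff]
      intro p q hp hq
      by_contra h
      exact hC.ham _ _ k p q h hp hq
  rw [Fintype.card_fin, mul_one] at this
  refine ⟨this.1, this.2.trans ?_⟩
  have e : ∀ x y, {q | (x, Function.update y k q) ∈ C}.ncard = 1 ↔ ∃! q, (x, Function.update y k q) ∈ C := by
    intro x y
    rw [Set.ncard_eq_one]
    constructor
    · rintro ⟨q, hq⟩
      exact ⟨q, (Set.ext_iff.1 hq q).2 rfl, fun r hr => (Set.ext_iff.1 hq r).1 hr⟩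
    · rintro ⟨q, h1, h2⟩
      exact ⟨q, Set.ext fun r => ⟨fun h => h2 r h, by rintro rfl; exact h1⟩⟩
  exact ⟨fun h x y => (e x y).1 (h (x, y)), fun h z => (e z.1 z.2).2 (h z.1 z.2)⟩

theorem DIndep.mul_ncard_le (hC : DIndep C) (h : 0 < m ∨ Nonempty ι) :
    4 * C.ncard ≤ Fintype.card ((Fin m → Shr) × (ι → Fin 4)) := by
  rcases h with h | ⟨⟨k⟩⟩
  · exact (hC.shr_line ⟨0, h⟩).1
  · exact (hC.ham_line k).1

/-- Every line carries at most a quarter of its points, and equality in the double count means that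
every line in every direction is full. At least one coordinate is needed, since otherwise the
conditions on `C` are empty. -/
theorem dCode_iff (h : 0 < m ∨ Nonempty ι) :
    DCode C ↔ DIndep C ∧ 4 * C.ncard = Fintype.card ((Fin m → Shr) × (ι → Fin 4)) := by
  constructor
  · intro hC
    refine ⟨hC.indep, ?_⟩
    rcases h with h | ⟨⟨k⟩⟩
    · exact (hC.indep.shr_line ⟨0, h⟩).2.2 fun x y => hC.shr x y _
    · exact (hC.indep.ham_line k).2.2 fun x y => hC.ham x y _
  · rintro ⟨hC, h⟩
    exact ⟨fun x y i => (hC.shr_line i).2.1 h x y, fun x y k => (hC.ham_line k).2.1 h x y⟩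

end Independent

/-! ### Passage to the graph of the statement. -/

section Link

variable {m n : ℕ}

/-- The elements of the Klein group. -/
def klein (q : Fin 4) : ZMod 2 × ZMod 2 := ![(0, 0), (0, 1), (1, 0), (1, 1)] q

theorem klein_bijective : Function.Bijective klein := by decide +kernel

theorem kleinGraph_adj : ∀ p q, kleinGraph.Adj (klein p) (klein q) ↔ p ≠ q := by
  unfold kleinGraph
  simp only [SimpleGraph.addCayley_adj']
  simp only [Set.mem_insert_iff, Set.mem_singleton_iff, exists_eq_or_imp, exists_eq_left]
  decide +kernel

theorem shrikhandeGraph_adj : ∀ u v : Shr, shrikhandeGraph.Adj u v ↔ shrAdj u v := by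
  unfold shrikhandeGraph
  simp only [SimpleGraph.addCayley_adj']
  simp only [Set.mem_insert_iff, Set.mem_singleton_iff, exists_eq_or_imp, exists_eq_left]
  decide +kernel

/-- The vertices of the Doob graph in coordinates. -/
noncomputable def vertexEquiv (m n : ℕ) : (Fin m → Shr) × (Fin n → Fin 4) ≃ DoobVertex m n :=
  (Equiv.refl _).prodCongr (Equiv.arrowCongr (Equiv.refl _) (Equiv.ofBijective klein klein_bijective))

theorem vertexEquiv_apply (z : (Fin m → Shr) × (Fin n → Fin 4)) : vertexEquiv m n z = (z.1, fun k => klein (z.2 k)) := rfl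

theorem isIndepSet_iff (S : Set (DoobVertex m n)) :
    (doobGraph m n).IsIndepSet S ↔ DIndep (vertexEquiv m n ⁻¹' S) := by
  have hadj : ∀ z w, (doobGraph m n).Adj (vertexEquiv m n z) (vertexEquiv m n w) ↔
      ((∃ i, shrAdj (z.1 i) (w.1 i) ∧ ∀ j, j ≠ i → z.1 j = w.1 j) ∧ z.2 = w.2) ∨
      ((∃ k, z.2 k ≠ w.2 k ∧ ∀ j, j ≠ k → z.2 j = w.2 j) ∧ z.1 = w.1) := by
    intro z w
    rw [doobGraph, SimpleGraph.boxProd_adj]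
    simp only [cartesianPower, vertexEquiv_apply, shrikhandeGraph_adj, kleinGraph_adj, klein_bijective.1.eq_iff]
    rw [show ((fun k => klein (z.2 k)) = fun k => klein (w.2 k)) ↔ z.2 = w.2 from
      klein_bijective.1.comp_left.eq_iff]
  constructor
  · intro h
    constructor
    · intro x y i u v huv hu hv
      have ha : (doobGraph m n).Adj (vertexEquiv m n (Function.update x i u, y)) (vertexEquiv m n (Function.update x i v, y)) :=
        (hadj _ _).2 (Or.inl ⟨⟨i, by simpa using huv, fun j hj => by simp [hj]⟩, rfl⟩)
      exact h hu hv ha.ne ha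
    · intro x y k p q hpq hp hq
      have ha : (doobGraph m n).Adj (vertexEquiv m n (x, Function.update y k p)) (vertexEquiv m n (x, Function.update y k q)) :=
        (hadj _ _).2 (Or.inr ⟨⟨k, by simpa using hpq, fun j hj => by simp [hj]⟩, rfl⟩)
      exact h hp hq ha.ne ha
  · intro h a ha b hb _ hab
    obtain ⟨z, rfl⟩ := (vertexEquiv m n).surjective a
    obtain ⟨w, rfl⟩ := (vertexEquiv m n).surjective b
    rcases (hadj z w).1 hab with ⟨⟨i, h1, h2⟩, h3⟩ | ⟨⟨k, h1, h2⟩, h3⟩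
    · have e : w = (Function.update z.1 i (w.1 i), z.2) := by
        refine Prod.ext ?_ h3.symm
        funext j
        by_cases hj : j = i
        · subst hj; simp
        · simp [hj, h2 j hj]
      refine h.shr z.1 z.2 i _ _ h1 ?_ ?_
      · rw [Function.update_eq_self]; exact ha
      · rw [← e]; exact hb
    · have e : w = (z.1, Function.update z.2 k (w.2 k)) := by
        refine Prod.ext h3.symm ?_
        funext j
        by_cases hj : j = k
        · subst hj; simp
        · simp [hj, h2 j hj]
      refine h.ham z.1 z.2 k _ _ h1 ?_ ?_
      · rw [Function.update_eq_self]; exact ha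
      · rw [← e]; exact hb

/-- The existence of one code shows that density one quarter is attained, so the maximum independent
sets are exactly those attaining it. -/
theorem numMDSCodes_eq (h : 0 < m + n) (hex : ∃ C : Set ((Fin m → Shr) × (Fin n → Fin 4)), DCode C) :
    numMDSCodes m n = {C : Set ((Fin m → Shr) × (Fin n → Fin 4)) | DCode C}.ncard := by
  classical
  have h' : 0 < m ∨ Nonempty (Fin n) := by
    rcases Nat.eq_zero_or_pos m with hm | hm
    · exact Or.inr ⟨⟨0, by omega⟩⟩
    · exact Or.inl hm
  have hcard : ∀ S : Finset (DoobVertex m n), (vertexEquiv m n ⁻¹' (S : Set (DoobVertex m n))).ncard = S.card := by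
    intro S
    rw [Set.ncard_preimage_of_injective_subset_range (vertexEquiv m n).injective
      (by rw [(vertexEquiv m n).surjective.range_eq]; exact Set.subset_univ _), Set.ncard_coe_finset]
  have key : ∀ S : Finset (DoobVertex m n), IsMDSCode S ↔ DCode (vertexEquiv m n ⁻¹' (S : Set (DoobVertex m n))) := by
    intro S
    rw [dCode_iff h', IsMDSCode, SimpleGraph.isMaximumIndepSet_iff, isIndepSet_iff, hcard]
    refine and_congr_right fun hS => ⟨fun hmax => ?_, fun heq T hT => ?_⟩
    · obtain ⟨C, hC⟩ := hex
      obtain ⟨hC1, hC2⟩ := (dCode_iff h').1 hC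
      have he : vertexEquiv m n ⁻¹' ((vertexEquiv m n '' C).toFinset : Set (DoobVertex m n)) = C := by
        rw [Set.coe_toFinset, Set.preimage_image_eq _ (vertexEquiv m n).injective]
      have h1 := hmax (vertexEquiv m n '' C).toFinset (by rw [isIndepSet_iff, he]; exact hC1)
      rw [← hcard (vertexEquiv m n '' C).toFinset, he] at h1
      have h2 := hS.mul_ncard_le h'
      rw [hcard] at h2
      omega
    · have h2 := ((isIndepSet_iff _).1 hT).mul_ncard_le h'
      rw [hcard] at h2
      omega
  rw [numMDSCodes, ← Nat.card_coe_set_eq]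
  have hb : Function.Bijective fun S : Finset (DoobVertex m n) => vertexEquiv m n ⁻¹' (S : Set (DoobVertex m n)) := by
    refine ⟨?_, ?_⟩
    · intro S T h
      exact Finset.coe_injective ((vertexEquiv m n).surjective.preimage_injective h)
    · intro C
      exact ⟨(vertexEquiv m n '' C).toFinset, by
        simp only [Set.coe_toFinset, Set.preimage_image_eq _ (vertexEquiv m n).injective]⟩
  exact Nat.card_congr ((Equiv.ofBijective _ hb).subtypeEquiv key)

end Link

/-! ### A large family of codes in the zero set of each linear function. -/

section Family

/-- The refinement of the label of a Shrikhande coordinate. -/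
def refS (l : Fin 3) (v : Shr) : ZMod 4 := ![v.1, v.1 - v.2, v.2] l

/-- The additional bit of a Shrikhande coordinate. -/
def bitS (l : Fin 3) (v : Shr) : ZMod 2 := ![par4 v.2, par4 v.1, par4 v.1] l

/-- The additional bit of a coordinate of the complete graph. -/
def bitK : Fin 3 → Fin 4 → ZMod 2 := ![![0, 1, 0, 1], ![0, 0, 1, 1], ![0, 0, 1, 1]]

theorem par4_add : ∀ a b, par4 (a + b) = par4 a + par4 b := by decide +kernel
theorem par4_refS : ∀ l v, par4 (refS l v) = chr l v := by decide +kernel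
theorem refS_surjective : ∀ l a, ∃ v, refS l v = a := by decide +kernel
theorem lb_surjective : ∀ l a, ∃ q, lb l q = a := by decide +kernel

/-- Keeping the refined label and flipping the bit changes every other label; this separates
families with different labels. -/
theorem exists_flipS : ∀ l v, ∃ v', refS l v' = refS l v ∧ bitS l v' = bitS l v + 1 ∧
    ∀ l', l' ≠ l → chr l' v' = chr l' v + 1 := by decide +kernel

theorem exists_flipK : ∀ l q, ∃ q', lb l q' = lb l q ∧ bitK l q' = bitK l q + 1 ∧
    ∀ l', l' ≠ l → lb l' q' = lb l' q + 1 := by decide +kernel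

/-- Two refined labels have the given parity. Each has four vertices, of which the chosen bit keeps
two, and the resulting four vertices are independent for every choice of bits. -/
theorem isCq_bitS (l : Fin 3) (c : ZMod 2) (τ : ZMod 4 → ZMod 2) :
    IsCq fun v => chr l v = c ∧ bitS l v = τ (refS l v) := by
  have key : ∀ (l : Fin 3) (c t0 t1 t2 t3 : ZMod 2), ∃ M ∈ cqMasks, ∀ v : Shr,
      (chr l v = c ∧ bitS l v = (![t0, t1, t2, t3] : Fin 4 → ZMod 2) (refS l v)) ↔ M.testBit (vcode v) = true := by
    decide +kernel
  have e : (![τ 0, τ 1, τ 2, τ 3] : Fin 4 → ZMod 2) = τ := by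
    funext a; fin_cases a <;> rfl
  have := key l c (τ 0) (τ 1) (τ 2) (τ 3)
  rw [e] at this
  exact this

theorem existsUnique_bitK (l : Fin 3) (c : ZMod 2) (τ : ZMod 2 → ZMod 2) :
    ∃! q, lb l q = c ∧ bitK l q = τ (lb l q) := by
  have key : ∀ (l : Fin 3) (c t : ZMod 2), ∃ q, (lb l q = c ∧ bitK l q = t) ∧ ∀ q', lb l q' = c ∧ bitK l q' = t → q' = q := by
    decide +kernel
  obtain ⟨q, ⟨h1, h2⟩, h3⟩ := key l c (τ c)
  exact ⟨q, ⟨h1, by rw [h1, h2]⟩, fun q' ⟨h, h'⟩ => h3 q' ⟨h, by rw [h', h]⟩⟩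

variable {m : ℕ} {ι : Type} [DecidableEq ι] [Fintype ι]

/-- The vector of refined labels. -/
def refV (l : Fin m → Fin 3) (μ : ι → Fin 3) (z : (Fin m → Shr) × (ι → Fin 4)) : (Fin m → ZMod 4) × (ι → ZMod 2) :=
  (fun i => refS (l i) (z.1 i), fun k => lb (μ k) (z.2 k))

/-- The sum of the additional bits. -/
def bitV (l : Fin m → Fin 3) (μ : ι → Fin 3) (z : (Fin m → Shr) × (ι → Fin 4)) : ZMod 2 :=
  ∑ i, bitS (l i) (z.1 i) + ∑ k, bitK (μ k) (z.2 k)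

/-- The parity of a vector of refined labels. -/
def parV (c : ZMod 2) (a : (Fin m → ZMod 4) × (ι → ZMod 2)) : ZMod 2 := c + (∑ i, par4 (a.1 i) + ∑ k, a.2 k)

/-- The code of a function of the refined labels. -/
def famCode (c : ZMod 2) (l : Fin m → Fin 3) (μ : ι → Fin 3) (σ : (Fin m → ZMod 4) × (ι → ZMod 2) → ZMod 2) :
    Set ((Fin m → Shr) × (ι → Fin 4)) := {z | dlin c l μ z = 0 ∧ bitV l μ z = σ (refV l μ z)}

variable (c : ZMod 2) (l : Fin m → Fin 3) (μ : ι → Fin 3)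

theorem parV_refV (z : (Fin m → Shr) × (ι → Fin 4)) : parV c (refV l μ z) = dlin c l μ z := by
  simp only [parV, refV, dlin, par4_refS]

theorem exists_refV (a : (Fin m → ZMod 4) × (ι → ZMod 2)) : ∃ z, refV l μ z = a := by
  choose x hx using fun i => refS_surjective (l i) (a.1 i)
  choose y hy using fun k => lb_surjective (μ k) (a.2 k)
  exact ⟨(x, y), Prod.ext (funext hx) (funext hy)⟩

variable {l μ}

theorem dlin_update_left (x : Fin m → Shr) (y : ι → Fin 4) (i : Fin m) (v : Shr) :
    dlin c l μ (Function.update x i v, y) = dlin c l μ (x, y) + chr (l i) (x i) + chr (l i) v := by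
  simp only [dlin, sum_update_zmod_two fun i => chr (l i)]; ring

theorem dlin_update_right (x : Fin m → Shr) (y : ι → Fin 4) (k : ι) (q : Fin 4) :
    dlin c l μ (x, Function.update y k q) = dlin c l μ (x, y) + lb (μ k) (y k) + lb (μ k) q := by
  simp only [dlin, sum_update_zmod_two fun k => lb (μ k)]; ring

theorem bitV_update_left (x : Fin m → Shr) (y : ι → Fin 4) (i : Fin m) (v : Shr) :
    bitV l μ (Function.update x i v, y) = bitV l μ (x, y) + bitS (l i) (x i) + bitS (l i) v := by
  simp only [bitV, sum_update_zmod_two fun i => bitS (l i)]; ring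

theorem bitV_update_right (x : Fin m → Shr) (y : ι → Fin 4) (k : ι) (q : Fin 4) :
    bitV l μ (x, Function.update y k q) = bitV l μ (x, y) + bitK (μ k) (y k) + bitK (μ k) q := by
  simp only [bitV, sum_update_zmod_two fun k => bitK (μ k)]; ring

theorem refV_update_left (x : Fin m → Shr) (y : ι → Fin 4) (i : Fin m) (v : Shr) :
    refV l μ (Function.update x i v, y) = (Function.update (refV l μ (x, y)).1 i (refS (l i) v), (refV l μ (x, y)).2) := by
  refine Prod.ext (funext fun j => ?_) rfl
  by_cases h : j = i
  · subst h; simp [refV]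
  · simp [refV, h]

theorem refV_update_right (x : Fin m → Shr) (y : ι → Fin 4) (k : ι) (q : Fin 4) :
    refV l μ (x, Function.update y k q) = ((refV l μ (x, y)).1, Function.update (refV l μ (x, y)).2 k (lb (μ k) q)) := by
  refine Prod.ext rfl (funext fun j => ?_)
  by_cases h : j = k
  · subst h; simp [refV]
  · simp [refV, h]

variable (l μ)

theorem dCode_famCode (σ : (Fin m → ZMod 4) × (ι → ZMod 2) → ZMod 2) : DCode (famCode c l μ σ) := by
  constructor
  · intro x y i
    simp only [famCode, Set.mem_ofPred_eq, dlin_update_left, bitV_update_left, refV_update_left, zmod_two_add_eq_zero,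
      zmod_two_swap (b := bitS _ _)]
    exact isCq_bitS (l i) _ fun a => bitV l μ (x, y) + bitS (l i) (x i) +
      σ (Function.update (refV l μ (x, y)).1 i a, (refV l μ (x, y)).2)
  · intro x y k
    simp only [famCode, Set.mem_ofPred_eq, dlin_update_right, bitV_update_right, refV_update_right, zmod_two_add_eq_zero,
      zmod_two_swap (b := bitK _ _)]
    exact existsUnique_bitK (μ k) _ fun a => bitV l μ (x, y) + bitK (μ k) (y k) +
      σ ((refV l μ (x, y)).1, Function.update (refV l μ (x, y)).2 k a)

theorem famCode_injOn {σ σ' : (Fin m → ZMod 4) × (ι → ZMod 2) → ZMod 2} (h : famCode c l μ σ = famCode c l μ σ')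
    {a : (Fin m → ZMod 4) × (ι → ZMod 2)} (ha : parV c a = 0) : σ a = σ' a := by
  obtain ⟨z, rfl⟩ := exists_refV l μ a
  have h1 := Set.ext_iff.1 h z
  rw [parV_refV] at ha
  simp only [famCode, Set.mem_ofPred_eq, ha, true_and] at h1
  have : ∀ a b c : ZMod 2, (a = b ↔ a = c) → b = c := by decide
  exact this _ _ _ h1

theorem famCode_congr {σ σ' : (Fin m → ZMod 4) × (ι → ZMod 2) → ZMod 2} (h : ∀ a, parV c a = 0 → σ a = σ' a) :
    famCode c l μ σ = famCode c l μ σ' := by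
  ext z
  simp only [famCode, Set.mem_ofPred_eq]
  refine and_congr_right fun hz => ?_
  rw [h _ (by rw [parV_refV]; exact hz)]

variable {c l μ}

theorem exists_flip {l' : Fin m → Fin 3} {μ' : ι → Fin 3} (c' : ZMod 2) (h : (l, μ) ≠ (l', μ'))
    (z : (Fin m → Shr) × (ι → Fin 4)) : ∃ z', refV l μ z' = refV l μ z ∧ bitV l μ z' = bitV l μ z + 1 ∧
      dlin c' l' μ' z' = dlin c' l' μ' z + 1 := by
  have hz : ∀ a b : ZMod 2, a + b + (b + 1) = a + 1 := by decide
  by_cases hl : l = l'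
  · obtain ⟨k, hk⟩ := Function.ne_iff.1 (fun e => h (by rw [hl, e]) : μ ≠ μ')
    obtain ⟨q, h1, h2, h3⟩ := exists_flipK (μ k) (z.2 k)
    refine ⟨(z.1, Function.update z.2 k q), ?_, ?_, ?_⟩
    · rw [refV_update_right, h1]
      exact Prod.ext rfl (Function.update_eq_self k _)
    · rw [bitV_update_right, h2, hz]
    · rw [dlin_update_right, h3 _ hk.symm, hz]
  · obtain ⟨k, hk⟩ := Function.ne_iff.1 hl
    obtain ⟨q, h1, h2, h3⟩ := exists_flipS (l k) (z.1 k)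
    refine ⟨(Function.update z.1 k q, z.2), ?_, ?_, ?_⟩
    · rw [refV_update_left, h1]
      exact Prod.ext (Function.update_eq_self k _) rfl
    · rw [bitV_update_left, h2, hz]
    · rw [dlin_update_left, h3 _ (Ne.symm hk), hz]

/-- Over a refined vector take a point and its flip from `exists_flip`: exactly one of the two is in
the code, and it is the one on which the second linear function vanishes. This forces the value of
the choice function. -/
theorem famCode_eq_of_subset {l' : Fin m → Fin 3} {μ' : ι → Fin 3} {c' : ZMod 2} (h : (l, μ) ≠ (l', μ'))
    {σ σ' : (Fin m → ZMod 4) × (ι → ZMod 2) → ZMod 2} (h1 : ∀ z ∈ famCode c l μ σ, dlin c' l' μ' z = 0)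
    (h2 : ∀ z ∈ famCode c l μ σ', dlin c' l' μ' z = 0) : famCode c l μ σ = famCode c l μ σ' := by
  refine famCode_congr c l μ fun a ha => ?_
  obtain ⟨z, rfl⟩ := exists_refV l μ a
  obtain ⟨z', e1, e2, e3⟩ := exists_flip c' h z
  have key : ∀ {σ : (Fin m → ZMod 4) × (ι → ZMod 2) → ZMod 2}, (∀ z ∈ famCode c l μ σ, dlin c' l' μ' z = 0) →
      σ (refV l μ z) = bitV l μ z + dlin c' l' μ' z := by
    intro σ hσ
    have hz := hσ z
    have hz' := hσ z'
    simp only [famCode, Set.mem_ofPred_eq, ← parV_refV c l μ, e1, ha, true_and, e2, e3] at hz hz'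
    revert hz hz'
    generalize σ (refV l μ z) = s
    generalize bitV l μ z = b
    generalize dlin c' l' μ' z = d
    clear * -
    revert s b d
    decide
  rw [key h1, key h2]

end Family

/-! ### The lower bound. -/

section LowerBound

/-- Discard from each family the codes lying in another `p b'`; at most one is lost for each `b'`,
and the remaining families are disjoint. -/
theorem sum_ncard_le_of_few_common {B α : Type*} [Fintype B] [Finite α] {f p : B → Set α} {L : ℕ}
    (hL : ∀ b, L ≤ (f b).ncard) (hfp : ∀ b, f b ⊆ p b) (h : ∀ b b', b ≠ b' → (f b ∩ p b').ncard ≤ 1) {T : Set α}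
    (hT : ∀ b, f b ⊆ T) : Fintype.card B * L ≤ T.ncard + Fintype.card B * Fintype.card B := by
  classical
  cases nonempty_fintype α
  let g : B → Finset α := fun b => Finset.univ.filter fun C => C ∈ f b ∧ ∀ b', b ≠ b' → C ∉ p b'
  have hg : ∀ b, L ≤ (g b).card + Fintype.card B := by
    intro b
    refine (hL b).trans ?_
    have hs : (f b).toFinset ⊆ g b ∪ (Finset.univ.filter fun b' => b ≠ b').biUnion fun b' => (f b ∩ p b').toFinset := by
      intro C hC
      rw [Set.mem_toFinset] at hC
      by_cases hC' : ∀ b', b ≠ b' → C ∉ p b'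
      · exact Finset.mem_union_left _ (Finset.mem_filter.2 ⟨Finset.mem_univ _, hC, hC'⟩)
      · push Not at hC'
        obtain ⟨b', h1, h2⟩ := hC'
        exact Finset.mem_union_right _ (Finset.mem_biUnion.2 ⟨b', by simp [h1], by simp [hC, h2]⟩)
    rw [Set.ncard_eq_toFinset_card']
    refine (Finset.card_le_card hs).trans ((Finset.card_union_le _ _).trans (Nat.add_le_add_left ?_ _))
    refine (Finset.card_biUnion_le_card_mul _ _ 1 fun b' hb' => ?_).trans ?_
    · rw [← Set.ncard_eq_toFinset_card']
      exact h b b' (by simpa using hb')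
    · rw [mul_one]
      exact Finset.card_le_univ _
  have hd : (Finset.univ.biUnion g).card = ∑ b, (g b).card := by
    refine Finset.card_biUnion fun b _ b' _ hb => Finset.disjoint_left.2 fun C hC hC' => ?_
    simp only [g, Finset.mem_filter, Finset.mem_univ, true_and] at hC hC'
    exact hC.2 b' hb (hfp b' hC'.1)
  have hle : (Finset.univ.biUnion g).card ≤ T.ncard := by
    rw [Set.ncard_eq_toFinset_card']
    refine Finset.card_le_card fun C hC => ?_
    obtain ⟨b, _, hb⟩ := Finset.mem_biUnion.1 hC
    simp only [g, Finset.mem_filter, Finset.mem_univ, true_and] at hb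
    exact Set.mem_toFinset.2 (hT b hb.1)
  calc Fintype.card B * L = ∑ b : B, L := by simp
    _ ≤ ∑ b, ((g b).card + Fintype.card B) := Finset.sum_le_sum fun b _ => hg b
    _ = (Finset.univ.biUnion g).card + Fintype.card B * Fintype.card B := by
      rw [Finset.sum_add_distrib, ← hd]; simp
    _ ≤ _ := Nat.add_le_add_right hle _

variable {m : ℕ} {ι : Type} [DecidableEq ι] [Fintype ι]

theorem parV_add (c : ZMod 2) (a t : (Fin m → ZMod 4) × (ι → ZMod 2)) : parV c (a + t) = parV c a + parV 0 t := by
  simp only [parV, Prod.fst_add, Prod.snd_add, Pi.add_apply, par4_add, Finset.sum_add_distrib]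
  ring

theorem exists_parV_eq_one (h : 0 < m ∨ Nonempty ι) : ∃ t : (Fin m → ZMod 4) × (ι → ZMod 2), parV 0 t = 1 := by
  have h0 : par4 0 = 0 := by decide
  have h1 : par4 1 = 1 := by decide
  rcases h with h | ⟨⟨k⟩⟩
  · refine ⟨(Pi.single ⟨0, h⟩ 1, 0), ?_⟩
    simp only [parV, Pi.zero_apply, Finset.sum_const_zero, add_zero, zero_add]
    rw [Fintype.sum_eq_single (⟨0, h⟩ : Fin m) fun j hj => by rw [Pi.single_eq_of_ne hj, h0], Pi.single_eq_same, h1]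
  · refine ⟨(0, Pi.single k 1), ?_⟩
    simp only [parV, Pi.zero_apply, h0, Finset.sum_const_zero, zero_add]
    rw [Fintype.sum_eq_single k fun j hj => Pi.single_eq_of_ne hj 1, Pi.single_eq_same]

/-- Translation by a vector of odd parity exchanges the two parities, so exactly half of the vectors
count. -/
theorem ncard_parV (h : 0 < m ∨ Nonempty ι) (c : ZMod 2) :
    {a : (Fin m → ZMod 4) × (ι → ZMod 2) | parV c a = 0}.ncard = 2 ^ (2 * m + Nat.card ι - 1) := by
  obtain ⟨t, ht⟩ := exists_parV_eq_one h
  set P := {a : (Fin m → ZMod 4) × (ι → ZMod 2) | parV c a = 0} with hP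
  have h1 : (Equiv.addRight t) ⁻¹' P = Pᶜ := by
    ext a
    rw [Set.mem_compl_iff, Set.mem_preimage, hP, Set.mem_ofPred_eq, Set.mem_ofPred_eq, Equiv.coe_addRight, parV_add, ht]
    generalize parV c a = s
    revert s; decide
  have h2 : Pᶜ.ncard = P.ncard := by
    rw [← h1, Set.ncard_preimage_of_injective_subset_range (Equiv.addRight t).injective
      (by rw [(Equiv.addRight t).surjective.range_eq]; exact Set.subset_univ _)]
  have h3 := Set.ncard_add_ncard_compl P
  have h4 : Nat.card ((Fin m → ZMod 4) × (ι → ZMod 2)) = 2 ^ (2 * m + Nat.card ι) := by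
    rw [Nat.card_eq_fintype_card, Nat.card_eq_fintype_card]
    simp only [Fintype.card_prod, Fintype.card_fun, Fintype.card_fin, ZMod.card, pow_add, pow_mul]
    norm_num
  have h5 : 2 * m + Nat.card ι = 2 * m + Nat.card ι - 1 + 1 := by
    rcases h with h | h
    · omega
    · have : 0 < Nat.card ι := Nat.card_pos
      omega
  rw [h2, h4, h5, pow_succ] at h3
  omega

open Classical in
/-- The extension by zero of a function on the vectors of even parity. -/
noncomputable def extPar (c : ZMod 2) (σ : {a : (Fin m → ZMod 4) × (ι → ZMod 2) // parV c a = 0} → ZMod 2)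
    (a : (Fin m → ZMod 4) × (ι → ZMod 2)) : ZMod 2 := if h : parV c a = 0 then σ ⟨a, h⟩ else 0

theorem ncard_range_famCode (h : 0 < m ∨ Nonempty ι) (c : ZMod 2) (l : Fin m → Fin 3) (μ : ι → Fin 3) :
    2 ^ 2 ^ (2 * m + Nat.card ι - 1) ≤ (Set.range (famCode c l μ)).ncard := by
  rw [← ncard_parV h c]
  have h1 : 2 ^ {a : (Fin m → ZMod 4) × (ι → ZMod 2) | parV c a = 0}.ncard =
      (Set.univ : Set ({a : (Fin m → ZMod 4) × (ι → ZMod 2) // parV c a = 0} → ZMod 2)).ncard := by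
    rw [Set.ncard_univ, Nat.card_fun, Nat.card_zmod]
    rfl
  rw [h1]
  refine Set.ncard_le_ncard_of_injOn (fun σ => famCode c l μ (extPar c σ)) (fun σ _ => ⟨_, rfl⟩) ?_ (Set.toFinite _)
  intro σ _ σ' _ e
  funext ⟨a, ha⟩
  have := famCode_injOn c l μ e ha
  simpa [extPar, ha] using this

theorem DCode.nonempty {C : Set ((Fin m → Shr) × (ι → Fin 4))} (hC : DCode C) (h : 0 < m ∨ Nonempty ι) : C.Nonempty := by
  have := ((dCode_iff h).1 hC).2
  by_contra hn
  rw [Set.not_nonempty_iff_eq_empty] at hn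
  rw [hn, Set.ncard_empty] at this
  exact Fintype.card_ne_zero this.symm

theorem le_ncard_dCode (h : 0 < m ∨ Nonempty ι) :
    2 * 3 ^ (m + Nat.card ι) * 2 ^ 2 ^ (2 * m + Nat.card ι - 1) ≤
      {C : Set ((Fin m → Shr) × (ι → Fin 4)) | DCode C}.ncard +
        2 * 3 ^ (m + Nat.card ι) * (2 * 3 ^ (m + Nat.card ι)) := by
  have hc : Fintype.card (ZMod 2 × (Fin m → Fin 3) × (ι → Fin 3)) = 2 * 3 ^ (m + Nat.card ι) := by
    rw [← ncard_univ_params, Set.ncard_univ, Nat.card_eq_fintype_card]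
  rw [← hc]
  refine sum_ncard_le_of_few_common (f := fun b : ZMod 2 × (Fin m → Fin 3) × (ι → Fin 3) =>
    Set.range (famCode b.1 b.2.1 b.2.2)) (p := fun b => DSub (dlin b.1 b.2.1 b.2.2))
    (fun b => ncard_range_famCode h _ _ _) ?_ ?_ ?_
  · rintro b _ ⟨σ, rfl⟩
    exact ⟨dCode_famCode _ _ _ _, fun z hz => hz.1⟩
  · rintro ⟨c, l, μ⟩ ⟨c', l', μ'⟩ hb
    rw [Set.ncard_le_one_iff]
    rintro _ _ ⟨⟨σ, rfl⟩, h1⟩ ⟨⟨σ', rfl⟩, h2⟩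
    by_cases hl : (l, μ) = (l', μ')
    · exfalso
      obtain ⟨rfl, rfl⟩ := Prod.mk.inj hl
      obtain ⟨z, hz⟩ := (dCode_famCode c l μ σ).nonempty h
      have e1 : dlin c l μ z = 0 := hz.1
      have e2 : dlin c' l μ z = 0 := h1.2 z hz
      refine hb ?_
      congr 1
      exact add_right_cancel (e1.trans e2.symm)
    · exact famCode_eq_of_subset hl h1.2 h2.2
  · rintro b _ ⟨σ, rfl⟩
    exact dCode_famCode _ _ _ _

end LowerBound

/-! ### Assembling the asymptotics. -/

theorem cube_le_two_pow {N : ℕ} (hN : 30 ≤ N) : 10 * N ^ 3 + N ≤ 2 ^ (N - 10) := by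
  obtain ⟨k, rfl⟩ := Nat.exists_eq_add_of_le hN
  rw [show 30 + k - 10 = 20 + k by omega]
  induction k with
  | zero => norm_num
  | succ k ih =>
    have h1 := ih (by omega)
    rw [show 20 + (k + 1) = 20 + k + 1 by ring, pow_succ 2 (20 + k)]
    nlinarith [sq_nonneg (k : ℤ), Nat.zero_le (k ^ 3), Nat.zero_le (k ^ 2)]

theorem five_mul_le_two_pow {N : ℕ} (hN : 30 ≤ N) : 5 * N ≤ 2 ^ (N - 2) := by
  have h1 := cube_le_two_pow hN
  have h2 : 2 ^ (N - 10) ≤ 2 ^ (N - 2) := Nat.pow_le_pow_right (by norm_num) (by omega)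
  have h3 : N ≤ N ^ 3 := Nat.le_self_pow (by norm_num) N
  omega

theorem three_pow_le (N : ℕ) : 3 ^ N ≤ 2 ^ (2 * N) := by
  rw [pow_mul]
  exact Nat.pow_le_pow_left (by norm_num) N

/-- With `N = 2 * m + n`, the upper error consists of the non-semilinear Hamming codes and the codes
with mixed labels from `m` trades; the lower error is the overlap of the families. Each is smaller
than its allowance by doubly exponential growth, and the threshold 30 is where `cube_le_two_pow` is
available. -/
theorem numMDSCodes_bounds {m n : ℕ} (h : 30 ≤ m + n) :
    2 ^ (m + n) * numMDSCodes m n ≤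
      2 ^ (m + n) * (2 * 3 ^ (m + n) * 2 ^ 2 ^ (2 * m + n - 1)) + 2 * 2 ^ 2 ^ (2 * m + n - 1) ∧
    2 ^ (m + n) * (2 * 3 ^ (m + n) * 2 ^ 2 ^ (2 * m + n - 1)) ≤
      2 ^ (m + n) * numMDSCodes m n + 2 * 3 ^ (m + n) * 2 ^ 2 ^ (2 * m + n - 1) := by
  have hn : 0 < m ∨ Nonempty (Fin n) := by
    rcases Nat.eq_zero_or_pos m with hm | hm
    · exact Or.inr ⟨⟨0, by omega⟩⟩
    · exact Or.inl hm
  rw [numMDSCodes_eq (by omega) ⟨_, dCode_famCode 0 (fun _ => 0) (fun _ => 0) fun _ => 0⟩]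
  have hlow := le_ncard_dCode (m := m) (ι := Fin n) hn
  have hup := ncard_dCode_le (m := m) (ι := Fin n) (N := 2 * m + n) (by omega) (by rw [Nat.card_fin])
  rw [Nat.card_fin] at hlow hup
  have hR := nonsemi_bound (N := 2 * m + n) (by omega)
  obtain ⟨N, hN⟩ : ∃ N, N = 2 * m + n := ⟨_, rfl⟩
  rw [← hN] at hlow hup hR ⊢
  have hN' : 30 ≤ N := by omega
  have h1 := cube_le_two_pow hN'
  have h2 := five_mul_le_two_pow hN'
  have hs : 2 ^ (m + n) ≤ 2 ^ N := Nat.pow_le_pow_right (by norm_num) (by omega)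
  have hs3 : 3 ^ (m + n) ≤ 3 ^ N := Nat.pow_le_pow_right (by norm_num) (by omega)
  have hX : 2 ^ 2 ^ (N - 1) = 2 ^ 2 ^ (N - 2) * 2 ^ 2 ^ (N - 2) := by
    rw [← pow_add, ← two_mul, ← pow_succ']
    congr 2; omega
  have h5 : 2 ^ (5 * N) ≤ 2 ^ 2 ^ (N - 2) := Nat.pow_le_pow_right (by norm_num) h2
  have h3 := three_pow_le N
  have hNN : N ≤ 2 ^ (N - 1) := by
    have : N - 1 < 2 ^ (N - 1) := Nat.lt_two_pow_self
    omega
  have hdbl : 2 * 2 ^ (N - 1) = 2 ^ N := by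
    rw [← pow_succ']; congr 1; omega
  have hA : 2 ^ N * {C : Set (Fin N → Fin 4) | IsCode C ∧ ¬ Semi C}.ncard ≤ 2 ^ 2 ^ (N - 1) := by
    refine Nat.le_of_mul_le_mul_right (c := 2 ^ (10 * N ^ 3)) ?_ (by positivity)
    rw [pow_add 2 (2 ^ (N - 1))] at hR
    refine le_trans ?_ hR
    rw [mul_comm (2 ^ N), mul_assoc, ← pow_add]
    exact Nat.mul_le_mul_left _ (Nat.pow_le_pow_right (by norm_num) (by omega))
  have hB : 2 ^ N * (m * (2 ^ 2 ^ (N - 2) * (2 * 3 ^ N))) ≤ 2 ^ 2 ^ (N - 1) := by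
    rw [hX]
    calc 2 ^ N * (m * (2 ^ 2 ^ (N - 2) * (2 * 3 ^ N)))
        ≤ 2 ^ N * (2 ^ (N - 1) * (2 ^ 2 ^ (N - 2) * (2 * 2 ^ (2 * N)))) := by gcongr; omega
      _ = 2 ^ 2 ^ (N - 2) * (2 ^ N * (2 * 2 ^ (N - 1)) * 2 ^ (2 * N)) := by ring
      _ = 2 ^ 2 ^ (N - 2) * 2 ^ (4 * N) := by
        rw [hdbl, ← pow_add, ← pow_add]; congr 2; ring
      _ ≤ 2 ^ 2 ^ (N - 2) * 2 ^ 2 ^ (N - 2) :=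
        Nat.mul_le_mul_left _ ((Nat.pow_le_pow_right (by norm_num) (by omega)).trans h5)
  have hK : 2 ^ (m + n) * (2 * 3 ^ (m + n)) ≤ 2 ^ 2 ^ (N - 1) := by
    calc 2 ^ (m + n) * (2 * 3 ^ (m + n)) ≤ 2 ^ N * (2 ^ N * 2 ^ (2 * N)) := by
          exact Nat.mul_le_mul hs (Nat.mul_le_mul (Nat.le_self_pow (by omega) 2) (hs3.trans h3))
      _ = 2 ^ (4 * N) := by rw [← pow_add, ← pow_add]; congr 1; ring
      _ ≤ 2 ^ (5 * N) := Nat.pow_le_pow_right (by norm_num) (by omega)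
      _ ≤ 2 ^ 2 ^ (N - 2) * 1 := by rw [mul_one]; exact h5
      _ ≤ 2 ^ 2 ^ (N - 1) := by rw [hX]; exact Nat.mul_le_mul_left _ Nat.one_le_two_pow
  constructor
  · calc _ ≤ 2 ^ (m + n) * _ := Nat.mul_le_mul_left _ hup
      _ ≤ _ := by
        rw [mul_add, mul_add, two_mul (2 ^ 2 ^ (N - 1))]
        exact Nat.add_le_add_left (Nat.add_le_add ((Nat.mul_le_mul_right _ hs).trans hA)
          ((Nat.mul_le_mul_right _ hs).trans hB)) _
  · calc _ ≤ 2 ^ (m + n) * _ := Nat.mul_le_mul_left _ hlow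
      _ ≤ _ := by
        rw [mul_add, ← mul_assoc _ (2 * 3 ^ (m + n)), mul_comm (2 * 3 ^ (m + n)) (2 ^ 2 ^ (N - 1))]
        exact Nat.add_le_add_left (Nat.mul_le_mul_right _ hK) _

theorem abs_numMDSCodes_div_sub_one_le {m n : ℕ} (h : 30 ≤ m + n) :
    |(numMDSCodes m n : ℝ) / (2 * 3 ^ (m + n) * 2 ^ (2 ^ (2 * m + n - 1))) - 1| ≤ (1 / 2) ^ (m + n) := by
  obtain ⟨h1, h2⟩ := numMDSCodes_bounds h
  have h3 : (1 : ℝ) ≤ 3 ^ (m + n) := one_le_pow₀ (by norm_num)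
  have h1' : (2 : ℝ) ^ (m + n) * numMDSCodes m n ≤
      2 ^ (m + n) * (2 * 3 ^ (m + n) * 2 ^ 2 ^ (2 * m + n - 1)) + 2 * 2 ^ 2 ^ (2 * m + n - 1) := by exact_mod_cast h1
  have h2' : (2 : ℝ) ^ (m + n) * (2 * 3 ^ (m + n) * 2 ^ 2 ^ (2 * m + n - 1)) ≤
      2 ^ (m + n) * numMDSCodes m n + 2 * 3 ^ (m + n) * 2 ^ 2 ^ (2 * m + n - 1) := by exact_mod_cast h2
  have hs : (0 : ℝ) < 2 ^ (m + n) := by positivity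
  have hX : (0 : ℝ) < 2 ^ 2 ^ (2 * m + n - 1) := by positivity
  generalize (2 : ℝ) ^ 2 ^ (2 * m + n - 1) = X at *
  generalize (3 : ℝ) ^ (m + n) = K at *
  have hKX : 0 < 2 * K * X := by positivity
  have hle : 2 * X ≤ 2 * K * X := by nlinarith
  rw [one_div, inv_pow]
  generalize (2 : ℝ) ^ (m + n) = S at *
  rw [← div_self hKX.ne', ← sub_div, abs_div, abs_of_pos hKX, div_le_iff₀ hKX, abs_le]
  have e : S * (S⁻¹ * (2 * K * X)) = 2 * K * X := by
    rw [← mul_assoc, mul_inv_cancel₀ hs.ne', one_mul]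
  constructor <;> refine le_of_mul_le_mul_left ?_ hs
  · rw [mul_neg, e]; linarith
  · rw [e]; linarith

theorem mainTheorem3 :
    Tendsto
      (fun p : ℕ × ℕ => (numMDSCodes p.1 p.2 : ℝ) /
        (2 * 3 ^ (p.1 + p.2) * 2 ^ (2 ^ (2 * p.1 + p.2 - 1))))
      (comap (fun p : ℕ × ℕ => p.1 + p.2) atTop) (𝓝 1) := by
  rw [← tendsto_sub_nhds_zero_iff]
  refine squeeze_zero_norm' ?_ ((tendsto_pow_atTop_nhds_zero_of_lt_one (r := (1 / 2 : ℝ)) (by norm_num)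
    (by norm_num)).comp tendsto_comap)
  filter_upwards [tendsto_comap.eventually (eventually_ge_atTop 30)] with p hp
  exact abs_numMDSCodes_div_sub_one_le hp
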